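/- **Setting.** Let $\mathcal P=\{P_1,\dots,P_n\}$ be parties, $\mathbb F$ a finite field, $\mathcal Z=\{Z_1,\dots,Z_h\}$ a collection of $h=|\mathcal Z|$ sets of parties, $M\ge 0$, and let $Z'\in\mathcal Z$ be a fixed publicly known set. A set is *corruptible* if it is contained in some $Z_q$; a set $A$ is a *quorum* if $\mathcal P\setminus A$ is corruptible. Put $S_q=\mathcal P\setminus Z_q$ and $t=\max_q|Z_q|$. $\mathbb Q^{(4)}(\mathcal P,\mathcal Z)$ means that $\mathcal P$ is not the union of four (not necessarily distinct) members of $\mathcal Z$. A sharing $[s]$ of $s\in\mathbb F$ is a vector $([s]_1,\dots,[s]_h)$ with sum $s$, where $[s]_q$ is held by every party in $S_q$. A computationally unbounded adversary statically corrupts a corruptible set $Z^\star$. **Functionalities.** $\mathcal F_{\mathsf{VSS}}$: one instance takes a vector $(s_1,\dots,s_h)$ from its dealer (the first one counts) and delivers to each honest $P_i$ the shares $s_q$ with $P_i\in S_q$; the adversary learns the $s_q$ with $S_q\cap Z^\star\ne\emptyset$. $\mathcal F_{\mathsf{ABA}}$: one instance collects votes in $\{0,1\}$ (visible to the adversary)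 and a quorum $\mathsf{CS}$ from the adversary; once all members of $\mathsf{CS}$ have voted it decides the common vote of the honest members of $\mathsf{CS}$ if there is one, otherwise the vote of the smallest-index corrupt member of $\mathsf{CS}$ (of the smallest-index member, if none is corrupt), and delivers the decision. $\mathcal F_{\mathsf{Triples}}$: parties send requests (those of honest parties are reported to the simulator); the simulator may send requests for corrupt parties and supplies for each of the $M$ triples the shares of $a,b,c$ with index $q$ such that $S_q\cap Z^\star\neq\emptyset$; once a quorum has sent requests, $a,b\in\mathbb F$ are chosen uniformly and independently for each triple, $c=ab$, the remaining shares of $a,b,c$ are chosen uniformly subject to the sums being $a$, $b$, $c$, and each honest party that has sent a request gets its shares of all triples (output on request, delay decided by the simulator). **Protocol $\Pi_{\mathsf{PerTriples}}$.** *Reconstruction* of a share $[v]_q$: every party of $S_q$ sends it to all parties outside $S_q$; a party outside $S_q$ accepts $x$ once it got $x$ from a subset of $S_q$ with corruptible complement in $S_q$. Reconstruction of $v$ reconstructs and adds all $[v]_q$. *Stage I.* Every $P_i$ shares $M$ random pairs $a^{(i),\ell},b^{(i),\ell}$ by $2M$ calls of $\mathcal F_{\mathsf{VSS}}$. In the ABA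 instance of $P_j$, a party votes $1$ when it has received all $2M$ outputs of dealer $P_j$, and $0$ once a quorum of parties has been decided $1$ if it has not voted there. When all $n$ instances are decided, $\mathcal{CS}$ is the set of parties decided $1$; $a^\ell=\sum_{j\in\mathcal{CS}}a^{(j),\ell}$, $b^\ell$ likewise. *Stage II.* Iterations $r=1,2,\dots$, starting with $\mathcal{GD}=\emptyset$. In iteration $r$, for each $Z\in\mathcal Z$ in parallel, start with $\mathsf{Sel}_Z=\emptyset$, with all index pairs $(p,q)$ as remaining summands, and $\mathsf{Sum}_Z^{(j)}=\{(p,q):P_j\in S_p\cap S_q\}$; while summands remain, do one hop: every $P_i\notin Z\cup\mathsf{Sel}_Z$ shares $\sum_{(p,q)\in\mathsf{Sum}^{(i)}_Z}[a^\ell]_p[b^\ell]_q$ for $\ell=1,\dots,M$ by $\mathcal F_{\mathsf{VSS}}$; in the ABA instance of $P_j$ for this hop a party votes $1$ if $P_j\notin\mathcal{GD}\cup Z\cup\mathsf{Sel}_Z$, $P_j$ is in none of its sets $\mathcal W_{r'},\mathcal{LD}_{r'}$ with $r'<r$, and all $M$ outputs of $P_j$ have been received; and votes $0$ in the instances where it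 has not voted once some party is decided $1$; when all are decided, the least $P_j$ decided $1$ joins $\mathsf{Sel}_Z$, and $\mathsf{Sum}_Z^{(j)}$ is removed from the remaining summands and from $\mathsf{Sum}_Z^{(k)}$ for all $P_k\notin Z\cup\mathsf{Sel}_Z$. Let $c_Z^\ell$ be the sum of the values so shared by the members of $\mathsf{Sel}_Z$. The differences $c_Z^\ell-c_{Z'}^\ell$ are reconstructed for all $Z,\ell$. If all are $0$, a party outputs its shares of all $(a^\ell,b^\ell,c^\ell_{Z'})$. Otherwise let $Z$ be the first set, and then $\ell$ the first index, with a non-zero difference. $\mathcal W_r$ starts as $\mathsf{Sel}_Z\cup\mathsf{Sel}_{Z'}$. Every $P_j\in\mathsf{Sel}_Z$ shares, for each $P_k\in\mathsf{Sel}_{Z'}$, the partial sum $d^{(jk)}$ of its $\ell$-th sum over $\mathsf{Sum}_Z^{(j)}\cap\mathsf{Sum}_{Z'}^{(k)}$, and every $P_k\in\mathsf{Sel}_{Z'}$ likewise shares $e^{(kj)}$ for each $P_j\in\mathsf{Sel}_Z$; a party leaves $\mathcal W_r$ when all its parts have been received. The differences between each selected party's $\ell$-th sum and the sum of its parts are reconstructed,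 and a party with a non-zero one enters $\mathcal{LD}_r$; the differences $d^{(jk)}-e^{(kj)}$ are reconstructed, and if one is non-zero, $d^{(jk)},e^{(kj)}$ and the relevant shares of $a^\ell,b^\ell$ are reconstructed and whichever of $P_j,P_k$ shared a wrong partial sum enters $\mathcal{LD}_r$. If $tn+1$ divides $r$, a party is added to $\mathcal{GD}$ before the next iteration starts: by ABA instances in which one votes $1$ for $P_j$ if $P_j\in\bigcup_{r'\le r}\mathcal{LD}_{r'}\setminus\mathcal{GD}$, and $0$, where one has not voted, once some party is decided $1$; when all are decided, the least party decided $1$ is taken. **Execution.** An environment (an arbitrary randomized machine) gives inputs to and activates honest parties, receives their outputs, exchanges messages with the adversary, and halts with a bit. Rounds: a round ends when every honest party that has its input has been activated in it. In the hybrid world with delay bound $B\in\mathbb N$ the adversary schedules all deliveries of messages and of functionality outputs, but cannot delay any of them by $B$ or more rounds from the time it is available (and requested), nor withhold a core set: $B$ rounds after the voters of an ABA instance became a quorum, the set of voters is used. In the ideal world with delay bound $B'$ the simulator cannot delay an honest party's output (nor withhold the corrupt parties' shares, which are then set to $0$) for more than $B'$ rounds after that party's request and after the honest parties that have sent requests became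 a quorum. **Theorem.** There is an absolute constant $C$ such that for all $n,h,M,\mathbb F,\mathcal Z,Z'$ as above, if $\mathbb Q^{(4)}(\mathcal P,\mathcal Z)$ holds, then: 1. (*Perfect UC-security of $\Pi_{\mathsf{PerTriples}}$ for $\mathcal F_{\mathsf{Triples}}$ in the $(\mathcal F_{\mathsf{VSS}},\mathcal F_{\mathsf{ABA}})$-hybrid model.*) For every $B\in\mathbb N$, every corruptible $Z^\star$ and every adversary there is a simulator such that for every environment and every number $k$ of steps, the environment's output after $k$ steps (a bit or "not halted") has the same distribution in the hybrid world with delay bound $B$ and in the ideal world with delay bound $B'=(n+h+B+2)^C$. 2. (*Complexity.*) In every execution with a corruptible set of corrupt parties, the honest parties use at most $C\,M|\mathcal Z|n^5$ instances of $\mathcal F_{\mathsf{VSS}}$ and at most $C\,|\mathcal Z|n^5$ instances of $\mathcal F_{\mathsf{ABA}}$, and in addition send messages carrying field elements, each encoded in $\lceil\log_2|\mathbb F|\rceil$ bits, of in total at most $C\,(M|\mathcal Z|^2n^5\log_2|\mathbb F|+|\mathcal Z|n^7\log_2|\mathbb F|)$ bits (message identifiers are not counted). -/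

import Mathlib

namespace AMPC

noncomputable section

open Classical

/-! ## Parties, adversary structure, sharing specification -/

/-- Public parameters: `n` parties, an adversary structure listed as `Z 0, …, Z (h-1)`, the number
`M` of triples, and the index `z0` of the fixed publicly known set used as reference in the
multiplication protocol. -/
structure Params where
  n : ℕ
  h : ℕ
  M : ℕ
  Z : Fin h → Finset (Fin n)
  z0 : Fin h

namespace Params

/-- The sharing specification: `S q` is the complement of `Z q`. -/
def S (P : Params) (q : Fin P.h) : Finset (Fin P.n) := (P.Z q)ᶜ

/-- `A` is a potentially corrupt set, i.e. it lies in (the downward closure of) the structure. -/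
def Covered (P : Params) (A : Finset (Fin P.n)) : Prop := ∃ q, A ⊆ P.Z q

/-- All parties outside `A` may be corrupt. -/
def Quorum (P : Params) (A : Finset (Fin P.n)) : Prop := P.Covered Aᶜ

/-- The condition `Q^(k)`: no `k` sets of the structure cover the set of all parties. -/
def Q (P : Params) (k : ℕ) : Prop :=
  ∀ f : Fin k → Fin P.h, ¬ ∀ i : Fin P.n, ∃ a : Fin k, i ∈ P.Z (f a)

/-- The largest size of a set of the structure. -/
def t (P : Params) : ℕ := Finset.univ.sup fun q => (P.Z q).card

end Params

/-- The least index with property `p`, if there is one. -/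
def least {m : ℕ} (p : Fin m → Prop) : Option (Fin m) :=
  if hp : (Finset.univ.filter p).Nonempty then some ((Finset.univ.filter p).min' hp) else none

/-- The uniform distribution on `s`; the value `d` is only used if `s` is empty. -/
def uniformOn {α : Type} (s : Finset α) (d : α) : PMF α :=
  if hs : s.Nonempty then PMF.uniformOfFinset s hs else PMF.pure d

/-! ## The interaction of an environment with a system -/

/-- Messages exchanged between the environment and the adversary. -/
abbrev Msg := List Bool

/-- The environment can give party `i` its input (the request to generate triples), activate party
`i`, or activate the adversary with a message. -/
inductive Cmd (n : ℕ) : Type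
  | input (i : Fin n)
  | activate (i : Fin n)
  | toAdv (m : Msg)

/-- What the environment gets back. -/
inductive Resp (Out : Type) : Type
  | nothing
  | output (o : Out)
  | fromAdv (m : Msg)

/-- An environment: a randomized machine that in each step, seeing the last response, either issues
a command or halts with an output bit. -/
structure Env (n : ℕ) (Out : Type) where
  St : Type
  init : St
  step : St → Resp Out → PMF (St × (Cmd n ⊕ Bool))

/-- A system that an environment can interact with. -/
structure System (n : ℕ) (Out : Type) where
  W : Type
  init : W
  respond : W → Cmd n → PMF (W × Resp Out)

/-- A configuration of the joint execution; `bit` is set once the environment has halted. -/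
structure Config {n : ℕ} {Out : Type} (E : Env n Out) (Y : System n Out) where
  env : E.St
  sys : Y.W
  last : Resp Out
  bit : Option Bool

/-- One step of the joint execution. -/
def runStep {n : ℕ} {Out : Type} (E : Env n Out) (Y : System n Out) (c : Config E Y) :
    PMF (Config E Y) :=
  if c.bit = none then
    (E.step c.env c.last).bind fun x =>
      match x.2 with
      | Sum.inl cmd => (Y.respond c.sys cmd).map fun y => ⟨x.1, y.1, y.2, none⟩
      | Sum.inr b => PMF.pure ⟨x.1, c.sys, c.last, some b⟩
  else PMF.pure c

/-- The distribution of the configuration after `k` steps. -/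
def run {n : ℕ} {Out : Type} (E : Env n Out) (Y : System n Out) : ℕ → PMF (Config E Y)
  | 0 => PMF.pure ⟨E.init, Y.init, Resp.nothing, none⟩
  | k + 1 => (run E Y k).bind (runStep E Y)

/-- The distribution of the output bit of the environment after `k` steps (`none`: not halted). -/
def outcome {n : ℕ} {Out : Type} (E : Env n Out) (Y : System n Out) (k : ℕ) : PMF (Option Bool) :=
  (run E Y k).map Config.bit

/-- Asynchronous rounds: a round ends once every honest party that has its input has been
activated in it.  Delays are measured in these rounds. -/
structure Clock (n : ℕ) where
  round : ℕ
  act : Finset (Fin n)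

/-- Party `i` has been activated; `alive` is the set of honest parties that have their input. -/
def Clock.tick {n : ℕ} (c : Clock n) (alive : Finset (Fin n)) (i : Fin n) : Clock n :=
  if alive ⊆ insert i c.act then ⟨c.round + 1, ∅⟩ else ⟨c.round, insert i c.act⟩

/-! ## Session identifiers -/

/-- The calls to the VSS functionality: the `l`-th first (`second = false`) or second
(`second = true`) random value of a party; the `l`-th sum of summands shared in a hop of the
optimistic multiplication with respect to `Z z`; the part, determined by party `other`, of the
dealer's sum of summands with respect to `Z z`. -/
inductive VSid (P : Params) : Type
  | input (dealer : Fin P.n) (second : Bool) (l : Fin P.M)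
  | summ (iter : ℕ) (z : Fin P.h) (hop : ℕ) (dealer : Fin P.n) (l : Fin P.M)
  | part (iter : ℕ) (z : Fin P.h) (dealer other : Fin P.n)

/-- The dealer of a VSS call. -/
def VSid.dealer {P : Params} : VSid P → Fin P.n
  | .input j _ _ => j
  | .summ _ _ _ j _ => j
  | .part _ _ j _ => j

/-- The calls to the ABA functionality: for the common subset of the first stage, for the selection
of a summand-sharing party in a hop, and for the identification of a cheater. -/
inductive ASid (P : Params) : Type
  | acs (j : Fin P.n)
  | sel (iter : ℕ) (z : Fin P.h) (hop : ℕ) (j : Fin P.n)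
  | gd (iter : ℕ) (j : Fin P.n)

/-- The shared values that are publicly reconstructed: the `l`-th difference `c_Z - c_Z'`, the
difference between `j`'s sum of summands and the sum of its parts, the difference between the two
versions of a part, a single part, and the shares (of the first or the second factor) that enter
the part of `(j, k)`. -/
inductive RTag (P : Params) : Type
  | diff (iter : ℕ) (z : Fin P.h) (l : Fin P.M)
  | sumCheck (iter : ℕ) (z : Fin P.h) (j : Fin P.n)
  | pairDiff (iter : ℕ) (j k : Fin P.n)
  | part (iter : ℕ) (z : Fin P.h) (j k : Fin P.n)
  | inp (iter : ℕ) (j k : Fin P.n) (second : Bool)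

/-- Things whose delivery to a given party is scheduled by the adversary: an output of a VSS or an
ABA instance, or the message of party `j` with its `q`-th share of the value `tag`. -/
inductive Item (P : Params) : Type
  | vss (sid : VSid P)
  | aba (sid : ASid P)
  | mail (j : Fin P.n) (tag : RTag P) (q : Fin P.h)

/-! ## The state of a party -/

/-- Variables of an instance of the optimistic multiplication with respect to one set `Z`:
the summand-sharing parties selected so far, the summands left, the summands of each party, the
hop in which a party was selected, and the current hop. -/
structure OptSt (P : Params) where
  selected : Finset (Fin P.n)
  rem : Finset (Fin P.h × Fin P.h)
  summ : Fin P.n → Finset (Fin P.h × Fin P.h)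
  hopOf : Fin P.n → ℕ
  hop : ℕ

def OptSt.init (P : Params) : OptSt P where
  selected := ∅
  rem := Finset.univ
  summ := fun j => Finset.univ.filter fun pq => j ∈ P.S pq.1 ∧ j ∈ P.S pq.2
  hopOf := fun _ => 0
  hop := 1

/-- The update at the end of a hop in which party `j` has been selected. -/
def OptSt.next {P : Params} (z : Fin P.h) (o : OptSt P) (j : Fin P.n) : OptSt P where
  selected := insert j o.selected
  rem := o.rem \ o.summ j
  summ := fun k => if k ∉ P.Z z ∧ k ∉ insert j o.selected then o.summ k \ o.summ j else o.summ k
  hopOf := Function.update o.hopOf j o.hop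
  hop := o.hop + 1

/-- Output of a party: for every triple its shares of the three values; the entries for the sets
`S q` to which the party does not belong are `0`. -/
abbrev Table (P : Params) (F : Type) := Fin P.M → Fin 3 → Fin P.h → F

/-- The local state of an honest party.  `vss`, `aba`, `msgs` is what it has received from the
functionalities and over the channels (sender, name, index of the share, value); `iter = 0` is the
first stage, `iter = r ≥ 1` is the `r`-th iteration of the multiplication protocol; `conf r` is the
conflicting set and the index of the conflicting pair found in the `r`-th iteration. -/
structure PartySt (P : Params) (F : Type) where
  started : Prop
  vss : VSid P → Option (Fin P.h → F)
  aba : ASid P → Option Bool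
  msgs : Set (Fin P.n × RTag P × Fin P.h × F)
  dealt : Set (VSid P)
  voted : ASid P → Option Bool
  iter : ℕ
  opt : ℕ → Fin P.h → OptSt P
  conf : ℕ → Option (Fin P.h × Fin P.M)
  GD : Finset (Fin P.n)
  out : Option (Table P F)

def PartySt.init (P : Params) (F : Type) : PartySt P F where
  started := False
  vss := fun _ => none
  aba := fun _ => none
  msgs := ∅
  dealt := ∅
  voted := fun _ => none
  iter := 0
  opt := fun _ _ => OptSt.init P
  conf := fun _ => none
  GD := ∅
  out := none

/-- The entries of a vector of shares that belong to party `i`. -/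
def mask {P : Params} {F : Type} [Field F] (i : Fin P.n) (v : Fin P.h → F) : Fin P.h → F :=
  fun q => if i ∈ P.S q then v q else 0

section Protocol

variable {P : Params} {F : Type} [Field F]

namespace PartySt

/-- The `q`-th share from a VSS call (meaningful once it has been received). -/
def val (s : PartySt P F) (sid : VSid P) (q : Fin P.h) : F :=
  match s.vss sid with
  | some v => v q
  | none => 0

def got (s : PartySt P F) (sid : VSid P) : Prop := s.vss sid ≠ none

/-- The common subset of the first stage. -/
def CS (s : PartySt P F) : Finset (Fin P.n) :=
  Finset.univ.filter fun j => s.aba (.acs j) = some true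

/-- The `q`-th share of the `l`-th first (`second = false`) or second factor. -/
def factor (s : PartySt P F) (second : Bool) (l : Fin P.M) (q : Fin P.h) : F :=
  ∑ j ∈ s.CS, s.val (.input j second l) q

/-- The sum of the given summands, from the shares of the factors. -/
def prodSum (s : PartySt P F) (l : Fin P.M) (T : Finset (Fin P.h × Fin P.h)) : F :=
  ∑ pq ∈ T, s.factor false l pq.1 * s.factor true l pq.2

/-- The parties selected in iteration `r` with respect to `Z z`. -/
def Sel (s : PartySt P F) (r : ℕ) (z : Fin P.h) : Finset (Fin P.n) := (s.opt r z).selected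

/-- The call in which party `j`, selected in iteration `r` for `z`, has shared its `l`-th sum. -/
def sumSid (s : PartySt P F) (r : ℕ) (z : Fin P.h) (j : Fin P.n) (l : Fin P.M) : VSid P :=
  .summ r z ((s.opt r z).hopOf j) j l

/-- The multiplication in iteration `r` with respect to `Z z` is complete. -/
def optDone (s : PartySt P F) (r : ℕ) (z : Fin P.h) : Prop :=
  (s.opt r z).rem = ∅ ∧ ∀ j ∈ s.Sel r z, ∀ l, s.got (s.sumSid r z j l)

/-- The `q`-th share of the `l`-th product computed in iteration `r` with respect to `Z z` (the
parties that have not been selected contribute a default sharing of `0`). -/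
def cShare (s : PartySt P F) (r : ℕ) (z : Fin P.h) (l : Fin P.M) (q : Fin P.h) : F :=
  ∑ j ∈ s.Sel r z, s.val (s.sumSid r z j l) q

/-- The summands common to `j` (with respect to the conflicting set `zc`) and `k` (with respect to
the reference set). -/
def inter (s : PartySt P F) (r : ℕ) (zc : Fin P.h) (j k : Fin P.n) :
    Finset (Fin P.h × Fin P.h) :=
  (s.opt r zc).summ j ∩ (s.opt r P.z0).summ k

/-- In iteration `r`, with conflicting sets `zc` and the reference set, party `j` has to share a
part determined by `k` with respect to `z`. -/
def partDue (s : PartySt P F) (r : ℕ) (zc z : Fin P.h) (j k : Fin P.n) : Prop :=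
  (z = zc ∧ j ∈ s.Sel r zc ∧ k ∈ s.Sel r P.z0) ∨ (z = P.z0 ∧ j ∈ s.Sel r P.z0 ∧ k ∈ s.Sel r zc)

/-- The summands of that part. -/
def partSumms (s : PartySt P F) (r : ℕ) (zc z : Fin P.h) (j k : Fin P.n) :
    Finset (Fin P.h × Fin P.h) :=
  if z = zc then s.inter r zc j k else s.inter r zc k j

/-- The own `q`-th share of the three kinds of differences, once it is available. -/
def baseShare (s : PartySt P F) (q : Fin P.h) : RTag P → Option F
  | .diff r z l =>
      if s.optDone r z ∧ s.optDone r P.z0 then some (s.cShare r z l q - s.cShare r P.z0 l q)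
      else none
  | .sumCheck r z j =>
      match s.conf r with
      | none => none
      | some (zc, l) =>
          if (z = zc ∨ z = P.z0) ∧ j ∈ s.Sel r z ∧ s.got (s.sumSid r z j l) ∧
              ∀ k, s.partDue r zc z j k → s.got (.part r z j k) then
            some (s.val (s.sumSid r z j l) q -
              ∑ k ∈ Finset.univ.filter (fun k => s.partDue r zc z j k), s.val (.part r z j k) q)
          else none
  | .pairDiff r j k =>
      match s.conf r with
      | none => none
      | some (zc, _) =>
          if j ∈ s.Sel r zc ∧ k ∈ s.Sel r P.z0 ∧ s.got (.part r zc j k) ∧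
              s.got (.part r P.z0 k j) then
            some (s.val (.part r zc j k) q - s.val (.part r P.z0 k j) q)
          else none
  | .part _ _ _ _ => none
  | .inp _ _ _ _ => none

/-- Reconstruction of a single share by party `i`: members of `S q` take their own share `own`;
the other parties wait for the same value from all members of `S q` but a potentially corrupt set. -/
def recShareWith (s : PartySt P F) (i : Fin P.n) (own : Option F) (tag : RTag P) (q : Fin P.h) :
    Option F :=
  if i ∈ P.S q then own
  else if hv : ∃ v : F, P.Covered (P.S q \ (P.S q).filter fun j => (j, tag, q, v) ∈ s.msgs) then
    some hv.choose
  else none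

/-- Reconstruction of a value, from the reconstruction of its shares. -/
def total (sh : Fin P.h → Option F) : Option F :=
  if ∀ q, sh q ≠ none then some (∑ q, (sh q).getD 0) else none

/-- Party `i` has found that the two versions of the part of `(j, k)` differ. -/
def pairBad (s : PartySt P F) (i : Fin P.n) (r : ℕ) (j k : Fin P.n) : Prop :=
  ∃ v, v ≠ 0 ∧
    total (fun q => s.recShareWith i (s.baseShare q (.pairDiff r j k)) (.pairDiff r j k) q) = some v

/-- The own `q`-th share of a value that is to be reconstructed, once party `i` takes part in this
reconstruction.  Single parts and shares of the factors are opened only for pairs whose versions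
differ. -/
def myShare (s : PartySt P F) (i : Fin P.n) (tag : RTag P) (q : Fin P.h) : Option F :=
  if i ∈ P.S q then
    match tag with
    | .part r z j k =>
        match s.conf r with
        | none => none
        | some (zc, _) =>
            if s.partDue r zc z j k ∧ s.got (.part r z j k) ∧
                (if z = zc then s.pairBad i r j k else s.pairBad i r k j) then
              some (s.val (.part r z j k) q)
            else none
    | .inp r j k second =>
        match s.conf r with
        | none => none
        | some (zc, l) =>
            if j ∈ s.Sel r zc ∧ k ∈ s.Sel r P.z0 ∧ s.pairBad i r j k ∧
                (∃ pq ∈ s.inter r zc j k, (if second then pq.2 else pq.1) = q) then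
              some (s.factor second l q)
            else none
    | tag' => s.baseShare q tag'
  else none

def recShare (s : PartySt P F) (i : Fin P.n) (tag : RTag P) (q : Fin P.h) : Option F :=
  s.recShareWith i (s.myShare i tag q) tag q

def recValue (s : PartySt P F) (i : Fin P.n) (tag : RTag P) : Option F :=
  total (s.recShare i tag)

/-- The waiting list of iteration `r`. -/
def Waiting (s : PartySt P F) (r : ℕ) (j : Fin P.n) : Prop :=
  match s.conf r with
  | none => False
  | some (zc, _) =>
      (j ∈ s.Sel r zc ∨ j ∈ s.Sel r P.z0) ∧
        ¬ ∀ z k, s.partDue r zc z j k → s.got (.part r z j k)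

/-- The parties locally discarded by party `i` with respect to iteration `r`: those for which the
parts do not add up, and those whose version of an opened part is wrong. -/
def LD (s : PartySt P F) (i : Fin P.n) (r : ℕ) (x : Fin P.n) : Prop :=
  match s.conf r with
  | none => False
  | some (zc, _) =>
      (∃ z, (z = zc ∨ z = P.z0) ∧ x ∈ s.Sel r z ∧ ∃ v, v ≠ 0 ∧ s.recValue i (.sumCheck r z x) = some v) ∨
      ∃ j k d e, j ∈ s.Sel r zc ∧ k ∈ s.Sel r P.z0 ∧ s.pairBad i r j k ∧
        s.recValue i (.part r zc j k) = some d ∧ s.recValue i (.part r P.z0 k j) = some e ∧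
        (∀ pq ∈ s.inter r zc j k, s.recShare i (.inp r j k false) pq.1 ≠ none ∧
          s.recShare i (.inp r j k true) pq.2 ≠ none) ∧
        ((x = j ∧ d ≠ ∑ pq ∈ s.inter r zc j k, (s.recShare i (.inp r j k false) pq.1).getD 0 *
            (s.recShare i (.inp r j k true) pq.2).getD 0) ∨
         (x = k ∧ e ≠ ∑ pq ∈ s.inter r zc j k, (s.recShare i (.inp r j k false) pq.1).getD 0 *
            (s.recShare i (.inp r j k true) pq.2).getD 0))

/-- A cheater is to be identified after iteration `r`. -/
def gdIter (P : Params) (r : ℕ) : Prop := 1 ≤ r ∧ (P.t * P.n + 1) ∣ r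

/-- The end of the first stage. -/
def stepStage (s : PartySt P F) : PartySt P F :=
  if s.iter = 0 ∧ (∀ j, s.aba (.acs j) ≠ none) ∧ ∀ j ∈ s.CS, ∀ b l, s.got (.input j b l) then
    { s with iter := 1 }
  else s

/-- The end of a hop of the current iteration with respect to `Z z`. -/
def hopEnd (s : PartySt P F) (z : Fin P.h) : OptSt P :=
  let o := s.opt s.iter z
  if 1 ≤ s.iter ∧ o.rem.Nonempty ∧ ∀ j, s.aba (.sel s.iter z o.hop j) ≠ none then
    match least fun j => s.aba (.sel s.iter z o.hop j) = some true with
    | some j => o.next z j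
    | none => o
  else o

def stepHop (s : PartySt P F) : PartySt P F :=
  { s with opt := Function.update s.opt s.iter s.hopEnd }

/-- The end of an iteration: if all differences are `0` the party outputs its shares, otherwise it
determines the conflicting set and the conflicting pair. -/
def stepCheck (i : Fin P.n) (s : PartySt P F) : PartySt P F :=
  if 1 ≤ s.iter ∧ s.out = none ∧ s.conf s.iter = none ∧ (∀ z, s.optDone s.iter z) ∧
      ∀ z l, s.recValue i (.diff s.iter z l) ≠ none then
    match least fun z => ∃ l, s.recValue i (.diff s.iter z l) ≠ some 0 with
    | none =>
        { s with out := some fun l =>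
            ![mask i (s.factor false l), mask i (s.factor true l),
              mask i (s.cShare s.iter P.z0 l)] }
    | some z =>
        let pair := (least fun l => s.recValue i (.diff s.iter z l) ≠ some 0).map fun l => (z, l)
        { s with conf := Function.update s.conf s.iter pair }
  else s

/-- Transition to the next iteration, preceded by the identification of a cheater if due. -/
def stepNext (s : PartySt P F) : PartySt P F :=
  if s.conf s.iter = none then s
  else if gdIter P s.iter then
    if ∀ j, s.aba (.gd s.iter j) ≠ none then
      match least fun j => s.aba (.gd s.iter j) = some true with
      | some j => { s with GD := insert j s.GD, iter := s.iter + 1 }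
      | none => s
    else s
  else { s with iter := s.iter + 1 }

/-- The local computation of party `i` in one activation. -/
def update (i : Fin P.n) (s : PartySt P F) : PartySt P F :=
  (((s.stepStage).stepHop).stepCheck i).stepNext

/-- The VSS instances from which the party is requesting an output (or has done so). -/
def wantsV (s : PartySt P F) : VSid P → Prop
  | .input _ _ _ => s.started
  | .summ r z hop _ _ => 1 ≤ r ∧ r ≤ s.iter ∧ 1 ≤ hop ∧
      (hop < (s.opt r z).hop ∨ hop = (s.opt r z).hop ∧ (s.opt r z).rem.Nonempty)
  | .part r z j k => ∃ zc l, s.conf r = some (zc, l) ∧ s.partDue r zc z j k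

/-- The ABA instances from which the party is requesting an output (or has done so). -/
def wantsA (s : PartySt P F) : ASid P → Prop
  | .acs _ => s.started
  | .sel r z hop _ => 1 ≤ r ∧ r ≤ s.iter ∧ 1 ≤ hop ∧
      (hop < (s.opt r z).hop ∨ hop = (s.opt r z).hop ∧ (s.opt r z).rem.Nonempty)
  | .gd r _ => s.conf r ≠ none ∧ gdIter P r

/-- The secrets that party `i` has to share by now, where `rnd` is the randomness for the first
stage. -/
def toDeal (s : PartySt P F) (i : Fin P.n) (rnd : Bool → Fin P.M → F) : List (VSid P × F) :=
  ([false, true].flatMap fun b => (List.finRange P.M).map fun l => (.input i b l, rnd b l)) ++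
  ((List.finRange P.h).flatMap fun z => (List.finRange P.M).flatMap fun l =>
    if 1 ≤ s.iter ∧ i ∉ P.Z z ∧ i ∉ s.Sel s.iter z ∧ (s.opt s.iter z).rem.Nonempty then
      [(.summ s.iter z (s.opt s.iter z).hop i l, s.prodSum l ((s.opt s.iter z).summ i))]
    else []) ++
  ((List.range (s.iter + 1)).flatMap fun r =>
    match s.conf r with
    | none => []
    | some (zc, l) =>
        (List.finRange P.n).flatMap fun k => [zc, P.z0].flatMap fun z =>
          if s.partDue r zc z i k then
            [(.part r z i k, s.prodSum l (s.partSumms r zc z i k))]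
          else [])

/-- The votes that party `i` casts now. -/
def newVote (s : PartySt P F) (i : Fin P.n) (sid : ASid P) : Option Bool :=
  if s.voted sid ≠ none then none
  else match sid with
  | .acs j =>
      if ∀ b l, s.got (.input j b l) then some true
      else if P.Quorum s.CS then some false
      else none
  | .sel r z hop j =>
      if 1 ≤ r ∧ r = s.iter ∧ hop = (s.opt r z).hop ∧ (s.opt r z).rem.Nonempty then
        if j ∉ s.GD ∧ j ∉ P.Z z ∧ j ∉ s.Sel r z ∧
            (∀ r', 1 ≤ r' → r' < r → ¬ s.Waiting r' j ∧ ¬ s.LD i r' j) ∧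
            ∀ l, s.got (.summ r z hop j l) then some true
        else if ∃ k, s.aba (.sel r z hop k) = some true then some false
        else none
      else none
  | .gd r j =>
      if r = s.iter ∧ s.conf r ≠ none ∧ gdIter P r then
        if j ∉ s.GD ∧ ∃ r', 1 ≤ r' ∧ r' ≤ r ∧ s.LD i r' j then some true
        else if ∃ k, s.aba (.gd r k) = some true then some false
        else none
      else none

end PartySt

/-! ## The hybrid world -/

/-- The global state: local states of the parties; for the VSS functionality the dealt vectors with
the round; for the ABA functionality the votes, the recorded core sets, the round in which the
voters first were a quorum, and the decisions with the round; the messages sent by honest parties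
(the `q`-th share of a value is sent to all parties outside `S q`) with the round; the clock. -/
structure World (P : Params) (F : Type) where
  parties : Fin P.n → PartySt P F
  deals : VSid P → Option ((Fin P.h → F) × ℕ)
  votes : ASid P → Fin P.n → Option Bool
  core : ASid P → Option (Finset (Fin P.n))
  quorumAt : ASid P → Option ℕ
  dec : ASid P → Option (Bool × ℕ)
  mail : Fin P.n → RTag P → Fin P.h → Option (F × ℕ)
  clock : Clock P.n

def World.init (P : Params) (F : Type) : World P F where
  parties := fun _ => PartySt.init P F
  deals := fun _ => none
  votes := fun _ _ => none
  core := fun _ => none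
  quorumAt := fun _ => none
  dec := fun _ => none
  mail := fun _ _ _ => none
  clock := ⟨0, ∅⟩

/-- What the adversary, corrupting `Zs`, can see: who has started, its shares of the dealt vectors
(`0` elsewhere), the votes, the existence of all messages and the content of those sent to a corrupt
party, the requests of the honest parties, and the round. -/
structure View (P : Params) (F : Type) where
  started : Set (Fin P.n)
  deals : VSid P → Option (Fin P.h → F)
  votes : ASid P → Fin P.n → Option Bool
  mail : Fin P.n → RTag P → Fin P.h → Option (Option F)
  wantsV : Fin P.n → VSid P → Prop
  wantsA : Fin P.n → ASid P → Prop
  round : ℕ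

/-- Some corrupt party belongs to `S q`. -/
def Visible (Zs : Finset (Fin P.n)) (q : Fin P.h) : Prop := ∃ i ∈ Zs, i ∈ P.S q

def World.view (Zs : Finset (Fin P.n)) (w : World P F) : View P F where
  started := {i | (w.parties i).started}
  deals := fun sid => (w.deals sid).map fun d => fun q => if Visible Zs q then d.1 q else 0
  votes := w.votes
  mail := fun j tag q => (w.mail j tag q).map fun m =>
    if ∃ i ∈ Zs, i ∉ P.S q then some m.1 else none
  wantsV := fun i => (w.parties i).wantsV
  wantsA := fun i => (w.parties i).wantsA
  round := w.clock.round

/-- What the adversary can do: deal and vote on behalf of corrupt parties, supply core sets to the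
ABA functionality, and send messages of corrupt parties to honest parties. -/
inductive Op (P : Params) (F : Type) : Type
  | deal (sid : VSid P) (v : Fin P.h → F)
  | vote (sid : ASid P) (j : Fin P.n) (b : Bool)
  | coreset (sid : ASid P) (C : Finset (Fin P.n))
  | send (j i : Fin P.n) (tag : RTag P) (q : Fin P.h) (v : F)

/-- A randomized adversary.  It is activated by messages of the environment, and whenever an honest
party is activated; then it also decides which items are delivered to that party. -/
structure Adversary (P : Params) (F : Type) where
  St : Type
  init : St
  onEnv : St → View P F → Msg → PMF (St × List (Op P F) × Msg)
  onReq : St → View P F → Fin P.n → PMF (St × List (Op P F) × Set (Item P))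

/-- The value that the ABA functionality computes for core set `C` and votes `x`. -/
def abaValue (Zs C : Finset (Fin P.n)) (x : Fin P.n → Option Bool) : Bool :=
  if ∀ j ∈ C \ Zs, x j = some true then true
  else if ∀ j ∈ C \ Zs, x j = some false then false
  else if hc : (C ∩ Zs).Nonempty then decide (x ((C ∩ Zs).min' hc) = some true)
  else if hc : C.Nonempty then decide (x (C.min' hc) = some true)
  else false

namespace World

/-- Replaces the local state of party `i`. -/
def setParty (w : World P F) (i : Fin P.n) (s : PartySt P F) : World P F :=
  { w with parties := Function.update w.parties i s }

/-- Those who have voted in an ABA instance. -/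
def voters (w : World P F) (sid : ASid P) : Finset (Fin P.n) :=
  Finset.univ.filter fun j => w.votes sid j ≠ none

/-- Every undecided ABA instance with a recorded core set all of whose members have voted gives
its decision. -/
def decideAba (Zs : Finset (Fin P.n)) (w : World P F) : World P F :=
  { w with dec := fun sid =>
      match w.dec sid, w.core sid with
      | none, some C =>
          if ∀ j ∈ C, w.votes sid j ≠ none then some (abaValue Zs C (w.votes sid), w.clock.round)
          else none
      | d, _ => d }

/-- Party `j` casts the votes `nv` (one per instance at most); votes in decided instances are
ignored. -/
def castVotes (Zs : Finset (Fin P.n)) (j : Fin P.n) (nv : ASid P → Option Bool) (w : World P F) :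
    World P F :=
  let vs : ASid P → Fin P.n → Option Bool := fun sid =>
    if w.dec sid = none ∧ nv sid ≠ none then Function.update (w.votes sid) j (nv sid)
    else w.votes sid
  let w1 : World P F := { w with votes := vs }
  let qs : ASid P → Option ℕ := fun sid =>
    if w.quorumAt sid = none ∧ P.Quorum (w1.voters sid) then some w.clock.round
    else w.quorumAt sid
  decideAba Zs { w1 with quorumAt := qs }

/-- Effect of an instruction of the adversary. -/
def applyOp (Zs : Finset (Fin P.n)) (w : World P F) : Op P F → World P F
  | .deal sid v =>
      if sid.dealer ∈ Zs ∧ w.deals sid = none then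
        { w with deals := Function.update w.deals sid (some (v, w.clock.round)) }
      else w
  | .vote sid j b =>
      if j ∈ Zs then w.castVotes Zs j (Function.update (fun _ => none) sid (some b)) else w
  | .coreset sid C =>
      if P.Quorum C ∧ w.dec sid = none then
        decideAba Zs { w with core := Function.update w.core sid (some C) }
      else w
  | .send j i tag q v =>
      if j ∈ Zs then
        w.setParty i { w.parties i with msgs := insert (j, tag, q, v) (w.parties i).msgs }
      else w

def applyOps (Zs : Finset (Fin P.n)) (w : World P F) (ops : List (Op P F)) : World P F :=
  ops.foldl (applyOp Zs) w

/-- Something that happened in round `c` cannot be held back any longer. -/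
def overdue (B : ℕ) (w : World P F) (c : ℕ) : Prop := c + B ≤ w.clock.round

/-- The adversary cannot withhold a core set indefinitely: `B` rounds after the voters became a
quorum, all of them are taken as the core set. -/
def forceAba (B : ℕ) (Zs : Finset (Fin P.n)) (w : World P F) : World P F :=
  let core' : ASid P → Option (Finset (Fin P.n)) := fun sid =>
    if w.dec sid = none ∧ ∃ c, w.quorumAt sid = some c ∧ w.overdue B c then some (w.voters sid)
    else w.core sid
  decideAba Zs { w with core := core' }

/-- Delivery to party `i` of what the adversary has chosen (`D`) and of what is overdue. -/
def deliver (B : ℕ) (i : Fin P.n) (D : Set (Item P)) (w : World P F) : World P F :=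
  let s := w.parties i
  w.setParty i
    { s with
      vss := fun sid =>
        if s.vss sid = none ∧ s.wantsV sid ∧
            ∃ v c, w.deals sid = some (v, c) ∧ (Item.vss sid ∈ D ∨ w.overdue B c) then
          (w.deals sid).map fun d => mask i d.1
        else s.vss sid
      aba := fun sid =>
        if s.aba sid = none ∧ s.wantsA sid ∧
            ∃ b c, w.dec sid = some (b, c) ∧ (Item.aba sid ∈ D ∨ w.overdue B c) then
          (w.dec sid).map Prod.fst
        else s.aba sid
      msgs := s.msgs ∪ {m | i ∉ P.S m.2.2.1 ∧ ∃ c,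
        w.mail m.1 m.2.1 m.2.2.1 = some (m.2.2.2, c) ∧
          (Item.mail m.1 m.2.1 m.2.2.1 ∈ D ∨ w.overdue B c)} }

/-- The honest parties that have received their input. -/
def alive (Zs : Finset (Fin P.n)) (w : World P F) : Finset (Fin P.n) :=
  Finset.univ.filter fun i => i ∉ Zs ∧ (w.parties i).started

end World

/-- A random vector of shares of `x`. -/
def randomShares [Fintype F] (x : F) : PMF (Fin P.h → F) :=
  uniformOn (Finset.univ.filter fun v : Fin P.h → F => ∑ q, v q = x) (fun _ => 0)

/-- Independent random sharings of a list of secrets. -/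
def shareAll [Fintype F] : List (VSid P × F) → PMF (VSid P → Option (Fin P.h → F))
  | [] => PMF.pure fun _ => none
  | x :: xs => (randomShares x.2).bind fun v =>
      (shareAll xs).map fun f => Function.update f x.1 (some v)

/-- The actions of party `i` after its local computation: it shares values, votes, and sends shares
of the values to be reconstructed. -/
def World.actions [Fintype F] (Zs : Finset (Fin P.n)) (i : Fin P.n) (w : World P F) :
    PMF (World P F) :=
  let s := (w.parties i).update i
  (PMF.uniformOfFintype (Bool → Fin P.M → F)).bind fun rnd =>
    (shareAll ((s.toDeal i rnd).filter fun x => decide (x.1 ∉ s.dealt))).map fun f =>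
      let s' := { s with
        dealt := s.dealt ∪ {sid | f sid ≠ none}
        voted := fun sid => if s.voted sid = none then s.newVote i sid else s.voted sid }
      World.castVotes Zs i (s.newVote i)
        { w with
          parties := Function.update w.parties i s'
          deals := fun sid => if w.deals sid = none then (f sid).map fun v => (v, w.clock.round)
            else w.deals sid
          mail := Function.update w.mail i fun tag q =>
            if w.mail i tag q = none then (s.myShare i tag q).map fun v => (v, w.clock.round)
            else w.mail i tag q }

/-- Activation of an honest party `i` that has its input, where the adversary has chosen the
deliveries `D`: the party outputs its shares in the activation in which it obtains them. -/
def World.activate [Fintype F] (B : ℕ) (Zs : Finset (Fin P.n)) (i : Fin P.n) (D : Set (Item P))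
    (w : World P F) : PMF (World P F × Resp (Table P F)) :=
  (((w.forceAba B Zs).deliver B i D).actions Zs i).map fun w' =>
    ({ w' with clock := w'.clock.tick (w'.alive Zs) i },
      match (w.parties i).out, (w'.parties i).out with
      | none, some o => .output o
      | _, _ => .nothing)

/-- The protocol in the hybrid model, with corrupt parties `Zs`, adversary `A` and delay bound
`B`. -/
def realSystem [Fintype F] (B : ℕ) (Zs : Finset (Fin P.n)) (A : Adversary P F) :
    System P.n (Table P F) where
  W := A.St × World P F
  init := (A.init, World.init P F)
  respond := fun x cmd =>
    match cmd with
    | .input i =>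
        PMF.pure ((x.1, if i ∈ Zs then x.2 else
          x.2.setParty i { x.2.parties i with started := True }), .nothing)
    | .toAdv m => (A.onEnv x.1 (x.2.view Zs) m).map fun a =>
        ((a.1, x.2.applyOps Zs a.2.1), .fromAdv a.2.2)
    | .activate i =>
        if i ∉ Zs ∧ (x.2.parties i).started then
          (A.onReq x.1 (x.2.view Zs) i).bind fun a =>
            ((x.2.applyOps Zs a.2.1).activate B Zs i a.2.2).map fun y => ((a.1, y.1), y.2)
        else PMF.pure (x, .nothing)

/-! ## Resources used by the honest parties -/

/-- The VSS instances that honest parties have called. -/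
def World.vssCalls (Zs : Finset (Fin P.n)) (w : World P F) : Set (VSid P) :=
  {sid | ∃ i, i ∉ Zs ∧ ((w.parties i).wantsV sid ∨ sid ∈ (w.parties i).dealt)}

/-- The ABA instances that honest parties have called. -/
def World.abaCalls (Zs : Finset (Fin P.n)) (w : World P F) : Set (ASid P) :=
  {sid | ∃ i, i ∉ Zs ∧ ((w.parties i).wantsA sid ∨ (w.parties i).voted sid ≠ none)}

/-- The point-to-point messages (sender, receiver, name, index of the share) sent by honest parties;
each of them carries one field element. -/
def World.sentMsgs (Zs : Finset (Fin P.n)) (w : World P F) :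
    Set (Fin P.n × Fin P.n × RTag P × Fin P.h) :=
  {m | m.1 ∉ Zs ∧ m.2.1 ∉ P.S m.2.2.2 ∧ w.mail m.1 m.2.2.1 m.2.2.2 ≠ none}

/-! ## The ideal world -/

/-- State of the functionality for multiplication triples: the parties on behalf of which
it has received a request, the rounds in which the honest parties have sent theirs, the round in
which these parties first were a quorum, the shares supplied by the simulator, the completed
sharings, and the parties that have received their output. -/
structure Ideal (P : Params) (F : Type) where
  sent : Finset (Fin P.n)
  startedAt : Fin P.n → Option ℕ
  quorumAt : Option ℕ
  shares : Option (Table P F)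
  result : Option (Table P F)
  delivered : Finset (Fin P.n)
  clock : Clock P.n

def Ideal.init (P : Params) (F : Type) : Ideal P F where
  sent := ∅
  startedAt := fun _ => none
  quorumAt := none
  shares := none
  result := none
  delivered := ∅
  clock := ⟨0, ∅⟩

/-- The simulator sees which honest parties have sent a request, and the round. -/
structure IdealView (P : Params) where
  started : Set (Fin P.n)
  round : ℕ

/-- The simulator can send a request on behalf of a corrupt party, and supply the shares of the
triples that belong to the corrupt parties (other entries are ignored). -/
inductive SOp (P : Params) (F : Type) : Type
  | triples (j : Fin P.n)
  | shares (T : Table P F)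

/-- A simulator.  It is activated by messages of the environment, and whenever an honest party
requests its output; then it also decides whether this request is granted. -/
structure Simulator (P : Params) (F : Type) where
  St : Type
  init : St
  onEnv : St → IdealView P → Msg → PMF (St × List (SOp P F) × Msg)
  onReq : St → IdealView P → Fin P.n → PMF (St × List (SOp P F) × Bool)

/-- Single sharing generation for all triples: independent uniform `a`, `b` with `c = a * b`, and
random sharings of them that agree with `T` in the shares of the corrupt parties. -/
def completeTriples [Fintype F] (Zs : Finset (Fin P.n)) (T : Table P F) : PMF (Table P F) :=
  (PMF.uniformOfFintype (Fin P.M → F)).bind fun a =>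
    (PMF.uniformOfFintype (Fin P.M → F)).bind fun b =>
      uniformOn (Finset.univ.filter fun R : Table P F =>
        (∀ l x q, Visible Zs q → R l x q = T l x q) ∧
        ∀ l, ∑ q, R l 0 q = a l ∧ ∑ q, R l 1 q = b l ∧ ∑ q, R l 2 q = a l * b l) T

namespace Ideal

def view (w : Ideal P F) : IdealView P := ⟨{i | w.startedAt i ≠ none}, w.clock.round⟩

/-- The honest parties that have sent a request. -/
def alive (w : Ideal P F) : Finset (Fin P.n) := Finset.univ.filter fun i => w.startedAt i ≠ none

/-- A request of the honest party `i`. -/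
def request (i : Fin P.n) (w : Ideal P F) : Ideal P F :=
  if w.startedAt i = none then
    let w1 := { w with
      sent := insert i w.sent
      startedAt := Function.update w.startedAt i (some w.clock.round) }
    { w1 with quorumAt :=
        if w.quorumAt = none ∧ P.Quorum w1.alive then some w.clock.round else w.quorumAt }
  else w

def applyOp (Zs : Finset (Fin P.n)) (w : Ideal P F) : SOp P F → Ideal P F
  | .triples j => if j ∈ Zs then { w with sent := insert j w.sent } else w
  | .shares T => if w.shares = none then { w with shares := some T } else w

def applyOps (Zs : Finset (Fin P.n)) (w : Ideal P F) (ops : List (SOp P F)) : Ideal P F :=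
  ops.foldl (applyOp Zs) w

/-- The output of party `i` can no longer be delayed: `B` rounds have passed since it has sent its
request and a quorum of honest parties has. -/
def due (B : ℕ) (i : Fin P.n) (w : Ideal P F) : Prop :=
  ∃ c d, w.startedAt i = some c ∧ w.quorumAt = some d ∧ max c d + B ≤ w.clock.round

/-- The sharings are fixed when the first output is given. -/
def prepare [Fintype F] (Zs : Finset (Fin P.n)) (w : Ideal P F) : PMF (Table P F) :=
  match w.result with
  | some R => PMF.pure R
  | none => completeTriples Zs (w.shares.getD fun _ _ _ => 0)

/-- Activation of the honest party `i`, which requests its output; `ok` is the decision of the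
simulator. -/
def activate [Fintype F] (B : ℕ) (Zs : Finset (Fin P.n)) (i : Fin P.n) (ok : Bool)
    (w : Ideal P F) : PMF (Ideal P F × Resp (Table P F)) :=
  let c := w.clock.tick w.alive i
  if i ∉ w.delivered ∧ P.Quorum w.sent ∧
      ((ok = true ∧ (w.shares ≠ none ∨ w.result ≠ none)) ∨ w.due B i) then
    (w.prepare Zs).map fun R =>
      ({ w with result := some R, delivered := insert i w.delivered, clock := c },
        .output fun l x => mask i (R l x))
  else PMF.pure ({ w with clock := c }, .nothing)

end Ideal

/-- The ideal world with the functionality for `M` multiplication triples, corrupt parties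
`Zs`, simulator `X` and delay bound `B`. -/
def idealSystem [Fintype F] (B : ℕ) (Zs : Finset (Fin P.n)) (X : Simulator P F) :
    System P.n (Table P F) where
  W := X.St × Ideal P F
  init := (X.init, Ideal.init P F)
  respond := fun x cmd =>
    match cmd with
    | .input i => PMF.pure ((x.1, if i ∈ Zs then x.2 else x.2.request i), .nothing)
    | .toAdv m => (X.onEnv x.1 x.2.view m).map fun a =>
        ((a.1, x.2.applyOps Zs a.2.1), .fromAdv a.2.2)
    | .activate i =>
        if i ∉ Zs ∧ x.2.startedAt i ≠ none then
          (X.onReq x.1 x.2.view i).bind fun a =>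
            ((x.2.applyOps Zs a.2.1).activate B Zs i a.2.2).map fun y => ((a.1, y.1), y.2)
        else PMF.pure (x, .nothing)

end Protocol

/-- Perfect UC-security of the protocol: for every adversary there is a simulator such that every
environment has the same output distribution in the hybrid world, with delay bound `B`, and in the
ideal world, with delay bound `B'`. -/
def PerfectlyUCRealizes (P : Params) (F : Type) [Field F] [Fintype F] (B B' : ℕ) : Prop :=
  ∀ Zs : Finset (Fin P.n), P.Covered Zs →
    ∀ A : Adversary P F, ∃ X : Simulator P F,
      ∀ (E : Env P.n (Table P F)) (k : ℕ),
        outcome E (realSystem B Zs A) k = outcome E (idealSystem B' Zs X) k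

end

end AMPC

/-!
All that honest parties ever agree on is the *public record* `Rec` of an execution: the decisions
of the ABA instances and the full vectors dealt in the VSS instances. Every notion of the protocol
(selected parties, differences, conflicts, refuted parties) makes sense for the record, and
`Agree` says that a local state is a partial view of it. Since `Q 4` holds, a share is accepted only
if an honest party has sent it, and honest parties send the shares given by the record; thus all
honest parties reconstruct the same values. The invariant `Inv` of the hybrid world contains
`Agree` for every honest party, and each step preserves it (`Inv.step`).

*Complexity.* A refuted party is corrupt (`Agree.LD_corrupt`). An identification, due every
`t * n + 1` iterations, adds a new refuted party to the set of identified ones, so that there are at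
most `n ^ 3` iterations (`Rec.GDDone.le`). Counting the instances and messages of an iteration
gives the bounds (`complexity`).

*Termination.* The progress of a local state (`PartySt.progress`) is monotone and bounded. A period
of `7 * B + 30` rounds in which a quorum of honest parties makes no progress, a `Window`, does not
exist unless these parties are done (`Window.out`). The critical case is an identification: some
party must be refuted in the eyes of all. A party that has withheld a part is not selected again
while it does so, and among the last `t + 1` iterations there is hence one in which nothing is
withheld (`Rec.exists_iter_dealt`). In that iteration two products differ; so a selected party has
shared something wrong (`exists_cheat`), and it is refuted as soon as the messages have arrived
(`identify`). Together these give the bound on the delay of the outputs (`Steps.out`).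

*Security.* The simulator runs a copy of the hybrid world, in which the honest parties draw their
inputs themselves, and extracts from it the shares of the triples that the adversary sees. All
corrupt parties lie in one set `Z qs`, so that the adversary sees no share with index `qs`. If the
input sharings of honest parties are changed in hidden shares (`Shift`), every dealt sum of products
can be adjusted in its share with index `qs`, and the result is again an execution
(`World.blur`). The adversary sees the same (`World.blur_view`), the opened values are the same, and
each transition of the hybrid world commutes with the shift (`Inv.activate_blur`). The product
computed with respect to `Z qs` comes from honest parties only; if all differences are zero, all
products are right (`ZeroDiff.table_sum`). Therefore a uniform shift turns the output of the copy
into a uniform completion of the visible shares to multiplication triples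
(`Rec.ZeroDiff.bind_completeTriples`), which is what the functionality delivers. The ideal world
followed by a uniform shift of the copy, given the completed triples, is thus distributed like the
hybrid world, step by step (`Matches`, `outcome_eq_of_simulation`), and perfect security follows
(`perfectlyUCRealizes`).
-/

set_option linter.unusedSectionVars false

namespace AMPC

noncomputable section

open Classical

variable {P : Params} {F : Type} [Field F]

/-! ### Adversary structures and least indices -/

theorem least_some {m : ℕ} {p : Fin m → Prop} {j : Fin m} (h : least p = some j) : p j := by
  unfold least at h
  split_ifs at h with hp
  have := Finset.min'_mem _ hp
  simp only [Option.some.injEq] at h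
  rw [h] at this
  simpa using this

theorem least_eq_none {m : ℕ} {p : Fin m → Prop} : least p = none ↔ ∀ j, ¬ p j := by
  unfold least
  split_ifs with hp
  · obtain ⟨j, hj⟩ := hp
    simp only [false_iff, not_forall, not_not]
    exact ⟨j, by simpa using hj⟩
  · simp only [true_iff]
    intro j hj
    exact hp ⟨j, by simpa using hj⟩

theorem exists_least {m : ℕ} {p : Fin m → Prop} (h : ∃ j, p j) : ∃ j, least p = some j := by
  by_contra hn
  push Not at hn
  obtain ⟨j, hj⟩ := h
  have : least p = none := by
    cases hl : least p with
    | none => rfl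
    | some k => exact absurd hl (hn k)
  exact least_eq_none.1 this j hj

namespace Params

theorem Covered.mono {P : Params} {A A' : Finset (Fin P.n)} (h : P.Covered A) (hs : A' ⊆ A) :
    P.Covered A' :=
  let ⟨q, hq⟩ := h
  ⟨q, hs.trans hq⟩

theorem Quorum.mono {P : Params} {A A' : Finset (Fin P.n)} (h : P.Quorum A) (hs : A ⊆ A') :
    P.Quorum A' :=
  Covered.mono h (Finset.compl_subset_compl.2 hs)

theorem quorum_univ (P : Params) : P.Quorum Finset.univ := ⟨P.z0, by simp⟩

theorem mem_S {P : Params} {i : Fin P.n} {q : Fin P.h} : i ∈ P.S q ↔ i ∉ P.Z q := by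
  simp [S]

theorem Q.exists_notMem {P : Params} (h : P.Q 4) (a b c d : Fin P.h) :
    ∃ i, i ∉ P.Z a ∧ i ∉ P.Z b ∧ i ∉ P.Z c ∧ i ∉ P.Z d := by
  by_contra hn
  push Not at hn
  refine h ![a, b, c, d] fun i => ?_
  by_cases h0 : i ∈ P.Z a
  · exact ⟨0, h0⟩
  by_cases h1 : i ∈ P.Z b
  · exact ⟨1, h1⟩
  by_cases h2 : i ∈ P.Z c
  · exact ⟨2, h2⟩
  exact ⟨3, hn i h0 h1 h2⟩

/-- A quorum contains an honest party outside of two given sets of the structure. -/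
theorem Quorum.exists_honest {P : Params} (h : P.Q 4) {A Zs : Finset (Fin P.n)} (hA : P.Quorum A)
    (hZ : P.Covered Zs) (a b : Fin P.h) : ∃ i ∈ A, i ∉ Zs ∧ i ∉ P.Z a ∧ i ∉ P.Z b := by
  obtain ⟨c, hc⟩ := hA
  obtain ⟨d, hd⟩ := hZ
  obtain ⟨i, ha, hb, hic, hid⟩ := h.exists_notMem a b c d
  refine ⟨i, ?_, fun hi => hid (hd hi), ha, hb⟩
  by_contra hi
  exact hic (hc (by simpa using hi))

/-- A set of members of `S q` whose complement in `S q` is corruptible contains an honest party. -/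
theorem Covered.exists_honest {P : Params} (h : P.Q 4) {A Zs : Finset (Fin P.n)} {q : Fin P.h}
    (hA : P.Covered (P.S q \ A)) (hZ : P.Covered Zs) : ∃ i ∈ A, i ∉ Zs ∧ i ∈ P.S q := by
  obtain ⟨c, hc⟩ := hA
  obtain ⟨d, hd⟩ := hZ
  obtain ⟨i, ha, -, hic, hid⟩ := h.exists_notMem q q c d
  refine ⟨i, ?_, fun hi => hid (hd hi), mem_S.2 ha⟩
  by_contra hi
  exact hic (hc (by simp [mem_S, ha, hi]))

theorem card_Z_lt {P : Params} (h : P.Q 4) (q : Fin P.h) : (P.Z q).card < P.n := by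
  obtain ⟨i, hi, -⟩ := h.exists_notMem q q q q
  have : (P.Z q).card < (Finset.univ : Finset (Fin P.n)).card :=
    Finset.card_lt_card ((Finset.ssubset_univ_iff).2 fun he => hi (by simp [he]))
  simpa using this

theorem t_lt {P : Params} (h : P.Q 4) : P.t < P.n := by
  unfold t
  obtain ⟨i, -⟩ := h.exists_notMem P.z0 P.z0 P.z0 P.z0
  rw [Finset.sup_lt_iff (by simpa using i.pos)]
  exact fun q _ => card_Z_lt h q

theorem Covered.card_le {P : Params} {A : Finset (Fin P.n)} (h : P.Covered A) : A.card ≤ P.t := by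
  obtain ⟨q, hq⟩ := h
  exact (Finset.card_le_card hq).trans
    (Finset.le_sup (f := fun q => (P.Z q).card) (Finset.mem_univ q))

end Params

/-! ### The hops of the optimistic multiplication -/

/-- The states that the multiplication of iteration `r` with respect to `Z z` runs through, when the
decisions of the ABA instances are given by the partial function `D`. -/
inductive OptReach (D : ASid P → Option Bool) (r : ℕ) (z : Fin P.h) : OptSt P → Prop
  | init : OptReach D r z (OptSt.init P)
  | next {o : OptSt P} {j : Fin P.n} (ho : OptReach D r z o) (hrem : o.rem.Nonempty)
      (hD : ∀ k, D (.sel r z o.hop k) ≠ none)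
      (hj : least (fun k => D (.sel r z o.hop k) = some true) = some j)
      (hjZ : j ∉ P.Z z) (hjs : j ∉ o.selected) : OptReach D r z (o.next z j)

/-- The partial function `D'` extends `D`. -/
def Extends {α β : Type} (D D' : α → Option β) : Prop := ∀ a b, D a = some b → D' a = some b

theorem Extends.ne_none {α β : Type} {D D' : α → Option β} (h : Extends D D') {a : α}
    (ha : D a ≠ none) : D' a ≠ none := by
  obtain ⟨b, hb⟩ := Option.ne_none_iff_exists'.1 ha
  simp [h a b hb]

theorem Extends.eq {α β : Type} {D D' : α → Option β} (h : Extends D D') {a : α}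
    (ha : D a ≠ none) : D' a = D a := by
  obtain ⟨b, hb⟩ := Option.ne_none_iff_exists'.1 ha
  rw [hb, h a b hb]

namespace OptReach

variable {D D' : ASid P → Option Bool} {r : ℕ} {z : Fin P.h} {o o' : OptSt P}

theorem mono (h : OptReach D r z o) (hD : Extends D D') : OptReach D' r z o := by
  induction h with
  | init => exact .init
  | next ho hrem hd hj hjZ hjs ih =>
      refine .next ih hrem (fun k => hD.ne_none (hd k)) ?_ hjZ hjs
      rw [← hj]
      congr 1
      funext k
      rw [hD.eq (hd k)]

theorem hop_eq (h : OptReach D r z o) : o.hop = o.selected.card + 1 := by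
  induction h with
  | init => simp [OptSt.init]
  | next ho hrem hd hj hjZ hjs ih => simp [OptSt.next, Finset.card_insert_of_notMem hjs, ih]

theorem one_le_hop (h : OptReach D r z o) : 1 ≤ o.hop := by
  rw [h.hop_eq]; omega

theorem notMem_Z (h : OptReach D r z o) {j : Fin P.n} (hj : j ∈ o.selected) : j ∉ P.Z z := by
  induction h with
  | init => simp [OptSt.init] at hj
  | next ho hrem hd hl hjZ hjs ih =>
      simp only [OptSt.next, Finset.mem_insert] at hj
      rcases hj with rfl | hj
      · exact hjZ
      · exact ih hj

theorem mem_S_of_mem_summ (h : OptReach D r z o) {j : Fin P.n} {pq : Fin P.h × Fin P.h}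
    (hpq : pq ∈ o.summ j) : j ∈ P.S pq.1 ∧ j ∈ P.S pq.2 := by
  induction h with
  | init => simpa [OptSt.init] using hpq
  | next ho hrem hd hl hjZ hjs ih =>
      simp only [OptSt.next] at hpq
      split_ifs at hpq
      · exact ih (Finset.mem_sdiff.1 hpq).1
      · exact ih hpq

theorem mem_summ_iff (h : OptReach D r z o) {k : Fin P.n} (hk : k ∉ P.Z z) (hks : k ∉ o.selected)
    (pq : Fin P.h × Fin P.h) :
    pq ∈ o.summ k ↔ pq ∈ o.rem ∧ k ∈ P.S pq.1 ∧ k ∈ P.S pq.2 := by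
  induction h with
  | init => simp [OptSt.init]
  | next ho hrem hd hl hjZ hjs ih =>
      simp only [OptSt.next, Finset.mem_insert, not_or] at hks ⊢
      rw [if_pos ⟨hk, by simp [hks]⟩, Finset.mem_sdiff, Finset.mem_sdiff, ih hks.2]
      tauto

/-- The selected parties and the remaining summands partition all summands. -/
theorem sum_summ {M : Type} [AddCommMonoid M] (h : OptReach D r z o)
    (f : Fin P.h × Fin P.h → M) :
    ∑ j ∈ o.selected, ∑ pq ∈ o.summ j, f pq + ∑ pq ∈ o.rem, f pq = ∑ pq, f pq := by
  induction h with
  | init => simp [OptSt.init]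
  | @next o j ho hrem hd hl hjZ hjs ih =>
      have h1 : ∀ k ∈ insert j o.selected, (o.next z j).summ k = o.summ k := by
        intro k hk
        simp only [OptSt.next]
        rw [if_neg (by tauto)]
      have hsub : o.summ j ⊆ o.rem := fun pq hpq => ((ho.mem_summ_iff hjZ hjs pq).1 hpq).1
      rw [← ih, ← Finset.sum_sdiff hsub]
      have h2 : ∑ k ∈ insert j o.selected, ∑ pq ∈ (o.next z j).summ k, f pq =
          ∑ k ∈ insert j o.selected, ∑ pq ∈ o.summ k, f pq :=
        Finset.sum_congr rfl fun k hk => by rw [h1 k hk]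
      change ∑ k ∈ insert j o.selected, ∑ pq ∈ (o.next z j).summ k, f pq +
        ∑ pq ∈ o.rem \ o.summ j, f pq = _
      rw [h2, Finset.sum_insert hjs]
      abel

/-- The states form a chain that is indexed by the hops. -/
theorem linear (h : OptReach D r z o) (h' : OptReach D r z o') (hle : o.hop ≤ o'.hop) :
    o = o' ∨ o.hop < o'.hop ∧ o.rem.Nonempty ∧ ∀ k, D (.sel r z o.hop k) ≠ none := by
  induction h' generalizing o with
  | init =>
      left
      cases h with
      | init => rfl
      | next ho =>
          have := ho.one_le_hop
          simp [OptSt.next, OptSt.init] at hle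
          omega
  | @next o' j ho' hrem hd hj hjZ hjs ih =>
      simp only [OptSt.next] at hle
      rcases Nat.lt_or_ge o'.hop o.hop with hlt | hge
      · left
        cases h with
        | init =>
            have := ho'.one_le_hop
            simp [OptSt.init] at hlt
            omega
        | @next o1 j1 ho1 hrem1 hd1 hj1 hjZ1 hjs1 =>
            simp only [OptSt.next] at hlt hle
            rcases ih ho1 (by omega) with rfl | ⟨h1, -⟩
            · rw [hj] at hj1
              cases hj1
              rfl
            · omega
      · right
        rcases ih h hge with rfl | ⟨h1, h2⟩
        · exact ⟨by simp [OptSt.next], hrem, hd⟩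
        · exact ⟨by simp only [OptSt.next]; omega, h2⟩

theorem eq_of_hop (h : OptReach D r z o) (h' : OptReach D r z o') (he : o.hop = o'.hop) :
    o = o' := by
  rcases h.linear h' he.le with rfl | ⟨h1, -⟩
  · rfl
  · omega

theorem hop_le_of_rem (h : OptReach D r z o) (h' : OptReach D r z o') (hr : o.rem = ∅) :
    o'.hop ≤ o.hop := by
  by_contra hc
  rcases h.linear h' (by omega) with rfl | ⟨-, h2, -⟩
  · omega
  · simp [hr] at h2

theorem eq_of_rem (h : OptReach D r z o) (h' : OptReach D r z o') (hr : o.rem = ∅)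
    (hr' : o'.rem = ∅) : o = o' :=
  h.eq_of_hop h' (le_antisymm (hop_le_of_rem h' h hr') (hop_le_of_rem h h' hr))

/-- The state in which a selected party was selected. -/
theorem exists_of_selected (h : OptReach D r z o) {j : Fin P.n} (hj : j ∈ o.selected) :
    ∃ o', OptReach D r z o' ∧ o'.hop = o.hopOf j ∧ o'.hop < o.hop ∧ o'.summ j = o.summ j ∧
      j ∉ o'.selected ∧ o'.rem.Nonempty ∧ D (.sel r z o'.hop j) = some true := by
  induction h with
  | init => simp [OptSt.init] at hj
  | @next o k ho hrem hd hl hjZ hjs ih =>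
      by_cases hjk : j = k
      · subst hjk
        refine ⟨o, ho, by simp [OptSt.next], by simp [OptSt.next], ?_, hjs, hrem,
          least_some hl⟩
        simp [OptSt.next]
      · have hj' : j ∈ o.selected := by
          simpa [OptSt.next, hjk] using hj
        obtain ⟨o', h1, h2, h3, h4, h5⟩ := ih hj'
        refine ⟨o', h1, ?_, ?_, ?_, h5⟩
        · simp [OptSt.next, Function.update_of_ne hjk, h2]
        · simp only [OptSt.next]; omega
        · simp [OptSt.next, hj', h4]

/-- As long as summands remain, every quorum contains an honest party that holds one of them. -/
theorem exists_candidate (h : OptReach D r z o) (hQ : P.Q 4) {A Zs : Finset (Fin P.n)}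
    (hA : P.Quorum A) (hAZ : Disjoint A Zs) (hr : o.rem.Nonempty) :
    ∃ j ∈ A, j ∉ Zs ∧ j ∉ P.Z z ∧ j ∉ o.selected := by
  obtain ⟨pq, hpq⟩ := hr
  obtain ⟨c, hc⟩ := hA
  obtain ⟨i, h1, h2, h3, h4⟩ := hQ.exists_notMem pq.1 pq.2 z c
  have hiA : i ∈ A := by
    by_contra hi
    exact h4 (hc (by simpa using hi))
  refine ⟨i, hiA, Finset.disjoint_left.1 hAZ hiA, h3, fun hi => ?_⟩
  have key : ∀ o : OptSt P, OptReach D r z o → i ∈ o.selected → pq ∉ o.rem := by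
    intro o ho
    induction ho with
    | init => simp [OptSt.init]
    | @next o k ho hrem hd hl hjZ hjs ih =>
        intro hi hp
        simp only [OptSt.next, Finset.mem_insert, Finset.mem_sdiff] at hi hp
        rcases hi with rfl | hi
        · exact hp.2 ((ho.mem_summ_iff hjZ hjs pq).2 ⟨hp.1, Params.mem_S.2 h1, Params.mem_S.2 h2⟩)
        · exact ih hi hp.1
  exact key o h hi hpq

theorem hop_le (h : OptReach D r z o) : o.hop ≤ P.n + 1 := by
  rw [h.hop_eq]
  have := Finset.card_le_univ o.selected
  simp at this
  omega

theorem hop_le_of_rem_nonempty (h : OptReach D r z o) (hQ : P.Q 4) (hr : o.rem.Nonempty) :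
    o.hop ≤ P.n := by
  obtain ⟨j, -, -, -, hj⟩ := h.exists_candidate hQ P.quorum_univ
    (Finset.disjoint_empty_right _) hr
  have : o.selected.card < (Finset.univ : Finset (Fin P.n)).card :=
    Finset.card_lt_card ((Finset.ssubset_univ_iff).2 fun he => hj (by simp [he]))
  rw [h.hop_eq]
  simp at this
  omega

end OptReach

/-- The parts of a sum, determined by the parties selected in another complete multiplication, add
up to the sum. -/
theorem OptReach.sum_inter {M : Type} [AddCommMonoid M] {D : ASid P → Option Bool} {r : ℕ}
    {z : Fin P.h} {o : OptSt P} (h : OptReach D r z o) (hr : o.rem = ∅)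
    (T : Finset (Fin P.h × Fin P.h)) (f : Fin P.h × Fin P.h → M) :
    ∑ j ∈ o.selected, ∑ pq ∈ T ∩ o.summ j, f pq = ∑ pq ∈ T, f pq := by
  have := h.sum_summ fun pq => if pq ∈ T then f pq else 0
  rw [hr, Finset.sum_empty, add_zero] at this
  simp only [Finset.sum_ite_mem, Finset.univ_inter] at this
  rw [← this]
  refine Finset.sum_congr rfl fun j _ => ?_
  rw [Finset.inter_comm]

/-! ### The public record of an execution -/

/-- What the parties can agree upon: the decisions of the ABA instances and the full vectors dealt
in the VSS instances, as far as they exist. -/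
structure Rec (P : Params) (F : Type) where
  D : ASid P → Option Bool
  V : VSid P → Option (Fin P.h → F)

/-- A record is below the records that extend it. -/
instance : LE (Rec P F) := ⟨fun G G' => Extends G.D G'.D ∧ Extends G.V G'.V⟩

namespace Rec

/-- `o` is the final state of the multiplication of iteration `r` with respect to `Z z`, and the
sums of the selected parties have been dealt. -/
def OptFinal (G : Rec P F) (r : ℕ) (z : Fin P.h) (o : OptSt P) : Prop :=
  OptReach G.D r z o ∧ o.rem = ∅ ∧
    ∀ j ∈ o.selected, ∀ l, G.V (.summ r z (o.hopOf j) j l) ≠ none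

/-- The final state of a multiplication; the initial state as long as there is no final one. -/
def opt (G : Rec P F) (r : ℕ) (z : Fin P.h) : OptSt P :=
  if h : ∃ o, G.OptFinal r z o then h.choose else OptSt.init P

/-- The state of an omniscient party, without the conflicts. -/
def pre (G : Rec P F) : PartySt P F :=
  { PartySt.init P F with vss := G.V, aba := G.D, opt := G.opt }

/-- All multiplications of iteration `r` are complete. -/
def AllDone (G : Rec P F) (r : ℕ) : Prop := ∀ z, ∃ o, G.OptFinal r z o

/-- The value of the `l`-th difference in iteration `r` with respect to `Z z`. -/
def diff (G : Rec P F) (r : ℕ) (z : Fin P.h) (l : Fin P.M) : F :=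
  ∑ q, (G.pre.cShare r z l q - G.pre.cShare r P.z0 l q)

/-- The conflicting set and the index of the conflicting pair in iteration `r`. -/
def conf (G : Rec P F) (r : ℕ) : Option (Fin P.h × Fin P.M) :=
  if G.AllDone r then
    match least fun z => ∃ l, G.diff r z l ≠ 0 with
    | none => none
    | some z => (least fun l => G.diff r z l ≠ 0).map fun l => (z, l)
  else none

/-- The state of an omniscient party that holds all shares; the notions that are defined for local
states can thus be used for the record. -/
def st (G : Rec P F) : PartySt P F := { G.pre with conf := G.conf }

/-- The first stage is complete. -/
def Stage1 (G : Rec P F) : Prop :=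
  (∀ j, G.D (.acs j) ≠ none) ∧ ∀ j ∈ G.st.CS, ∀ b l, G.V (.input j b l) ≠ none

/-- All products of iteration `r` have been computed and agree. -/
def ZeroDiff (G : Rec P F) (r : ℕ) : Prop := G.AllDone r ∧ ∀ z l, G.diff r z l = 0

/-- The party identified after iteration `r`. -/
def gdAt (G : Rec P F) (r : ℕ) : Option (Fin P.n) :=
  if ∀ k, G.D (.gd r k) ≠ none then least fun k => G.D (.gd r k) = some true else none

/-- The parties identified before iteration `r`. -/
def GD (G : Rec P F) (r : ℕ) : Finset (Fin P.n) :=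
  Finset.univ.filter fun j => ∃ r' < r, PartySt.gdIter P r' ∧ G.gdAt r' = some j

/-- All identifications that are due before iteration `r` have been decided. -/
def GDDone (G : Rec P F) (r : ℕ) : Prop :=
  ∀ r' < r, PartySt.gdIter P r' → ∀ k, G.D (.gd r' k) ≠ none

/-- The `q`-th share of a value that is to be reconstructed. -/
def share (G : Rec P F) (tag : RTag P) (q : Fin P.h) : Option F :=
  match tag with
  | .part r z j k =>
      match G.conf r with
      | none => none
      | some (zc, _) =>
          if G.st.partDue r zc z j k ∧ G.st.got (.part r z j k) then
            some (G.st.val (.part r z j k) q)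
          else none
  | .inp r j k second =>
      match G.conf r with
      | none => none
      | some (zc, l) =>
          if G.Stage1 ∧ j ∈ G.st.Sel r zc ∧ k ∈ G.st.Sel r P.z0 ∧
              (∃ pq ∈ G.st.inter r zc j k, (if second then pq.2 else pq.1) = q) then
            some (G.st.factor second l q)
          else none
  | tag' => G.st.baseShare q tag'

/-- What a vote of an honest party reveals about the record. -/
def VoteOK (Zs : Finset (Fin P.n)) (G : Rec P F) : ASid P → Bool → Prop
  | .acs j, true => ∀ b l, G.V (.input j b l) ≠ none
  | .acs _, false => P.Quorum G.st.CS
  | .sel r z hop j, true => 1 ≤ r ∧ (∃ o, OptReach G.D r z o ∧ o.hop = hop ∧ j ∉ P.Z z ∧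
      j ∉ o.selected) ∧ (∀ l, G.V (.summ r z hop j l) ≠ none) ∧ G.GDDone r ∧ j ∉ G.GD r ∧
      ∀ r', 1 ≤ r' → r' < r → ∃ zc l, G.conf r' = some (zc, l) ∧
        ((j ∈ G.st.Sel r' zc ∨ j ∈ G.st.Sel r' P.z0) →
          ∀ z k, G.st.partDue r' zc z j k → G.V (.part r' z j k) ≠ none)
  | .sel r z hop _, false => ∃ k, G.D (.sel r z hop k) = some true
  | .gd r j, true => j ∈ Zs ∧ G.GDDone r ∧ j ∉ G.GD r
  | .gd r _, false => ∃ k, G.D (.gd r k) = some true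

/-- The vectors dealt by honest parties share the right secrets. -/
def DealOK (G : Rec P F) : VSid P → (Fin P.h → F) → Prop
  | .input _ _ _, _ => True
  | .summ r z hop i l, v => 1 ≤ r ∧ G.Stage1 ∧ ∃ o, OptReach G.D r z o ∧ o.hop = hop ∧
      o.rem.Nonempty ∧ i ∉ P.Z z ∧ i ∉ o.selected ∧ ∑ q, v q = G.st.prodSum l (o.summ i)
  | .part r z i k, v => G.Stage1 ∧ ∃ zc l, G.conf r = some (zc, l) ∧ G.st.partDue r zc z i k ∧
      ∑ q, v q = G.st.prodSum l (G.st.partSumms r zc z i k)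

end Rec

/-! ### Refinement of local states -/

/-- The state `s'` knows at least as much as `s`, where shares are compared for indices in `I`. -/
structure Ref (I : Fin P.h → Prop) (s s' : PartySt P F) : Prop where
  vss : ∀ sid v, s.vss sid = some v → ∃ v', s'.vss sid = some v' ∧ ∀ q, I q → v' q = v q
  opt : ∀ r z, s.optDone r z → s'.opt r z = s.opt r z
  conf : ∀ r p, s.conf r = some p → s'.conf r = some p ∧ ∀ z, s.optDone r z

namespace Ref

variable {I : Fin P.h → Prop} {s s' : PartySt P F}

theorem got (h : Ref I s s') {sid : VSid P} (hg : s.got sid) : s'.got sid := by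
  obtain ⟨v, hv⟩ := Option.ne_none_iff_exists'.1 hg
  obtain ⟨v', hv', -⟩ := h.vss sid v hv
  simp [PartySt.got, hv']

theorem val (h : Ref I s s') {sid : VSid P} (hg : s.got sid) {q : Fin P.h} (hq : I q) :
    s'.val sid q = s.val sid q := by
  obtain ⟨v, hv⟩ := Option.ne_none_iff_exists'.1 hg
  obtain ⟨v', hv', h'⟩ := h.vss sid v hv
  simp [PartySt.val, hv', hv, h' q hq]

theorem optDone (h : Ref I s s') {r : ℕ} {z : Fin P.h} (hd : s.optDone r z) : s'.optDone r z := by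
  have := h.opt r z hd
  unfold PartySt.optDone PartySt.Sel PartySt.sumSid at *
  rw [this]
  exact ⟨hd.1, fun j hj l => h.got (hd.2 j hj l)⟩

theorem Sel (h : Ref I s s') {r : ℕ} {z : Fin P.h} (hd : s.optDone r z) :
    s'.Sel r z = s.Sel r z := by
  simp [PartySt.Sel, h.opt r z hd]

theorem sumSid (h : Ref I s s') {r : ℕ} {z : Fin P.h} (hd : s.optDone r z) (j : Fin P.n)
    (l : Fin P.M) : s'.sumSid r z j l = s.sumSid r z j l := by
  simp [PartySt.sumSid, h.opt r z hd]

theorem cShare (h : Ref I s s') {r : ℕ} {z : Fin P.h} (hd : s.optDone r z) (l : Fin P.M)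
    {q : Fin P.h} (hq : I q) : s'.cShare r z l q = s.cShare r z l q := by
  unfold PartySt.cShare
  rw [h.Sel hd]
  refine Finset.sum_congr rfl fun j hj => ?_
  rw [h.sumSid hd, h.val (hd.2 j hj l) hq]

theorem partDue (h : Ref I s s') {r : ℕ} {zc : Fin P.h} (hc : s.optDone r zc)
    (h0 : s.optDone r P.z0) (z : Fin P.h) (j k : Fin P.n) :
    s'.partDue r zc z j k ↔ s.partDue r zc z j k := by
  simp [PartySt.partDue, h.Sel hc, h.Sel h0]

theorem inter (h : Ref I s s') {r : ℕ} {zc : Fin P.h} (hc : s.optDone r zc)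
    (h0 : s.optDone r P.z0) (j k : Fin P.n) : s'.inter r zc j k = s.inter r zc j k := by
  simp [PartySt.inter, h.opt r _ hc, h.opt r _ h0]

theorem partSumms (h : Ref I s s') {r : ℕ} {zc : Fin P.h} (hc : s.optDone r zc)
    (h0 : s.optDone r P.z0) (z : Fin P.h) (j k : Fin P.n) :
    s'.partSumms r zc z j k = s.partSumms r zc z j k := by
  simp [PartySt.partSumms, h.inter hc h0]

theorem baseShare (h : Ref I s s') {q : Fin P.h} (hq : I q) {tag : RTag P} {v : F}
    (hv : s.baseShare q tag = some v) : s'.baseShare q tag = some v := by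
  cases tag with
  | diff r z l =>
      simp only [PartySt.baseShare] at hv ⊢
      split_ifs at hv with hd
      rw [if_pos ⟨h.optDone hd.1, h.optDone hd.2⟩, h.cShare hd.1 l hq, h.cShare hd.2 l hq, hv]
  | sumCheck r z j =>
      simp only [PartySt.baseShare] at hv ⊢
      cases hc : s.conf r with
      | none => simp [hc] at hv
      | some p =>
          obtain ⟨zc, l⟩ := p
          obtain ⟨hc', hd⟩ := h.conf r _ hc
          simp only [hc, hc'] at hv ⊢
          split_ifs at hv with hcond
          obtain ⟨h1, h2, h3, h4⟩ := hcond
          simp only [h.partDue (hd zc) (hd P.z0), h.sumSid (hd z), h.Sel (hd z)]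
          rw [if_pos ⟨h1, h2, h.got h3, fun k hk => h.got (h4 k hk)⟩, ← hv, h.val h3 hq]
          congr 2
          refine Finset.sum_congr rfl fun k hk => ?_
          rw [h.val (h4 k (Finset.mem_filter.1 hk).2) hq]
  | pairDiff r j k =>
      simp only [PartySt.baseShare] at hv ⊢
      cases hc : s.conf r with
      | none => simp [hc] at hv
      | some p =>
          obtain ⟨zc, l⟩ := p
          obtain ⟨hc', hd⟩ := h.conf r _ hc
          simp only [hc, hc'] at hv ⊢
          split_ifs at hv with hcond
          obtain ⟨h1, h2, h3, h4⟩ := hcond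
          rw [h.Sel (hd zc), h.Sel (hd P.z0), if_pos ⟨h1, h2, h.got h3, h.got h4⟩, ← hv,
            h.val h3 hq, h.val h4 hq]
  | part r z j k => simp [PartySt.baseShare] at hv
  | inp r j k b => simp [PartySt.baseShare] at hv

theorem factor (h : Ref I s s') (hCS : s'.CS = s.CS)
    (hg : ∀ j ∈ s.CS, ∀ b l, s.got (.input j b l)) (b : Bool) (l : Fin P.M) {q : Fin P.h}
    (hq : I q) : s'.factor b l q = s.factor b l q := by
  unfold PartySt.factor
  rw [hCS]
  exact Finset.sum_congr rfl fun j hj => h.val (hg j hj b l) hq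

end Ref

namespace Rec

variable {G G' : Rec P F} {r : ℕ} {z : Fin P.h} {o : OptSt P}

theorem le_refl (G : Rec P F) : G ≤ G := ⟨fun _ _ h => h, fun _ _ h => h⟩

theorem OptFinal.mono (h : G.OptFinal r z o) (hG : G ≤ G') : G'.OptFinal r z o :=
  ⟨h.1.mono hG.1, h.2.1, fun j hj l => hG.2.ne_none (h.2.2 j hj l)⟩

theorem OptFinal.opt_eq (h : G.OptFinal r z o) : G.opt r z = o := by
  have h' : ∃ o, G.OptFinal r z o := ⟨o, h⟩
  have := h'.choose_spec
  rw [opt, dif_pos h']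
  exact this.1.eq_of_rem h.1 this.2.1 h.2.1

theorem init_rem_ne (P : Params) : (OptSt.init P).rem ≠ ∅ := by
  have : (P.z0, P.z0) ∈ (OptSt.init P).rem := Finset.mem_univ _
  intro h
  simp [h] at this

theorem optFinal_of_rem (h : (G.opt r z).rem = ∅) : G.OptFinal r z (G.opt r z) := by
  by_cases h' : ∃ o, G.OptFinal r z o
  · obtain ⟨o, ho⟩ := h'
    rw [ho.opt_eq]
    exact ho
  · rw [opt, dif_neg h'] at h
    exact absurd h (init_rem_ne P)

theorem pre_optDone : G.pre.optDone r z ↔ ∃ o, G.OptFinal r z o := by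
  constructor
  · exact fun h => ⟨_, optFinal_of_rem h.1⟩
  · rintro ⟨o, ho⟩
    have := ho.opt_eq
    refine ⟨?_, ?_⟩
    · change (G.opt r z).rem = ∅
      rw [this, ho.2.1]
    · change ∀ j ∈ (G.opt r z).selected, ∀ l, G.V (.summ r z ((G.opt r z).hopOf j) j l) ≠ none
      rw [this]
      exact ho.2.2

theorem st_optDone : G.st.optDone r z ↔ ∃ o, G.OptFinal r z o := pre_optDone

theorem conf_allDone {p : Fin P.h × Fin P.M} (h : G.conf r = some p) : G.AllDone r := by
  unfold conf at h
  split_ifs at h with h'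
  exact h'

theorem ref_pre (hG : G ≤ G') : Ref (fun _ => True) G.pre G'.pre where
  vss sid v hv := ⟨v, hG.2 sid v hv, fun _ _ => rfl⟩
  opt r z hd := by
    obtain ⟨o, ho⟩ := pre_optDone.1 hd
    change G'.opt r z = G.opt r z
    rw [ho.opt_eq, (ho.mono hG).opt_eq]
  conf _ _ hp := by simp [pre, PartySt.init] at hp

theorem AllDone.mono (h : G.AllDone r) (hG : G ≤ G') : G'.AllDone r := fun z =>
  let ⟨o, ho⟩ := h z
  ⟨o, ho.mono hG⟩

theorem AllDone.diff_eq (h : G.AllDone r) (hG : G ≤ G') (z : Fin P.h) (l : Fin P.M) :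
    G'.diff r z l = G.diff r z l := by
  unfold diff
  refine Finset.sum_congr rfl fun q _ => ?_
  rw [(ref_pre hG).cShare (pre_optDone.2 (h z)) l trivial,
    (ref_pre hG).cShare (pre_optDone.2 (h P.z0)) l trivial]

theorem AllDone.conf_eq (h : G.AllDone r) (hG : G ≤ G') : G'.conf r = G.conf r := by
  unfold conf
  simp only [h.diff_eq hG, if_pos h, if_pos (h.mono hG)]

theorem conf_mono (hG : G ≤ G') {p : Fin P.h × Fin P.M} (h : G.conf r = some p) :
    G'.conf r = some p := by
  rw [(conf_allDone h).conf_eq hG, h]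

theorem ref_st (hG : G ≤ G') : Ref (fun _ => True) G.st G'.st where
  vss := (ref_pre hG).vss
  opt := (ref_pre hG).opt
  conf _ _ hp := ⟨conf_mono hG hp, fun z => st_optDone.2 (conf_allDone hp z)⟩

theorem ZeroDiff.mono (h : G.ZeroDiff r) (hG : G ≤ G') : G'.ZeroDiff r :=
  ⟨h.1.mono hG, fun z l => by rw [h.1.diff_eq hG, h.2]⟩

theorem conf_some {zc : Fin P.h} {l : Fin P.M} (h : G.conf r = some (zc, l)) :
    G.diff r zc l ≠ 0 := by
  unfold conf at h
  split_ifs at h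
  cases hl : least fun z => ∃ l, G.diff r z l ≠ 0 with
  | none => simp [hl] at h
  | some z =>
      simp only [hl, Option.map_eq_some_iff, Prod.mk.injEq] at h
      obtain ⟨l', h1, rfl, rfl⟩ := h
      exact least_some h1

theorem diff_z0 (G : Rec P F) (r : ℕ) (l : Fin P.M) : G.diff r P.z0 l = 0 := by
  simp [diff]

theorem conf_ne_z0 {zc : Fin P.h} {l : Fin P.M} (h : G.conf r = some (zc, l)) : zc ≠ P.z0 := by
  rintro rfl
  exact conf_some h (diff_z0 G r l)

theorem ZeroDiff.conf_eq (h : G.ZeroDiff r) : G.conf r = none := by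
  by_contra hc
  obtain ⟨⟨zc, l⟩, hc⟩ := Option.ne_none_iff_exists'.1 hc
  exact conf_some hc (h.2 zc l)

theorem CS_mono (hG : G ≤ G') : G.st.CS ⊆ G'.st.CS := by
  intro j hj
  simp only [PartySt.CS, Finset.mem_filter, Finset.mem_univ, true_and] at hj ⊢
  exact hG.1 _ _ hj

theorem Stage1.CS_eq (h : G.Stage1) (hG : G ≤ G') : G'.st.CS = G.st.CS := by
  ext j
  simp only [PartySt.CS, Finset.mem_filter, Finset.mem_univ, true_and]
  change G'.D _ = _ ↔ G.D _ = _
  rw [hG.1.eq (h.1 j)]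

theorem Stage1.mono (h : G.Stage1) (hG : G ≤ G') : G'.Stage1 :=
  ⟨fun j => hG.1.ne_none (h.1 j), fun j hj b l => hG.2.ne_none (h.2 j (by rwa [← h.CS_eq hG]) b l)⟩

theorem Stage1.factor_eq (h : G.Stage1) (hG : G ≤ G') (b : Bool) (l : Fin P.M) (q : Fin P.h) :
    G'.st.factor b l q = G.st.factor b l q :=
  (ref_st hG).factor (h.CS_eq hG) h.2 b l trivial

theorem Stage1.prodSum_eq (h : G.Stage1) (hG : G ≤ G') (l : Fin P.M)
    (T : Finset (Fin P.h × Fin P.h)) : G'.st.prodSum l T = G.st.prodSum l T := by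
  simp only [PartySt.prodSum, h.factor_eq hG]

theorem share_mono (hG : G ≤ G') {tag : RTag P} {q : Fin P.h} {v : F}
    (h : G.share tag q = some v) : G'.share tag q = some v := by
  have hR := ref_st hG
  cases tag with
  | diff r z l =>
      simp only [share] at h ⊢
      exact hR.baseShare trivial h
  | sumCheck r z j =>
      simp only [share] at h ⊢
      exact hR.baseShare trivial h
  | pairDiff r j k =>
      simp only [share] at h ⊢
      exact hR.baseShare trivial h
  | part r z j k =>
      simp only [share] at h ⊢
      cases hc : G.conf r with
      | none => simp [hc] at h
      | some p =>
          obtain ⟨zc, l⟩ := p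
          have hd := fun z => st_optDone.2 (conf_allDone hc z)
          simp only [hc, conf_mono hG hc] at h ⊢
          split_ifs at h with hcond
          rw [hR.partDue (hd _) (hd _), if_pos ⟨hcond.1, hR.got hcond.2⟩, ← h,
            hR.val hcond.2 trivial]
  | inp r j k b =>
      simp only [share] at h ⊢
      cases hc : G.conf r with
      | none => simp [hc] at h
      | some p =>
          obtain ⟨zc, l⟩ := p
          have hd := fun z => st_optDone.2 (conf_allDone hc z)
          simp only [hc, conf_mono hG hc] at h ⊢
          obtain ⟨hcond, h⟩ := Option.ite_none_right_eq_some.1 h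
          rw [hR.Sel (hd _), hR.Sel (hd _), hR.inter (hd _) (hd _),
            if_pos ⟨hcond.1.mono hG, hcond.2⟩, ← h, hcond.1.factor_eq hG]

theorem GDDone.gdAt_eq (h : G.GDDone r) (hG : G ≤ G') {r' : ℕ} (hr : r' < r)
    (hg : PartySt.gdIter P r') : G'.gdAt r' = G.gdAt r' := by
  unfold gdAt
  have : ∀ k, G'.D (.gd r' k) = G.D (.gd r' k) := fun k => hG.1.eq (h r' hr hg k)
  simp only [this]

theorem GDDone.GD_eq (h : G.GDDone r) (hG : G ≤ G') : G'.GD r = G.GD r := by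
  ext j
  simp only [GD, Finset.mem_filter, Finset.mem_univ, true_and]
  constructor
  · rintro ⟨r', h1, h2, h3⟩
    exact ⟨r', h1, h2, by rw [← h.gdAt_eq hG h1 h2, h3]⟩
  · rintro ⟨r', h1, h2, h3⟩
    exact ⟨r', h1, h2, by rw [h.gdAt_eq hG h1 h2, h3]⟩

theorem GDDone.mono (h : G.GDDone r) (hG : G ≤ G') : G'.GDDone r :=
  fun r' h1 h2 k => hG.1.ne_none (h r' h1 h2 k)

theorem VoteOK.mono {Zs : Finset (Fin P.n)} (hG : G ≤ G') {sid : ASid P} {b : Bool}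
    (h : G.VoteOK Zs sid b) : G'.VoteOK Zs sid b := by
  cases sid with
  | acs j =>
      cases b
      · exact Params.Quorum.mono h (CS_mono hG)
      · exact fun b l => hG.2.ne_none (h b l)
  | sel r z hop j =>
      cases b
      · obtain ⟨k, hk⟩ := h
        exact ⟨k, hG.1 _ _ hk⟩
      · obtain ⟨h1, ⟨o, h2, h3⟩, h4, h5, h6, h7⟩ := h
        refine ⟨h1, ⟨o, h2.mono hG.1, h3⟩, fun l => hG.2.ne_none (h4 l), h5.mono hG,
          by rwa [h5.GD_eq hG], fun r' h8 h9 => ?_⟩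
        obtain ⟨zc, l, hc, hd⟩ := h7 r' h8 h9
        have hD := fun z => st_optDone.2 (conf_allDone hc z)
        have hR := ref_st hG
        refine ⟨zc, l, conf_mono hG hc, fun hj z k hk => hG.2.ne_none (hd ?_ z k ?_)⟩
        · rwa [hR.Sel (hD _), hR.Sel (hD _)] at hj
        · rwa [hR.partDue (hD _) (hD _)] at hk
  | gd r j =>
      cases b
      · obtain ⟨k, hk⟩ := h
        exact ⟨k, hG.1 _ _ hk⟩
      · exact ⟨h.1, h.2.1.mono hG, by rw [h.2.1.GD_eq hG]; exact h.2.2⟩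

theorem DealOK.mono (hG : G ≤ G') {sid : VSid P} {v : Fin P.h → F} (h : G.DealOK sid v) :
    G'.DealOK sid v := by
  cases sid with
  | input j b l => trivial
  | summ r z hop i l =>
      obtain ⟨h1, h2, o, h3, h4, h5, h6, h7, h8⟩ := h
      exact ⟨h1, h2.mono hG, o, h3.mono hG.1, h4, h5, h6, h7, by rw [h2.prodSum_eq hG, h8]⟩
  | part r z i k =>
      obtain ⟨h2, zc, l, hc, h3, h4⟩ := h
      have hD := fun z => st_optDone.2 (conf_allDone hc z)
      have hR := ref_st hG
      exact ⟨h2.mono hG, zc, l, conf_mono hG hc, by rwa [hR.partDue (hD _) (hD _)],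
        by rw [h2.prodSum_eq hG, hR.partSumms (hD _) (hD _), h4]⟩

end Rec

/-! ### Honest local states -/

namespace Rec

/-- Every decision has been supported by an honest vote. -/
def DecOK (Zs : Finset (Fin P.n)) (G : Rec P F) : Prop :=
  ∀ sid b, G.D sid = some b → G.VoteOK Zs sid b

/-- What honest dealers have dealt is right. -/
def DealsOK (Zs : Finset (Fin P.n)) (G : Rec P F) : Prop :=
  ∀ sid v, G.V sid = some v → sid.dealer ∉ Zs → G.DealOK sid v

variable {G : Rec P F} {Zs : Finset (Fin P.n)} {r : ℕ} {z : Fin P.h}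

theorem DecOK.exists_sel (h : G.DecOK Zs) {o : OptSt P} (ho : OptReach G.D r z o)
    (hD : ∀ k, G.D (.sel r z o.hop k) ≠ none) (hn : 0 < P.n) :
    ∃ j, least (fun k => G.D (.sel r z o.hop k) = some true) = some j ∧ j ∉ P.Z z ∧
      j ∉ o.selected := by
  have hex : ∃ k, G.D (.sel r z o.hop k) = some true := by
    obtain ⟨b, hb⟩ := Option.ne_none_iff_exists'.1 (hD ⟨0, hn⟩)
    cases b
    · exact h _ _ hb
    · exact ⟨_, hb⟩
  obtain ⟨j, hj⟩ := exists_least hex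
  obtain ⟨-, ⟨o', ho', he, h1, h2⟩, -⟩ := h _ _ (least_some hj)
  rw [ho'.eq_of_hop ho he] at h2
  exact ⟨j, hj, h1, h2⟩

theorem DecOK.exists_gd (h : G.DecOK Zs) (hD : ∀ k, G.D (.gd r k) ≠ none) (hn : 0 < P.n) :
    ∃ j, G.gdAt r = some j := by
  rw [gdAt, if_pos hD]
  apply exists_least
  obtain ⟨b, hb⟩ := Option.ne_none_iff_exists'.1 (hD ⟨0, hn⟩)
  cases b
  · exact h _ _ hb
  · exact ⟨_, hb⟩

/-- Honest parties vote only for identifying parties that are refuted and hence corrupt. -/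
theorem gdAt_mem (h : G.DecOK Zs) {j : Fin P.n} (hj : G.gdAt r = some j) :
    j ∈ Zs ∧ j ∉ G.GD r := by
  unfold gdAt at hj
  split_ifs at hj
  have := h _ _ (least_some hj)
  exact ⟨this.1, this.2.2⟩

theorem GD_subset (h : G.DecOK Zs) (r : ℕ) : G.GD r ⊆ Zs := by
  intro j hj
  obtain ⟨-, r', -, -, h3⟩ := Finset.mem_filter.1 hj
  exact (gdAt_mem h h3).1

theorem GD_succ_of_gdIter (hg : PartySt.gdIter P r) {j : Fin P.n} (hj : G.gdAt r = some j) :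
    G.GD (r + 1) = insert j (G.GD r) := by
  ext k
  simp only [GD, Finset.mem_filter, Finset.mem_univ, true_and, Finset.mem_insert]
  constructor
  · rintro ⟨r', h1, h2, h3⟩
    rcases Nat.lt_succ_iff_lt_or_eq.1 h1 with h1 | rfl
    · exact Or.inr ⟨r', h1, h2, h3⟩
    · rw [hj] at h3
      exact Or.inl (Option.some.inj h3).symm
  · rintro (rfl | ⟨r', h1, h2, h3⟩)
    · exact ⟨r, by omega, hg, hj⟩
    · exact ⟨r', by omega, h2, h3⟩

theorem GD_succ_of_not (hg : ¬ PartySt.gdIter P r) : G.GD (r + 1) = G.GD r := by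
  ext k
  simp only [GD, Finset.mem_filter, Finset.mem_univ, true_and]
  constructor
  · rintro ⟨r', h1, h2, h3⟩
    rcases Nat.lt_succ_iff_lt_or_eq.1 h1 with h1 | rfl
    · exact ⟨r', h1, h2, h3⟩
    · exact absurd h2 hg
  · rintro ⟨r', h1, h2, h3⟩
    exact ⟨r', by omega, h2, h3⟩

/-- The value shared in a VSS instance. -/
def tot (G : Rec P F) (sid : VSid P) : F := ∑ q, G.st.val sid q

theorem reach_opt (h : G.AllDone r) (z : Fin P.h) : G.OptFinal r z (G.opt r z) := by
  obtain ⟨o, ho⟩ := h z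
  rw [ho.opt_eq]
  exact ho

theorem DealsOK.dealOK (h : G.DealsOK Zs) {sid : VSid P} (hg : G.st.got sid)
    (hd : sid.dealer ∉ Zs) : ∃ v, G.V sid = some v ∧ G.tot sid = ∑ q, v q ∧ G.DealOK sid v := by
  obtain ⟨v, hv⟩ := Option.ne_none_iff_exists'.1 hg
  refine ⟨v, hv, ?_, h _ _ hv hd⟩
  simp only [tot, PartySt.val, hv]

theorem DealsOK.tot_sum (h : G.DealsOK Zs) (hD : G.AllDone r) {j : Fin P.n} (hj : j ∉ Zs)
    (hs : j ∈ G.st.Sel r z) (l : Fin P.M) :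
    G.tot (G.st.sumSid r z j l) = G.st.prodSum l ((G.opt r z).summ j) := by
  have hf := reach_opt hD z
  obtain ⟨v, -, h1, -, -, o, ho, h2, -, -, -, h3⟩ := h.dealOK (hf.2.2 j hs l) hj
  obtain ⟨o', h4, h5, -, h6, -⟩ := hf.1.exists_of_selected hs
  rw [ho.eq_of_hop h4 (by rw [h2, h5])] at h3
  rw [← h6, ← h3, ← h1]
  rfl

theorem DealsOK.tot_part (h : G.DealsOK Zs) {zc : Fin P.h} {l : Fin P.M}
    (hc : G.conf r = some (zc, l)) {j k : Fin P.n} (hj : j ∉ Zs)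
    (hg : G.st.got (.part r z j k)) :
    G.tot (.part r z j k) = G.st.prodSum l (G.st.partSumms r zc z j k) := by
  obtain ⟨v, -, h1, -, zc', l', h2, -, h3⟩ := h.dealOK hg hj
  rw [hc] at h2
  cases h2
  rw [h1, h3]

theorem filter_partDue_zc {zc : Fin P.h} {l : Fin P.M} (hc : G.conf r = some (zc, l))
    {j : Fin P.n} (hj : j ∈ G.st.Sel r zc) :
    (Finset.univ.filter fun k => G.st.partDue r zc zc j k) = G.st.Sel r P.z0 := by
  have := conf_ne_z0 hc
  ext k
  simp [PartySt.partDue, hj, this]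

theorem filter_partDue_z0 {zc : Fin P.h} {l : Fin P.M} (hc : G.conf r = some (zc, l))
    {j : Fin P.n} (hj : j ∈ G.st.Sel r P.z0) :
    (Finset.univ.filter fun k => G.st.partDue r zc P.z0 j k) = G.st.Sel r zc := by
  have := (conf_ne_z0 hc).symm
  ext k
  simp [PartySt.partDue, hj, this]

/-- The summands of the parts partition the summands of a selected party. -/
theorem sum_partSumms {M : Type} [AddCommMonoid M] {zc : Fin P.h} {l : Fin P.M}
    (hc : G.conf r = some (zc, l)) (hz : z = zc ∨ z = P.z0) {j : Fin P.n} (hj : j ∈ G.st.Sel r z)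
    (f : Fin P.h × Fin P.h → M) :
    ∑ k ∈ Finset.univ.filter (fun k => G.st.partDue r zc z j k),
      ∑ pq ∈ G.st.partSumms r zc z j k, f pq = ∑ pq ∈ (G.opt r z).summ j, f pq := by
  have hne := conf_ne_z0 hc
  rcases hz with rfl | rfl
  · rw [filter_partDue_zc hc hj]
    simp only [PartySt.partSumms, if_true]
    have := reach_opt (conf_allDone hc) P.z0
    exact this.1.sum_inter this.2.1 _ f
  · rw [filter_partDue_z0 hc hj]
    simp only [PartySt.partSumms, if_neg hne.symm]
    have := reach_opt (conf_allDone hc) zc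
    rw [← this.1.sum_inter this.2.1 _ f]
    refine Finset.sum_congr rfl fun k _ => ?_
    rw [Finset.inter_comm]
    rfl

/-- The parts of an honest party add up to its sum. -/
theorem DealsOK.sumCheck (h : G.DealsOK Zs) {zc : Fin P.h} {l : Fin P.M}
    (hc : G.conf r = some (zc, l)) (hz : z = zc ∨ z = P.z0) {j : Fin P.n} (hj : j ∉ Zs)
    (hs : j ∈ G.st.Sel r z) (hg : ∀ k, G.st.partDue r zc z j k → G.st.got (.part r z j k)) :
    G.tot (G.st.sumSid r z j l) =
      ∑ k ∈ Finset.univ.filter (fun k => G.st.partDue r zc z j k), G.tot (.part r z j k) := by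
  rw [h.tot_sum (conf_allDone hc) hj hs]
  unfold PartySt.prodSum
  rw [← sum_partSumms hc hz hs]
  refine Finset.sum_congr rfl fun k hk => ?_
  rw [h.tot_part hc hj (hg k (Finset.mem_filter.1 hk).2)]
  rfl

theorem share_sumCheck {j : Fin P.n} {q : Fin P.h} {v : F}
    (h : G.share (.sumCheck r z j) q = some v) : ∃ zc l, G.conf r = some (zc, l) ∧
      (z = zc ∨ z = P.z0) ∧ j ∈ G.st.Sel r z ∧
      (∀ k, G.st.partDue r zc z j k → G.st.got (.part r z j k)) ∧
      v = G.st.val (G.st.sumSid r z j l) q -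
        ∑ k ∈ Finset.univ.filter (fun k => G.st.partDue r zc z j k),
          G.st.val (.part r z j k) q := by
  simp only [share, PartySt.baseShare] at h
  cases hc : G.st.conf r with
  | none => simp [hc] at h
  | some p =>
      obtain ⟨zc, l⟩ := p
      simp only [hc] at h
      obtain ⟨⟨h1, h2, h3, h4⟩, h⟩ := Option.ite_none_right_eq_some.1 h
      exact ⟨zc, l, hc, h1, h2, h4, (Option.some.inj h).symm⟩

theorem share_pairDiff {j k : Fin P.n} {q : Fin P.h} {v : F}
    (h : G.share (.pairDiff r j k) q = some v) : ∃ zc l, G.conf r = some (zc, l) ∧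
      j ∈ G.st.Sel r zc ∧ k ∈ G.st.Sel r P.z0 ∧ G.st.got (.part r zc j k) ∧
      G.st.got (.part r P.z0 k j) ∧
      v = G.st.val (.part r zc j k) q - G.st.val (.part r P.z0 k j) q := by
  simp only [share, PartySt.baseShare] at h
  cases hc : G.st.conf r with
  | none => simp [hc] at h
  | some p =>
      obtain ⟨zc, l⟩ := p
      simp only [hc] at h
      obtain ⟨⟨h1, h2, h3, h4⟩, h⟩ := Option.ite_none_right_eq_some.1 h
      exact ⟨zc, l, hc, h1, h2, h3, h4, (Option.some.inj h).symm⟩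

theorem share_part {j k : Fin P.n} {q : Fin P.h} {v : F}
    (h : G.share (.part r z j k) q = some v) :
    G.st.got (.part r z j k) ∧ v = G.st.val (.part r z j k) q := by
  simp only [share] at h
  cases hc : G.conf r with
  | none => simp [hc] at h
  | some p =>
      obtain ⟨zc, l⟩ := p
      simp only [hc] at h
      obtain ⟨⟨-, h4⟩, h⟩ := Option.ite_none_right_eq_some.1 h
      exact ⟨h4, (Option.some.inj h).symm⟩

theorem share_inp {j k : Fin P.n} {b : Bool} {q : Fin P.h} {v : F} {zc : Fin P.h} {l : Fin P.M}
    (hc : G.conf r = some (zc, l)) (h : G.share (.inp r j k b) q = some v) :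
    v = G.st.factor b l q := by
  simp only [share, hc] at h
  obtain ⟨-, h⟩ := Option.ite_none_right_eq_some.1 h
  exact (Option.some.inj h).symm

end Rec

/-- The local state `s` of the honest party `i` agrees with the record `G`. -/
structure Agree (Zs : Finset (Fin P.n)) (G : Rec P F) (i : Fin P.n) (s : PartySt P F) : Prop where
  vss : ∀ sid v, s.vss sid = some v → ∃ d, G.V sid = some d ∧ v = mask i d
  aba : Extends s.aba G.D
  stage : 1 ≤ s.iter → (∀ j, s.aba (.acs j) ≠ none) ∧ ∀ j ∈ s.CS, ∀ b l, s.got (.input j b l)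
  opt : ∀ r z, OptReach G.D r z (s.opt r z)
  optInit : ∀ r z, s.iter < r ∨ r = 0 → s.opt r z = OptSt.init P
  confSome : ∀ r p, s.conf r = some p →
    1 ≤ r ∧ r ≤ s.iter ∧ (∀ z, s.optDone r z) ∧ G.conf r = some p
  confPast : ∀ r, 1 ≤ r → r < s.iter → s.conf r ≠ none
  gd : s.GD = G.GD s.iter
  gdDone : G.GDDone s.iter
  out : ∀ T, s.out = some T → 1 ≤ s.iter ∧ G.ZeroDiff s.iter ∧ (∀ z, s.optDone s.iter z) ∧
    T = fun l => ![mask i (G.st.factor false l), mask i (G.st.factor true l),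
      mask i (G.st.cShare s.iter P.z0 l)]
  msgs : ∀ m ∈ s.msgs, m.1 ∉ Zs → G.share m.2.1 m.2.2.1 = some m.2.2.2

theorem mask_congr {i : Fin P.n} {v v' : Fin P.h → F} (h : ∀ q, i ∈ P.S q → v q = v' q) :
    mask i v = mask i v' := by
  funext q
  unfold mask
  split_ifs with hq
  · exact h q hq
  · rfl

namespace Agree

variable {Zs : Finset (Fin P.n)} {G G' : Rec P F} {i : Fin P.n} {s : PartySt P F}

theorem mono_aux (h : Agree Zs G i s) (hi : 1 ≤ s.iter) : G.Stage1 ∧ s.CS = G.st.CS := by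
  obtain ⟨h1, h2⟩ := h.stage hi
  have hCS : s.CS = G.st.CS := by
    ext j
    simp only [PartySt.CS, Finset.mem_filter, Finset.mem_univ, true_and]
    change _ ↔ G.D _ = _
    rw [h.aba.eq (h1 j)]
  refine ⟨⟨fun j => h.aba.ne_none (h1 j), fun j hj b l => ?_⟩, hCS⟩
  rw [← hCS] at hj
  obtain ⟨v, hv⟩ := Option.ne_none_iff_exists'.1 (h2 j hj b l)
  obtain ⟨d, hd, -⟩ := h.vss _ _ hv
  simp [hd]

theorem stage1 (h : Agree Zs G i s) (hi : 1 ≤ s.iter) : G.Stage1 := (h.mono_aux hi).1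

theorem optFinal (h : Agree Zs G i s) {r : ℕ} {z : Fin P.h} (hd : s.optDone r z) :
    G.OptFinal r z (s.opt r z) := by
  refine ⟨h.opt r z, hd.1, fun j hj l => ?_⟩
  obtain ⟨v, hv⟩ := Option.ne_none_iff_exists'.1 (hd.2 j hj l)
  obtain ⟨d, hd, -⟩ := h.vss _ _ hv
  rw [PartySt.sumSid] at hd
  simp [hd]

theorem ref (h : Agree Zs G i s) : Ref (fun q => i ∈ P.S q) s G.st where
  vss sid v hv := by
    obtain ⟨d, hd, rfl⟩ := h.vss sid v hv
    exact ⟨d, hd, fun q hq => by simp [mask, hq]⟩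
  opt r z hd := (h.optFinal hd).opt_eq
  conf r p hp := ⟨(h.confSome r p hp).2.2.2, (h.confSome r p hp).2.2.1⟩

theorem factor (h : Agree Zs G i s) (hi : 1 ≤ s.iter) {q : Fin P.h} (hq : i ∈ P.S q) (b : Bool)
    (l : Fin P.M) : s.factor b l q = G.st.factor b l q :=
  (h.ref.factor (h.mono_aux hi).2.symm (h.stage hi).2 b l hq).symm

theorem prodSum (h : Agree Zs G i s) (hi : 1 ≤ s.iter) (l : Fin P.M)
    {T : Finset (Fin P.h × Fin P.h)} (hT : ∀ pq ∈ T, i ∈ P.S pq.1 ∧ i ∈ P.S pq.2) :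
    s.prodSum l T = G.st.prodSum l T := by
  unfold PartySt.prodSum
  refine Finset.sum_congr rfl fun pq hpq => ?_
  rw [h.factor hi (hT pq hpq).1, h.factor hi (hT pq hpq).2]

theorem mono (h : Agree Zs G i s) (hG : G ≤ G') : Agree Zs G' i s where
  vss sid v hv := by
    obtain ⟨d, hd, rfl⟩ := h.vss sid v hv
    exact ⟨d, hG.2 _ _ hd, rfl⟩
  aba sid b hb := hG.1 _ _ (h.aba sid b hb)
  stage := h.stage
  opt r z := (h.opt r z).mono hG.1
  optInit := h.optInit
  confSome r p hp := by
    obtain ⟨h1, h2, h3, h4⟩ := h.confSome r p hp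
    exact ⟨h1, h2, h3, Rec.conf_mono hG h4⟩
  confPast := h.confPast
  gd := by rw [h.gd, h.gdDone.GD_eq hG]
  gdDone := h.gdDone.mono hG
  out T hT := by
    obtain ⟨h1, h2, h3, rfl⟩ := h.out T hT
    refine ⟨h1, h2.mono hG, h3, ?_⟩
    funext l
    have e : ∀ b, G'.st.factor b l = G.st.factor b l := fun b =>
      funext fun q => (h.stage1 h1).factor_eq hG b l q
    have e2 : G'.st.cShare s.iter P.z0 l = G.st.cShare s.iter P.z0 l := funext fun q =>
      (Rec.ref_st hG).cShare (Rec.st_optDone.2 (h2.1 _)) l trivial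
    rw [e, e, e2]
  msgs m hm hj := Rec.share_mono hG (h.msgs m hm hj)

theorem recShareWith (h : Agree Zs G i s) (hQ : P.Q 4) (hZ : P.Covered Zs) {tag : RTag P}
    {own : Option F} {q : Fin P.h} {v : F}
    (hown : i ∈ P.S q → ∀ v, own = some v → G.share tag q = some v)
    (hv : s.recShareWith i own tag q = some v) : G.share tag q = some v := by
  unfold PartySt.recShareWith at hv
  split_ifs at hv with hi hex
  · exact hown hi v hv
  · have hs := hex.choose_spec
    simp only [Option.some.injEq] at hv
    rw [hv] at hs
    obtain ⟨j, hj, hjZ, -⟩ := hs.exists_honest hQ hZ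
    exact h.msgs _ (Finset.mem_filter.1 hj).2 hjZ

theorem total_some {sh : Fin P.h → Option F} {v : F} (hv : PartySt.total sh = some v) :
    (∀ q, sh q ≠ none) ∧ v = ∑ q, (sh q).getD 0 := by
  unfold PartySt.total at hv
  split_ifs at hv with hs
  exact ⟨hs, (Option.some.inj hv).symm⟩

theorem total_of_share {tag : RTag P} {sh : Fin P.h → Option F} {v : F}
    (hsh : ∀ q v, sh q = some v → G.share tag q = some v) (hv : PartySt.total sh = some v) :
    (∀ q, G.share tag q ≠ none) ∧ v = ∑ q, (G.share tag q).getD 0 := by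
  obtain ⟨h1, h2⟩ := total_some hv
  have h3 : ∀ q, G.share tag q = sh q := fun q => by
    obtain ⟨x, hx⟩ := Option.ne_none_iff_exists'.1 (h1 q)
    rw [hx, hsh q x hx]
  simp only [h3]
  exact ⟨h1, h2⟩

theorem share_of_base {tag : RTag P} {q : Fin P.h} {v : F}
    (hv : G.st.baseShare q tag = some v) : G.share tag q = some v := by
  cases tag <;> first | exact hv | simp [PartySt.baseShare] at hv

theorem inter_mem_S (h : Agree Zs G i s) {r : ℕ} {zc : Fin P.h} {j k : Fin P.n}
    {pq : Fin P.h × Fin P.h} (hpq : pq ∈ s.inter r zc j k) :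
    (j ∈ P.S pq.1 ∧ j ∈ P.S pq.2) ∧ k ∈ P.S pq.1 ∧ k ∈ P.S pq.2 :=
  ⟨(h.opt r zc).mem_S_of_mem_summ (Finset.mem_inter.1 hpq).1,
    (h.opt r P.z0).mem_S_of_mem_summ (Finset.mem_inter.1 hpq).2⟩

theorem share (h : Agree Zs G i s) {tag : RTag P} {q : Fin P.h} {v : F}
    (hv : s.myShare i tag q = some v) : i ∈ P.S q ∧ G.share tag q = some v := by
  unfold PartySt.myShare at hv
  split_ifs at hv with hi
  refine ⟨hi, ?_⟩
  have hR := h.ref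
  cases tag with
  | diff r z l => exact share_of_base (hR.baseShare hi hv)
  | sumCheck r z j => exact share_of_base (hR.baseShare hi hv)
  | pairDiff r j k => exact share_of_base (hR.baseShare hi hv)
  | part r z j k =>
      simp only at hv
      cases hc : s.conf r with
      | none => simp [hc] at hv
      | some p =>
          obtain ⟨zc, l⟩ := p
          obtain ⟨-, -, hd, hc'⟩ := h.confSome r _ hc
          simp only [hc] at hv
          obtain ⟨⟨h1, h2, -⟩, hv⟩ := Option.ite_none_right_eq_some.1 hv
          simp only [Rec.share, hc']
          rw [if_pos ⟨(hR.partDue (hd _) (hd _) _ _ _).2 h1, hR.got h2⟩, hR.val h2 hi, hv]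
  | inp r j k b =>
      simp only at hv
      cases hc : s.conf r with
      | none => simp [hc] at hv
      | some p =>
          obtain ⟨zc, l⟩ := p
          obtain ⟨hr1, hr2, hd, hc'⟩ := h.confSome r _ hc
          simp only [hc] at hv
          obtain ⟨⟨h1, h2, -, h3⟩, hv⟩ := Option.ite_none_right_eq_some.1 hv
          simp only [Rec.share, hc']
          rw [if_pos ⟨h.stage1 (by omega), by rwa [hR.Sel (hd _)], by rwa [hR.Sel (hd _)],
            by rwa [hR.inter (hd _) (hd _)]⟩, ← h.factor (by omega) hi, hv]

theorem recShare (h : Agree Zs G i s) (hQ : P.Q 4) (hZ : P.Covered Zs) {tag : RTag P}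
    {q : Fin P.h} {v : F} (hv : s.recShare i tag q = some v) : G.share tag q = some v :=
  h.recShareWith hQ hZ (fun _ _ hx => (h.share hx).2) hv

theorem recValue (h : Agree Zs G i s) (hQ : P.Q 4) (hZ : P.Covered Zs) {tag : RTag P} {v : F}
    (hv : s.recValue i tag = some v) :
    (∀ q, G.share tag q ≠ none) ∧ v = ∑ q, (G.share tag q).getD 0 :=
  total_of_share (fun _ _ hx => h.recShare hQ hZ hx) hv

/-- The reconstructed difference of the two versions of a part. -/
theorem pairDiff_value (h : Agree Zs G i s) (hQ : P.Q 4) (hZ : P.Covered Zs) {r : ℕ}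
    {j k : Fin P.n} {v : F} (hv : PartySt.total (fun q =>
      s.recShareWith i (s.baseShare q (.pairDiff r j k)) (.pairDiff r j k) q) = some v) :
    ∃ zc l, G.conf r = some (zc, l) ∧
      j ∈ G.st.Sel r zc ∧ k ∈ G.st.Sel r P.z0 ∧ G.st.got (.part r zc j k) ∧
      G.st.got (.part r P.z0 k j) ∧ v = G.tot (.part r zc j k) - G.tot (.part r P.z0 k j) := by
  obtain ⟨h1, h2⟩ := total_of_share (tag := .pairDiff r j k) (G := G) (fun q x hx =>
    h.recShareWith hQ hZ (fun hi y hy => share_of_base (h.ref.baseShare hi hy)) hx) hv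
  obtain ⟨x, hx⟩ := Option.ne_none_iff_exists'.1 (h1 P.z0)
  obtain ⟨zc, l, hc, h3, h4, h5, h6, -⟩ := Rec.share_pairDiff hx
  refine ⟨zc, l, hc, h3, h4, h5, h6, ?_⟩
  have : ∀ q, (G.share (.pairDiff r j k) q).getD 0 =
      G.st.val (.part r zc j k) q - G.st.val (.part r P.z0 k j) q := fun q => by
    obtain ⟨x, hx⟩ := Option.ne_none_iff_exists'.1 (h1 q)
    obtain ⟨zc', l', hc', -, -, -, -, h7⟩ := Rec.share_pairDiff hx
    rw [hc] at hc'
    cases hc'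
    rw [hx, h7]
    rfl
  rw [h2, Finset.sum_congr rfl fun q _ => this q, Finset.sum_sub_distrib]
  rfl

theorem pairBad (h : Agree Zs G i s) (hQ : P.Q 4) (hZ : P.Covered Zs) {r : ℕ} {j k : Fin P.n}
    (hb : s.pairBad i r j k) : ∃ zc l, G.conf r = some (zc, l) ∧
      j ∈ G.st.Sel r zc ∧ k ∈ G.st.Sel r P.z0 ∧ G.st.got (.part r zc j k) ∧
      G.st.got (.part r P.z0 k j) ∧ G.tot (.part r zc j k) ≠ G.tot (.part r P.z0 k j) := by
  obtain ⟨v, hv0, hv⟩ := hb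
  obtain ⟨zc, l, hc, h3, h4, h5, h6, h7⟩ := h.pairDiff_value hQ hZ hv
  exact ⟨zc, l, hc, h3, h4, h5, h6, fun he => hv0 (by rw [h7, he, sub_self])⟩

/-- Two honest parties share the same partial sum, namely that of the summands assigned to both. -/
theorem pairBad_corrupt (h : Agree Zs G i s) (hQ : P.Q 4) (hZ : P.Covered Zs)
    (hG : G.DealsOK Zs) {r : ℕ} {j k : Fin P.n} (hb : s.pairBad i r j k) : j ∈ Zs ∨ k ∈ Zs := by
  by_contra hn
  push Not at hn
  obtain ⟨zc, l, hc, h1, h2, h3, h4, h5⟩ := h.pairBad hQ hZ hb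
  refine h5 ?_
  rw [hG.tot_part hc hn.1 h3, hG.tot_part hc hn.2 h4]
  simp [PartySt.partSumms, (Rec.conf_ne_z0 hc).symm]

theorem diff (h : Agree Zs G i s) (hQ : P.Q 4) (hZ : P.Covered Zs) {r : ℕ} {z : Fin P.h}
    {l : Fin P.M} {v : F} (hv : s.recValue i (.diff r z l) = some v) : v = G.diff r z l := by
  obtain ⟨h1, h2⟩ := h.recValue hQ hZ hv
  rw [h2, Rec.diff]
  refine Finset.sum_congr rfl fun q _ => ?_
  obtain ⟨x, hx⟩ := Option.ne_none_iff_exists'.1 (h1 q)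
  rw [hx]
  simp only [Rec.share, PartySt.baseShare] at hx
  obtain ⟨-, hx⟩ := Option.ite_none_right_eq_some.1 hx
  rw [← Option.some.inj hx]
  rfl

/-- The reconstructed difference between a sum and the sum of its parts. -/
theorem sumCheck_value (h : Agree Zs G i s) (hQ : P.Q 4) (hZ : P.Covered Zs) {r : ℕ}
    {z zc : Fin P.h} {l : Fin P.M} {x : Fin P.n} {v : F} (hc : G.conf r = some (zc, l))
    (hv : s.recValue i (.sumCheck r z x) = some v) :
    (∀ k, G.st.partDue r zc z x k → G.st.got (.part r z x k)) ∧
      v = G.tot (G.st.sumSid r z x l) -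
        ∑ k ∈ Finset.univ.filter (fun k => G.st.partDue r zc z x k), G.tot (.part r z x k) := by
  obtain ⟨h1, h2⟩ := h.recValue hQ hZ hv
  have h3 : ∀ q, (∀ k, G.st.partDue r zc z x k → G.st.got (.part r z x k)) ∧
      (G.share (.sumCheck r z x) q).getD 0 = G.st.val (G.st.sumSid r z x l) q -
        ∑ k ∈ Finset.univ.filter (fun k => G.st.partDue r zc z x k),
          G.st.val (.part r z x k) q := fun q => by
    obtain ⟨y, hy⟩ := Option.ne_none_iff_exists'.1 (h1 q)
    obtain ⟨zc', l', hc', -, -, h5, h6⟩ := Rec.share_sumCheck hy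
    rw [hc] at hc'
    cases hc'
    refine ⟨h5, ?_⟩
    rw [hy, h6]
    rfl
  refine ⟨(h3 P.z0).1, ?_⟩
  rw [h2, Finset.sum_congr rfl fun q _ => (h3 q).2, Finset.sum_sub_distrib, Finset.sum_comm]
  rfl

/-- A reconstructed partial sum is the value that was shared. -/
theorem part_value (h : Agree Zs G i s) (hQ : P.Q 4) (hZ : P.Covered Zs) {r : ℕ}
    {z : Fin P.h} {j k : Fin P.n} {d : F} (hv : s.recValue i (.part r z j k) = some d) :
    G.st.got (.part r z j k) ∧ d = G.tot (.part r z j k) := by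
  obtain ⟨h1, h2⟩ := h.recValue hQ hZ hv
  constructor
  · obtain ⟨y, hy⟩ := Option.ne_none_iff_exists'.1 (h1 P.z0)
    exact (Rec.share_part hy).1
  · rw [h2, Rec.tot]
    refine Finset.sum_congr rfl fun q _ => ?_
    obtain ⟨y, hy⟩ := Option.ne_none_iff_exists'.1 (h1 q)
    rw [hy, (Rec.share_part hy).2]
    rfl

/-- The partial sum computed from the opened shares of the factors. -/
theorem inp_value (h : Agree Zs G i s) (hQ : P.Q 4) (hZ : P.Covered Zs) {r : ℕ}
    {zc : Fin P.h} {l : Fin P.M} {j k : Fin P.n} (hc : s.conf r = some (zc, l))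
    (hin : ∀ pq ∈ s.inter r zc j k, s.recShare i (.inp r j k false) pq.1 ≠ none ∧
      s.recShare i (.inp r j k true) pq.2 ≠ none) :
    ∑ pq ∈ s.inter r zc j k, (s.recShare i (.inp r j k false) pq.1).getD 0 *
      (s.recShare i (.inp r j k true) pq.2).getD 0 = G.st.prodSum l (G.st.inter r zc j k) := by
  obtain ⟨-, -, hd, hc'⟩ := h.confSome r _ hc
  rw [h.ref.inter (hd _) (hd _), PartySt.prodSum]
  refine Finset.sum_congr rfl fun pq hpq => ?_
  obtain ⟨h5, h6⟩ := hin pq hpq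
  obtain ⟨y, hy⟩ := Option.ne_none_iff_exists'.1 h5
  obtain ⟨y', hy'⟩ := Option.ne_none_iff_exists'.1 h6
  rw [hy, hy', Rec.share_inp hc' (h.recShare hQ hZ hy), Rec.share_inp hc' (h.recShare hQ hZ hy')]
  rfl

/-- Honest parties are never discarded. -/
theorem LD_corrupt (h : Agree Zs G i s) (hQ : P.Q 4) (hZ : P.Covered Zs) (hG : G.DealsOK Zs)
    {r : ℕ} {x : Fin P.n} (hx : s.LD i r x) : x ∈ Zs := by
  by_contra hxZ
  unfold PartySt.LD at hx
  cases hc : s.conf r with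
  | none => simp [hc] at hx
  | some p =>
      obtain ⟨zc, l⟩ := p
      simp only [hc] at hx
      obtain ⟨hr1, hr2, hd, hc'⟩ := h.confSome r _ hc
      have hR := h.ref
      rcases hx with ⟨z, hz, hs, v, hv0, hv⟩ | ⟨j, k, d, e, hj, hk, hb, hvd, hve, hin, hor⟩
      · obtain ⟨h1, h2⟩ := h.sumCheck_value hQ hZ hc' hv
        apply hv0
        rw [h2]
        exact sub_eq_zero.2 (hG.sumCheck hc' hz hxZ (by rwa [hR.Sel (hd z)]) h1)
      · rw [h.inp_value hQ hZ hc hin] at hor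
        rcases hor with ⟨rfl, hne⟩ | ⟨rfl, hne⟩
        · obtain ⟨h5, h6⟩ := h.part_value hQ hZ hvd
          apply hne
          rw [h6, hG.tot_part hc' hxZ h5, PartySt.partSumms, if_pos rfl]
        · obtain ⟨h5, h6⟩ := h.part_value hQ hZ hve
          apply hne
          rw [h6, hG.tot_part hc' hxZ h5, PartySt.partSumms, if_neg (Rec.conf_ne_z0 hc').symm]

end Agree

/-! ### Local computations preserve agreement with the record -/

namespace Agree

variable {Zs : Finset (Fin P.n)} {G G' : Rec P F} {i : Fin P.n} {s : PartySt P F}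

theorem one_le_of_conf (h : Agree Zs G i s) {r : ℕ} (hc : s.conf r ≠ none) :
    1 ≤ r ∧ r ≤ s.iter ∧ ∀ z, s.optDone r z := by
  obtain ⟨p, hp⟩ := Option.ne_none_iff_exists'.1 hc
  obtain ⟨h1, h2, h3, -⟩ := h.confSome r p hp
  exact ⟨h1, h2, h3⟩

theorem conf_none_of_out (h : Agree Zs G i s) (ho : s.out ≠ none) : s.conf s.iter = none := by
  obtain ⟨T, hT⟩ := Option.ne_none_iff_exists'.1 ho
  obtain ⟨-, h2, -⟩ := h.out T hT
  by_contra hc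
  obtain ⟨p, hp⟩ := Option.ne_none_iff_exists'.1 hc
  have := (h.confSome _ p hp).2.2.2
  rw [h2.conf_eq] at this
  cases this

theorem stepStage_eq (s : PartySt P F) : s.stepStage = s ∨
    s.iter = 0 ∧ (∀ j, s.aba (.acs j) ≠ none) ∧ (∀ j ∈ s.CS, ∀ b l, s.got (.input j b l)) ∧
      s.stepStage = { s with iter := 1 } := by
  unfold PartySt.stepStage
  split_ifs with hc
  · exact Or.inr ⟨hc.1, hc.2.1, hc.2.2, rfl⟩
  · exact Or.inl rfl

theorem stepStage (h : Agree Zs G i s) : Agree Zs G i s.stepStage := by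
  rcases stepStage_eq s with he | ⟨h0, h1, h2, he⟩
  · rwa [he]
  rw [he]
  exact
    { vss := h.vss
      aba := h.aba
      stage := fun _ => ⟨h1, h2⟩
      opt := h.opt
      optInit := fun r z hr => h.optInit r z (by simp only at hr; omega)
      confSome := fun r p hp => by
        obtain ⟨h3, h4, -⟩ := h.confSome r p hp
        omega
      confPast := fun r h3 h4 => by simp only at h4; omega
      gd := by
        have hg := h.gd
        simp only [h0] at hg ⊢
        rw [hg, Rec.GD_succ_of_not]
        simp [PartySt.gdIter]
      gdDone := fun r hr hg => by
        simp only at hr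
        obtain ⟨h3, -⟩ := hg
        omega
      out := fun T hT => by
        have := (h.out T hT).1
        omega
      msgs := h.msgs }

theorem hopEnd_of_rem {z : Fin P.h} (hr : (s.opt s.iter z).rem = ∅) :
    s.hopEnd z = s.opt s.iter z := by
  unfold PartySt.hopEnd
  simp [hr]

theorem hopEnd_reach (h : Agree Zs G i s) (hD : G.DecOK Zs) (z : Fin P.h) :
    OptReach G.D s.iter z (s.hopEnd z) := by
  unfold PartySt.hopEnd
  simp only
  split_ifs with hc
  · have hd : ∀ k, G.D (.sel s.iter z (s.opt s.iter z).hop k) ≠ none := fun k =>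
      h.aba.ne_none (hc.2.2 k)
    obtain ⟨j, hj, hjZ, hjs⟩ := hD.exists_sel (h.opt s.iter z) hd i.pos
    have hj' : least (fun k => s.aba (.sel s.iter z (s.opt s.iter z).hop k) = some true) =
        some j := by
      rw [← hj]
      congr 1
      funext k
      rw [h.aba.eq (hc.2.2 k)]
    rw [hj']
    exact .next (h.opt s.iter z) hc.2.1 hd hj hjZ hjs
  · exact h.opt s.iter z

theorem stepHop_opt_of_done {r : ℕ} {z : Fin P.h} (hd : s.optDone r z) :
    s.stepHop.opt r z = s.opt r z := by
  simp only [PartySt.stepHop, Function.update_apply]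
  split_ifs with he
  · subst he
    rw [hopEnd_of_rem hd.1]
  · rfl

theorem stepHop_optDone {r : ℕ} {z : Fin P.h} (hd : s.optDone r z) :
    s.stepHop.optDone r z := by
  have := stepHop_opt_of_done hd
  unfold PartySt.optDone PartySt.Sel PartySt.sumSid at *
  rw [this]
  exact hd

theorem stepHop (h : Agree Zs G i s) (hD : G.DecOK Zs) : Agree Zs G i s.stepHop where
  vss := h.vss
  aba := h.aba
  stage := h.stage
  opt r z := by
    simp only [PartySt.stepHop, Function.update_apply]
    split_ifs with he
    · subst he
      exact h.hopEnd_reach hD z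
    · exact h.opt r z
  optInit r z hr := by
    simp only [PartySt.stepHop, Function.update_apply] at hr ⊢
    split_ifs with he
    · subst he
      have h0 : s.iter = 0 := by omega
      have h1 : ¬ 1 ≤ s.iter := by omega
      simp only [PartySt.hopEnd, h1, false_and, if_false]
      exact h.optInit _ _ (Or.inr h0)
    · exact h.optInit r z hr
  confSome r p hp := by
    obtain ⟨h1, h2, h3, h4⟩ := h.confSome r p hp
    exact ⟨h1, h2, fun z => stepHop_optDone (h3 z), h4⟩
  confPast := h.confPast
  gd := h.gd
  gdDone := h.gdDone
  out T hT := by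
    obtain ⟨h1, h2, h3, h4⟩ := h.out T hT
    exact ⟨h1, h2, fun z => stepHop_optDone (h3 z), h4⟩
  msgs := h.msgs

/-- The two ways in which an iteration ends. -/
theorem stepCheck_eq (h : Agree Zs G i s) (hQ : P.Q 4) (hZ : P.Covered Zs) :
    s.stepCheck i = s ∨
    1 ≤ s.iter ∧ s.out = none ∧ s.conf s.iter = none ∧ (∀ z, s.optDone s.iter z) ∧
      (∀ z l, s.recValue i (.diff s.iter z l) ≠ none) ∧
      ((G.ZeroDiff s.iter ∧ s.stepCheck i =
          { s with
            out := some fun l => ![mask i (s.factor false l), mask i (s.factor true l),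
              mask i (s.cShare s.iter P.z0 l)] }) ∨
        (G.conf s.iter ≠ none ∧
          s.stepCheck i = { s with conf := Function.update s.conf s.iter (G.conf s.iter) })) := by
  unfold PartySt.stepCheck
  split_ifs with hc
  · right
    obtain ⟨h1, h2, h3, h4, h5⟩ := hc
    refine ⟨h1, h2, h3, h4, h5, ?_⟩
    have hA : G.AllDone s.iter := fun z => ⟨_, h.optFinal (h4 z)⟩
    have hv : ∀ z l, s.recValue i (.diff s.iter z l) = some (G.diff s.iter z l) := fun z l => by
      obtain ⟨v, hv⟩ := Option.ne_none_iff_exists'.1 (h5 z l)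
      rw [hv, h.diff hQ hZ hv]
    simp only [hv, ne_eq, Option.some.injEq]
    cases hl : least fun z => ∃ l, ¬ G.diff s.iter z l = 0 with
    | none =>
        left
        refine ⟨⟨hA, fun z l => ?_⟩, rfl⟩
        by_contra hn
        exact least_eq_none.1 hl z ⟨l, hn⟩
    | some z =>
        right
        have hconf : G.conf s.iter =
            (least fun l => ¬ G.diff s.iter z l = 0).map fun l => (z, l) := by
          rw [Rec.conf, if_pos hA]
          simp only [ne_eq, hl]
        refine ⟨?_, by rw [hconf]⟩
        obtain ⟨l, hl⟩ := exists_least (least_some hl)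
        rw [hconf, hl]
        simp
  · exact Or.inl rfl

theorem stepCheck (h : Agree Zs G i s) (hQ : P.Q 4) (hZ : P.Covered Zs) :
    Agree Zs G i (s.stepCheck i) := by
  rcases h.stepCheck_eq hQ hZ with he | ⟨h1, h2, h3, h4, h5, ⟨h6, he⟩ | ⟨h6, he⟩⟩
  · rwa [he]
  · rw [he]
    refine { h with out := fun T hT => ⟨h1, h6, h4, ?_⟩ }
    simp only [Option.some.injEq] at hT
    rw [← hT]
    funext l
    congr 1
    · exact mask_congr fun q hq => h.factor h1 hq _ _
    congr 1
    · exact mask_congr fun q hq => h.factor h1 hq _ _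
    congr 1
    exact mask_congr fun q hq => (h.ref.cShare (h4 P.z0) l hq).symm
  · rw [he]
    refine { h with confSome := fun r p hp => ?_, confPast := fun r h7 h8 => ?_ }
    · simp only [Function.update_apply] at hp
      split_ifs at hp with hr
      · subst hr
        exact ⟨h1, le_rfl, h4, hp⟩
      · exact h.confSome r p hp
    · simp only [Function.update_apply] at h8 ⊢
      rw [if_neg (by omega)]
      exact h.confPast r h7 h8

theorem stepNext_eq (h : Agree Zs G i s) (hD : G.DecOK Zs) :
    s.stepNext = s ∨ s.conf s.iter ≠ none ∧
      ((¬ PartySt.gdIter P s.iter ∧ s.stepNext = { s with iter := s.iter + 1 }) ∨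
      (PartySt.gdIter P s.iter ∧ (∀ j, s.aba (.gd s.iter j) ≠ none) ∧ ∃ j,
        G.gdAt s.iter = some j ∧
        s.stepNext = { s with GD := insert j s.GD, iter := s.iter + 1 })) := by
  unfold PartySt.stepNext
  split_ifs with hc hg ha
  · exact Or.inl rfl
  · right
    refine ⟨hc, Or.inr ⟨hg, ha, ?_⟩⟩
    have hd : ∀ k, G.D (.gd s.iter k) ≠ none := fun k => h.aba.ne_none (ha k)
    obtain ⟨j, hj⟩ := hD.exists_gd hd i.pos
    refine ⟨j, hj, ?_⟩
    have : least (fun k => s.aba (.gd s.iter k) = some true) = some j := by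
      rw [← hj, Rec.gdAt, if_pos hd]
      congr 1
      funext k
      rw [h.aba.eq (ha k)]
    rw [this]
  · exact Or.inl rfl
  · exact Or.inr ⟨hc, Or.inl ⟨hg, rfl⟩⟩

theorem next_iter (h : Agree Zs G i s) (hc : s.conf s.iter ≠ none) (A : Finset (Fin P.n))
    (hA : A = G.GD (s.iter + 1)) (hgd : G.GDDone (s.iter + 1)) :
    Agree Zs G i { s with GD := A, iter := s.iter + 1 } where
  vss := h.vss
  aba := h.aba
  stage _ := h.stage (h.one_le_of_conf hc).1
  opt := h.opt
  optInit r z hr := h.optInit r z (by simp only at hr; omega)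
  confSome r p hp := by
    obtain ⟨h1, h2, h3⟩ := h.confSome r p hp
    exact ⟨h1, by simp only; omega, h3⟩
  confPast r h1 h2 := by
    simp only at h2
    rcases Nat.lt_succ_iff_lt_or_eq.1 h2 with h2 | rfl
    · exact h.confPast r h1 h2
    · exact hc
  gd := hA
  gdDone := hgd
  out T hT := absurd (h.conf_none_of_out (by simp only at hT; simp [hT])) hc
  msgs := h.msgs

theorem stepNext (h : Agree Zs G i s) (hD : G.DecOK Zs) : Agree Zs G i s.stepNext := by
  rcases h.stepNext_eq hD with he | ⟨hc, ⟨hg, he⟩ | ⟨hg, ha, j, hj, he⟩⟩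
  · rwa [he]
  · rw [he]
    exact h.next_iter hc s.GD (by rw [h.gd, Rec.GD_succ_of_not hg]) fun r hr hg' => by
      rcases Nat.lt_succ_iff_lt_or_eq.1 hr with hr | rfl
      · exact h.gdDone r hr hg'
      · exact absurd hg' hg
  · rw [he]
    exact h.next_iter hc _ (by rw [Rec.GD_succ_of_gdIter hg hj, h.gd]) fun r hr hg' => by
      rcases Nat.lt_succ_iff_lt_or_eq.1 hr with hr | rfl
      · exact h.gdDone r hr hg'
      · exact fun k => h.aba.ne_none (ha k)

/-- The local computation of an activation preserves agreement with the record. -/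
theorem update (h : Agree Zs G i s) (hQ : P.Q 4) (hZ : P.Covered Zs) (hD : G.DecOK Zs) :
    Agree Zs G i (s.update i) :=
  ((h.stepStage.stepHop hD).stepCheck hQ hZ).stepNext hD

theorem got_V (h : Agree Zs G i s) {sid : VSid P} (hg : s.got sid) : G.V sid ≠ none := by
  obtain ⟨v, hv⟩ := Option.ne_none_iff_exists'.1 hg
  obtain ⟨d, hd, -⟩ := h.vss _ _ hv
  simp [hd]

/-- The votes of honest parties are justified by the record. -/
theorem newVote (h : Agree Zs G i s) (hQ : P.Q 4) (hZ : P.Covered Zs) (hG : G.DealsOK Zs)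
    {sid : ASid P} {b : Bool} (hv : s.newVote i sid = some b) :
    s.voted sid = none ∧ G.VoteOK Zs sid b := by
  unfold PartySt.newVote at hv
  by_cases h0 : s.voted sid ≠ none
  · rw [if_pos h0] at hv
    cases hv
  rw [if_neg h0] at hv
  refine ⟨not_not.1 h0, ?_⟩
  cases sid with
  | acs j =>
      simp only at hv
      split_ifs at hv with h1 h2
      · cases hv
        exact fun b l => h.got_V (h1 b l)
      · cases hv
        refine Params.Quorum.mono h2 fun j hj => ?_
        simp only [PartySt.CS, Finset.mem_filter, Finset.mem_univ, true_and] at hj ⊢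
        exact h.aba _ _ hj
  | sel r z hop j =>
      simp only at hv
      split_ifs at hv with h1 h2 h3
      · cases hv
        obtain ⟨h4, rfl, rfl, h5⟩ := h1
        obtain ⟨h6, h7, h8, h9, h10⟩ := h2
        refine ⟨h4, ⟨_, h.opt _ z, rfl, h7, h8⟩, fun l => h.got_V (h10 l), h.gdDone,
          by rwa [← h.gd], fun r' h11 h12 => ?_⟩
        obtain ⟨⟨zc, l⟩, hc⟩ := Option.ne_none_iff_exists'.1 (h.confPast r' h11 h12)
        obtain ⟨-, -, hd, hc'⟩ := h.confSome _ _ hc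
        have hR := h.ref
        refine ⟨zc, l, hc', fun hj z k hk => ?_⟩
        rw [hR.Sel (hd _), hR.Sel (hd _)] at hj
        rw [hR.partDue (hd _) (hd _)] at hk
        have hW := (h9 r' h11 h12).1
        simp only [PartySt.Waiting, hc, not_and, not_not] at hW
        exact h.got_V (hW hj z k hk)
      · cases hv
        obtain ⟨k, hk⟩ := h3
        exact ⟨k, h.aba _ _ hk⟩
  | gd r j =>
      simp only at hv
      split_ifs at hv with h1 h2 h3
      · cases hv
        obtain ⟨rfl, -⟩ := h1
        obtain ⟨h4, r', -, -, h5⟩ := h2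
        exact ⟨h.LD_corrupt hQ hZ hG h5, h.gdDone, by rwa [← h.gd]⟩
      · cases hv
        obtain ⟨k, hk⟩ := h3
        exact ⟨k, h.aba _ _ hk⟩

theorem partSumms_mem_S (h : Agree Zs G i s) {r : ℕ} {zc z : Fin P.h} {k : Fin P.n}
    {pq : Fin P.h × Fin P.h}
    (hpq : pq ∈ s.partSumms r zc z i k) :
    i ∈ P.S pq.1 ∧ i ∈ P.S pq.2 := by
  unfold PartySt.partSumms at hpq
  split_ifs at hpq with hz
  · exact (h.inter_mem_S hpq).1
  · exact (h.inter_mem_S hpq).2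

/-- The members of `toDeal`. -/
theorem mem_toDeal {rnd : Bool → Fin P.M → F} {x : VSid P × F} :
    x ∈ s.toDeal i rnd ↔ (∃ b l, x = (.input i b l, rnd b l)) ∨
      (∃ z l, (1 ≤ s.iter ∧ i ∉ P.Z z ∧ i ∉ s.Sel s.iter z ∧ (s.opt s.iter z).rem.Nonempty) ∧
        x = (.summ s.iter z (s.opt s.iter z).hop i l, s.prodSum l ((s.opt s.iter z).summ i))) ∨
      ∃ r zc l, r ≤ s.iter ∧ s.conf r = some (zc, l) ∧ ∃ k z, (z = zc ∨ z = P.z0) ∧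
        s.partDue r zc z i k ∧
        x = (.part r z i k, s.prodSum l (s.partSumms r zc z i k)) := by
  unfold PartySt.toDeal
  rw [List.mem_append, List.mem_append, or_assoc]
  refine or_congr ?_ (or_congr ?_ ?_)
  · simp [eq_comm]
  · simp only [List.mem_flatMap, List.mem_finRange, true_and]
    refine exists_congr fun z => exists_congr fun l => ?_
    split_ifs with hc <;> simp [hc]
  · simp only [List.mem_flatMap, List.mem_range]
    constructor
    · rintro ⟨r, hr, hx⟩
      cases hc : s.conf r with
      | none => simp [hc] at hx
      | some p =>
          obtain ⟨zc, l⟩ := p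
          simp only [hc, List.mem_flatMap, List.mem_finRange, true_and] at hx
          obtain ⟨k, z, hz, hx⟩ := hx
          split_ifs at hx with hd
          · exact ⟨r, zc, l, by omega, hc, k, z, by simpa using hz, hd, by simpa using hx⟩
          · simp at hx
    · rintro ⟨r, zc, l, hr, hc, k, z, hz, hd, rfl⟩
      refine ⟨r, by omega, ?_⟩
      simp only [hc, List.mem_flatMap, List.mem_finRange, true_and]
      refine ⟨k, z, by simpa using hz, ?_⟩
      rw [if_pos hd]
      simp

/-- Honest parties share the values that the protocol prescribes; no randomness enters into this
except in the inputs. -/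
theorem toDeal (h : Agree Zs G i s) {rnd : Bool → Fin P.M → F} {x : VSid P × F}
    (hx : x ∈ s.toDeal i rnd) : x.1.dealer = i ∧ ∀ v, ∑ q, v q = x.2 → G.DealOK x.1 v := by
  rcases mem_toDeal.1 hx with ⟨b, l, rfl⟩ | ⟨z, l, ⟨h1, h2, h3, h4⟩, rfl⟩ |
    ⟨r, zc, l, hr, hc, k, z, hz, hd, rfl⟩
  · exact ⟨rfl, fun _ _ => trivial⟩
  · refine ⟨rfl, fun v hv => ⟨h1, h.stage1 h1, _, h.opt _ _, rfl, h4, h2, h3, ?_⟩⟩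
    rw [hv, h.prodSum h1]
    exact fun pq hpq => (h.opt _ _).mem_S_of_mem_summ hpq
  · obtain ⟨h1, h2, h3, h4⟩ := h.confSome _ _ hc
    have hR := h.ref
    refine ⟨rfl, fun v hv => ⟨h.stage1 (by omega), zc, l, h4,
      (hR.partDue (h3 _) (h3 _) _ _ _).2 hd, ?_⟩⟩
    rw [hv, hR.partSumms (h3 _) (h3 _), h.prodSum (by omega)]
    exact fun pq hpq => h.partSumms_mem_S hpq

end Agree

/-! ### Growth of local states -/

/-- What never gets lost in a local state. -/
structure PLe (s s' : PartySt P F) : Prop where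
  started : s.started → s'.started
  vss : Extends s.vss s'.vss
  aba : Extends s.aba s'.aba
  msgs : s.msgs ⊆ s'.msgs
  voted : Extends s.voted s'.voted
  iter : s.iter ≤ s'.iter
  conf : Extends s.conf s'.conf
  out : s.out ≠ none → s'.out = s.out ∧ s'.iter = s.iter
  hop : ∀ r z, (s.opt r z).hop < (s'.opt r z).hop ∨ s'.opt r z = s.opt r z
  optRem : ∀ r z, (s.opt r z).rem = ∅ → s'.opt r z = s.opt r z

theorem Extends.refl {α β : Type} (D : α → Option β) : Extends D D := fun _ _ h => h

theorem Extends.trans {α β : Type} {D D' D'' : α → Option β} (h : Extends D D')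
    (h' : Extends D' D'') : Extends D D'' := fun a b hb => h' a b (h a b hb)

namespace PLe

theorem refl (s : PartySt P F) : PLe s s where
  started h := h
  vss := .refl _
  aba := .refl _
  msgs := subset_rfl
  voted := .refl _
  iter := le_rfl
  conf := .refl _
  out _ := ⟨rfl, rfl⟩
  hop _ _ := Or.inr rfl
  optRem _ _ _ := rfl

theorem trans {s s' s'' : PartySt P F} (h : PLe s s') (h' : PLe s' s'') : PLe s s'' where
  started hs := h'.started (h.started hs)
  vss := h.vss.trans h'.vss
  aba := h.aba.trans h'.aba
  msgs := h.msgs.trans h'.msgs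
  voted := h.voted.trans h'.voted
  iter := h.iter.trans h'.iter
  conf := h.conf.trans h'.conf
  out ho := by
    obtain ⟨h1, h2⟩ := h.out ho
    obtain ⟨h3, h4⟩ := h'.out (by rwa [h1])
    exact ⟨h3.trans h1, h4.trans h2⟩
  hop r z := by
    rcases h.hop r z with h1 | h1 <;> rcases h'.hop r z with h2 | h2
    · exact Or.inl (h1.trans h2)
    · exact Or.inl (by rwa [h2])
    · exact Or.inl (by rwa [← h1])
    · exact Or.inr (h2.trans h1)
  optRem r z hr := by
    have h1 := h.optRem r z hr
    rw [← h1] at hr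
    rw [h'.optRem r z hr, h1]

variable {Zs : Finset (Fin P.n)} {G : Rec P F} {i : Fin P.n} {s s' : PartySt P F}

theorem got (h : PLe s s') {sid : VSid P} (hg : s.got sid) : s'.got sid := h.vss.ne_none hg

theorem optDone (h : PLe s s') {r : ℕ} {z : Fin P.h} (hd : s.optDone r z) : s'.optDone r z := by
  have := h.optRem r z hd.1
  unfold PartySt.optDone PartySt.Sel PartySt.sumSid at *
  rw [this]
  exact ⟨hd.1, fun j hj l => h.got (hd.2 j hj l)⟩

theorem hop_le (h : PLe s s') (r : ℕ) (z : Fin P.h) : (s.opt r z).hop ≤ (s'.opt r z).hop := by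
  rcases h.hop r z with h1 | h1
  · exact h1.le
  · rw [h1]

theorem wantsA (h : PLe s s') {sid : ASid P} (hw : s.wantsA sid) : s'.wantsA sid := by
  cases sid with
  | acs j => exact h.started hw
  | sel r z hop j =>
      obtain ⟨h1, h2, h3, h4⟩ := hw
      refine ⟨h1, h2.trans h.iter, h3, ?_⟩
      rcases h.hop r z with h5 | h5
      · exact Or.inl (by omega)
      · rwa [h5]
  | gd r j => exact ⟨h.conf.ne_none hw.1, hw.2⟩

theorem ref (h : PLe s s') (hA : Agree Zs G i s) (I : Fin P.h → Prop) : Ref I s s' where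
  vss sid v hv := ⟨v, h.vss sid v hv, fun _ _ => rfl⟩
  opt r z hd := h.optRem r z hd.1
  conf r p hp := ⟨h.conf r p hp, (hA.confSome r p hp).2.2.1⟩

theorem wantsV (h : PLe s s') (hA : Agree Zs G i s) {sid : VSid P} (hw : s.wantsV sid) :
    s'.wantsV sid := by
  cases sid with
  | input i b l => exact h.started hw
  | summ r z hop j l =>
      obtain ⟨h1, h2, h3, h4⟩ := hw
      refine ⟨h1, h2.trans h.iter, h3, ?_⟩
      rcases h.hop r z with h5 | h5
      · exact Or.inl (by omega)
      · rwa [h5]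
  | part r z j k =>
      obtain ⟨zc, l, hc, hd⟩ := hw
      have h3 := (hA.confSome r _ hc).2.2.1
      exact ⟨zc, l, h.conf _ _ hc, ((h.ref hA fun _ => True).partDue (h3 _) (h3 _) _ _ _).2 hd⟩

end PLe

namespace Agree

variable {Zs : Finset (Fin P.n)} {G G' : Rec P F} {i : Fin P.n} {s s' : PartySt P F}

theorem ple_stepStage (s : PartySt P F) (ho : s.out ≠ none → 1 ≤ s.iter) : PLe s s.stepStage := by
  rcases stepStage_eq s with he | ⟨h0, -, -, he⟩
  · rw [he]
    exact .refl s
  · rw [he]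
    exact { PLe.refl s with iter := by simp [h0], out := fun h => by have := ho h; omega }

theorem hopEnd_hop (s : PartySt P F) (z : Fin P.h) :
    (s.opt s.iter z).hop < (s.hopEnd z).hop ∨ s.hopEnd z = s.opt s.iter z := by
  unfold PartySt.hopEnd
  simp only
  split_ifs
  · split
    · left
      simp [OptSt.next]
    · exact Or.inr rfl
  · exact Or.inr rfl

theorem ple_stepHop (s : PartySt P F) : PLe s s.stepHop :=
  { PLe.refl s with
    hop := fun r z => by
      simp only [PartySt.stepHop, Function.update_apply]
      split_ifs with he
      · subst he
        exact hopEnd_hop s z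
      · exact Or.inr rfl
    optRem := fun r z hr => by
      simp only [PartySt.stepHop, Function.update_apply]
      split_ifs with he
      · subst he
        exact hopEnd_of_rem hr
      · rfl }

theorem ple_stepCheck (h : Agree Zs G i s) (hQ : P.Q 4) (hZ : P.Covered Zs) :
    PLe s (s.stepCheck i) := by
  rcases h.stepCheck_eq hQ hZ with he | ⟨h1, h2, h3, h4, h5, ⟨h6, he⟩ | ⟨h6, he⟩⟩
  · rw [he]
    exact .refl s
  · rw [he]
    exact { PLe.refl s with out := fun h => absurd h2 h }
  · rw [he]
    refine { PLe.refl s with conf := fun r p hp => ?_ }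
    simp only [Function.update_apply]
    split_ifs with hr
    · subst hr
      rw [h3] at hp
      cases hp
    · exact hp

theorem ple_stepNext (h : Agree Zs G i s) (hD : G.DecOK Zs) : PLe s s.stepNext := by
  rcases h.stepNext_eq hD with he | ⟨hc, ⟨hg, he⟩ | ⟨hg, ha, j, hj, he⟩⟩
  · rw [he]
    exact .refl s
  all_goals
    rw [he]
    exact { PLe.refl s with
      iter := by simp
      out := fun ho => absurd (h.conf_none_of_out ho) hc }

theorem one_le_of_out (h : Agree Zs G i s) (ho : s.out ≠ none) : 1 ≤ s.iter := by
  obtain ⟨T, hT⟩ := Option.ne_none_iff_exists'.1 ho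
  exact (h.out T hT).1

theorem ple_update (h : Agree Zs G i s) (hQ : P.Q 4) (hZ : P.Covered Zs) (hD : G.DecOK Zs) :
    PLe s (s.update i) :=
  (ple_stepStage s h.one_le_of_out).trans <| (ple_stepHop _).trans <|
    ((h.stepStage.stepHop hD).ple_stepCheck hQ hZ).trans
      (((h.stepStage.stepHop hD).stepCheck hQ hZ).ple_stepNext hD)

/-- More deliveries preserve agreement. -/
theorem grow (h : Agree Zs G i s) {vss : VSid P → Option (Fin P.h → F)}
    {aba : ASid P → Option Bool} {msgs : Set (Fin P.n × RTag P × Fin P.h × F)}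
    (hv : Extends s.vss vss) (hv' : ∀ sid v, vss sid = some v → ∃ d, G.V sid = some d ∧ v = mask i d)
    (ha : Extends s.aba aba) (ha' : Extends aba G.D)
    (hm : ∀ m ∈ msgs, m.1 ∉ Zs → G.share m.2.1 m.2.2.1 = some m.2.2.2) :
    Agree Zs G i { s with vss := vss, aba := aba, msgs := msgs } where
  vss := hv'
  aba := ha'
  stage hi := by
    obtain ⟨h1, h2⟩ := h.stage hi
    refine ⟨fun j => ha.ne_none (h1 j), fun j hj b l => hv.ne_none (h2 j ?_ b l)⟩
    simp only [PartySt.CS, Finset.mem_filter, Finset.mem_univ, true_and] at hj ⊢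
    rwa [ha.eq (h1 j)] at hj
  opt := h.opt
  optInit := h.optInit
  confSome r p hp := by
    obtain ⟨h1, h2, h3, h4⟩ := h.confSome r p hp
    exact ⟨h1, h2, fun z => ⟨(h3 z).1, fun j hj l => hv.ne_none ((h3 z).2 j hj l)⟩, h4⟩
  confPast := h.confPast
  gd := h.gd
  gdDone := h.gdDone
  out T hT := by
    obtain ⟨h1, h2, h3, h4⟩ := h.out T hT
    exact ⟨h1, h2, fun z => ⟨(h3 z).1, fun j hj l => hv.ne_none ((h3 z).2 j hj l)⟩, h4⟩
  msgs := hm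

theorem newVote_wantsA (h : Agree Zs G i s) (hs : s.started) {sid : ASid P}
    (hv : s.newVote i sid ≠ none) : s.wantsA sid := by
  unfold PartySt.newVote at hv
  rw [ite_ne_left_iff] at hv
  replace hv := hv.2.symm
  cases sid with
  | acs j => exact hs
  | sel r z hop j =>
      simp only at hv
      rw [ite_ne_right_iff] at hv
      obtain ⟨⟨h1, h2, h3, h4⟩, -⟩ := hv
      exact ⟨h1, h2.le, by rw [h3]; exact (h.opt r z).one_le_hop, Or.inr ⟨h3, h4⟩⟩
  | gd r j =>
      simp only at hv
      rw [ite_ne_right_iff] at hv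
      exact hv.1.2

theorem toDeal_wantsV (h : Agree Zs G i s) (hs : s.started) {rnd : Bool → Fin P.M → F}
    {x : VSid P × F} (hx : x ∈ s.toDeal i rnd) : s.wantsV x.1 := by
  rcases mem_toDeal.1 hx with ⟨b, l, rfl⟩ | ⟨z, l, ⟨h1, h2, h3, h4⟩, rfl⟩ |
    ⟨r, zc, l, hr, hc, k, z, hz, hd, rfl⟩
  · exact hs
  · exact ⟨h1, le_rfl, (h.opt _ z).one_le_hop, Or.inr ⟨rfl, h4⟩⟩
  · exact ⟨zc, l, hc, hd⟩

theorem congr (h : Agree Zs G i s) (h1 : s'.vss = s.vss) (h2 : s'.aba = s.aba)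
    (h3 : s'.msgs = s.msgs) (h4 : s'.iter = s.iter) (h5 : s'.opt = s.opt) (h6 : s'.conf = s.conf)
    (h7 : s'.GD = s.GD) (h8 : s'.out = s.out) : Agree Zs G i s' := by
  obtain ⟨a1, a2, a3, a4, a5, a6, a7, a8, a9, a10, a11⟩ := h
  cases s
  cases s'
  simp only at h1 h2 h3 h4 h5 h6 h7 h8
  subst h1 h2 h3 h4 h5 h6 h7 h8
  exact ⟨a1, a2, a3, a4, a5, a6, a7, a8, a9, a10, a11⟩

/-- The iteration to which a reconstructed value belongs. -/
def _root_.AMPC.RTag.iter : RTag P → ℕ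
  | .diff r _ _ | .sumCheck r _ _ | .pairDiff r _ _ | .part r _ _ _ | .inp r _ _ _ => r

theorem iter_of_rem (h : Agree Zs G i s) {r : ℕ} {z : Fin P.h} (hr : (s.opt r z).rem = ∅) :
    1 ≤ r ∧ r ≤ s.iter := by
  by_contra hc
  rw [h.optInit r z (by omega)] at hr
  exact Rec.init_rem_ne P hr

theorem tag_iter (h : Agree Zs G i s) {tag : RTag P} {q : Fin P.h}
    (hv : s.myShare i tag q ≠ none) : 1 ≤ tag.iter ∧ tag.iter ≤ s.iter := by
  unfold PartySt.myShare at hv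
  rw [ite_ne_right_iff] at hv
  obtain ⟨-, hv⟩ := hv
  cases tag with
  | diff r z l =>
      simp only [PartySt.baseShare] at hv
      rw [ite_ne_right_iff] at hv
      exact h.iter_of_rem hv.1.1.1
  | sumCheck r z j =>
      simp only [PartySt.baseShare] at hv
      have : s.conf r ≠ none := fun hc => by simp [hc] at hv
      exact ⟨(h.one_le_of_conf this).1, (h.one_le_of_conf this).2.1⟩
  | pairDiff r j k =>
      simp only [PartySt.baseShare] at hv
      have : s.conf r ≠ none := fun hc => by simp [hc] at hv
      exact ⟨(h.one_le_of_conf this).1, (h.one_le_of_conf this).2.1⟩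
  | part r z j k =>
      have : s.conf r ≠ none := fun hc => by simp [hc] at hv
      exact ⟨(h.one_le_of_conf this).1, (h.one_le_of_conf this).2.1⟩
  | inp r j k b =>
      have : s.conf r ≠ none := fun hc => by simp [hc] at hv
      exact ⟨(h.one_le_of_conf this).1, (h.one_le_of_conf this).2.1⟩

end Agree

/-! ### Invariants of the hybrid world -/

/-- The public record of a world. -/
def World.record (w : World P F) : Rec P F :=
  ⟨fun sid => (w.dec sid).map Prod.fst, fun sid => (w.deals sid).map Prod.fst⟩

/-- The safety invariants; `pend` are votes that honest parties have cast but that have not yet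
reached the ABA functionality. -/
structure PreInv (Zs : Finset (Fin P.n)) (pend : Fin P.n → ASid P → Option Bool)
    (w : World P F) : Prop where
  agree : ∀ i ∉ Zs, Agree Zs w.record i (w.parties i)
  startedHonest : ∀ i, (w.parties i).started → i ∉ Zs
  votes : ∀ i ∉ Zs, ∀ sid b, w.votes sid i = some b →
    (w.parties i).started ∧ (w.parties i).voted sid = some b ∧ w.record.VoteOK Zs sid b
  voted : ∀ i ∉ Zs, ∀ sid b, (w.parties i).voted sid = some b →
    (w.parties i).wantsA sid ∧ w.record.VoteOK Zs sid b ∧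
      (w.votes sid i = some b ∨ w.dec sid ≠ none ∨ pend i sid = some b)
  dec : ∀ sid b c, w.dec sid = some (b, c) → (∃ j ∉ Zs, w.votes sid j = some b) ∧
    c ≤ w.clock.round ∧ ∃ C, P.Quorum C ∧ ∀ j ∈ C, w.votes sid j ≠ none
  core : ∀ sid C, w.core sid = some C → P.Quorum C
  quorumAt : ∀ sid c, w.quorumAt sid = some c → c ≤ w.clock.round ∧ P.Quorum (w.voters sid)
  quorum : ∀ sid, P.Quorum (w.voters sid) → w.quorumAt sid ≠ none
  deals : ∀ sid d c, w.deals sid = some (d, c) → c ≤ w.clock.round ∧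
    (sid.dealer ∉ Zs → w.record.DealOK sid d ∧ (w.parties sid.dealer).started)
  dealt : ∀ i ∉ Zs, ∀ sid ∈ (w.parties i).dealt,
    w.deals sid ≠ none ∧ sid.dealer = i ∧ (w.parties i).wantsV sid
  mail : ∀ j ∉ Zs, ∀ tag q v c, w.mail j tag q = some (v, c) → c ≤ w.clock.round ∧
    w.record.share tag q = some v ∧ 1 ≤ tag.iter ∧ tag.iter ≤ (w.parties j).iter

/-- The safety invariants of the hybrid world. -/
def Inv (Zs : Finset (Fin P.n)) (w : World P F) : Prop := PreInv Zs (fun _ _ => none) w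

/-- What never gets lost in a world. -/
structure WLe (Zs : Finset (Fin P.n)) (w w' : World P F) : Prop where
  deals : Extends w.deals w'.deals
  dec : Extends w.dec w'.dec
  mail : ∀ j tag, Extends (w.mail j tag) (w'.mail j tag)
  quorumAt : Extends w.quorumAt w'.quorumAt
  round : w.clock.round ≤ w'.clock.round
  parties : ∀ i, PLe (w.parties i) (w'.parties i)

theorem WLe.record {Zs : Finset (Fin P.n)} {w w' : World P F} (h : WLe Zs w w') :
    w.record ≤ w'.record := by
  constructor
  · intro sid b hb
    simp only [World.record, Option.map_eq_some_iff] at hb ⊢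
    obtain ⟨x, hx, rfl⟩ := hb
    exact ⟨x, h.dec _ _ hx, rfl⟩
  · intro sid b hb
    simp only [World.record, Option.map_eq_some_iff] at hb ⊢
    obtain ⟨x, hx, rfl⟩ := hb
    exact ⟨x, h.deals _ _ hx, rfl⟩

theorem WLe.refl (Zs : Finset (Fin P.n)) (w : World P F) : WLe Zs w w :=
  ⟨.refl _, .refl _, fun _ _ => .refl _, .refl _, le_rfl, fun _ => .refl _⟩

theorem WLe.trans {Zs : Finset (Fin P.n)} {w w' w'' : World P F} (h : WLe Zs w w')
    (h' : WLe Zs w' w'') : WLe Zs w w'' :=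
  ⟨h.deals.trans h'.deals, h.dec.trans h'.dec, fun j t => (h.mail j t).trans (h'.mail j t),
    h.quorumAt.trans h'.quorumAt, h.round.trans h'.round,
    fun i => (h.parties i).trans (h'.parties i)⟩

section Invariants

variable {Zs : Finset (Fin P.n)} {w : World P F} {pend : Fin P.n → ASid P → Option Bool}

theorem PreInv.decOK (h : PreInv Zs pend w) : w.record.DecOK Zs := by
  intro sid b hb
  simp only [World.record, Option.map_eq_some_iff] at hb
  obtain ⟨⟨b', c⟩, hx, rfl⟩ := hb
  obtain ⟨⟨j, hj, hv⟩, -⟩ := h.dec _ _ _ hx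
  exact (h.votes j hj _ _ hv).2.2

theorem PreInv.dealsOK (h : PreInv Zs pend w) : w.record.DealsOK Zs := by
  intro sid v hv hd
  simp only [World.record, Option.map_eq_some_iff] at hv
  obtain ⟨⟨v', c⟩, hx, rfl⟩ := hv
  exact ((h.deals _ _ _ hx).2 hd).1

/-- The value of the ABA functionality is the vote of an honest member of the core set. -/
theorem abaValue_honest (hQ : P.Q 4) (hZ : P.Covered Zs) {C : Finset (Fin P.n)} (hC : P.Quorum C)
    {x : Fin P.n → Option Bool} (hx : ∀ j ∈ C, x j ≠ none) :
    ∃ j ∉ Zs, x j = some (abaValue Zs C x) := by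
  obtain ⟨j, hj, hjZ, -⟩ := hC.exists_honest hQ hZ P.z0 P.z0
  have hjm : j ∈ C \ Zs := Finset.mem_sdiff.2 ⟨hj, hjZ⟩
  unfold abaValue
  by_cases h1 : ∀ j ∈ C \ Zs, x j = some true
  · rw [if_pos h1]
    exact ⟨j, hjZ, h1 j hjm⟩
  rw [if_neg h1]
  by_cases h2 : ∀ j ∈ C \ Zs, x j = some false
  · rw [if_pos h2]
    exact ⟨j, hjZ, h2 j hjm⟩
  rw [if_neg h2]
  push Not at h1 h2
  obtain ⟨a, ha, ha1⟩ := h1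
  obtain ⟨b, hb, hb1⟩ := h2
  have ha2 : x a = some false := by
    obtain ⟨y, hy⟩ := Option.ne_none_iff_exists'.1 (hx a (Finset.mem_sdiff.1 ha).1)
    cases y
    · exact hy
    · exact absurd hy ha1
  have hb2 : x b = some true := by
    obtain ⟨y, hy⟩ := Option.ne_none_iff_exists'.1 (hx b (Finset.mem_sdiff.1 hb).1)
    cases y
    · exact absurd hy hb1
    · exact hy
  generalize (if hc : (C ∩ Zs).Nonempty then decide (x ((C ∩ Zs).min' hc) = some true)
    else if hc : C.Nonempty then decide (x (C.min' hc) = some true) else false) = y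
  cases y
  · exact ⟨a, (Finset.mem_sdiff.1 ha).2, ha2⟩
  · exact ⟨b, (Finset.mem_sdiff.1 hb).2, hb2⟩

/-- Changes of the state of the ABA functionality other than votes. -/
theorem PreInv.dec_step (h : PreInv Zs pend w) {core' : ASid P → Option (Finset (Fin P.n))}
    {dec' : ASid P → Option (Bool × ℕ)} (hcore : ∀ sid C, core' sid = some C → P.Quorum C)
    (hext : Extends w.dec dec')
    (hnew : ∀ sid b c, w.dec sid = none → dec' sid = some (b, c) →
      (∃ j ∉ Zs, w.votes sid j = some b) ∧ c ≤ w.clock.round ∧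
        ∃ C, P.Quorum C ∧ ∀ j ∈ C, w.votes sid j ≠ none) :
    PreInv Zs pend { w with core := core', dec := dec' } ∧
      WLe Zs w { w with core := core', dec := dec' } := by
  have hW : WLe Zs w { w with core := core', dec := dec' } := { WLe.refl Zs w with dec := hext }
  have hG := hW.record
  refine ⟨?_, hW⟩
  exact
    { agree := fun i hi => (h.agree i hi).mono hG
      startedHonest := h.startedHonest
      votes := fun i hi sid b hb => by
        obtain ⟨h1, h2, h3⟩ := h.votes i hi sid b hb
        exact ⟨h1, h2, h3.mono hG⟩
      voted := fun i hi sid b hb => by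
        obtain ⟨h1, h2, h3⟩ := h.voted i hi sid b hb
        exact ⟨h1, h2.mono hG, h3.imp_right (Or.imp_left hext.ne_none)⟩
      dec := fun sid b c hb => by
        cases hd : w.dec sid with
        | none => exact hnew sid b c hd hb
        | some x =>
            have := hext sid x hd
            simp only at hb
            rw [this] at hb
            cases hb
            exact h.dec sid b c hd
      core := hcore
      quorumAt := h.quorumAt
      quorum := h.quorum
      deals := fun sid d c hd => by
        obtain ⟨h1, h2⟩ := h.deals sid d c hd
        exact ⟨h1, fun hz => ⟨(h2 hz).1.mono hG, (h2 hz).2⟩⟩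
      dealt := h.dealt
      mail := fun j hj tag q v c hm => by
        obtain ⟨h1, h2, h3⟩ := h.mail j hj tag q v c hm
        exact ⟨h1, Rec.share_mono hG h2, h3⟩ }

theorem PreInv.decideAba (h : PreInv Zs pend w) (hQ : P.Q 4) (hZ : P.Covered Zs)
    {core' : ASid P → Option (Finset (Fin P.n))}
    (hcore : ∀ sid C, core' sid = some C → P.Quorum C) :
    PreInv Zs pend (World.decideAba Zs { w with core := core' }) ∧
      WLe Zs w (World.decideAba Zs { w with core := core' }) := by
  refine h.dec_step (core' := core') hcore ?_ ?_
  · intro sid x hx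
    simp [hx]
  · intro sid b c hn hd
    simp only [hn] at hd
    cases hC : core' sid with
    | none => simp [hC] at hd
    | some C =>
        simp only [hC] at hd
        obtain ⟨hv, hd⟩ := Option.ite_none_right_eq_some.1 hd
        simp only [Option.some.injEq, Prod.mk.injEq] at hd
        obtain ⟨rfl, rfl⟩ := hd
        exact ⟨abaValue_honest hQ hZ (hcore sid C hC) hv, le_rfl, C, hcore sid C hC, hv⟩

theorem Inv.forceAba (h : Inv Zs w) (hQ : P.Q 4) (hZ : P.Covered Zs) (B : ℕ) :
    Inv Zs (w.forceAba B Zs) ∧ WLe Zs w (w.forceAba B Zs) := by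
  refine PreInv.decideAba h hQ hZ fun sid C hC => ?_
  split_ifs at hC with hc
  · obtain ⟨-, c, h1, -⟩ := hc
    cases hC
    exact (h.quorumAt sid c h1).2
  · exact h.core sid C hC

/-- The votes after party `j` has cast the votes `nv`. -/
theorem PreInv.castVotes {j : Fin P.n} {nv : ASid P → Option Bool}
    (h : PreInv Zs (fun i sid => if i = j then nv sid else none) w) (hQ : P.Q 4)
    (hZ : P.Covered Zs) (hnv : j ∉ Zs → ∀ sid b, nv sid = some b →
      (w.parties j).started ∧ (w.parties j).voted sid = some b) :
    Inv Zs (w.castVotes Zs j nv) ∧ WLe Zs w (w.castVotes Zs j nv) ∧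
      ∀ sid, (nv sid ≠ none ∨ w.votes sid j ≠ none) → w.dec sid = none →
        (w.castVotes Zs j nv).votes sid j ≠ none := by
  set vs : ASid P → Fin P.n → Option Bool := fun sid =>
    if w.dec sid = none ∧ nv sid ≠ none then Function.update (w.votes sid) j (nv sid)
    else w.votes sid with hvs
  set w1 : World P F := { w with votes := vs } with hw1
  set qs : ASid P → Option ℕ := fun sid =>
    if w.quorumAt sid = none ∧ P.Quorum (w1.voters sid) then some w.clock.round
    else w.quorumAt sid with hqs
  have hmono : ∀ sid i, w.votes sid i ≠ none → vs sid i ≠ none := by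
    intro sid i hi
    simp only [hvs]
    split_ifs with hc
    · rw [Function.update_apply]
      split_ifs
      · exact hc.2
      · exact hi
    · exact hi
  have hsub : ∀ sid, w.voters sid ⊆ w1.voters sid := by
    intro sid i hi
    simp only [World.voters, Finset.mem_filter, Finset.mem_univ, true_and] at hi ⊢
    exact hmono sid i hi
  have hkeep : ∀ i ∉ Zs, ∀ sid b, w.votes sid i = some b → vs sid i = some b := by
    intro i hi sid b hb
    simp only [hvs]
    split_ifs with hc
    · rw [Function.update_apply]
      split_ifs with hij
      · subst hij
        obtain ⟨b', hb'⟩ := Option.ne_none_iff_exists'.1 hc.2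
        rw [hb', ← (hnv hi sid b' hb').2, (h.votes i hi sid b hb).2.1]
      · exact hb
    · exact hb
  have key : PreInv Zs (fun _ _ => none) { w1 with quorumAt := qs } ∧
      WLe Zs w { w1 with quorumAt := qs } := by
    constructor
    · refine ⟨h.agree, h.startedHonest, ?_, ?_, ?_, h.core, ?_, ?_, h.deals, h.dealt, h.mail⟩
      · intro i hi sid b hb
        simp only [hw1, hvs] at hb
        split_ifs at hb with hc
        · rw [Function.update_apply] at hb
          split_ifs at hb with hij
          · subst hij
            obtain ⟨h1, h2⟩ := hnv hi sid b hb
            exact ⟨h1, h2, (h.voted i hi sid b h2).2.1⟩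
          · exact h.votes i hi sid b hb
        · exact h.votes i hi sid b hb
      · intro i hi sid b hb
        obtain ⟨h1, h2, h3⟩ := h.voted i hi sid b hb
        refine ⟨h1, h2, ?_⟩
        rcases h3 with h3 | h3 | h3
        · exact Or.inl (hkeep i hi sid b h3)
        · exact Or.inr (Or.inl h3)
        · split_ifs at h3 with hij
          subst hij
          by_cases hd : w.dec sid = none
          · left
            simp only [hw1, hvs]
            rw [if_pos ⟨hd, by simp [h3]⟩, Function.update_self, h3]
          · exact Or.inr (Or.inl hd)
      · intro sid b c hd
        obtain ⟨⟨k, hk, h1⟩, h2, C, h3, h4⟩ := h.dec sid b c hd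
        exact ⟨⟨k, hk, hkeep k hk sid b h1⟩, h2, C, h3, fun i hi => hmono sid i (h4 i hi)⟩
      · intro sid c hc
        simp only [hqs] at hc
        split_ifs at hc with hq
        · cases hc
          exact ⟨le_rfl, hq.2⟩
        · obtain ⟨h1, h2⟩ := h.quorumAt sid c hc
          exact ⟨h1, h2.mono (hsub sid)⟩
      · intro sid hq
        simp only [hqs]
        split_ifs with hc
        · simp
        · intro hn
          exact hc ⟨hn, hq⟩
    · refine { WLe.refl Zs w with quorumAt := fun sid c hc => ?_ }
      simp only [hqs]
      rw [if_neg (by simp [hc]), hc]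
  obtain ⟨h1, h2⟩ := PreInv.decideAba (core' := w.core) key.1 hQ hZ h.core
  refine ⟨h1, key.2.trans h2, fun sid hs hd => ?_⟩
  change vs sid j ≠ none
  by_cases hn : nv sid ≠ none
  · simp only [hvs]
    rw [if_pos ⟨hd, hn⟩, Function.update_self]
    exact hn
  · exact hmono sid j (hs.resolve_left hn)

theorem Inv.toPre (h : Inv Zs w) (pend : Fin P.n → ASid P → Option Bool) : PreInv Zs pend w :=
  { h with
    voted := fun i hi sid b hb => by
      obtain ⟨h1, h2, h3⟩ := h.voted i hi sid b hb
      exact ⟨h1, h2, h3.imp_right fun h => Or.inl (h.resolve_right (by simp))⟩ }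

theorem Inv.start (h : Inv Zs w) {i : Fin P.n} (hi : i ∉ Zs) :
    Inv Zs (w.setParty i { w.parties i with started := True }) ∧
      WLe Zs w (w.setParty i { w.parties i with started := True }) := by
  have hp : ∀ k, PLe (w.parties k)
      (Function.update w.parties i { w.parties i with started := True } k) := by
    intro k
    by_cases hk : k = i
    · subst hk
      rw [Function.update_self]
      exact { PLe.refl _ with started := fun _ => trivial }
    · rw [Function.update_of_ne hk]
      exact .refl _
  refine ⟨?_, { WLe.refl Zs w with parties := hp }⟩
  have hf : ∀ {α : Type} (g : PartySt P F → α) (_ : ∀ s : PartySt P F, g { s with started := True }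
      = g s) (k : Fin P.n),
      g (Function.update w.parties i { w.parties i with started := True } k) =
        g (w.parties k) := by
    intro α g hg k
    by_cases hk : k = i
    · subst hk
      rw [Function.update_self, hg]
    · rw [Function.update_of_ne hk]
  refine ⟨?_, ?_, ?_, ?_, h.dec, h.core, h.quorumAt, h.quorum, ?_, ?_, ?_⟩
  · intro k hk
    exact (h.agree k hk).congr (hf PartySt.vss (fun _ => rfl) k) (hf PartySt.aba (fun _ => rfl) k)
      (hf PartySt.msgs (fun _ => rfl) k) (hf PartySt.iter (fun _ => rfl) k)
      (hf PartySt.opt (fun _ => rfl) k) (hf PartySt.conf (fun _ => rfl) k)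
      (hf PartySt.GD (fun _ => rfl) k) (hf PartySt.out (fun _ => rfl) k)
  · intro k hk
    by_cases hki : k = i
    · subst hki
      exact hi
    · simp only [World.setParty, Function.update_of_ne hki] at hk
      exact h.startedHonest k hk
  · intro k hk sid b hb
    obtain ⟨h1, h2, h3⟩ := h.votes k hk sid b hb
    refine ⟨(hp k).started h1, ?_, h3⟩
    exact (congrFun (hf PartySt.voted (fun _ => rfl) k) sid).trans h2
  · intro k hk sid b hb
    have hb' : (w.parties k).voted sid = some b :=
      (congrFun (hf PartySt.voted (fun _ => rfl) k) sid).symm.trans hb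
    obtain ⟨h1, h2, h3⟩ := h.voted k hk sid b hb'
    exact ⟨(hp k).wantsA h1, h2, h3⟩
  · intro sid d c hd
    obtain ⟨h1, h2⟩ := h.deals sid d c hd
    exact ⟨h1, fun hz => ⟨(h2 hz).1, (hp _).started (h2 hz).2⟩⟩
  · intro k hk sid hs
    obtain ⟨h1, h2, h3⟩ := h.dealt k hk sid (by rwa [← hf PartySt.dealt (fun _ => rfl) k])
    exact ⟨h1, h2, (hp k).wantsV (h.agree k hk) h3⟩
  · intro k hk tag q v c hm
    obtain ⟨h1, h2, h3, h4⟩ := h.mail k hk tag q v c hm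
    exact ⟨h1, h2, h3, h4.trans (hp k).iter⟩

/-- Replacing the state of an honest party that has received more. -/
theorem Inv.setParty (h : Inv Zs w) {i : Fin P.n} {vss : VSid P → Option (Fin P.h → F)}
    {aba : ASid P → Option Bool} {msgs : Set (Fin P.n × RTag P × Fin P.h × F)}
    (hi : i ∉ Zs → Agree Zs w.record i
      { w.parties i with vss := vss, aba := aba, msgs := msgs })
    (hv : Extends (w.parties i).vss vss) (ha : Extends (w.parties i).aba aba)
    (hm : (w.parties i).msgs ⊆ msgs) :
    Inv Zs (w.setParty i { w.parties i with vss := vss, aba := aba, msgs := msgs }) ∧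
      WLe Zs w (w.setParty i { w.parties i with vss := vss, aba := aba, msgs := msgs }) := by
  have hp : ∀ k, PLe (w.parties k)
      (Function.update w.parties i
        { w.parties i with vss := vss, aba := aba, msgs := msgs } k) := by
    intro k
    by_cases hk : k = i
    · subst hk
      rw [Function.update_self]
      exact { PLe.refl _ with vss := hv, aba := ha, msgs := hm }
    · rw [Function.update_of_ne hk]
      exact .refl _
  refine ⟨?_, { WLe.refl Zs w with parties := hp }⟩
  have hf : ∀ {α : Type} (g : PartySt P F → α) (_ : ∀ s : PartySt P F,
      g { s with vss := vss, aba := aba, msgs := msgs } = g s) (k : Fin P.n),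
      g (Function.update w.parties i { w.parties i with vss := vss, aba := aba, msgs := msgs } k)
        = g (w.parties k) := by
    intro α g hg k
    by_cases hk : k = i
    · subst hk
      rw [Function.update_self, hg]
    · rw [Function.update_of_ne hk]
  have hst : ∀ k, (Function.update w.parties i
      { w.parties i with vss := vss, aba := aba, msgs := msgs } k).started ↔
      (w.parties k).started := fun k => by rw [hf PartySt.started (fun _ => rfl) k]
  refine ⟨?_, ?_, ?_, ?_, h.dec, h.core, h.quorumAt, h.quorum, ?_, ?_, ?_⟩
  · intro k hk
    by_cases hki : k = i
    · subst hki
      simp only [World.setParty, Function.update_self]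
      exact hi hk
    · simp only [World.setParty, Function.update_of_ne hki]
      exact h.agree k hk
  · intro k hk
    exact h.startedHonest k ((hst k).1 hk)
  · intro k hk sid b hb
    obtain ⟨h1, h2, h3⟩ := h.votes k hk sid b hb
    refine ⟨(hp k).started h1, ?_, h3⟩
    exact (congrFun (hf PartySt.voted (fun _ => rfl) k) sid).trans h2
  · intro k hk sid b hb
    have hb' : (w.parties k).voted sid = some b :=
      (congrFun (hf PartySt.voted (fun _ => rfl) k) sid).symm.trans hb
    obtain ⟨h1, h2, h3⟩ := h.voted k hk sid b hb'
    exact ⟨(hp k).wantsA h1, h2, h3⟩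
  · intro sid d c hd
    obtain ⟨h1, h2⟩ := h.deals sid d c hd
    exact ⟨h1, fun hz => ⟨(h2 hz).1, (hp _).started (h2 hz).2⟩⟩
  · intro k hk sid hs
    obtain ⟨h1, h2, h3⟩ := h.dealt k hk sid (by rwa [← hf PartySt.dealt (fun _ => rfl) k])
    exact ⟨h1, h2, (hp k).wantsV (h.agree k hk) h3⟩
  · intro k hk tag q v c hm
    obtain ⟨h1, h2, h3, h4⟩ := h.mail k hk tag q v c hm
    exact ⟨h1, h2, h3, h4.trans (hp k).iter⟩

theorem Inv.applyOp (h : Inv Zs w) (hQ : P.Q 4) (hZ : P.Covered Zs) (op : Op P F) :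
    Inv Zs (World.applyOp Zs w op) ∧ WLe Zs w (World.applyOp Zs w op) := by
  cases op with
  | deal sid v =>
      simp only [World.applyOp]
      split_ifs with hc
      · have hW : WLe Zs w
            { w with deals := Function.update w.deals sid (some (v, w.clock.round)) } := by
          refine { WLe.refl Zs w with deals := fun sid' x hx => ?_ }
          simp only [Function.update_apply]
          split_ifs with he
          · subst he
            rw [hc.2] at hx
            cases hx
          · exact hx
        have hG := hW.record
        refine ⟨?_, hW⟩
        exact
          { agree := fun i hi => (h.agree i hi).mono hG
            startedHonest := h.startedHonest
            votes := fun i hi sid b hb => by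
              obtain ⟨h1, h2, h3⟩ := h.votes i hi sid b hb
              exact ⟨h1, h2, h3.mono hG⟩
            voted := fun i hi sid b hb => by
              obtain ⟨h1, h2, h3⟩ := h.voted i hi sid b hb
              exact ⟨h1, h2.mono hG, h3⟩
            dec := h.dec
            core := h.core
            quorumAt := h.quorumAt
            quorum := h.quorum
            deals := fun sid' d c hd => by
              simp only [Function.update_apply] at hd
              split_ifs at hd with he
              · subst he
                cases hd
                exact ⟨le_rfl, fun hz => absurd hc.1 hz⟩
              · obtain ⟨h1, h2⟩ := h.deals sid' d c hd
                exact ⟨h1, fun hz => ⟨(h2 hz).1.mono hG, (h2 hz).2⟩⟩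
            dealt := fun i hi sid' hs => by
              obtain ⟨h1, h2⟩ := h.dealt i hi sid' hs
              exact ⟨hW.deals.ne_none h1, h2⟩
            mail := fun j hj tag q v c hm => by
              obtain ⟨h1, h2, h3⟩ := h.mail j hj tag q v c hm
              exact ⟨h1, Rec.share_mono hG h2, h3⟩ }
      · exact ⟨h, .refl _ _⟩
  | vote sid j b =>
      simp only [World.applyOp]
      split_ifs with hc
      · obtain ⟨h1, h2, -⟩ := (h.toPre _).castVotes (j := j)
          (nv := Function.update (fun _ => none) sid (some b)) hQ hZ fun hj => absurd hc hj
        exact ⟨h1, h2⟩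
      · exact ⟨h, .refl _ _⟩
  | coreset sid C =>
      simp only [World.applyOp]
      split_ifs with hc
      · refine PreInv.decideAba h hQ hZ fun sid' C' hC => ?_
        rw [Function.update_apply] at hC
        split_ifs at hC with he
        · cases hC
          exact hc.1
        · exact h.core sid' C' hC
      · exact ⟨h, .refl _ _⟩
  | send j i tag q v =>
      simp only [World.applyOp]
      split_ifs with hc
      · refine Inv.setParty (vss := (w.parties i).vss) (aba := (w.parties i).aba) h
          (fun hi => ?_) (.refl _) (.refl _) (Set.subset_insert _ _)
        have hA := h.agree i hi
        refine hA.grow (.refl _) hA.vss (.refl _) hA.aba fun m hm hmZ => ?_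
        rcases hm with rfl | hm
        · exact absurd hc hmZ
        · exact hA.msgs m hm hmZ
      · exact ⟨h, .refl _ _⟩

theorem Inv.applyOps (h : Inv Zs w) (hQ : P.Q 4) (hZ : P.Covered Zs) (ops : List (Op P F)) :
    Inv Zs (w.applyOps Zs ops) ∧ WLe Zs w (w.applyOps Zs ops) := by
  unfold World.applyOps
  induction ops generalizing w with
  | nil => exact ⟨h, .refl _ _⟩
  | cons op ops ih =>
      obtain ⟨h1, h2⟩ := h.applyOp hQ hZ op
      obtain ⟨h3, h4⟩ := ih h1
      exact ⟨h3, h2.trans h4⟩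

theorem Inv.deliver (h : Inv Zs w) {i : Fin P.n} (hi : i ∉ Zs) (B : ℕ) (D : Set (Item P)) :
    Inv Zs (w.deliver B i D) ∧ WLe Zs w (w.deliver B i D) := by
  have hA := h.agree i hi
  have hv : Extends (w.parties i).vss ((w.deliver B i D).parties i).vss := by
    intro sid v hv
    simp [World.deliver, World.setParty, hv]
  have ha : Extends (w.parties i).aba ((w.deliver B i D).parties i).aba := by
    intro sid v hv
    simp [World.deliver, World.setParty, hv]
  have hm : (w.parties i).msgs ⊆ ((w.deliver B i D).parties i).msgs := by
    simp [World.deliver, World.setParty]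
  refine h.setParty (i := i) (fun _ => hA.grow ?_ ?_ ?_ ?_ ?_) ?_ ?_ ?_
  · simpa [World.deliver, World.setParty] using hv
  · intro sid v hv
    split_ifs at hv with hc
    · obtain ⟨x, hx, rfl⟩ := Option.map_eq_some_iff.1 hv
      exact ⟨x.1, by simp [World.record, hx], rfl⟩
    · exact hA.vss sid v hv
  · simpa [World.deliver, World.setParty] using ha
  · intro sid b hb
    simp only at hb
    split_ifs at hb with hc
    · exact hb
    · exact hA.aba sid b hb
  · intro m hm hmZ
    rcases hm with hm | ⟨-, c, hc, -⟩
    · exact hA.msgs m hm hmZ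
    · exact (h.mail m.1 hmZ _ _ _ _ hc).2.1
  · simpa [World.deliver, World.setParty] using hv
  · simpa [World.deliver, World.setParty] using ha
  · simp

theorem PreInv.tick (h : Inv Zs w) (A : Finset (Fin P.n)) (i : Fin P.n) :
    Inv Zs { w with clock := w.clock.tick A i } ∧
      WLe Zs w { w with clock := w.clock.tick A i } := by
  have hr : w.clock.round ≤ (w.clock.tick A i).round := by
    unfold Clock.tick
    split_ifs <;> simp
  refine ⟨?_, { WLe.refl Zs w with round := hr }⟩
  exact
    { agree := h.agree
      startedHonest := h.startedHonest
      votes := h.votes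
      voted := h.voted
      dec := fun sid b c hd => by
        obtain ⟨h1, h2, h3⟩ := h.dec sid b c hd
        exact ⟨h1, h2.trans hr, h3⟩
      core := h.core
      quorumAt := fun sid c hc => ⟨(h.quorumAt sid c hc).1.trans hr, (h.quorumAt sid c hc).2⟩
      quorum := h.quorum
      deals := fun sid d c hd => ⟨(h.deals sid d c hd).1.trans hr, (h.deals sid d c hd).2⟩
      dealt := h.dealt
      mail := fun j hj tag q v c hm => by
        obtain ⟨h1, h2⟩ := h.mail j hj tag q v c hm
        exact ⟨h1.trans hr, h2⟩ }

end Invariants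

/-! ### Activations -/

theorem PartySt.update_fields (i : Fin P.n) (s : PartySt P F) :
    (s.update i).started = s.started ∧ (s.update i).vss = s.vss ∧ (s.update i).aba = s.aba ∧
      (s.update i).msgs = s.msgs ∧ (s.update i).dealt = s.dealt ∧
      (s.update i).voted = s.voted := by
  have key : ∀ f : PartySt P F → PartySt P F, (f = PartySt.stepStage ∨ f = PartySt.stepHop ∨
      f = PartySt.stepCheck i ∨ f = PartySt.stepNext) → ∀ s : PartySt P F,
      (f s).started = s.started ∧ (f s).vss = s.vss ∧ (f s).aba = s.aba ∧
      (f s).msgs = s.msgs ∧ (f s).dealt = s.dealt ∧ (f s).voted = s.voted := by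
    rintro f (rfl | rfl | rfl | rfl) s
    · unfold PartySt.stepStage
      split_ifs <;> simp
    · simp [PartySt.stepHop]
    · unfold PartySt.stepCheck
      split_ifs
      · split <;> simp
      · simp
    · unfold PartySt.stepNext
      split_ifs
      · simp
      · split <;> simp
      · simp
      · simp
  have h1 := key PartySt.stepStage (by tauto) s
  have h2 := key PartySt.stepHop (by tauto) s.stepStage
  have h3 := key (PartySt.stepCheck i) (by tauto) s.stepStage.stepHop
  have h4 := key PartySt.stepNext (by tauto) (s.stepStage.stepHop.stepCheck i)
  unfold PartySt.update
  refine ⟨?_, ?_, ?_, ?_, ?_, ?_⟩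
  · rw [h4.1, h3.1, h2.1, h1.1]
  · rw [h4.2.1, h3.2.1, h2.2.1, h1.2.1]
  · rw [h4.2.2.1, h3.2.2.1, h2.2.2.1, h1.2.2.1]
  · rw [h4.2.2.2.1, h3.2.2.2.1, h2.2.2.2.1, h1.2.2.2.1]
  · rw [h4.2.2.2.2.1, h3.2.2.2.2.1, h2.2.2.2.2.1, h1.2.2.2.2.1]
  · rw [h4.2.2.2.2.2, h3.2.2.2.2.2, h2.2.2.2.2.2, h1.2.2.2.2.2]

/-- The effect of the actions of party `i` when it deals the vectors `f`. -/
def World.acted (Zs : Finset (Fin P.n)) (i : Fin P.n) (w : World P F)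
    (f : VSid P → Option (Fin P.h → F)) : World P F :=
  let s := (w.parties i).update i
  let s' := { s with
    dealt := s.dealt ∪ {sid | f sid ≠ none}
    voted := fun sid => if s.voted sid = none then s.newVote i sid else s.voted sid }
  World.castVotes Zs i (s.newVote i)
    { w with
      parties := Function.update w.parties i s'
      deals := fun sid => if w.deals sid = none then (f sid).map fun v => (v, w.clock.round)
        else w.deals sid
      mail := Function.update w.mail i fun tag q =>
        if w.mail i tag q = none then (s.myShare i tag q).map fun v => (v, w.clock.round)
        else w.mail i tag q }

theorem World.actions_eq [Fintype F] (Zs : Finset (Fin P.n)) (i : Fin P.n) (w : World P F) :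
    w.actions Zs i = (PMF.uniformOfFintype (Bool → Fin P.M → F)).bind fun rnd =>
      (shareAll ((((w.parties i).update i).toDeal i rnd).filter
        fun x => decide (x.1 ∉ ((w.parties i).update i).dealt))).map (w.acted Zs i) := rfl

theorem sum_of_mem_randomShares [Fintype F] {x : F} {v : Fin P.h → F}
    (hv : v ∈ (randomShares (P := P) x).support) : ∑ q, v q = x := by
  unfold randomShares uniformOn at hv
  have hne : (Finset.univ.filter fun v : Fin P.h → F => ∑ q, v q = x).Nonempty :=
    ⟨Pi.single P.z0 x, by simp⟩
  rw [dif_pos hne, PMF.support_uniformOfFinset] at hv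
  simpa using hv

theorem mem_support_shareAll [Fintype F] {L : List (VSid P × F)}
    {f : VSid P → Option (Fin P.h → F)} (hf : f ∈ (shareAll L).support) :
    (∀ sid v, f sid = some v → ∃ x, (sid, x) ∈ L ∧ ∑ q, v q = x) ∧
      ∀ x ∈ L, f x.1 ≠ none := by
  induction L generalizing f with
  | nil =>
      simp only [shareAll, PMF.support_pure, Set.mem_singleton_iff] at hf
      subst hf
      simp
  | cons x L ih =>
      simp only [shareAll, PMF.mem_support_bind_iff, PMF.mem_support_map_iff] at hf
      obtain ⟨v, hv, g, hg, rfl⟩ := hf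
      obtain ⟨h1, h2⟩ := ih hg
      constructor
      · intro sid u hu
        rw [Function.update_apply] at hu
        split_ifs at hu with he
        · cases hu
          exact ⟨x.2, by simp [he], sum_of_mem_randomShares hv⟩
        · obtain ⟨y, hy, hs⟩ := h1 sid u hu
          exact ⟨y, by simp [hy], hs⟩
      · intro y hy
        rw [Function.update_apply]
        split_ifs with he
        · simp
        · rcases List.mem_cons.1 hy with rfl | hy
          · exact absurd rfl he
          · exact h2 y hy

/-- What holds after an honest party has been activated. -/
structure Acted (i : Fin P.n) (s : PartySt P F) (w' : World P F) : Prop where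
  deals : ∀ rnd, ∀ x ∈ s.toDeal i rnd, w'.deals x.1 ≠ none
  votes : ∀ sid, s.newVote i sid ≠ none → (w'.parties i).voted sid ≠ none
  mail : ∀ tag q, s.myShare i tag q ≠ none → w'.mail i tag q ≠ none
  ple : PLe s (w'.parties i)
  iter : (w'.parties i).iter = s.iter
  opt : (w'.parties i).opt = s.opt
  conf : (w'.parties i).conf = s.conf
  out : (w'.parties i).out = s.out

section

variable {Zs : Finset (Fin P.n)} {w : World P F}

theorem Inv.acted (h : Inv Zs w) (hQ : P.Q 4) (hZ : P.Covered Zs) {i : Fin P.n} (hi : i ∉ Zs)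
    (hs : (w.parties i).started) {f : VSid P → Option (Fin P.h → F)}
    {rnd : Bool → Fin P.M → F}
    (hf : ∀ sid v, f sid = some v →
      ∃ x, (sid, x) ∈ ((w.parties i).update i).toDeal i rnd ∧ ∑ q, v q = x)
    (hf' : ∀ x ∈ ((w.parties i).update i).toDeal i rnd, x.1 ∉ ((w.parties i).update i).dealt →
      f x.1 ≠ none) :
    Inv Zs (w.acted Zs i f) ∧ WLe Zs w (w.acted Zs i f) ∧
      Acted i ((w.parties i).update i) (w.acted Zs i f) ∧
      ∀ k ≠ i, (w.acted Zs i f).parties k = w.parties k := by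
  have hA := h.agree i hi
  have hA' := hA.update hQ hZ h.decOK
  obtain ⟨u1, u2, u3, u4, u5, u6⟩ := PartySt.update_fields i (w.parties i)
  have hPL := hA.ple_update hQ hZ h.decOK
  set s := (w.parties i).update i with hsdef
  set s' : PartySt P F := { s with
    dealt := s.dealt ∪ {sid | f sid ≠ none}
    voted := fun sid => if s.voted sid = none then s.newVote i sid else s.voted sid } with hs'
  set wm : World P F := { w with
      parties := Function.update w.parties i s'
      deals := fun sid => if w.deals sid = none then (f sid).map fun v => (v, w.clock.round)
        else w.deals sid
      mail := Function.update w.mail i fun tag q =>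
        if w.mail i tag q = none then (s.myShare i tag q).map fun v => (v, w.clock.round)
        else w.mail i tag q } with hwm
  have hss' : PLe s s' := { PLe.refl s with
    voted := fun sid b hb => by simp [hs', hb] }
  have hp : ∀ k, PLe (w.parties k) (wm.parties k) := by
    intro k
    by_cases hk : k = i
    · subst hk
      simp only [hwm, Function.update_self]
      exact hPL.trans hss'
    · simp only [hwm, Function.update_of_ne hk]
      exact .refl _
  have hW : WLe Zs w wm :=
    { WLe.refl Zs w with
      deals := fun sid x hx => by simp [hwm, hx]
      mail := fun j tag q x hx => by
        by_cases hj : j = i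
        · subst hj
          simp only [hwm, Function.update_self]
          rw [if_neg (by simp [hx]), hx]
        · simp only [hwm, Function.update_of_ne hj]
          exact hx
      parties := hp }
  have hG := hW.record
  have hdealer : ∀ sid v, f sid = some v → sid.dealer = i ∧ w.record.DealOK sid v := by
    intro sid v hv
    obtain ⟨x, hx, hsum⟩ := hf sid v hv
    obtain ⟨h1, h2⟩ := hA'.toDeal hx
    exact ⟨h1, h2 v hsum⟩
  have key : PreInv Zs (fun k sid => if k = i then s.newVote i sid else none) wm := by
    refine ⟨?_, ?_, ?_, ?_, h.dec, h.core, h.quorumAt, h.quorum, ?_, ?_, ?_⟩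
    · intro k hk
      by_cases hki : k = i
      · subst hki
        simp only [hwm, Function.update_self]
        exact (hA'.congr (s' := s') rfl rfl rfl rfl rfl rfl rfl rfl).mono hG
      · simp only [hwm, Function.update_of_ne hki]
        exact (h.agree k hk).mono hG
    · intro k hk
      by_cases hki : k = i
      · subst hki
        exact hi
      · simp only [hwm, Function.update_of_ne hki] at hk
        exact h.startedHonest k hk
    · intro k hk sid b hb
      obtain ⟨h1, h2, h3⟩ := h.votes k hk sid b hb
      exact ⟨(hp k).started h1, (hp k).voted _ _ h2, h3.mono hG⟩
    · intro k hk sid b hb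
      by_cases hki : k = i
      · subst hki
        simp only [hwm, Function.update_self, hs'] at hb
        split_ifs at hb with h0
        · have hpk : wm.parties k = s' := by simp only [hwm, Function.update_self]
          refine ⟨?_, (hA'.newVote hQ hZ h.dealsOK hb).2.mono hG,
            Or.inr (Or.inr (by simpa using hb))⟩
          rw [hpk]
          exact hss'.wantsA (hA'.newVote_wantsA (sid := sid) (by rwa [u1]) (by rw [hb]; simp))
        · rw [u6] at hb
          obtain ⟨h1, h2, h3⟩ := h.voted k hk sid b hb
          exact ⟨(hp k).wantsA h1, h2.mono hG, h3.imp_right fun h => Or.inl (h.resolve_right (by simp))⟩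
      · simp only [hwm, Function.update_of_ne hki] at hb ⊢
        obtain ⟨h1, h2, h3⟩ := h.voted k hk sid b hb
        exact ⟨h1, h2.mono hG, h3.imp_right fun h => Or.inl (h.resolve_right (by simp))⟩
    · intro sid d c hd
      simp only [hwm] at hd
      split_ifs at hd with h0
      · obtain ⟨v, hv, he⟩ := Option.map_eq_some_iff.1 hd
        cases he
        obtain ⟨h1, h2⟩ := hdealer sid d hv
        exact ⟨le_rfl, fun _ => ⟨h2.mono hG, by rw [h1]; exact (hp i).started hs⟩⟩
      · obtain ⟨h1, h2⟩ := h.deals sid d c hd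
        exact ⟨h1, fun hz => ⟨(h2 hz).1.mono hG, (hp _).started (h2 hz).2⟩⟩
    · intro k hk sid hsid
      by_cases hki : k = i
      · subst hki
        simp only [hwm, Function.update_self, hs'] at hsid
        rcases hsid with hsid | hsid
        · rw [u5] at hsid
          obtain ⟨h1, h2, h3⟩ := h.dealt k hk sid hsid
          exact ⟨hW.deals.ne_none h1, h2, (hp k).wantsV hA h3⟩
        · obtain ⟨v, hv⟩ := Option.ne_none_iff_exists'.1 hsid
          refine ⟨?_, (hdealer sid v hv).1, ?_⟩
          swap
          · obtain ⟨x, hx, -⟩ := hf sid v hv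
            simp only [hwm, Function.update_self]
            exact hss'.wantsV hA' (hA'.toDeal_wantsV (by rwa [u1]) hx)
          simp only [hwm]
          split_ifs with h0
          · simp [hv]
          · exact h0
      · simp only [hwm, Function.update_of_ne hki] at hsid
        obtain ⟨h1, h2, h3⟩ := h.dealt k hk sid hsid
        exact ⟨hW.deals.ne_none h1, h2, by simpa only [hwm, Function.update_of_ne hki] using h3⟩
    · intro k hk tag q v c hm
      by_cases hki : k = i
      · subst hki
        simp only [hwm, Function.update_self] at hm ⊢
        split_ifs at hm with h0
        · obtain ⟨x, hx, he⟩ := Option.map_eq_some_iff.1 hm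
          cases he
          exact ⟨le_rfl, Rec.share_mono hG (hA'.share hx).2, hA'.tag_iter (q := q) (by simp [hx])⟩
        · obtain ⟨h1, h2, h3, h4⟩ := h.mail k hk tag q v c hm
          exact ⟨h1, Rec.share_mono hG h2, h3, h4.trans hPL.iter⟩
      · simp only [hwm, Function.update_of_ne hki] at hm ⊢
        obtain ⟨h1, h2, h3⟩ := h.mail k hk tag q v c hm
        exact ⟨h1, Rec.share_mono hG h2, h3⟩
  obtain ⟨h1, h2, -⟩ := key.castVotes hQ hZ fun _ sid b hb => by
    refine ⟨(hp i).started hs, ?_⟩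
    simp only [hwm, Function.update_self, hs']
    rw [if_pos (hA'.newVote hQ hZ h.dealsOK hb).1, hb]
  have hpi : (w.acted Zs i f).parties i = s' := by
    change Function.update w.parties i s' i = s'
    rw [Function.update_self]
  refine ⟨h1, hW.trans h2, ?_, fun k hk => ?_⟩
  · refine ⟨fun rnd' x hx => ?_, fun sid hv => ?_, fun tag q hm => ?_, ?_, ?_, ?_, ?_, ?_⟩
    · have hx' : ∃ y, (x.1, y) ∈ s.toDeal i rnd := by
        rcases Agree.mem_toDeal.1 hx with ⟨b, l, rfl⟩ | h2 | h3
        · exact ⟨_, Agree.mem_toDeal.2 (Or.inl ⟨b, l, rfl⟩)⟩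
        · exact ⟨x.2, Agree.mem_toDeal.2 (Or.inr (Or.inl h2))⟩
        · exact ⟨x.2, Agree.mem_toDeal.2 (Or.inr (Or.inr h3))⟩
      obtain ⟨y, hy⟩ := hx'
      change wm.deals x.1 ≠ none
      by_cases hd : x.1 ∈ s.dealt
      · rw [u5] at hd
        exact hW.deals.ne_none (h.dealt i hi _ hd).1
      · have := hf' _ hy hd
        simp only [hwm]
        split_ifs with h0
        · simpa using this
        · exact h0
    · rw [hpi, hs']
      simp only
      split_ifs with h0
      · exact hv
      · exact h0
    · change wm.mail i tag q ≠ none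
      simp only [hwm, Function.update_self]
      split_ifs with h0
      · simpa using hm
      · exact h0
    · rw [hpi]
      exact hss'
    all_goals rw [hpi]
  · change Function.update w.parties i s' k = _
    rw [Function.update_of_ne hk]

/-- The transitions of the hybrid world: a party gets its input, the adversary acts, an honest
party is activated. -/
inductive Step [Fintype F] (B : ℕ) (Zs : Finset (Fin P.n)) : World P F → World P F → Prop
  | start {w : World P F} {i : Fin P.n} (hi : i ∉ Zs) :
      Step B Zs w (w.setParty i { w.parties i with started := True })
  | ops {w : World P F} (ops : List (Op P F)) : Step B Zs w (w.applyOps Zs ops)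
  | act {w : World P F} {i : Fin P.n} (hi : i ∉ Zs) (hs : (w.parties i).started)
      (D : Set (Item P)) {w' : World P F}
      (hw : w' ∈ (((w.forceAba B Zs).deliver B i D).actions Zs i).support) :
      Step B Zs w { w' with clock := w'.clock.tick (w'.alive Zs) i }

theorem Inv.actions [Fintype F] (h : Inv Zs w) (hQ : P.Q 4) (hZ : P.Covered Zs) {i : Fin P.n}
    (hi : i ∉ Zs) (hs : (w.parties i).started) {w' : World P F}
    (hw : w' ∈ (w.actions Zs i).support) :
    Inv Zs w' ∧ WLe Zs w w' ∧ Acted i ((w.parties i).update i) w' ∧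
      (∀ k ≠ i, w'.parties k = w.parties k) ∧ w'.clock = w.clock := by
  rw [World.actions_eq, PMF.mem_support_bind_iff] at hw
  obtain ⟨rnd, -, hw⟩ := hw
  obtain ⟨f, hf, rfl⟩ := (PMF.mem_support_map_iff _ _ _).1 hw
  obtain ⟨h1, h2⟩ := mem_support_shareAll hf
  obtain ⟨h3, h4, h5, h6⟩ := h.acted hQ hZ hi hs (rnd := rnd) (f := f) (fun sid v hv => by
    obtain ⟨x, hx, hsum⟩ := h1 sid v hv
    exact ⟨x, (List.mem_filter.1 hx).1, hsum⟩) (fun x hx hd =>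
      h2 x (List.mem_filter.2 ⟨hx, by simpa using hd⟩))
  exact ⟨h3, h4, h5, h6, rfl⟩

/-- Every step of an execution preserves the invariants, and the world only grows. -/
theorem Inv.step [Fintype F] (h : Inv Zs w) (hQ : P.Q 4) (hZ : P.Covered Zs) {B : ℕ}
    {w' : World P F} (hw : Step B Zs w w') : Inv Zs w' ∧ WLe Zs w w' := by
  cases hw with
  | start hi => exact h.start hi
  | ops ops => exact h.applyOps hQ hZ ops
  | act hi hs D hw =>
      obtain ⟨h1, h2⟩ := h.forceAba hQ hZ B
      obtain ⟨h3, h4⟩ := h1.deliver hi B D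
      obtain ⟨h5, h6, -⟩ := h3.actions hQ hZ hi ((h4.parties _).started ((h2.parties _).started hs))
        hw
      obtain ⟨h7, h8⟩ := PreInv.tick h5 (World.alive Zs _) _
      exact ⟨h7, h2.trans (h4.trans (h6.trans h8))⟩

theorem Inv.init (hQ : P.Q 4) (Zs : Finset (Fin P.n)) : Inv Zs (World.init P F) where
  agree i _ :=
    { vss := fun _ _ h => by simp [World.init, PartySt.init] at h
      aba := fun _ _ h => by simp [World.init, PartySt.init] at h
      stage := fun h => by simp [World.init, PartySt.init] at h
      opt := fun _ _ => .init
      optInit := fun _ _ _ => rfl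
      confSome := fun _ _ h => by simp [World.init, PartySt.init] at h
      confPast := fun _ h1 h2 => by simp [World.init, PartySt.init] at h2
      gd := by simp [World.init, PartySt.init, Rec.GD]
      gdDone := fun _ h => by simp [World.init, PartySt.init] at h
      out := fun _ h => by simp [World.init, PartySt.init] at h
      msgs := fun _ h => by simp [World.init, PartySt.init] at h }
  startedHonest _ h := by simp [World.init, PartySt.init] at h
  votes _ _ _ _ h := by simp [World.init] at h
  voted _ _ _ _ h := by simp [World.init, PartySt.init] at h
  dec _ _ _ h := by simp [World.init] at h
  core _ _ h := by simp [World.init] at h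
  quorumAt _ _ h := by simp [World.init] at h
  quorum sid hq := by
    obtain ⟨i, hi, -⟩ := hq.exists_honest hQ (Zs := ∅) ⟨P.z0, by simp⟩ P.z0 P.z0
    simp [World.voters, World.init] at hi
  deals _ _ _ h := by simp [World.init] at h
  dealt _ _ _ h := by simp [World.init, PartySt.init] at h
  mail _ _ _ _ _ _ h := by simp [World.init] at h

end

/-! ### Resources used by the honest parties -/

/-- The worlds that can occur in an execution. -/
def Reachable [Fintype F] (B : ℕ) (Zs : Finset (Fin P.n)) (w : World P F) : Prop :=
  Relation.ReflTransGen (Step B Zs) (World.init P F) w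

theorem Reachable.inv [Fintype F] {B : ℕ} {Zs : Finset (Fin P.n)} {w : World P F}
    (h : Reachable B Zs w) (hQ : P.Q 4) (hZ : P.Covered Zs) : Inv Zs w := by
  induction h with
  | refl => exact .init hQ Zs
  | tail _ hs ih => exact (ih.step hQ hZ hs).1

theorem reachable_respond [Fintype F] (hQ : P.Q 4) {B : ℕ} {Zs : Finset (Fin P.n)}
    (hZ : P.Covered Zs) {A : Adversary P F}
    {x : A.St × World P F} (hx : Reachable B Zs x.2) {cmd : Cmd P.n}
    {y : (A.St × World P F) × Resp (Table P F)}
    (hy : y ∈ ((realSystem B Zs A).respond x cmd).support) : Reachable B Zs y.1.2 := by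
  cases cmd with
  | input i =>
      obtain rfl := (PMF.mem_support_pure_iff _ _).1 hy
      by_cases hi : i ∈ Zs
      · simpa [hi] using hx
      · simp only [hi, if_false]
        exact hx.tail (.start hi)
  | toAdv m =>
      obtain ⟨a, -, rfl⟩ := (PMF.mem_support_map_iff _ _ _).1 hy
      exact hx.tail (.ops _)
  | activate i =>
      by_cases hi : i ∉ Zs ∧ (x.2.parties i).started
      · have he : (realSystem B Zs A).respond x (.activate i) =
          (A.onReq x.1 (x.2.view Zs) i).bind fun a =>
            ((x.2.applyOps Zs a.2.1).activate B Zs i a.2.2).map fun y => ((a.1, y.1), y.2) :=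
          if_pos hi
        rw [he] at hy
        obtain ⟨a, -, hy⟩ := (PMF.mem_support_bind_iff _ _ _).1 hy
        obtain ⟨y', hy', rfl⟩ := (PMF.mem_support_map_iff _ _ _).1 hy
        obtain ⟨w', hw', rfl⟩ := (PMF.mem_support_map_iff _ _ _).1 hy'
        refine (hx.tail (.ops a.2.1)).tail (.act hi.1 ?_ a.2.2 hw')
        exact (((hx.inv hQ hZ).applyOps hQ hZ a.2.1).2.parties i).started hi.2
      · have he : (realSystem B Zs A).respond x (.activate i) = PMF.pure (x, .nothing) :=
          if_neg hi
        rw [he] at hy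
        obtain rfl := (PMF.mem_support_pure_iff _ _).1 hy
        exact hx

theorem reachable_run [Fintype F] (hQ : P.Q 4) {B : ℕ} {Zs : Finset (Fin P.n)}
    (hZ : P.Covered Zs) {A : Adversary P F}
    {E : Env P.n (Table P F)} {k : ℕ} {c : Config E (realSystem B Zs A)}
    (hc : c ∈ (run E (realSystem B Zs A) k).support) : Reachable B Zs c.sys.2 := by
  induction k generalizing c with
  | zero =>
      simp only [run, PMF.support_pure, Set.mem_singleton_iff] at hc
      subst hc
      exact .refl
  | succ k ih =>
      simp only [run, PMF.mem_support_bind_iff] at hc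
      obtain ⟨c', hc', hc⟩ := hc
      have h' := ih hc'
      unfold runStep at hc
      split_ifs at hc with hb
      · simp only [PMF.mem_support_bind_iff] at hc
        obtain ⟨⟨e, x⟩, -, hc⟩ := hc
        cases x with
        | inl cmd =>
            simp only [PMF.mem_support_map_iff] at hc
            obtain ⟨y, hy, rfl⟩ := hc
            exact reachable_respond hQ hZ h' hy
        | inr b =>
            simp only [PMF.support_pure, Set.mem_singleton_iff] at hc
            subst hc
            exact h'
      · simp only [PMF.support_pure, Set.mem_singleton_iff] at hc
        subst hc
        exact h'

section

variable {Zs : Finset (Fin P.n)} {w : World P F} {G : Rec P F}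

/-- Each time a cheater is due to be identified, a new corrupt party is. -/
theorem Rec.le_card_GD (hD : G.DecOK Zs) (hn : 0 < P.n) {r : ℕ} (h : G.GDDone r) :
    (r - 1) / (P.t * P.n + 1) ≤ (G.GD r).card := by
  induction r with
  | zero => simp
  | succ r ih =>
      have ih := ih fun r' h1 h2 => h r' (by omega) h2
      by_cases hg : PartySt.gdIter P r
      · obtain ⟨j, hj⟩ := hD.exists_gd (h r (by omega) hg) hn
        rw [Rec.GD_succ_of_gdIter hg hj, Finset.card_insert_of_notMem (Rec.gdAt_mem hD hj).2]
        obtain ⟨h1, h2⟩ := hg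
        obtain ⟨r, rfl⟩ : ∃ r', r = r' + 1 := ⟨r - 1, by omega⟩
        rw [Nat.add_sub_cancel, Nat.succ_div, if_pos h2]
        exact Nat.succ_le_succ ih
      · rw [Rec.GD_succ_of_not hg]
        refine LE.le.trans (le_of_eq ?_) ih
        clear ih h
        rcases r with _ | r
        · rfl
        · rw [Nat.add_sub_cancel, Nat.succ_div, if_neg fun h2 => hg ⟨by omega, h2⟩]
          rfl

/-- At most `t` parties can be identified, one in every `t * n + 1` iterations; as `t < n`, there are
at most `n ^ 3` iterations. -/
theorem Rec.GDDone.le (hQ : P.Q 4) (hZ : P.Covered Zs) (hD : G.DecOK Zs) {r : ℕ}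
    (h : G.GDDone r) : r ≤ P.n ^ 3 := by
  have ht := Params.t_lt hQ
  have h1 := Rec.le_card_GD hD (by omega) h
  have h2 := (Finset.card_le_card (Rec.GD_subset hD r)).trans hZ.card_le
  have h3 : (r - 1) / (P.t * P.n + 1) < P.t + 1 := by omega
  rw [Nat.div_lt_iff_lt_mul (by omega)] at h3
  have h4 : P.t + 1 ≤ P.n := ht
  have h5 : P.t * P.n + 1 ≤ P.n * P.n := by nlinarith
  calc r ≤ (P.t + 1) * (P.t * P.n + 1) := by omega
    _ ≤ P.n * (P.n * P.n) := Nat.mul_le_mul h4 h5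
    _ = P.n ^ 3 := by ring

theorem Inv.iter_le (h : Inv Zs w) (hQ : P.Q 4) (hZ : P.Covered Zs) {i : Fin P.n}
    (hi : i ∉ Zs) : (w.parties i).iter ≤ P.n ^ 3 :=
  (h.agree i hi).gdDone.le hQ hZ h.decOK

theorem Inv.wants_hop (h : Inv Zs w) (hQ : P.Q 4) (hZ : P.Covered Zs) {i : Fin P.n}
    (hi : i ∉ Zs) {r hop : ℕ} {z : Fin P.h} (h1 : 1 ≤ r ∧ r ≤ (w.parties i).iter ∧ 1 ≤ hop ∧
      (hop < ((w.parties i).opt r z).hop ∨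
        hop = ((w.parties i).opt r z).hop ∧ ((w.parties i).opt r z).rem.Nonempty)) :
    r ∈ Finset.Icc 1 (P.n ^ 3) ∧ hop ∈ Finset.Icc 1 P.n := by
  have h2 := h.iter_le hQ hZ hi
  have h3 := ((h.agree i hi).opt r z).hop_le
  rw [Finset.mem_Icc, Finset.mem_Icc]
  refine ⟨by omega, h1.2.2.1, ?_⟩
  rcases h1.2.2.2 with h4 | ⟨h4, h5⟩
  · omega
  · rw [h4]
    exact ((h.agree i hi).opt r z).hop_le_of_rem_nonempty hQ h5

theorem finite_ncard_le {α : Type} {S : Set α} {T : Finset α} {m : ℕ} (h : S ⊆ T)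
    (hm : T.card ≤ m) : S.Finite ∧ S.ncard ≤ m :=
  ⟨T.finite_toSet.subset h,
    (Set.ncard_le_ncard h T.finite_toSet).trans (by rwa [Set.ncard_coe_finset])⟩

theorem Inv.vssCalls (h : Inv Zs w) (hQ : P.Q 4) (hZ : P.Covered Zs) :
    (w.vssCalls Zs).Finite ∧ (w.vssCalls Zs).ncard ≤ 4 * (P.M * P.h * P.n ^ 5) := by
  have hn : 0 < P.n := by have := Params.t_lt hQ; omega
  have hh : 0 < P.h := P.z0.pos
  set T1 : Finset (VSid P) := Finset.univ.image
    fun x : Fin P.n × Bool × Fin P.M => .input x.1 x.2.1 x.2.2 with hT1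
  set T2 : Finset (VSid P) := (Finset.Icc 1 (P.n ^ 3) ×ˢ (Finset.univ : Finset (Fin P.h)) ×ˢ
    Finset.Icc 1 P.n ×ˢ (Finset.univ : Finset (Fin P.n × Fin P.M))).image
      fun x => .summ x.1 x.2.1 x.2.2.1 x.2.2.2.1 x.2.2.2.2 with hT2
  set T3 : Finset (VSid P) := (Finset.Icc 1 (P.n ^ 3) ×ˢ
    (Finset.univ : Finset (Fin P.h × Fin P.n × Fin P.n × Fin P.M))).image
      fun x => .part x.1 x.2.1 x.2.2.1 x.2.2.2.1 with hT3
  refine finite_ncard_le (T := T1 ∪ T2 ∪ T3) ?_ ?_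
  · rintro sid ⟨i, hi, hw⟩
    have hw : (w.parties i).wantsV sid :=
      hw.elim id fun hd => (h.dealt i hi sid hd).2.2
    rw [Finset.mem_coe, Finset.mem_union, Finset.mem_union]
    cases sid with
    | input j b l => exact Or.inl (Or.inl (Finset.mem_image.2 ⟨(j, b, l), by simp, rfl⟩))
    | summ r z hop j l =>
        obtain ⟨h1, h2⟩ := h.wants_hop hQ hZ hi hw
        exact Or.inl (Or.inr (Finset.mem_image.2 ⟨(r, z, hop, j, l), by
          simp only [Finset.mem_product, Finset.mem_univ, and_true, true_and]
          exact ⟨h1, h2⟩, rfl⟩))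
    | part r z j k =>
        obtain ⟨zc, l, hc, -⟩ := hw
        obtain ⟨h1, h2, -⟩ := (h.agree i hi).confSome _ _ hc
        have h3 := h.iter_le hQ hZ hi
        -- a conflicting pair only exists if there are pairs at all
        exact Or.inr (Finset.mem_image.2 ⟨(r, z, j, k, l), by
          simp only [Finset.mem_product, Finset.mem_univ, and_true, Finset.mem_Icc]
          omega, rfl⟩)
  · have c1 : T1.card ≤ P.n * (2 * P.M) := by
      refine Finset.card_image_le.trans (le_of_eq ?_)
      simp
    have c2 : T2.card ≤ P.n ^ 3 * (P.h * (P.n * (P.n * P.M))) := by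
      refine Finset.card_image_le.trans (le_of_eq ?_)
      simp [Finset.card_product]
    have c3 : T3.card ≤ P.n ^ 3 * (P.h * (P.n * (P.n * P.M))) := by
      refine Finset.card_image_le.trans (le_of_eq ?_)
      simp [Finset.card_product]
    have c4 : P.n * (2 * P.M) ≤ 2 * (P.M * P.h * P.n ^ 5) := by
      calc P.n * (2 * P.M) = 2 * (P.M * 1 * P.n) := by ring
        _ ≤ 2 * (P.M * P.h * P.n ^ 5) := by
            gcongr
            · exact hh
            · exact Nat.le_self_pow (by norm_num) _
    have := Finset.card_union_le (T1 ∪ T2) T3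
    have := Finset.card_union_le T1 T2
    have e : P.n ^ 3 * (P.h * (P.n * (P.n * P.M))) = P.M * P.h * P.n ^ 5 := by ring
    omega

theorem Inv.abaCalls (h : Inv Zs w) (hQ : P.Q 4) (hZ : P.Covered Zs) :
    (w.abaCalls Zs).Finite ∧ (w.abaCalls Zs).ncard ≤ 3 * (P.h * P.n ^ 5) := by
  have hn : 0 < P.n := by have := Params.t_lt hQ; omega
  have hh : 0 < P.h := P.z0.pos
  set T1 : Finset (ASid P) := Finset.univ.image fun x : Fin P.n => .acs x with hT1
  set T2 : Finset (ASid P) := (Finset.Icc 1 (P.n ^ 3) ×ˢ (Finset.univ : Finset (Fin P.h)) ×ˢ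
    Finset.Icc 1 P.n ×ˢ (Finset.univ : Finset (Fin P.n))).image
      fun x => .sel x.1 x.2.1 x.2.2.1 x.2.2.2 with hT2
  set T3 : Finset (ASid P) := (Finset.Icc 1 (P.n ^ 3) ×ˢ
    (Finset.univ : Finset (Fin P.n))).image fun x => .gd x.1 x.2 with hT3
  refine finite_ncard_le (T := T1 ∪ T2 ∪ T3) ?_ ?_
  · rintro sid ⟨i, hi, hw⟩
    have hw : (w.parties i).wantsA sid := hw.elim id fun hd => by
      obtain ⟨b, hb⟩ := Option.ne_none_iff_exists'.1 hd
      exact (h.voted i hi sid b hb).1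
    rw [Finset.mem_coe, Finset.mem_union, Finset.mem_union]
    cases sid with
    | acs j => exact Or.inl (Or.inl (Finset.mem_image.2 ⟨j, by simp, rfl⟩))
    | sel r z hop j =>
        obtain ⟨h1, h2⟩ := h.wants_hop hQ hZ hi hw
        exact Or.inl (Or.inr (Finset.mem_image.2 ⟨(r, z, hop, j), by
          simp only [Finset.mem_product, Finset.mem_univ, and_true, true_and]
          exact ⟨h1, h2⟩, rfl⟩))
    | gd r j =>
        obtain ⟨h1, h2, -⟩ := (h.agree i hi).one_le_of_conf hw.1
        have h3 := h.iter_le hQ hZ hi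
        exact Or.inr (Finset.mem_image.2 ⟨(r, j), by
          simp only [Finset.mem_product, Finset.mem_univ, and_true, Finset.mem_Icc]
          omega, rfl⟩)
  · have c1 : T1.card ≤ P.n := by
      refine Finset.card_image_le.trans (le_of_eq ?_)
      simp
    have c2 : T2.card ≤ P.n ^ 3 * (P.h * (P.n * P.n)) := by
      refine Finset.card_image_le.trans (le_of_eq ?_)
      simp [Finset.card_product]
    have c3 : T3.card ≤ P.n ^ 3 * P.n := by
      refine Finset.card_image_le.trans (le_of_eq ?_)
      simp [Finset.card_product]
    have c4 : P.n ≤ P.h * P.n ^ 5 := by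
      calc P.n = 1 * P.n := by ring
        _ ≤ P.h * P.n ^ 5 := by
            gcongr
            · exact hh
            · exact Nat.le_self_pow (by norm_num) _
    have c5 : P.n ^ 3 * P.n ≤ P.h * P.n ^ 5 := by
      calc P.n ^ 3 * P.n = 1 * P.n ^ 4 := by ring
        _ ≤ P.h * P.n ^ 5 := by
            exact Nat.mul_le_mul hh (Nat.pow_le_pow_right hn (by norm_num))
    have := Finset.card_union_le (T1 ∪ T2) T3
    have := Finset.card_union_le T1 T2
    have e : P.n ^ 3 * (P.h * (P.n * P.n)) = P.h * P.n ^ 5 := by ring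
    omega

theorem Inv.sentMsgs (h : Inv Zs w) (hQ : P.Q 4) (hZ : P.Covered Zs) :
    (w.sentMsgs Zs).Finite ∧
      (w.sentMsgs Zs).ncard ≤ P.M * P.h ^ 2 * P.n ^ 5 + 7 * (P.h * P.n ^ 7) := by
  have hn : 0 < P.n := by have := Params.t_lt hQ; omega
  set zs : ℕ → Bool → Fin P.h := fun r b =>
    if b then ((w.record.conf r).map Prod.fst).getD P.z0 else P.z0 with hzs
  have hzs' : ∀ r zc l z, w.record.conf r = some (zc, l) → z = zc ∨ z = P.z0 →
      ∃ b, zs r b = z := by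
    rintro r zc l z hc (rfl | rfl)
    · exact ⟨true, by simp [hzs, hc]⟩
    · exact ⟨false, by simp [hzs]⟩
  set I : Finset ℕ := Finset.Icc 1 (P.n ^ 3) with hI
  set T1 : Finset (Fin P.n × Fin P.n × RTag P × Fin P.h) := (I ×ˢ
    (Finset.univ : Finset (Fin P.n × Fin P.n × Fin P.h × Fin P.M × Fin P.h))).image
      fun x => (x.2.1, x.2.2.1, .diff x.1 x.2.2.2.1 x.2.2.2.2.1, x.2.2.2.2.2) with hT1
  set T2 : Finset (Fin P.n × Fin P.n × RTag P × Fin P.h) := (I ×ˢ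
    (Finset.univ : Finset (Fin P.n × Fin P.n × Bool × Fin P.n × Fin P.h))).image
      fun x => (x.2.1, x.2.2.1, .sumCheck x.1 (zs x.1 x.2.2.2.1) x.2.2.2.2.1, x.2.2.2.2.2) with hT2
  set T3 : Finset (Fin P.n × Fin P.n × RTag P × Fin P.h) := (I ×ˢ
    (Finset.univ : Finset (Fin P.n × Fin P.n × Fin P.n × Fin P.n × Fin P.h))).image
      fun x => (x.2.1, x.2.2.1, .pairDiff x.1 x.2.2.2.1 x.2.2.2.2.1, x.2.2.2.2.2) with hT3
  set T4 : Finset (Fin P.n × Fin P.n × RTag P × Fin P.h) := (I ×ˢ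
    (Finset.univ : Finset (Fin P.n × Fin P.n × Bool × Fin P.n × Fin P.n × Fin P.h))).image
      fun x => (x.2.1, x.2.2.1, .part x.1 (zs x.1 x.2.2.2.1) x.2.2.2.2.1 x.2.2.2.2.2.1,
        x.2.2.2.2.2.2) with hT4
  set T5 : Finset (Fin P.n × Fin P.n × RTag P × Fin P.h) := (I ×ˢ
    (Finset.univ : Finset (Fin P.n × Fin P.n × Bool × Fin P.n × Fin P.n × Fin P.h))).image
      fun x => (x.2.1, x.2.2.1, .inp x.1 x.2.2.2.2.1 x.2.2.2.2.2.1 x.2.2.2.1,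
        x.2.2.2.2.2.2) with hT5
  refine finite_ncard_le (T := T1 ∪ T2 ∪ T3 ∪ T4 ∪ T5) ?_ ?_
  · rintro ⟨i, i', tag, q⟩ ⟨hi, -, hm⟩
    obtain ⟨⟨v, c⟩, hm⟩ := Option.ne_none_iff_exists'.1 hm
    obtain ⟨-, h1, h2, h3⟩ := h.mail i hi tag q v c hm
    have h4 := h.iter_le hQ hZ hi
    have hr : tag.iter ∈ I := Finset.mem_Icc.2 ⟨h2, h3.trans h4⟩
    simp only [Finset.mem_coe, Finset.mem_union]
    cases tag with
    | diff r z l =>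
        refine Or.inl (Or.inl (Or.inl (Or.inl (Finset.mem_image.2 ⟨(r, i, i', z, l, q), ?_, rfl⟩))))
        simpa [RTag.iter] using hr
    | sumCheck r z j =>
        obtain ⟨zc, l, hc, hz, -⟩ := Rec.share_sumCheck h1
        obtain ⟨b, hb⟩ := hzs' r zc l z hc hz
        refine Or.inl (Or.inl (Or.inl (Or.inr (Finset.mem_image.2 ⟨(r, i, i', b, j, q), ?_, ?_⟩))))
        · simpa [RTag.iter] using hr
        · simp only [hb]
    | pairDiff r j k =>
        refine Or.inl (Or.inl (Or.inr (Finset.mem_image.2 ⟨(r, i, i', j, k, q), ?_, rfl⟩)))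
        simpa [RTag.iter] using hr
    | part r z j k =>
        simp only [Rec.share] at h1
        cases hc : w.record.conf r with
        | none => simp [hc] at h1
        | some p =>
            obtain ⟨zc, l⟩ := p
            simp only [hc] at h1
            obtain ⟨⟨hd, -⟩, -⟩ := Option.ite_none_right_eq_some.1 h1
            obtain ⟨b, hb⟩ := hzs' r zc l z hc (hd.imp (fun h => h.1) fun h => h.1)
            refine Or.inl (Or.inr (Finset.mem_image.2 ⟨(r, i, i', b, j, k, q), ?_, ?_⟩))
            · simpa [RTag.iter] using hr
            · simp only [hb]
    | inp r j k b =>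
        refine Or.inr (Finset.mem_image.2 ⟨(r, i, i', b, j, k, q), ?_, rfl⟩)
        simpa [RTag.iter] using hr
  · have c1 : T1.card ≤ P.M * P.h ^ 2 * P.n ^ 5 := by
      refine Finset.card_image_le.trans (le_of_eq ?_)
      simp [Finset.card_product, hI]
      ring
    have c2 : T2.card ≤ 2 * (P.h * P.n ^ 6) := by
      refine Finset.card_image_le.trans (le_of_eq ?_)
      simp [Finset.card_product, hI]
      ring
    have c3 : T3.card ≤ P.h * P.n ^ 7 := by
      refine Finset.card_image_le.trans (le_of_eq ?_)
      simp [Finset.card_product, hI]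
      ring
    have c4 : T4.card ≤ 2 * (P.h * P.n ^ 7) := by
      refine Finset.card_image_le.trans (le_of_eq ?_)
      simp [Finset.card_product, hI]
      ring
    have c5 : T5.card ≤ 2 * (P.h * P.n ^ 7) := by
      refine Finset.card_image_le.trans (le_of_eq ?_)
      simp [Finset.card_product, hI]
      ring
    have c6 : P.h * P.n ^ 6 ≤ P.h * P.n ^ 7 := by
      exact Nat.mul_le_mul_left _ (Nat.pow_le_pow_right hn (by norm_num))
    have := Finset.card_union_le (T1 ∪ T2 ∪ T3 ∪ T4) T5
    have := Finset.card_union_le (T1 ∪ T2 ∪ T3) T4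
    have := Finset.card_union_le (T1 ∪ T2) T3
    have := Finset.card_union_le T1 T2
    omega

/-- A field element is encoded in at most `2 * log |F|` bits. -/
theorem clog_le_two_mul_logb {m : ℕ} (hm : 2 ≤ m) : (Nat.clog 2 m : ℝ) ≤ 2 * Real.logb 2 m := by
  have h1 : (Nat.clog 2 m : ℝ) ≤ Nat.log 2 m + 1 := by
    exact_mod_cast Nat.clog_le_of_le_pow (Nat.lt_pow_succ_log_self one_lt_two m).le
  have h2 : (Nat.log 2 m : ℝ) ≤ Real.logb 2 m := by
    have := Real.natLog_le_logb m 2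
    exact_mod_cast this
  have h3 : (1 : ℝ) ≤ Real.logb 2 m := by
    rw [Real.le_logb_iff_rpow_le (by norm_num) (by positivity)]
    simpa using (by exact_mod_cast hm : (2 : ℝ) ≤ m)
  linarith

end

/-- The complexity bounds. -/
theorem complexity [Fintype F] (hQ : P.Q 4) {B : ℕ} {Zs : Finset (Fin P.n)} (hZ : P.Covered Zs)
    {C : ℕ} (hC : 14 ≤ C) {w : World P F} (hw : Reachable B Zs w) :
    ((w.vssCalls Zs).Finite ∧ (w.vssCalls Zs).ncard ≤ C * (P.M * P.h * P.n ^ 5)) ∧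
      ((w.abaCalls Zs).Finite ∧ (w.abaCalls Zs).ncard ≤ C * (P.h * P.n ^ 5)) ∧
      ((w.sentMsgs Zs).Finite ∧
        (((w.sentMsgs Zs).ncard * Nat.clog 2 (Fintype.card F) : ℕ) : ℝ) ≤
          C * (P.M * P.h ^ 2 * P.n ^ 5 * Real.logb 2 (Fintype.card F) +
            P.h * P.n ^ 7 * Real.logb 2 (Fintype.card F))) := by
  have h := hw.inv hQ hZ
  obtain ⟨a1, a2⟩ := h.vssCalls hQ hZ
  obtain ⟨b1, b2⟩ := h.abaCalls hQ hZ
  obtain ⟨c1, c2⟩ := h.sentMsgs hQ hZ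
  refine ⟨⟨a1, a2.trans (Nat.mul_le_mul_right _ (by omega))⟩,
    ⟨b1, b2.trans (Nat.mul_le_mul_right _ (by omega))⟩, c1, ?_⟩
  have hF : 2 ≤ Fintype.card F := Fintype.one_lt_card
  have hl := clog_le_two_mul_logb hF
  have hl0 : (0 : ℝ) ≤ Nat.clog 2 (Fintype.card F) := by positivity
  have c3 : ((w.sentMsgs Zs).ncard : ℝ) ≤ P.M * P.h ^ 2 * P.n ^ 5 + 7 * (P.h * P.n ^ 7) := by
    exact_mod_cast c2
  have hC' : (14 : ℝ) ≤ C := by exact_mod_cast hC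
  have hx : (0 : ℝ) ≤ P.M * P.h ^ 2 * P.n ^ 5 := by positivity
  have hy : (0 : ℝ) ≤ P.h * P.n ^ 7 := by positivity
  push_cast
  set L := Real.logb 2 (Fintype.card F)
  have hL : 0 ≤ L := by linarith
  calc ((w.sentMsgs Zs).ncard : ℝ) * Nat.clog 2 (Fintype.card F)
      ≤ (P.M * P.h ^ 2 * P.n ^ 5 + 7 * (P.h * P.n ^ 7)) * (2 * L) :=
        mul_le_mul c3 hl hl0 (by positivity)
    _ ≤ 14 * (P.M * P.h ^ 2 * P.n ^ 5 * L + P.h * P.n ^ 7 * L) := by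
        nlinarith [mul_nonneg hx hL]
    _ ≤ C * (P.M * P.h ^ 2 * P.n ^ 5 * L + P.h * P.n ^ 7 * L) :=
        mul_le_mul_of_nonneg_right hC' (by positivity)

/-! ### Rounds and activations -/

/-- The honest party `i` is activated. -/
def ActStep [Fintype F] (B : ℕ) (Zs : Finset (Fin P.n)) (i : Fin P.n) (w w'' : World P F) : Prop :=
  i ∉ Zs ∧ (w.parties i).started ∧ ∃ D, ∃ w' ∈ (((w.forceAba B Zs).deliver B i D).actions Zs i).support,
    w'' = { w' with clock := w'.clock.tick (w'.alive Zs) i }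

/-- Executions in which the set of honest parties that have their input is constantly `A`. -/
def Path [Fintype F] (B : ℕ) (Zs A : Finset (Fin P.n)) : World P F → World P F → Prop :=
  Relation.ReflTransGen fun w w' => Step B Zs w w' ∧ w.alive Zs = A ∧ w'.alive Zs = A

section

variable [Fintype F] {B : ℕ} {Zs A : Finset (Fin P.n)} {w w' : World P F}

theorem World.applyOps_clock (Zs : Finset (Fin P.n)) (w : World P F) (ops : List (Op P F)) :
    (w.applyOps Zs ops).clock = w.clock := by
  unfold World.applyOps
  induction ops generalizing w with
  | nil => rfl
  | cons op ops ih =>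
      rw [List.foldl_cons, ih]
      cases op <;> simp only [World.applyOp] <;> split_ifs <;> rfl

theorem World.actions_clock {i : Fin P.n} (hw : w' ∈ (w.actions Zs i).support) :
    w'.clock = w.clock := by
  rw [World.actions_eq, PMF.mem_support_bind_iff] at hw
  obtain ⟨rnd, -, hw⟩ := hw
  obtain ⟨f, hf, rfl⟩ := (PMF.mem_support_map_iff _ _ _).1 hw
  rfl

/-- A transition is an activation or does not change the clock. -/
theorem Step.clock (h : Step B Zs w w') : w'.clock = w.clock ∨
    ∃ i, ActStep B Zs i w w' ∧ w'.clock = w.clock.tick (w'.alive Zs) i := by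
  cases h with
  | start hi => exact Or.inl rfl
  | ops ops => exact Or.inl (w.applyOps_clock Zs ops)
  | @act i hi hs D w1 hw =>
      refine Or.inr ⟨i, ⟨hi, hs, D, w1, hw, rfl⟩, ?_⟩
      have := World.actions_clock hw
      simp only
      rw [this]
      rfl

theorem Clock.tick_round {n : ℕ} (c : Clock n) (A : Finset (Fin n)) (i : Fin n) :
    (c.tick A i).round ≤ c.round + 1 := by
  unfold Clock.tick
  split_ifs <;> simp

theorem Step.round_le (h : Step B Zs w w') : w'.clock.round ≤ w.clock.round + 1 := by
  rcases h.clock with h | ⟨i, -, h⟩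
  · rw [h]
    omega
  · rw [h]
    exact Clock.tick_round _ _ _

theorem Path.le (h : Path B Zs A w w') (hi : Inv Zs w) (hQ : P.Q 4) (hZ : P.Covered Zs) :
    Inv Zs w' ∧ WLe Zs w w' := by
  induction h with
  | refl => exact ⟨hi, .refl _ _⟩
  | tail _ hs ih =>
      obtain ⟨h1, h2⟩ := ih.1.step hQ hZ hs.1
      exact ⟨h1, ih.2.trans h2⟩

theorem Path.alive (h : Path B Zs A w w') (hA : w.alive Zs = A) : w'.alive Zs = A := by
  induction h with
  | refl => exact hA
  | tail _ hs _ => exact hs.2.2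

theorem Path.exists_round (h : Path B Zs A w w') {t : ℕ} (h1 : w.clock.round ≤ t) (h2 : t ≤ w'.clock.round) :
    ∃ v, Path B Zs A w v ∧ Path B Zs A v w' ∧ v.clock.round = t := by
  induction h with
  | refl => exact ⟨w, .refl, .refl, le_antisymm h1 h2⟩
  | @tail b c hp hs ih =>
      have := hs.1.round_le
      rcases Nat.lt_or_ge b.clock.round t with hb | hb
      · exact ⟨c, hp.tail hs, .refl, by omega⟩
      · obtain ⟨v, h3, h4, h5⟩ := ih hb
        exact ⟨v, h3, h4.tail hs, h5⟩

/-- Party `i` is activated in the course of an execution. -/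
def Did (B : ℕ) (Zs A : Finset (Fin P.n)) (i : Fin P.n) (w w' : World P F) : Prop :=
  ∃ v v', Path B Zs A w v ∧ ActStep B Zs i v v' ∧ Path B Zs A v v' ∧ Path B Zs A v' w'

theorem Did.tail {i : Fin P.n} {w'' : World P F} (h : Did B Zs A i w w')
    (hs : Path B Zs A w' w'') : Did B Zs A i w w'' := by
  obtain ⟨v, v', h1, h2, h3, h4⟩ := h
  exact ⟨v, v', h1, h2, h3, h4.trans hs⟩

/-- In each completed round every party has been activated. -/
theorem Path.did_aux (h : Path B Zs A w w') :
    (w'.clock.round = w.clock.round ∧ ∀ i ∈ w'.clock.act, i ∈ w.clock.act ∨ Did B Zs A i w w') ∨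
    (w'.clock.round = w.clock.round + 1 ∧ ∀ i ∈ w'.clock.act, Did B Zs A i w w') ∨
    (w.clock.round + 2 ≤ w'.clock.round ∧ ∀ i ∈ A, Did B Zs A i w w') := by
  induction h with
  | refl => exact Or.inl ⟨rfl, fun i hi => Or.inl hi⟩
  | @tail b c hp hs ih =>
      have hbc : Path B Zs A b c := .single hs
      rcases hs.1.clock with hc | ⟨j, hj, hc⟩
      · rw [hc]
        exact ih.imp (fun h => ⟨h.1, fun i hi => (h.2 i hi).imp_right fun h => h.tail hbc⟩)
          (Or.imp (fun h => ⟨h.1, fun i hi => (h.2 i hi).tail hbc⟩)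
            fun h => ⟨h.1, fun i hi => (h.2 i hi).tail hbc⟩)
      · have hd : Did B Zs A j w c := ⟨b, c, hp, hj, hbc, .refl⟩
        rw [hs.2.2] at hc
        rw [hc]
        unfold Clock.tick
        split_ifs with hA
        · rcases ih with ⟨h1, h2⟩ | ⟨h1, h2⟩ | ⟨h1, h2⟩
          · refine Or.inr (Or.inl ⟨by simp only; omega, fun i hi => ?_⟩)
            simp at hi
          · refine Or.inr (Or.inr ⟨by simp only; omega, fun i hi => ?_⟩)
            rcases Finset.mem_insert.1 (hA hi) with rfl | hi
            · exact hd
            · exact (h2 i hi).tail hbc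
          · exact Or.inr (Or.inr ⟨by simp only; omega, fun i hi => (h2 i hi).tail hbc⟩)
        · rcases ih with ⟨h1, h2⟩ | ⟨h1, h2⟩ | ⟨h1, h2⟩
          · refine Or.inl ⟨h1, fun i hi => ?_⟩
            rcases Finset.mem_insert.1 hi with rfl | hi
            · exact Or.inr hd
            · exact (h2 i hi).imp_right fun h => h.tail hbc
          · refine Or.inr (Or.inl ⟨h1, fun i hi => ?_⟩)
            rcases Finset.mem_insert.1 hi with rfl | hi
            · exact hd
            · exact (h2 i hi).tail hbc
          · exact Or.inr (Or.inr ⟨h1, fun i hi => (h2 i hi).tail hbc⟩)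

/-- Of two round ends, the second one completes a round that lies entirely in the path. -/
theorem Path.did (h : Path B Zs A w w') (hr : w.clock.round + 2 ≤ w'.clock.round) {i : Fin P.n}
    (hi : i ∈ A) : Did B Zs A i w w' := by
  rcases h.did_aux with ⟨h1, -⟩ | ⟨h1, -⟩ | ⟨-, h1⟩
  · omega
  · omega
  · exact h1 i hi

/-- The part of a local state that determines what the party is to do next. -/
structure SameCtl (s s' : PartySt P F) : Prop where
  iter : s'.iter = s.iter
  opt : s'.opt = s.opt
  conf : s'.conf = s.conf
  out : s'.out = s.out

/-- Between two states with the same control all states have the same control. -/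
theorem PLe.sandwich {s s' s'' : PartySt P F} (h : PLe s s') (h' : PLe s' s'')
    (hc : SameCtl s s'') : SameCtl s s' where
  iter := le_antisymm (h'.iter.trans hc.iter.le) h.iter
  opt := by
    funext r z
    rcases h.hop r z with h1 | h1
    · have := h'.hop_le r z
      rw [hc.opt] at this
      omega
    · exact h1
  conf := by
    funext r
    cases h1 : s'.conf r with
    | none =>
        by_contra hn
        exact h.conf.ne_none (fun h2 => hn h2.symm) h1
    | some p =>
        have := h'.conf _ _ h1
        rw [hc.conf] at this
        exact this.symm
  out := by
    by_cases h1 : s'.out = none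
    · by_contra hn
      have h2 : s.out ≠ none := fun h2 => hn (h1.trans h2.symm)
      rw [(h.out h2).1] at h1
      exact h2 h1
    · rw [← (h'.out h1).1, hc.out]

namespace SameCtl

variable {s s' s'' : PartySt P F}

theorem symm (h : SameCtl s s') : SameCtl s' s :=
  ⟨h.iter.symm, h.opt.symm, h.conf.symm, h.out.symm⟩

theorem trans (h : SameCtl s s') (h' : SameCtl s' s'') : SameCtl s s'' :=
  ⟨h'.iter.trans h.iter, h'.opt.trans h.opt, h'.conf.trans h.conf, h'.out.trans h.out⟩

theorem partDue (h : SameCtl s s') : s'.partDue = s.partDue := by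
  funext r zc z j k
  simp [PartySt.partDue, PartySt.Sel, h.opt]

end SameCtl

/-- A party whose control is not changed by its local computation is waiting. -/
theorem Agree.quiet {G : Rec P F} {i : Fin P.n} {s : PartySt P F} (h : Agree Zs G i s)
    (hQ : P.Q 4) (hZ : P.Covered Zs) (hD : G.DecOK Zs) (hc : SameCtl s (s.update i)) :
    s.stepStage = s ∧ (∀ z, s.hopEnd z = s.opt s.iter z) ∧ s.stepCheck i = s ∧ s.stepNext = s := by
  have a1 := h.stepStage
  have a2 := a1.stepHop hD
  have a3 := a2.stepCheck hQ hZ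
  have p1 := Agree.ple_stepStage s h.one_le_of_out
  have p2 := Agree.ple_stepHop s.stepStage
  have p3 := a2.ple_stepCheck hQ hZ
  have p4 := a3.ple_stepNext hD
  have e1 : s.stepStage = s := by
    have := p1.sandwich (p2.trans (p3.trans p4)) hc
    rcases Agree.stepStage_eq s with he | ⟨h0, -, -, he⟩
    · exact he
    · have := this.iter
      rw [he] at this
      simp only at this
      omega
  rw [e1] at a1 a2 a3 p2 p3 p4
  have c2 := p2.sandwich (p3.trans p4) (by unfold PartySt.update at hc; rwa [e1] at hc)
  have e2' : ∀ z, s.hopEnd z = s.opt s.iter z := fun z => by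
    have := congrFun (congrFun c2.opt s.iter) z
    simpa [PartySt.stepHop] using this
  have e2 : s.stepHop = s := by
    have : s.hopEnd = s.opt s.iter := funext e2'
    simp [PartySt.stepHop, this]
  rw [e2] at a2 a3 p3 p4
  have c3 := p3.sandwich p4 (by unfold PartySt.update at hc; rwa [e1, e2] at hc)
  have e3 : s.stepCheck i = s := by
    rcases h.stepCheck_eq hQ hZ with he | ⟨h1, h2, h3, h4, h5, ⟨h6, he⟩ | ⟨h6, he⟩⟩
    · exact he
    · have := c3.out
      rw [he, h2] at this
      simp at this
    · have := congrFun c3.conf s.iter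
      rw [he, h3] at this
      simp only [Function.update_self] at this
      exact absurd this h6
  refine ⟨e1, e2', e3, ?_⟩
  rw [e3] at a3 p4
  have hc4 : s.stepNext.iter = s.iter := by
    have := hc.iter
    unfold PartySt.update at this
    rwa [e1, e2, e3] at this
  rcases h.stepNext_eq hD with he | ⟨hn, ⟨hg, he⟩ | ⟨hg, ha, j, hj, he⟩⟩
  · exact he
  all_goals
    rw [he] at hc4
    simp at hc4

theorem Agree.quiet_update {G : Rec P F} {i : Fin P.n} {s : PartySt P F} (h : Agree Zs G i s)
    (hQ : P.Q 4) (hZ : P.Covered Zs) (hD : G.DecOK Zs) (hc : SameCtl s (s.update i)) :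
    s.update i = s := by
  obtain ⟨h1, h2, h3, h4⟩ := h.quiet hQ hZ hD hc
  have : s.hopEnd = s.opt s.iter := funext h2
  have e2 : s.stepHop = s := by simp [PartySt.stepHop, this]
  rw [PartySt.update, h1, e2, h3, h4]

/-- An activation of party `i` in which it only receives and sends; `s` is its state after the
deliveries. -/
structure Activation (B : ℕ) (Zs : Finset (Fin P.n)) (i : Fin P.n) (v : World P F)
    (s : PartySt P F) (v' : World P F) : Prop where
  ple : PLe (v.parties i) s
  same : SameCtl (v.parties i) s
  agree : Agree Zs v'.record i s
  quiet : s.stepStage = s ∧ (∀ z, s.hopEnd z = s.opt s.iter z) ∧ s.stepCheck i = s ∧ s.stepNext = s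
  acted : Acted i s v'
  vss : ∀ sid d c, (v.parties i).wantsV sid → v.deals sid = some (d, c) → v.overdue B c → s.got sid
  aba : ∀ sid b c, (v.parties i).wantsA sid → v.dec sid = some (b, c) → v.overdue B c →
    s.aba sid ≠ none
  dec : ∀ sid c, v.quorumAt sid = some c → v.overdue B c → v'.dec sid ≠ none
  msgs : ∀ j tag q x c, i ∉ P.S q → v.mail j tag q = some (x, c) → v.overdue B c →
    (j, tag, q, x) ∈ s.msgs

theorem World.forceAba_dec {w : World P F} {sid : ASid P} {c : ℕ} (hq : w.quorumAt sid = some c)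
    (hc : w.overdue B c) : (w.forceAba B Zs).dec sid ≠ none := by
  simp only [World.forceAba, World.decideAba]
  cases hd : w.dec sid with
  | some x => simp
  | none =>
      simp only [true_and]
      rw [if_pos ⟨c, hq, hc⟩]
      simp only
      rw [if_pos]
      · simp
      · intro j hj
        simpa [World.voters] using hj

theorem ActStep.activation {i : Fin P.n} (h : ActStep B Zs i w w') (hi : Inv Zs w) (hQ : P.Q 4)
    (hZ : P.Covered Zs) (hc : SameCtl (w.parties i) (w'.parties i)) :
    ∃ s, Activation B Zs i w s w' := by
  obtain ⟨hiZ, hs, D, w1, hw1, rfl⟩ := h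
  obtain ⟨f1, f2⟩ := hi.forceAba hQ hZ B
  obtain ⟨d1, d2⟩ := f1.deliver hiZ B D
  set wd := (w.forceAba B Zs).deliver B i D with hwd
  obtain ⟨a1, a2, a3, a4, a5⟩ := d1.actions hQ hZ hiZ
    ((d2.parties i).started ((f2.parties i).started hs)) hw1
  obtain ⟨t1, t2⟩ := PreInv.tick a1 (w1.alive Zs) i
  have hG : wd.record ≤ w1.record := a2.record
  have hA : Agree Zs wd.record i (wd.parties i) := d1.agree i hiZ
  have hpl : PLe (w.parties i) (wd.parties i) := (f2.parties i).trans (d2.parties i)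
  have hsame : SameCtl (w.parties i) (wd.parties i) := hpl.sandwich (a2.parties i) hc
  have hsame' : SameCtl (wd.parties i) ((wd.parties i).update i) := by
    have h1 : SameCtl (w.parties i) (w1.parties i) := hc
    exact hsame.symm.trans ⟨by rw [← a3.iter, h1.iter], by rw [← a3.opt, h1.opt],
      by rw [← a3.conf, h1.conf], by rw [← a3.out, h1.out]⟩
  have hq := hA.quiet hQ hZ d1.decOK hsame'
  rw [hA.quiet_update hQ hZ d1.decOK hsame'] at a3
  refine ⟨wd.parties i, hpl, hsame, hA.mono hG, hq, ?_, ?_, ?_, ?_, ?_⟩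
  · exact ⟨a3.deals, a3.votes, a3.mail, a3.ple, a3.iter, a3.opt, a3.conf, a3.out⟩
  · intro sid d c hwant hd hov
    by_cases hg : (w.parties i).vss sid = none
    · have : (wd.parties i).vss sid = some (mask i d) := by
        simp only [hwd, World.deliver, World.setParty, Function.update_self]
        rw [if_pos ⟨hg, hwant, d, c, hd, Or.inr hov⟩]
        change (w.deals sid).map _ = _
        rw [hd]
        rfl
      simp [PartySt.got, this]
    · exact hpl.got hg
  · intro sid b c hwant hd hov
    by_cases hg : (w.parties i).aba sid = none
    · have hd' : (w.forceAba B Zs).dec sid = some (b, c) := f2.dec _ _ hd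
      have : (wd.parties i).aba sid = some b := by
        simp only [hwd, World.deliver, World.setParty, Function.update_self]
        rw [if_pos ⟨hg, hwant, b, c, hd', Or.inr hov⟩, hd']
        rfl
      simp [this]
    · exact hpl.aba.ne_none hg
  · intro sid c hq hov
    exact (d2.trans a2).dec.ne_none (World.forceAba_dec hq hov)
  · intro j tag q x c hiS hm hov
    simp only [hwd, World.deliver, World.setParty, Function.update_self]
    exact Or.inr ⟨hiS, c, hm, Or.inr hov⟩

end

/-! ### Periods without progress -/

/-- A period of an execution, from `w` to `u`, in which the honest parties that have their input are
the members of the quorum `A` and none of them makes progress. -/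
structure Window [Fintype F] (B : ℕ) (Zs A : Finset (Fin P.n)) (w u : World P F) : Prop where
  hQ : P.Q 4
  hZ : P.Covered Zs
  inv : Inv Zs w
  alive : w.alive Zs = A
  quorum : P.Quorum A
  path : Path B Zs A w u
  same : ∀ i ∈ A, SameCtl (w.parties i) (u.parties i)

/-- In the period from `w` to `u`, the property `Y` holds after `t` rounds. -/
def At [Fintype F] (B : ℕ) (Zs A : Finset (Fin P.n)) (w u : World P F) (t : ℕ)
    (Y : World P F → Prop) : Prop :=
  ∀ v, Path B Zs A w v → Path B Zs A v u → w.clock.round + t ≤ v.clock.round → Y v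

/-- A party has voted, or it does not matter any more. -/
def Settled (sid : ASid P) (i : Fin P.n) (v : World P F) : Prop :=
  v.votes sid i ≠ none ∨ v.dec sid ≠ none

/-- The messages needed for the reconstruction of the `q`-th share of a value have arrived. -/
def Arrived (s : PartySt P F) (i : Fin P.n) (tag : RTag P) (q : Fin P.h) : Prop :=
  i ∉ P.S q → ∃ v, P.Covered (P.S q \ (P.S q).filter fun j => (j, tag, q, v) ∈ s.msgs)

theorem At.mono [Fintype F] {B : ℕ} {Zs A : Finset (Fin P.n)} {w u : World P F} {t t' : ℕ}
    {Y : World P F → Prop} (h : At B Zs A w u t Y) (ht : t ≤ t') : At B Zs A w u t' Y :=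
  fun v h1 h2 h3 => h v h1 h2 (by omega)

namespace Window

variable [Fintype F] {B : ℕ} {Zs A : Finset (Fin P.n)} {w u v : World P F} {i j : Fin P.n}

theorem mem (W : Window B Zs A w u) (hi : i ∈ A) : i ∉ Zs ∧ (w.parties i).started := by
  rw [← W.alive] at hi
  simpa [World.alive] using hi

theorem invAt (W : Window B Zs A w u) (hv : Path B Zs A w v) : Inv Zs v :=
  (hv.le W.inv W.hQ W.hZ).1

theorem le (W : Window B Zs A w u) (hv : Path B Zs A w v) : WLe Zs w v :=
  (hv.le W.inv W.hQ W.hZ).2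

theorem sameAt (W : Window B Zs A w u) (hv : Path B Zs A w v) (hv' : Path B Zs A v u)
    (hi : i ∈ A) : SameCtl (w.parties i) (v.parties i) :=
  ((W.le hv).parties i).sandwich ((hv'.le (W.invAt hv) W.hQ W.hZ).2.parties i) (W.same i hi)

theorem agree (W : Window B Zs A w u) (hi : i ∈ A) : Agree Zs w.record i (w.parties i) :=
  W.inv.agree i (W.mem hi).1

theorem disjoint (W : Window B Zs A w u) : Disjoint A Zs :=
  Finset.disjoint_left.2 fun _ hi => (W.mem hi).1

theorem nonempty (W : Window B Zs A w u) : ∃ i, i ∈ A := by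
  obtain ⟨i, hi, -⟩ := W.quorum.exists_honest W.hQ W.hZ P.z0 P.z0
  exact ⟨i, hi⟩

/-- No further honest party receives its input during the period. -/
theorem mem_of_started (W : Window B Zs A w u) (hv : Path B Zs A w v) (hi : i ∉ Zs)
    (hs : (v.parties i).started) : i ∈ A := by
  rw [← hv.alive W.alive]
  simp [World.alive, hi, hs]

/-- Every two rounds each party is activated. -/
theorem act (W : Window B Zs A w u) (hi : i ∈ A) {t : ℕ} {X Y : World P F → Prop}
    (hX : At B Zs A w u t X)
    (hXY : ∀ v s v', Path B Zs A w v → Path B Zs A v v' → Path B Zs A v' u →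
      w.clock.round + t ≤ v.clock.round → X v → Activation B Zs i v s v' → Y v')
    (hY : ∀ v v', Inv Zs v → WLe Zs v v' → Y v → Y v') : At B Zs A w u (t + 2) Y := by
  intro v h1 h2 h3
  obtain ⟨v0, h4, h5, h6⟩ := h1.exists_round (t := w.clock.round + t) (by omega) (by omega)
  obtain ⟨v1, v2, h7, h8, h9, h10⟩ := h5.did (by omega) hi
  have hw1 := h4.trans h7
  have hu2 := h10.trans h2
  have hw2 := hw1.trans h9
  have hr : w.clock.round + t ≤ v1.clock.round := by
    have := (h7.le (W.invAt h4) W.hQ W.hZ).2.round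
    omega
  obtain ⟨s, hs⟩ := h8.activation (W.invAt hw1) W.hQ W.hZ
    ((W.sameAt hw1 (h9.trans hu2) hi).symm.trans (W.sameAt hw2 hu2 hi))
  exact hY v2 v (W.invAt hw2) (h10.le (W.invAt hw2) W.hQ W.hZ).2
    (hXY v1 s v2 hw1 h9 hu2 hr (hX v1 hw1 (h9.trans hu2) hr) hs)

/-- A period is over when a party is ready to proceed. -/
theorem contra (W : Window B Zs A w u) (hi : i ∈ A) {t : ℕ}
    (ht : w.clock.round + t + 2 ≤ u.clock.round) {X : World P F → Prop}
    (hX : At B Zs A w u t X)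
    (hXF : ∀ v s v', Path B Zs A w v → Path B Zs A v v' → Path B Zs A v' u →
      X v → Activation B Zs i v s v' → False) : False :=
  W.act hi (Y := fun _ => False) hX (fun v s v' h1 h2 h3 _ h4 h5 => hXF v s v' h1 h2 h3 h4 h5)
    (fun _ _ _ _ h => h) u W.path .refl ht

/-- The round in which something has become available. -/
theorem timed (W : Window B Zs A w u) {t : ℕ} {α : Type} {f : World P F → Option (α × ℕ)}
    (hf : At B Zs A w u t fun v => f v ≠ none)
    (hle : ∀ v x c, Inv Zs v → f v = some (x, c) → c ≤ v.clock.round)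
    (hext : ∀ v v', WLe Zs v v' → ∀ x, f v = some x → f v' = some x) (hv : Path B Zs A w v)
    (hv' : Path B Zs A v u) (hr : w.clock.round + (t + B) ≤ v.clock.round) :
    ∃ x c, f v = some (x, c) ∧ v.overdue B c := by
  obtain ⟨v0, h4, h5, h6⟩ := hv.exists_round (t := w.clock.round + t) (by omega) (by omega)
  obtain ⟨⟨x, c⟩, hx⟩ := Option.ne_none_iff_exists'.1 (hf v0 h4 (h5.trans hv') (by omega))
  have := hle v0 x c (W.invAt h4) hx
  refine ⟨x, c, hext v0 v (h5.le (W.invAt h4) W.hQ W.hZ).2 _ hx, ?_⟩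
  simp only [World.overdue]
  omega

theorem wantsV (W : Window B Zs A w u) (hi : i ∈ A) (hv : Path B Zs A w v) {sid : VSid P}
    (h : (w.parties i).wantsV sid) : (v.parties i).wantsV sid :=
  ((W.le hv).parties i).wantsV (W.agree hi) h

theorem got (W : Window B Zs A w u) (hi : i ∈ A) {sid : VSid P} {t : ℕ}
    (hw : (w.parties i).wantsV sid) (hd : At B Zs A w u t fun v => v.deals sid ≠ none) :
    At B Zs A w u (t + B + 2) fun v => (v.parties i).got sid := by
  refine W.act hi (X := fun _ => True) (fun _ _ _ _ => trivial) ?_ fun v v' _ h1 h2 =>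
    (h1.parties i).got h2
  intro v s v' h1 h2 h3 hr _ hs
  obtain ⟨x, c, h4, h5⟩ := W.timed (f := fun v => v.deals sid) hd
    (fun v x c hi hx => (hi.deals _ _ _ hx).1) (fun v v' h x hx => h.deals _ _ hx) h1
    (h2.trans h3) (by omega)
  exact hs.acted.ple.got (hs.vss sid x c (W.wantsV hi h1 hw) h4 h5)

theorem aba (W : Window B Zs A w u) (hi : i ∈ A) {sid : ASid P} {t : ℕ}
    (hw : (w.parties i).wantsA sid) (hd : At B Zs A w u t fun v => v.dec sid ≠ none) :
    At B Zs A w u (t + B + 2) fun v => (v.parties i).aba sid ≠ none := by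
  refine W.act hi (X := fun _ => True) (fun _ _ _ _ => trivial) ?_ fun v v' _ h1 h2 =>
    (h1.parties i).aba.ne_none h2
  intro v s v' h1 h2 h3 hr _ hs
  obtain ⟨x, c, h4, h5⟩ := W.timed (f := fun v => v.dec sid) hd
    (fun v x c hi hx => (hi.dec _ _ _ hx).2.1) (fun v v' h x hx => h.dec _ _ hx) h1
    (h2.trans h3) (by omega)
  exact hs.acted.ple.aba.ne_none
    (hs.aba sid x c (((W.le h1).parties i).wantsA hw) h4 h5)

theorem deal (W : Window B Zs A w u) (hi : i ∈ A) {sid : VSid P}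
    (h : ∀ s : PartySt P F, SameCtl (w.parties i) s → ∃ x ∈ s.toDeal i fun _ _ => 0, x.1 = sid) :
    At B Zs A w u 2 fun v => v.deals sid ≠ none := by
  refine W.act (t := 0) hi (X := fun _ => True) (fun _ _ _ _ => trivial) ?_ fun v v' _ h1 h2 =>
    h1.deals.ne_none h2
  intro v s v' h1 h2 h3 hr _ hs
  obtain ⟨x, hx, rfl⟩ := h s ((W.sameAt h1 (h2.trans h3) hi).trans hs.same)
  exact hs.acted.deals _ x hx

theorem vote (W : Window B Zs A w u) (hi : i ∈ A) {sid : ASid P} {t : ℕ} {X : World P F → Prop}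
    (hX : At B Zs A w u t X)
    (h : ∀ v s v', Path B Zs A w v → Path B Zs A v v' → Path B Zs A v' u → X v →
      Activation B Zs i v s v' → s.voted sid = none → s.newVote i sid ≠ none) :
    At B Zs A w u (t + 2) (Settled sid i) := by
  have hiZ := (W.mem hi).1
  have key : ∀ v : World P F, Inv Zs v → (v.parties i).voted sid ≠ none → Settled sid i v := by
    intro v hv hn
    obtain ⟨b, hb⟩ := Option.ne_none_iff_exists'.1 hn
    rcases (hv.voted i hiZ sid b hb).2.2 with h1 | h1 | h1
    · exact Or.inl (by simp [h1])
    · exact Or.inr h1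
    · simp at h1
  have h2 : At B Zs A w u (t + 2) fun v => (v.parties i).voted sid ≠ none := by
    refine W.act hi hX ?_ fun v v' _ h1 h2 => (h1.parties i).voted.ne_none h2
    intro v s v' h1 h2 h3 hr hx hs
    by_cases hn : s.voted sid = none
    · exact hs.acted.votes _ (h v s v' h1 h2 h3 hx hs hn)
    · exact hs.acted.ple.voted.ne_none hn
  exact fun v h3 h4 h5 => key v (W.invAt h3) (h2 v h3 h4 h5)

/-- Once all members of the quorum `A` have voted, the decision is forced `B` rounds later. -/
theorem decide (W : Window B Zs A w u) {sid : ASid P} {t : ℕ}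
    (h : ∀ i ∈ A, At B Zs A w u t (Settled sid i)) :
    At B Zs A w u (t + B + 2) fun v => v.dec sid ≠ none := by
  obtain ⟨i, hi⟩ := W.nonempty
  refine W.act hi (X := fun _ => True) (fun _ _ _ _ => trivial) ?_ fun v v' _ h1 h2 =>
    h1.dec.ne_none h2
  intro v s v' h1 h2 h3 hr _ hs
  obtain ⟨v0, h4, h5, h6⟩ := h1.exists_round (t := w.clock.round + t) (by omega) (by omega)
  have hle := (h5.le (W.invAt h4) W.hQ W.hZ).2
  have hle' := (h2.le (W.invAt h1) W.hQ W.hZ).2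
  by_cases hd : v0.dec sid = none
  · have hq : P.Quorum (v0.voters sid) := W.quorum.mono fun j hj => by
      rcases h j hj v0 h4 (h5.trans (h2.trans h3)) (by omega) with h7 | h7
      · simpa [World.voters] using h7
      · exact absurd hd h7
    obtain ⟨c, hc⟩ := Option.ne_none_iff_exists'.1 ((W.invAt h4).quorum sid hq)
    have := ((W.invAt h4).quorumAt sid c hc).1
    refine hs.dec sid c (hle.quorumAt _ _ hc) ?_
    simp only [World.overdue]
    omega
  · exact (hle.trans hle').dec.ne_none hd

/-- All members of a family of votings are decided once everybody votes. -/
theorem decideAll (W : Window B Zs A w u) {sid : Fin P.n → ASid P} {t : ℕ}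
    (hw : ∀ i ∈ A, ∀ k, (w.parties i).wantsA (sid k))
    (h : ∀ i ∈ A, ∀ k, At B Zs A w u t (Settled (sid k) i)) (hi : i ∈ A) :
    At B Zs A w u (t + 2 * B + 4) fun v => ∀ k, (v.parties i).aba (sid k) ≠ none := by
  intro v h1 h2 h3 k
  exact W.aba hi (hw i hi k) (W.decide fun i hi => h i hi k) v h1 h2 (by omega)

/-- The election of a party: if everybody votes for some party, then all votings are decided. -/
theorem elect (W : Window B Zs A w u) {sid : Fin P.n → ASid P} {t : ℕ} {j0 : Fin P.n}
    (hw : ∀ i ∈ A, ∀ k, (w.parties i).wantsA (sid k))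
    (hfalse : ∀ v : World P F, ∀ k, v.record.VoteOK Zs (sid k) false →
      ∃ k', v.record.D (sid k') = some true)
    (hvote : ∀ i ∈ A, ∀ s : PartySt P F, SameCtl (w.parties i) s →
      (∃ k, s.aba (sid k) = some true) → ∀ k, s.voted (sid k) = none →
        s.newVote i (sid k) ≠ none)
    (h0 : ∀ i ∈ A, At B Zs A w u t (Settled (sid j0) i)) (hi : i ∈ A) :
    At B Zs A w u (t + 4 * B + 10) fun v => ∀ k, (v.parties i).aba (sid k) ≠ none := by
  have h1 : At B Zs A w u (t + B + 2) fun v => ∃ k, v.record.D (sid k) = some true := by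
    intro v h1 h2 h3
    have hd := W.decide h0 v h1 h2 h3
    have hd' : v.record.D (sid j0) ≠ none := by simpa [World.record] using hd
    obtain ⟨b, hb⟩ := Option.ne_none_iff_exists'.1 hd'
    cases b
    · exact hfalse v j0 ((W.invAt h1).decOK _ _ hb)
    · exact ⟨j0, hb⟩
  have h2 : ∀ i ∈ A, At B Zs A w u (t + 2 * B + 4) fun v =>
      ∃ k, (v.parties i).aba (sid k) = some true := by
    intro i hi v h3 h4 h5
    obtain ⟨v0, h6, h7, h8⟩ := h3.exists_round (t := w.clock.round + (t + B + 2)) (by omega)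
      (by omega)
    obtain ⟨k, hk⟩ := h1 v0 h6 (h7.trans h4) (by omega)
    have hdec : At B Zs A w u (t + B + 2) fun v' => v0.clock.round ≤ v'.clock.round :=
      fun v' _ _ hr => by omega
    obtain ⟨⟨b, c⟩, hx, rfl⟩ : ∃ x, v0.dec (sid k) = some x ∧ x.1 = true := by
      simpa [World.record] using hk
    -- the period that starts with the decision
    have W' : Window B Zs A v0 u :=
      ⟨W.hQ, W.hZ, W.invAt h6, h6.alive W.alive, W.quorum, h7.trans h4, fun i hi =>
        (W.sameAt h6 (h7.trans h4) hi).symm.trans (W.same i hi)⟩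
    have h9 := W'.aba (t := 0) hi (((W.le h6).parties i).wantsA (hw i hi k)) (fun v' g1 g2 _ =>
      (W'.le g1).dec.ne_none (by simp [hx])) v h7 h4 (by omega)
    refine ⟨k, ?_⟩
    obtain ⟨b', hb'⟩ := Option.ne_none_iff_exists'.1 h9
    have := ((W.invAt h3).agree i (W.mem hi).1).aba _ _ hb'
    rw [(W'.le h7).record.1 _ _ hk] at this
    rw [hb', ← this]
  have h3 : ∀ i ∈ A, ∀ k, At B Zs A w u (t + 2 * B + 6) (Settled (sid k) i) := by
    intro i hi k
    refine W.vote hi (h2 i hi) ?_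
    intro v s v' g1 g2 g3 hx hs hn
    obtain ⟨k', hk'⟩ := hx
    exact hvote i hi s ((W.sameAt g1 (g2.trans g3) hi).trans hs.same)
      ⟨k', hs.ple.aba _ _ hk'⟩ k hn
  exact (W.decideAll hw h3 hi).mono (by omega)

theorem mail (W : Window B Zs A w u) (hi : i ∈ A) {tag : RTag P} {q : Fin P.h} {t : ℕ}
    {X : World P F → Prop} (hX : At B Zs A w u t X)
    (h : ∀ v s v', Path B Zs A w v → Path B Zs A v v' → Path B Zs A v' u → X v →
      Activation B Zs i v s v' → s.myShare i tag q ≠ none) :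
    At B Zs A w u (t + 2) fun v => v.mail i tag q ≠ none := by
  refine W.act hi hX ?_ fun v v' _ h1 h2 => (h1.mail i tag).ne_none h2
  intro v s v' h1 h2 h3 hr hx hs
  exact hs.acted.mail tag q (h v s v' h1 h2 h3 hx hs)

theorem _root_.AMPC.PLe.arrived {s s' : PartySt P F} (h : PLe s s') {tag : RTag P} {q : Fin P.h}
    (ha : Arrived s i tag q) : Arrived s' i tag q := by
  intro hi
  obtain ⟨v, hv⟩ := ha hi
  refine ⟨v, hv.mono fun j hj => ?_⟩
  simp only [Finset.mem_sdiff, Finset.mem_filter, not_and] at hj ⊢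
  exact ⟨hj.1, fun h1 h2 => hj.2 h1 (h.msgs h2)⟩

/-- A share that all its honest holders have sent can be accepted: the holders outside `A` are
covered by a set of the structure. -/
theorem arrived (W : Window B Zs A w u) (hi : i ∈ A) {tag : RTag P} {q : Fin P.h} {t : ℕ}
    (hm : ∀ j ∈ A, j ∈ P.S q → At B Zs A w u t fun v => v.mail j tag q ≠ none) :
    At B Zs A w u (t + B + 2) fun v => Arrived (v.parties i) i tag q := by
  refine W.act hi (X := fun _ => True) (fun _ _ _ _ => trivial) ?_ fun v v' _ h1 h2 =>
    (h1.parties i).arrived h2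
  intro v s v' h1 h2 h3 hr _ hs
  refine hs.acted.ple.arrived fun hiS => ?_
  have key : ∀ j ∈ A, j ∈ P.S q →
      ∃ x, (j, tag, q, x) ∈ s.msgs ∧ v.record.share tag q = some x := by
    intro j hj hjS
    obtain ⟨x, c, h4, h5⟩ := W.timed (f := fun v => v.mail j tag q) (hm j hj hjS)
      (fun v x c hv hx => (hv.mail j (W.mem hj).1 _ _ _ _ hx).1)
      (fun v v' h x hx => h.mail j tag _ _ hx) h1 (h2.trans h3) (by omega)
    exact ⟨x, hs.msgs j tag q x c hiS h4 h5, ((W.invAt h1).mail j (W.mem hj).1 _ _ _ _ h4).2.1⟩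
  refine ⟨(v.record.share tag q).getD 0, Params.Covered.mono W.quorum fun j hj => ?_⟩
  simp only [Finset.mem_sdiff, Finset.mem_filter, not_and, Finset.mem_compl] at hj ⊢
  intro hjA
  obtain ⟨x, h4, h5⟩ := key j hjA hj.1
  refine hj.2 hj.1 ?_
  rw [h5]
  exact h4

theorem _root_.AMPC.PartySt.recShareWith_ne_none {s : PartySt P F} {own : Option F}
    {tag : RTag P} {q : Fin P.h} (ha : Arrived s i tag q) (ho : i ∈ P.S q → own ≠ none) :
    s.recShareWith i own tag q ≠ none := by
  unfold PartySt.recShareWith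
  split_ifs with h1 h2
  · exact ho h1
  · simp
  · exact absurd (ha h1) h2

theorem _root_.AMPC.PartySt.total_ne_none {sh : Fin P.h → Option F} (h : ∀ q, sh q ≠ none) :
    PartySt.total sh ≠ none := by
  rw [PartySt.total, if_pos h]
  simp

end Window

/-! ### A party that can proceed does so -/

namespace Agree

variable {Zs : Finset (Fin P.n)} {G : Rec P F} {i : Fin P.n} {s : PartySt P F}

theorem stepStage_ne (h0 : s.iter = 0) (ha : ∀ j, s.aba (.acs j) ≠ none)
    (hg : ∀ j ∈ s.CS, ∀ b l, s.got (.input j b l)) : s.stepStage ≠ s := by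
  intro he
  unfold PartySt.stepStage at he
  rw [if_pos ⟨h0, ha, hg⟩] at he
  have := congrArg PartySt.iter he
  simp [h0] at this

theorem hopEnd_ne (h : Agree Zs G i s) (hD : G.DecOK Zs) {z : Fin P.h} (h1 : 1 ≤ s.iter)
    (hr : (s.opt s.iter z).rem.Nonempty)
    (ha : ∀ j, s.aba (.sel s.iter z (s.opt s.iter z).hop j) ≠ none) :
    s.hopEnd z ≠ s.opt s.iter z := by
  obtain ⟨j, hj, -⟩ := hD.exists_sel (h.opt s.iter z) (fun k => h.aba.ne_none (ha k)) i.pos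
  have hj' : least (fun k => s.aba (.sel s.iter z (s.opt s.iter z).hop k) = some true) =
      some j := by
    rw [← hj]
    congr 1
    funext k
    rw [h.aba.eq (ha k)]
  unfold PartySt.hopEnd
  simp only
  rw [if_pos ⟨h1, hr, ha⟩, hj']
  intro he
  have := congrArg OptSt.hop he
  simp [OptSt.next] at this

theorem stepCheck_ne (h1 : 1 ≤ s.iter) (h2 : s.out = none) (h3 : s.conf s.iter = none)
    (h4 : ∀ z, s.optDone s.iter z) (h5 : ∀ z l, s.recValue i (.diff s.iter z l) ≠ none) :
    s.stepCheck i ≠ s := by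
  intro he
  unfold PartySt.stepCheck at he
  rw [if_pos ⟨h1, h2, h3, h4, h5⟩] at he
  split at he
  · have := congrArg PartySt.out he
    simp [h2] at this
  · rename_i z hz
    obtain ⟨l, hl⟩ := exists_least (least_some hz)
    have := congrFun (congrArg PartySt.conf he) s.iter
    simp [hl, h3] at this

theorem stepNext_ne (h : Agree Zs G i s) (hD : G.DecOK Zs) (hc : s.conf s.iter ≠ none)
    (ha : PartySt.gdIter P s.iter → ∀ j, s.aba (.gd s.iter j) ≠ none) : s.stepNext ≠ s := by
  intro he
  have he := congrArg PartySt.iter he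
  unfold PartySt.stepNext at he
  rw [if_neg hc] at he
  by_cases hg : PartySt.gdIter P s.iter
  · have ha := ha hg
    have hd : ∀ k, G.D (.gd s.iter k) ≠ none := fun k => h.aba.ne_none (ha k)
    obtain ⟨j, hj⟩ := hD.exists_gd hd i.pos
    have : least (fun k => s.aba (.gd s.iter k) = some true) = some j := by
      rw [← hj, Rec.gdAt, if_pos hd]
      congr 1
      funext k
      rw [h.aba.eq (ha k)]
    rw [if_pos hg, if_pos ha, this] at he
    simp at he
  · rw [if_neg hg] at he
    simp at he

end Agree

namespace Window

variable [Fintype F] {B : ℕ} {Zs A : Finset (Fin P.n)} {w u v : World P F} {i j : Fin P.n}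

theorem drop (W : Window B Zs A w u) (hv : Path B Zs A w v) (hv' : Path B Zs A v u) :
    Window B Zs A v u :=
  ⟨W.hQ, W.hZ, W.invAt hv, hv.alive W.alive, W.quorum, hv', fun i hi =>
    (W.sameAt hv hv' hi).symm.trans (W.same i hi)⟩

/-- The first stage does not last. -/
theorem one_le_iter (W : Window B Zs A w u) (ht : w.clock.round + (6 * B + 20) ≤ u.clock.round)
    (hi : i ∈ A) : 1 ≤ (w.parties i).iter := by
  by_contra h0
  have hgot : ∀ i ∈ A, ∀ j ∈ A, At B Zs A w u (B + 4) fun v =>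
      ∀ b l, (v.parties i).got (.input j b l) := by
    intro i hi j hj v h1 h2 h3 b l
    refine W.got hi (sid := .input j b l) (W.mem hi).2 (W.deal hj fun s _ => ?_) v h1 h2 (by omega)
    exact ⟨_, Agree.mem_toDeal.2 (Or.inl ⟨b, l, rfl⟩), rfl⟩
  have hdec : ∀ j ∈ A, At B Zs A w u (2 * B + 8) fun v => v.dec (.acs j) ≠ none := by
    intro j hj
    refine (W.decide (t := B + 4 + 2) fun i hi => W.vote hi (hgot i hi j hj) ?_).mono (by omega)
    intro v s v' h1 h2 h3 h4 hs hn
    simp only [PartySt.newVote, hn, ne_eq, not_true_eq_false, if_false]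
    rw [if_pos fun b l => hs.ple.got (h4 b l)]
    simp
  have hCS : At B Zs A w u (2 * B + 8) fun v => P.Quorum v.record.st.CS := by
    intro v h1 h2 h3
    by_cases hall : ∀ j ∈ A, v.record.D (.acs j) = some true
    · refine W.quorum.mono fun j hj => ?_
      simp only [PartySt.CS, Finset.mem_filter, Finset.mem_univ, true_and]
      exact hall j hj
    · push Not at hall
      obtain ⟨j, hj, hne⟩ := hall
      have hd : v.record.D (.acs j) ≠ none := by
        simpa [World.record] using hdec j hj v h1 h2 h3
      obtain ⟨b, hb⟩ := Option.ne_none_iff_exists'.1 hd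
      cases b
      · exact (W.invAt h1).decOK _ _ hb
      · exact absurd hb hne
  have hCS' : ∀ i ∈ A, At B Zs A w u (3 * B + 10) fun v => P.Quorum (v.parties i).CS := by
    intro i hi v h1 h2 h3
    obtain ⟨v0, h4, h5, h6⟩ := h1.exists_round (t := w.clock.round + (2 * B + 8)) (by omega)
      (by omega)
    have W' := W.drop h4 (h5.trans h2)
    refine (hCS v0 h4 (h5.trans h2) (by omega)).mono fun j hj => ?_
    simp only [PartySt.CS, Finset.mem_filter, Finset.mem_univ, true_and] at hj ⊢
    change v0.record.D _ = _ at hj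
    have hd : v0.dec (.acs j) ≠ none := fun hn => by simp [World.record, hn] at hj
    have h7 := W'.aba (t := 0) hi (sid := .acs j) (W'.mem hi).2 (fun v' g1 g2 _ =>
      (W'.le g1).dec.ne_none hd) v h5 h2 (by omega)
    obtain ⟨b, hb⟩ := Option.ne_none_iff_exists'.1 h7
    have := ((W.invAt h1).agree i (W.mem hi).1).aba _ _ hb
    rw [(W'.le h5).record.1 _ _ hj] at this
    rw [hb, ← this]
  have haba : ∀ i ∈ A, At B Zs A w u (5 * B + 16) fun v =>
      ∀ k, (v.parties i).aba (.acs k) ≠ none := by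
    intro i hi
    refine (W.decideAll (sid := .acs) (t := 3 * B + 10 + 2) (fun i hi k => (W.mem hi).2) ?_
      hi).mono (by omega)
    intro i hi k
    refine W.vote hi (hCS' i hi) ?_
    intro v s v' h1 h2 h3 h4 hs hn
    have hq : P.Quorum s.CS := h4.mono fun j hj => by
      simp only [PartySt.CS, Finset.mem_filter, Finset.mem_univ, true_and] at hj ⊢
      exact hs.ple.aba _ _ hj
    simp only [PartySt.newVote, hn, ne_eq, not_true_eq_false, if_false]
    split_ifs <;> simp
  have hin : At B Zs A w u (6 * B + 18) fun v => (∀ k, (v.parties i).aba (.acs k) ≠ none) ∧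
      ∀ j ∈ (v.parties i).CS, ∀ b l, (v.parties i).got (.input j b l) := by
    intro v h1 h2 h3
    refine ⟨haba i hi v h1 h2 (by omega), fun j hj b l => ?_⟩
    obtain ⟨v0, h4, h5, h6⟩ := h1.exists_round (t := w.clock.round + (5 * B + 16)) (by omega)
      (by omega)
    have W' := W.drop h4 (h5.trans h2)
    simp only [PartySt.CS, Finset.mem_filter, Finset.mem_univ, true_and] at hj
    have h7 := haba i hi v0 h4 (h5.trans h2) (by omega) j
    rw [((W'.le h5).parties i).aba.eq h7] at hj
    have h8 := (W'.inv.decOK _ _ ((W'.agree hi).aba _ _ hj)) b l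
    have h9 : v0.deals (.input j b l) ≠ none := by
      simpa [World.record] using h8
    exact W'.got (t := 0) hi (sid := .input j b l) (W'.mem hi).2 (fun v' g1 g2 _ =>
      (W'.le g1).deals.ne_none h9) v h5 h2 (by omega)
  refine W.contra hi ht hin ?_
  intro v s v' h1 h2 h3 h4 hs
  refine Agree.stepStage_ne ?_ (fun j => hs.ple.aba.ne_none (h4.1 j)) (fun j hj b l => ?_)
    hs.quiet.1
  · rw [hs.same.iter, (W.sameAt h1 (h2.trans h3) hi).iter]
    omega
  · refine hs.ple.got (h4.2 j ?_ b l)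
    simp only [PartySt.CS, Finset.mem_filter, Finset.mem_univ, true_and] at hj ⊢
    rwa [hs.ple.aba.eq (h4.1 j)] at hj

theorem optDone_of_lt (W : Window B Zs A w u) (hi : i ∈ A) {r : ℕ} (h1 : 1 ≤ r)
    (hr : r < (w.parties i).iter) (z : Fin P.h) : (w.parties i).optDone r z :=
  ((W.agree hi).one_le_of_conf ((W.agree hi).confPast r h1 hr)).2.2 z

/-- The parts of the members of `A` arrive everywhere. -/
theorem parts (W : Window B Zs A w u) (hi : i ∈ A) (hj : j ∈ A) {r : ℕ} {zc z : Fin P.h}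
    {l : Fin P.M} {k : Fin P.n} (hci : (w.parties i).conf r = some (zc, l))
    (hcj : (w.parties j).conf r ≠ none) (hd : (w.parties i).partDue r zc z j k) :
    At B Zs A w u (B + 4) fun v => (v.parties i).got (.part r z j k) := by
  refine (W.got hi (sid := .part r z j k) (t := 2) ⟨zc, l, hci, hd⟩ (W.deal hj ?_)).mono (by omega)
  intro s hs
  obtain ⟨-, -, hdi, hgi⟩ := (W.agree hi).confSome _ _ hci
  obtain ⟨p, hcj⟩ := Option.ne_none_iff_exists'.1 hcj
  obtain ⟨-, h2, hdj, hgj⟩ := (W.agree hj).confSome _ _ hcj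
  rw [hgi] at hgj
  cases hgj
  have hd' : (w.parties j).partDue r zc z j k := by
    rw [← (W.agree hj).ref.partDue (hdj _) (hdj _), (W.agree hi).ref.partDue (hdi _) (hdi _)]
    exact hd
  refine ⟨_, Agree.mem_toDeal.2 (Or.inr (Or.inr ⟨r, zc, l, by rw [hs.iter]; exact h2,
    by rw [hs.conf]; exact hcj, k, z, hd.imp (fun h => h.1) fun h => h.1,
    by rw [hs.partDue]; exact hd', rfl⟩)), rfl⟩

/-- The multiplications do not last. -/
theorem rem_eq (W : Window B Zs A w u) (ht : w.clock.round + (5 * B + 20) ≤ u.clock.round)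
    {r : ℕ} (h1 : 1 ≤ r) (hr : ∀ j ∈ A, r ≤ (w.parties j).iter) (hi : i ∈ A) (z : Fin P.h) :
    ((w.parties i).opt r z).rem = ∅ := by
  by_contra hne
  obtain ⟨i0, hi0, hmin⟩ := Finset.exists_min_image
    (A.filter fun i => ((w.parties i).opt r z).rem.Nonempty) (fun i => ((w.parties i).opt r z).hop)
    ⟨i, Finset.mem_filter.2 ⟨hi, Finset.nonempty_iff_ne_empty.2 hne⟩⟩
  obtain ⟨hi0, hrem⟩ := Finset.mem_filter.1 hi0
  set o := (w.parties i0).opt r z with ho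
  have hor : OptReach w.record.D r z o := (W.agree hi0).opt r z
  have hle : ∀ j ∈ A, o.hop ≤ ((w.parties j).opt r z).hop := by
    intro j hj
    rcases Finset.eq_empty_or_nonempty ((w.parties j).opt r z).rem with he | he
    · exact ((W.agree hj).opt r z).hop_le_of_rem hor he
    · exact hmin j (Finset.mem_filter.2 ⟨hj, he⟩)
  have hiter : ∀ j ∈ A, ((w.parties j).opt r z).rem.Nonempty → (w.parties j).iter = r := by
    intro j hj he
    by_contra hn
    have := (W.optDone_of_lt hj h1 (lt_of_le_of_ne (hr j hj) (Ne.symm hn)) z).1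
    simp [this] at he
  have heq : ∀ j ∈ A, o.hop = ((w.parties j).opt r z).hop → (w.parties j).opt r z = o :=
    fun j hj h => ((W.agree hj).opt r z).eq_of_hop hor h.symm
  have hwant : ∀ j ∈ A, ∀ k, (w.parties j).wantsA (.sel r z o.hop k) := by
    intro j hj k
    refine ⟨h1, hr j hj, hor.one_le_hop, ?_⟩
    rcases (hle j hj).lt_or_eq with h | h
    · exact Or.inl h
    · exact Or.inr ⟨h, by rw [heq j hj h]; exact hrem⟩
  -- once the decisions of the hop have arrived, the hop ends
  have hend : At B Zs A w u (5 * B + 18) (fun v =>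
      ∀ k, (v.parties i0).aba (.sel r z o.hop k) ≠ none) → False := by
    intro hX
    refine W.contra hi0 ht hX ?_
    intro v s v' g1 g2 g3 g4 hs
    have hsame := (W.sameAt g1 (g2.trans g3) hi0).trans hs.same
    have hsi : s.iter = r := hsame.iter.trans (hiter i0 hi0 hrem)
    have hso : s.opt r z = o := by rw [hsame.opt]
    refine hs.agree.hopEnd_ne (W.invAt (g1.trans g2)).decOK (z := z) (by omega) ?_ ?_
      (hs.quiet.2.1 z)
    · rw [hsi, hso]
      exact hrem
    · rw [hsi, hso]
      exact fun k => hs.ple.aba.ne_none (g4 k)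
  by_cases hall : ∀ j ∈ A, o.hop = ((w.parties j).opt r z).hop
  swap
  · push Not at hall
    obtain ⟨j, hj, hne⟩ := hall
    rcases hor.linear ((W.agree hj).opt r z) (hle j hj) with h | ⟨-, -, h⟩
    · exact hne (by rw [h])
    · refine hend fun v g1 g2 g3 k => ?_
      exact W.aba (t := 0) hi0 (hwant i0 hi0 k) (fun v' g1 g2 _ => (W.le g1).dec.ne_none
        (by simpa [World.record] using h k)) v g1 g2 (by omega)
  · have hop : ∀ j ∈ A, (w.parties j).opt r z = o := fun j hj => heq j hj (hall j hj)
    have hit : ∀ j ∈ A, (w.parties j).iter = r := fun j hj =>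
      hiter j hj (by rw [hop j hj]; exact hrem)
    obtain ⟨j0, hj0, hj0Z, hj0z, hj0s⟩ := hor.exists_candidate W.hQ W.quorum W.disjoint hrem
    have hgot : ∀ i ∈ A, At B Zs A w u (B + 4) fun v =>
        (∀ l, (v.parties i).got (.summ r z o.hop j0 l)) ∧
        ∀ r', 1 ≤ r' → r' < r → ∀ zc l, (w.parties i).conf r' = some (zc, l) → ∀ z' k,
          (w.parties i).partDue r' zc z' j0 k → (v.parties i).got (.part r' z' j0 k) := by
      intro i hi v g1 g2 g3
      constructor
      · intro l
        refine W.got (t := 2) hi (sid := .summ r z o.hop j0 l) (hwant i hi j0) (W.deal hj0 ?_)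
          v g1 g2 (by omega)
        intro s hs
        have hsi : s.iter = r := hs.iter.trans (hit j0 hj0)
        have hso : s.opt r z = o := by rw [hs.opt]; exact hop j0 hj0
        refine ⟨_, Agree.mem_toDeal.2 (Or.inr (Or.inl ⟨z, l, ⟨?_, hj0z, ?_, ?_⟩, rfl⟩)), ?_⟩
        · omega
        · rw [hsi, PartySt.Sel, hso]
          exact hj0s
        · rw [hsi, hso]
          exact hrem
        · simp only [hsi, hso]
      · intro r' h2 h3 zc l hc z' k hd
        exact W.parts hi hj0 hc ((W.agree hj0).confPast r' h2 (by rw [hit j0 hj0]; exact h3)) hd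
          v g1 g2 g3
    refine hend ((W.elect (t := B + 6) (j0 := j0) (sid := fun k => .sel r z o.hop k) hwant
      (fun v k h => h) ?_ ?_ hi0).mono (by omega))
    · rintro i hi s hs ⟨k', hk'⟩ k hn
      have hsi : s.iter = r := hs.iter.trans (hit i hi)
      have hso : s.opt r z = o := by rw [hs.opt]; exact hop i hi
      simp only [PartySt.newVote, hn, ne_eq, not_true_eq_false, if_false]
      rw [if_pos ⟨h1, hsi.symm, by rw [hso], by rw [hso]; exact hrem⟩]
      by_cases hg : k ∉ s.GD ∧ k ∉ P.Z z ∧ k ∉ s.Sel r z ∧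
          (∀ r', 1 ≤ r' → r' < r → ¬ s.Waiting r' k ∧ ¬ s.LD i r' k) ∧
          ∀ l, s.got (.summ r z o.hop k l)
      · rw [if_pos hg]
        simp
      · rw [if_neg hg, if_pos ⟨k', hk'⟩]
        simp
    · intro i hi
      refine W.vote hi (hgot i hi) ?_
      intro v s v' g1 g2 g3 g4 hs hn
      have hsame := (W.sameAt g1 (g2.trans g3) hi).trans hs.same
      have hsi : s.iter = r := hsame.iter.trans (hit i hi)
      have hso : s.opt r z = o := by rw [hsame.opt]; exact hop i hi
      have hinv := W.invAt (g1.trans g2)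
      simp only [PartySt.newVote, hn, ne_eq, not_true_eq_false, if_false]
      rw [if_pos ⟨h1, hsi.symm, by rw [hso], by rw [hso]; exact hrem⟩, if_pos]
      · simp
      refine ⟨?_, hj0z, ?_, ?_, fun l => hs.ple.got (g4.1 l)⟩
      · rw [hs.agree.gd]
        exact fun h => hj0Z (Rec.GD_subset hinv.decOK _ h)
      · rw [PartySt.Sel, hso]
        exact hj0s
      · intro r' h2 h3
        refine ⟨?_, fun h => hj0Z (hs.agree.LD_corrupt W.hQ W.hZ hinv.dealsOK h)⟩
        obtain ⟨⟨zc, l⟩, hc⟩ := Option.ne_none_iff_exists'.1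
          ((W.agree hi).confPast r' h2 (by rw [hit i hi]; exact h3))
        simp only [PartySt.Waiting, hsame.conf, hc, not_and, not_not]
        intro _ z' k hd
        rw [hsame.partDue] at hd
        exact hs.ple.got (g4.2 r' h2 h3 zc l hc z' k hd)

theorem optDone (W : Window B Zs A w u) (hi : i ∈ A) {r : ℕ} {z : Fin P.h} (h1 : 1 ≤ r)
    (hr : r ≤ (w.parties i).iter) (hrem : ((w.parties i).opt r z).rem = ∅) :
    At B Zs A w u (B + 2) fun v => (v.parties i).optDone r z := by
  intro v g1 g2 g3
  have hsame := W.sameAt g1 g2 hi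
  simp only [PartySt.optDone, PartySt.Sel, PartySt.sumSid, hsame.opt]
  refine ⟨hrem, fun j hj l => ?_⟩
  obtain ⟨o', h2, h3, h4, -, -, -, h5⟩ := ((W.agree hi).opt r z).exists_of_selected hj
  obtain ⟨-, -, h6, -⟩ := W.inv.decOK _ _ h5
  rw [← h3]
  refine W.got (t := 0) hi (sid := .summ r z o'.hop j l) ⟨h1, hr, h2.one_le_hop, Or.inl h4⟩ (fun v' g1 g2 _ =>
    (W.le g1).deals.ne_none ?_) v g1 g2 (by omega)
  simpa [World.record] using h6 l

/-- The comparison of the products does not last. -/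
theorem checked (W : Window B Zs A w u) (ht : w.clock.round + (5 * B + 20) ≤ u.clock.round)
    {r : ℕ} (h1 : 1 ≤ r) (hr : ∀ j ∈ A, r ≤ (w.parties j).iter) (hi : i ∈ A)
    (hir : (w.parties i).iter = r) :
    (w.parties i).out ≠ none ∨ (w.parties i).conf r ≠ none := by
  by_contra hn
  push Not at hn
  have hdone : ∀ j ∈ A, ∀ z, At B Zs A w u (B + 2) fun v => (v.parties j).optDone r z :=
    fun j hj z => W.optDone hj h1 (hr j hj) (W.rem_eq ht h1 hr hj z)
  have hbase : ∀ (s : PartySt P F) z l q, (∀ z, s.optDone r z) →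
      s.baseShare q (.diff r z l) ≠ none := by
    intro s z l q h
    simp only [PartySt.baseShare]
    rw [if_pos ⟨h z, h _⟩]
    simp
  have hmail : ∀ j ∈ A, ∀ z l q, j ∈ P.S q →
      At B Zs A w u (B + 4) fun v => v.mail j (.diff r z l) q ≠ none := by
    intro j hj z l q hq
    refine W.mail hj (X := fun v => ∀ z, (v.parties j).optDone r z)
      (fun v g1 g2 g3 z => hdone j hj z v g1 g2 g3) ?_
    intro v s v' g1 g2 g3 g4 hs
    simp only [PartySt.myShare, if_pos hq]
    exact hbase s z l q fun z => hs.ple.optDone (g4 z)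
  have hX : At B Zs A w u (2 * B + 6) fun v => (∀ z, (v.parties i).optDone r z) ∧
      ∀ z l q, Arrived (v.parties i) i (.diff r z l) q := by
    intro v g1 g2 g3
    refine ⟨fun z => hdone i hi z v g1 g2 (by omega), fun z l q => ?_⟩
    exact W.arrived hi (t := B + 4) (fun j hj hq => hmail j hj z l q hq) v g1 g2 (by omega)
  refine W.contra hi (by omega) hX ?_
  intro v s v' g1 g2 g3 g4 hs
  have hsame := (W.sameAt g1 (g2.trans g3) hi).trans hs.same
  have hsi : s.iter = r := hsame.iter.trans hir
  have hdone' : ∀ z, s.optDone r z := fun z => hs.ple.optDone (g4.1 z)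
  refine Agree.stepCheck_ne (i := i) (by omega) (by rw [hsame.out]; exact hn.1)
    (by rw [hsi, hsame.conf]; exact hn.2) (by rwa [hsi]) ?_ hs.quiet.2.2.1
  intro z l
  rw [hsi]
  refine PartySt.total_ne_none fun q => ?_
  refine PartySt.recShareWith_ne_none (hs.ple.arrived (g4.2 z l q)) fun hq => ?_
  simp only [PartySt.myShare, if_pos hq]
  exact hbase s z l q hdone'

end Window

/-! ### Identification of a cheater -/

namespace Rec

variable {G G' : Rec P F} {Zs : Finset (Fin P.n)} {r : ℕ} {z : Fin P.h}

theorem tot_mono (hG : G ≤ G') {sid : VSid P} (hg : G.st.got sid) : G'.tot sid = G.tot sid :=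
  Finset.sum_congr rfl fun _ _ => (ref_st hG).val hg trivial

theorem diff_eq_tot (G : Rec P F) (r : ℕ) (z : Fin P.h) (l : Fin P.M) :
    G.diff r z l = ∑ j ∈ G.st.Sel r z, G.tot (G.st.sumSid r z j l) -
      ∑ k ∈ G.st.Sel r P.z0, G.tot (G.st.sumSid r P.z0 k l) := by
  unfold diff
  rw [Finset.sum_sub_distrib]
  congr 1
  · exact Finset.sum_comm
  · exact Finset.sum_comm

/-- If the products differ, then the parts of some party do not add up, or the two versions of some
part differ. -/
theorem exists_cheat {zc : Fin P.h} {l : Fin P.M} (hc : G.conf r = some (zc, l)) :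
    (∃ z x, (z = zc ∨ z = P.z0) ∧ x ∈ G.st.Sel r z ∧ G.tot (G.st.sumSid r z x l) -
      ∑ k ∈ Finset.univ.filter (fun k => G.st.partDue r zc z x k), G.tot (.part r z x k) ≠ 0) ∨
    ∃ j k, j ∈ G.st.Sel r zc ∧ k ∈ G.st.Sel r P.z0 ∧
      G.tot (.part r zc j k) ≠ G.tot (.part r P.z0 k j) := by
  by_contra hn
  push Not at hn
  obtain ⟨h1, h2⟩ := hn
  refine conf_some hc ?_
  rw [diff_eq_tot]
  have e1 : ∀ j ∈ G.st.Sel r zc, G.tot (G.st.sumSid r zc j l) =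
      ∑ k ∈ G.st.Sel r P.z0, G.tot (.part r zc j k) := fun j hj => by
    rw [← filter_partDue_zc hc hj]
    exact sub_eq_zero.1 (h1 zc j (Or.inl rfl) hj)
  have e2 : ∀ k ∈ G.st.Sel r P.z0, G.tot (G.st.sumSid r P.z0 k l) =
      ∑ j ∈ G.st.Sel r zc, G.tot (.part r P.z0 k j) := fun k hk => by
    rw [← filter_partDue_z0 hc hk]
    exact sub_eq_zero.1 (h1 P.z0 k (Or.inr rfl) hk)
  rw [Finset.sum_congr rfl e1, Finset.sum_congr rfl e2, Finset.sum_comm, sub_eq_zero]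
  exact Finset.sum_congr rfl fun k hk => Finset.sum_congr rfl fun j hj => h2 j k hj hk

theorem selected_voteOK (hD : G.DecOK Zs) (hA : G.AllDone r) {x : Fin P.n}
    (hx : x ∈ G.st.Sel r z) : ∃ hop, G.VoteOK Zs (.sel r z hop x) true := by
  obtain ⟨o', -, -, -, -, -, -, h⟩ := (reach_opt hA z).1.exists_of_selected hx
  exact ⟨_, hD _ _ h⟩

theorem partDue_sel {s : PartySt P F} {zc : Fin P.h} {x k : Fin P.n}
    (h : s.partDue r zc z x k) : (z = zc ∨ z = P.z0) ∧ x ∈ s.Sel r z ∧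
      (x ∈ s.Sel r zc ∨ x ∈ s.Sel r P.z0) := by
  rcases h with ⟨rfl, h, -⟩ | ⟨rfl, h, -⟩
  · exact ⟨Or.inl rfl, h, Or.inl h⟩
  · exact ⟨Or.inr rfl, h, Or.inr h⟩

/-- Since a party that withholds a part is not selected any more, in one of the iterations since the
last identification no part is withheld. -/
theorem exists_iter_dealt (hD : G.DecOK Zs) (hZ : P.Covered Zs) (hn : 0 < P.n)
    (hg : PartySt.gdIter P r) :
    ∃ r', 1 ≤ r' ∧ r' ≤ r ∧ G.GD r' = G.GD r ∧ ∀ zc l, G.conf r' = some (zc, l) →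
      ∀ x ∈ Zs, ∀ z k, G.st.partDue r' zc z x k → G.V (.part r' z x k) ≠ none := by
  by_contra hcon
  push Not at hcon
  -- the iterations `r - t, …, r` are `t + 1` in number, and a different corrupt party would withhold
  -- a part in each of them
  have htn : P.t ≤ P.t * P.n := Nat.le_mul_of_pos_right _ hn
  have hrt : P.t * P.n + 1 ≤ r := Nat.le_of_dvd hg.1 hg.2
  have key : ∀ r', r' ∈ Finset.Icc (r - P.t) r → ∃ x ∈ Zs, ∃ zc l z k, G.conf r' = some (zc, l) ∧
      G.st.partDue r' zc z x k ∧ G.V (.part r' z x k) = none := by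
    intro r' hr'
    rw [Finset.mem_Icc] at hr'
    have hGD : G.GD r' = G.GD r := by
      ext j
      simp only [GD, Finset.mem_filter, Finset.mem_univ, true_and]
      constructor
      · rintro ⟨r'', h1, h2⟩
        exact ⟨r'', by omega, h2⟩
      · rintro ⟨r'', h1, h2, h3⟩
        refine ⟨r'', ?_, h2, h3⟩
        -- multiples of `t * n + 1` are more than `t` apart
        have := Nat.le_of_dvd (by omega) (Nat.dvd_sub hg.2 h2.2)
        omega
    obtain ⟨zc, l, h1, x, hx, z, k, h2, h3⟩ := hcon r' (by omega) hr'.2 hGD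
    exact ⟨x, hx, zc, l, z, k, h1, h2, h3⟩
  have : Nonempty (Fin P.n) := ⟨⟨0, hn⟩⟩
  choose! f hf1 hf2 using key
  have hlt : ∀ r1 ∈ Finset.Icc (r - P.t) r, ∀ r2 ∈ Finset.Icc (r - P.t) r, r1 < r2 →
      f r1 ≠ f r2 := by
    intro r1 h1 r2 h2 hlt he
    obtain ⟨zc1, l1, z1, k1, c1, d1, n1⟩ := hf2 r1 h1
    obtain ⟨zc2, l2, z2, k2, c2, d2, -⟩ := hf2 r2 h2
    rw [← he] at d2
    obtain ⟨hop, -, -, -, -, -, h3⟩ :=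
      selected_voteOK hD (conf_allDone c2) (partDue_sel d2).2.1
    obtain ⟨zc, l, c3, h4⟩ := h3 r1 (by rw [Finset.mem_Icc] at h1; omega) hlt
    rw [c1] at c3
    cases c3
    exact h4 (partDue_sel d1).2.2 z1 k1 d1 n1
  have hcard : (Finset.Icc (r - P.t) r).card ≤ Zs.card := by
    refine Finset.card_le_card_of_injOn f (fun r' h => hf1 r' h) ?_
    intro r1 h1 r2 h2 he
    rcases lt_trichotomy r1 r2 with h | h | h
    · exact absurd he (hlt r1 h1 r2 h2 h)
    · exact h
    · exact absurd he.symm (hlt r2 h2 r1 h1 h)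
  have := hZ.card_le
  rw [Nat.card_Icc] at hcard
  omega

end Rec

/-- The property `Φ` holds for party `i` in the world `v` and in all later ones. -/
def Sure (Zs : Finset (Fin P.n)) (i : Fin P.n) (Φ : PartySt P F → Prop) (v : World P F) : Prop :=
  ∀ G s, v.record ≤ G → PLe (v.parties i) s → SameCtl (v.parties i) s → Agree Zs G i s → Φ s

namespace Window

variable [Fintype F] {B : ℕ} {Zs A : Finset (Fin P.n)} {w u v : World P F} {i j : Fin P.n}

/-- What is sure at the beginning of an activation holds for the updated local state. -/
theorem sure (W : Window B Zs A w u) {Φ : PartySt P F → Prop} {v v' : World P F} {s : PartySt P F}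
    (hv : Path B Zs A w v) (hv' : Path B Zs A v v') (h : Sure Zs i Φ v)
    (ha : Activation B Zs i v s v') : Φ s :=
  h v'.record s (hv'.le (W.invAt hv) W.hQ W.hZ).2.record ha.ple ha.same ha.agree

/-- A share that everybody is ready to send arrives everywhere. -/
theorem openShare (W : Window B Zs A w u) {tag : RTag P} {q : Fin P.h} {t : ℕ}
    (h : ∀ i ∈ A, i ∈ P.S q → At B Zs A w u t (Sure Zs i fun s => s.myShare i tag q ≠ none))
    (hi : i ∈ A) : At B Zs A w u (t + B + 4) (Sure Zs i fun s => Arrived s i tag q) := by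
  intro v h1 h2 h3 G s _ h4 _ _
  refine h4.arrived (W.arrived (t := t + 2) hi (fun j hj hq => ?_) v h1 h2 (by omega))
  refine W.mail hj (h j hj hq) ?_
  intro v s v' g1 g2 g3 g4 hs
  exact W.sure g1 g2 g4 hs

theorem mem_of_selected (W : Window B Zs A w u) {r : ℕ} {z : Fin P.h} {x : Fin P.n}
    (hA : w.record.AllDone r) (l : Fin P.M) (hx : x ∈ w.record.st.Sel r z) (hxZ : x ∉ Zs) :
    x ∈ A := by
  obtain ⟨hop, -, -, h, -⟩ := Rec.selected_voteOK W.inv.decOK hA hx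
  obtain ⟨⟨d, c⟩, hd⟩ : ∃ d, w.deals (.summ r z hop x l) = some d :=
    Option.ne_none_iff_exists'.1 (by simpa [World.record] using h l)
  exact W.mem_of_started .refl hxZ ((W.inv.deals _ _ _ hd).2 hxZ).2

/-- All parts of an iteration in which no corrupt party withholds a part arrive everywhere. -/
theorem allParts (W : Window B Zs A w u) {r : ℕ} {zc : Fin P.h} {l : Fin P.M}
    (hc : ∀ i ∈ A, (w.parties i).conf r = some (zc, l))
    (hd : ∀ x ∈ Zs, ∀ z k, w.record.st.partDue r zc z x k →
      w.record.V (.part r z x k) ≠ none) (hi : i ∈ A) :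
    At B Zs A w u (B + 4) (Sure Zs i fun s =>
      ∀ z x k, s.partDue r zc z x k → s.got (.part r z x k)) := by
  intro v h1 h2 h3 G s _ h4 h5 _ z x k hdue
  have hsame := (W.sameAt h1 h2 hi).trans h5
  rw [hsame.partDue] at hdue
  obtain ⟨-, -, hdone, hcG⟩ := (W.agree hi).confSome _ _ (hc i hi)
  have hdueG := ((W.agree hi).ref.partDue (hdone _) (hdone _) z x k).2 hdue
  refine h4.got ?_
  by_cases hx : x ∈ Zs
  · refine W.got (t := 0) hi (sid := .part r z x k) ⟨zc, l, hc i hi, hdue⟩ (fun v' g1 g2 _ =>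
      (W.le g1).deals.ne_none ?_) v h1 h2 (by omega)
    simpa [World.record] using hd x hx z k hdueG
  · have hxA := W.mem_of_selected (Rec.conf_allDone hcG) l (Rec.partDue_sel hdueG).2.1 hx
    exact W.parts hi hxA (hc i hi) (by rw [hc x hxA]; simp) hdue v h1 h2 h3

/-- What the parties know once all parts of an iteration have arrived: the totals of the vectors
are those of the record `u.record`. -/
theorem known (W : Window B Zs A w u) {r : ℕ} {zc : Fin P.h} {l : Fin P.M} {t : ℕ}
    (hc : ∀ i ∈ A, (w.parties i).conf r = some (zc, l))
    (hp : ∀ i ∈ A, At B Zs A w u t (Sure Zs i fun s =>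
      ∀ z x k, s.partDue r zc z x k → s.got (.part r z x k)))
    (hi : i ∈ A) (h1 : Path B Zs A w v) (h2 : Path B Zs A v u)
    (h3 : w.clock.round + t ≤ v.clock.round) {G : Rec P F} {s : PartySt P F} (h4 : v.record ≤ G)
    (h5 : PLe (v.parties i) s) (h6 : SameCtl (v.parties i) s) (h7 : Agree Zs G i s) :
    s.conf r = some (zc, l) ∧ G.conf r = some (zc, l) ∧ (∀ z, s.optDone r z) ∧
      (∀ z x k, s.partDue r zc z x k → s.got (.part r z x k)) ∧
      (∀ z, s.opt r z = u.record.st.opt r z) ∧ (∀ z, G.st.opt r z = u.record.st.opt r z) ∧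
      (∀ z x k, s.partDue r zc z x k → G.tot (.part r z x k) = u.record.tot (.part r z x k)) ∧
      (∀ z, ∀ x ∈ s.Sel r z, G.tot (s.sumSid r z x l) = u.record.tot (s.sumSid r z x l)) ∧
      ∀ T, G.st.prodSum l T = u.record.st.prodSum l T := by
  have hvu := (h2.le (W.invAt h1) W.hQ W.hZ).2.record
  have hv := (W.invAt h1).agree i (W.mem hi).1
  have hsame := W.sameAt h1 h2 hi
  have hcv : (v.parties i).conf r = some (zc, l) := by rw [hsame.conf, hc i hi]
  obtain ⟨hr1, hr2, hdv, hcG⟩ := hv.confSome _ _ hcv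
  have hcs : s.conf r = some (zc, l) := by rw [h6.conf, hcv]
  obtain ⟨-, -, hds, hcG'⟩ := h7.confSome _ _ hcs
  have hdG : ∀ z, v.record.st.optDone r z := fun z => Rec.st_optDone.2 (Rec.conf_allDone hcG z)
  have hs : ∀ z, s.opt r z = v.record.st.opt r z := fun z => by
    rw [h6.opt, hv.ref.opt r z (hdv z)]
  have htot : ∀ {sid}, v.record.st.got sid → G.tot sid = u.record.tot sid := fun hg => by
    rw [Rec.tot_mono h4 hg, Rec.tot_mono hvu hg]
  have hst := hv.stage1 (hr1.trans hr2)
  refine ⟨hcs, hcG', hds, hp i hi v h1 h2 h3 G s h4 h5 h6 h7, fun z => ?_, fun z => ?_,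
    fun z x k hd => htot ?_, fun z x hx => htot ?_, fun T => ?_⟩
  · rw [hs, (Rec.ref_st hvu).opt r z (hdG z)]
  · rw [(Rec.ref_st h4).opt r z (hdG z), (Rec.ref_st hvu).opt r z (hdG z)]
  · rw [h6.partDue] at hd
    exact hv.ref.got (hp i hi v h1 h2 h3 _ _ (Rec.le_refl _) (.refl _) ⟨rfl, rfl, rfl, rfl⟩ hv
      z x k hd)
  · simp only [PartySt.Sel, PartySt.sumSid, hs] at hx ⊢
    exact (hdG z).2 x hx l
  · rw [hst.prodSum_eq h4, hst.prodSum_eq hvu]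

/-- If all parts of an iteration arrive, then everybody discards the same party. -/
theorem identify (W : Window B Zs A w u) {r : ℕ} {zc : Fin P.h} {l : Fin P.M}
    (hc : ∀ i ∈ A, (w.parties i).conf r = some (zc, l))
    (hp : ∀ i ∈ A, At B Zs A w u (B + 4) (Sure Zs i fun s =>
      ∀ z x k, s.partDue r zc z x k → s.got (.part r z x k))) :
    ∃ z x, x ∈ u.record.st.Sel r z ∧
      ∀ i ∈ A, At B Zs A w u (3 * B + 12) (Sure Zs i fun s => s.LD i r x) := by
  obtain ⟨i0, hi0⟩ := W.nonempty
  obtain ⟨-, -, -, hcw⟩ := (W.agree hi0).confSome _ _ (hc i0 hi0)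
  have hcu : u.record.conf r = some (zc, l) := Rec.conf_mono (W.le W.path).record hcw
  have hz0 := Rec.conf_ne_z0 hcu
  have hval : ∀ {s : PartySt P F} {i tag}, (∀ q, Arrived s i tag q) →
      (∀ q, i ∈ P.S q → s.myShare i tag q ≠ none) → s.recValue i tag ≠ none := fun h1 h2 =>
    PartySt.total_ne_none fun q => PartySt.recShareWith_ne_none (h1 q) (h2 q)
  rcases Rec.exists_cheat hcu with ⟨z, x, hz, hx, hne⟩ | ⟨j, k, hj, hk, hne⟩
  · refine ⟨z, x, hx, fun i hi => ?_⟩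
    have hbase : ∀ i ∈ A, ∀ q, i ∈ P.S q → At B Zs A w u (B + 4)
        (Sure Zs i fun s => s.myShare i (.sumCheck r z x) q ≠ none) := by
      intro i hi q hq v h1 h2 h3 G s h4 h5 h6 h7
      obtain ⟨hcs, -, hd, hg, ho, -⟩ := W.known hc hp hi h1 h2 h3 h4 h5 h6 h7
      have hxs : x ∈ s.Sel r z := by rw [PartySt.Sel, ho]; exact hx
      simp only [PartySt.myShare, if_pos hq, PartySt.baseShare, hcs]
      rw [if_pos ⟨hz, hxs, (hd z).2 x hxs l, fun k hk => hg z x k hk⟩]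
      simp
    intro v h1 h2 h3 G s h4 h5 h6 h7
    obtain ⟨hcs, hcG, hd, hg, ho, hoG, htp, hts, -⟩ :=
      W.known hc hp hi h1 h2 (by omega) h4 h5 h6 h7
    have hxs : x ∈ s.Sel r z := by rw [PartySt.Sel, ho]; exact hx
    obtain ⟨y, hy⟩ := Option.ne_none_iff_exists'.1 (hval (s := s) (i := i) (tag := .sumCheck r z x)
      (fun q => W.openShare (fun j hj hq => hbase j hj q hq) hi v h1 h2 (by omega) G s h4 h5 h6 h7)
      (fun q hq => hbase i hi q hq v h1 h2 (by omega) G s h4 h5 h6 h7))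
    obtain ⟨-, hyv⟩ := h7.sumCheck_value W.hQ W.hZ hcG hy
    have hpd : ∀ k, G.st.partDue r zc z x k ↔ u.record.st.partDue r zc z x k := fun k => by
      simp [PartySt.partDue, PartySt.Sel, hoG]
    have hpd' : ∀ k, s.partDue r zc z x k ↔ u.record.st.partDue r zc z x k := fun k => by
      simp [PartySt.partDue, PartySt.Sel, ho]
    have hsid : s.sumSid r z x l = u.record.st.sumSid r z x l := by simp [PartySt.sumSid, ho]
    have hsid' : G.st.sumSid r z x l = u.record.st.sumSid r z x l := by simp [PartySt.sumSid, hoG]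
    have hts := hts z x hxs
    rw [hsid] at hts
    simp only [PartySt.LD, hcs]
    refine Or.inl ⟨z, hz, hxs, y, ?_, hy⟩
    rw [hyv, hsid', hts]
    simp only [hpd]
    rw [Finset.sum_congr rfl fun k hk => htp z x k ((hpd' k).2 (Finset.mem_filter.1 hk).2)]
    exact hne
  · have hown : ∀ i ∈ A, ∀ q, i ∈ P.S q → At B Zs A w u (B + 4)
        (Sure Zs i fun s => s.myShare i (.pairDiff r j k) q ≠ none) := by
      intro i hi q hq v h1 h2 h3 G s h4 h5 h6 h7
      obtain ⟨hcs, -, hd, hg, ho, -⟩ := W.known hc hp hi h1 h2 h3 h4 h5 h6 h7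
      have hjs : j ∈ s.Sel r zc := by rw [PartySt.Sel, ho]; exact hj
      have hks : k ∈ s.Sel r P.z0 := by rw [PartySt.Sel, ho]; exact hk
      simp only [PartySt.myShare, if_pos hq, PartySt.baseShare, hcs]
      rw [if_pos ⟨hjs, hks, hg zc j k (Or.inl ⟨rfl, hjs, hks⟩),
        hg P.z0 k j (Or.inr ⟨rfl, hks, hjs⟩)⟩]
      simp
    have hbad : ∀ i ∈ A, At B Zs A w u (2 * B + 8) (Sure Zs i fun s => s.pairBad i r j k) := by
      intro i hi v h1 h2 h3 G s h4 h5 h6 h7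
      obtain ⟨hcs, hcG, hd, hg, ho, hoG, htp, -, -⟩ :=
        W.known hc hp hi h1 h2 (by omega) h4 h5 h6 h7
      have hjs : j ∈ s.Sel r zc := by rw [PartySt.Sel, ho]; exact hj
      have hks : k ∈ s.Sel r P.z0 := by rw [PartySt.Sel, ho]; exact hk
      have hne' : PartySt.total (fun q => s.recShareWith i (s.baseShare q (.pairDiff r j k))
          (.pairDiff r j k) q) ≠ none := by
        refine PartySt.total_ne_none fun q => PartySt.recShareWith_ne_none
          (W.openShare (fun j hj hq => hown j hj q hq) hi v h1 h2 (by omega) G s h4 h5 h6 h7)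
          fun hq => ?_
        have := hown i hi q hq v h1 h2 (by omega) G s h4 h5 h6 h7
        simp only [PartySt.myShare, if_pos hq] at this
        exact this
      obtain ⟨y, hy⟩ := Option.ne_none_iff_exists'.1 hne'
      obtain ⟨zc', l', hcG', -, -, -, -, hyv⟩ := h7.pairDiff_value W.hQ W.hZ hy
      rw [hcG] at hcG'
      cases hcG'
      refine ⟨y, ?_, hy⟩
      rw [hyv, htp zc j k (Or.inl ⟨rfl, hjs, hks⟩), htp P.z0 k j (Or.inr ⟨rfl, hks, hjs⟩)]
      exact sub_ne_zero.2 hne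
    have hown1 : ∀ i ∈ A, ∀ q, i ∈ P.S q → At B Zs A w u (2 * B + 8) (Sure Zs i fun s =>
        s.myShare i (.part r zc j k) q ≠ none ∧ s.myShare i (.part r P.z0 k j) q ≠ none ∧
        ∀ b, (∃ pq ∈ s.inter r zc j k, (if b then pq.2 else pq.1) = q) →
          s.myShare i (.inp r j k b) q ≠ none) := by
      intro i hi q hq v h1 h2 h3 G s h4 h5 h6 h7
      obtain ⟨hcs, -, hd, hg, ho, -⟩ := W.known hc hp hi h1 h2 (by omega) h4 h5 h6 h7
      have hjs : j ∈ s.Sel r zc := by rw [PartySt.Sel, ho]; exact hj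
      have hks : k ∈ s.Sel r P.z0 := by rw [PartySt.Sel, ho]; exact hk
      have hb := hbad i hi v h1 h2 h3 G s h4 h5 h6 h7
      have d1 : s.partDue r zc zc j k := Or.inl ⟨rfl, hjs, hks⟩
      have d2 : s.partDue r zc P.z0 k j := Or.inr ⟨rfl, hks, hjs⟩
      simp only [PartySt.myShare, if_pos hq, hcs]
      refine ⟨?_, ?_, fun b hpq => ?_⟩
      · rw [if_pos ⟨d1, hg _ _ _ d1, by rw [if_pos trivial]; exact hb⟩]
        simp
      · rw [if_pos ⟨d2, hg _ _ _ d2, by rw [if_neg hz0.symm]; exact hb⟩]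
        simp
      · rw [if_pos ⟨hjs, hks, hb, hpq⟩]
        simp
    have key : ∀ i ∈ A, ∀ v, Path B Zs A w v → Path B Zs A v u →
        w.clock.round + (3 * B + 12) ≤ v.clock.round → ∀ G s, v.record ≤ G →
        PLe (v.parties i) s → SameCtl (v.parties i) s → Agree Zs G i s →
        (u.record.tot (.part r zc j k) ≠ u.record.st.prodSum l (u.record.st.inter r zc j k) →
          s.LD i r j) ∧
        (u.record.tot (.part r P.z0 k j) ≠ u.record.st.prodSum l (u.record.st.inter r zc j k) →
          s.LD i r k) := by
      intro i hi v h1 h2 h3 G s h4 h5 h6 h7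
      obtain ⟨hcs, hcG, hd, hg, ho, hoG, htp, -, hps⟩ :=
        W.known hc hp hi h1 h2 (by omega) h4 h5 h6 h7
      have hjs : j ∈ s.Sel r zc := by rw [PartySt.Sel, ho]; exact hj
      have hks : k ∈ s.Sel r P.z0 := by rw [PartySt.Sel, ho]; exact hk
      have hb := hbad i hi v h1 h2 (by omega) G s h4 h5 h6 h7
      have hmy := fun q hq => hown1 i hi q hq v h1 h2 (by omega) G s h4 h5 h6 h7
      have harr : ∀ tag q, (∀ i ∈ A, i ∈ P.S q → At B Zs A w u (2 * B + 8)
          (Sure Zs i fun s => s.myShare i tag q ≠ none)) → Arrived s i tag q := fun tag q h =>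
        W.openShare h hi v h1 h2 (by omega) G s h4 h5 h6 h7
      obtain ⟨d, hd1⟩ := Option.ne_none_iff_exists'.1 (hval (s := s) (i := i)
        (tag := .part r zc j k) (fun q => harr _ q fun i' hi' hq v h1 h2 h3 G s h4 h5 h6 h7 =>
          (hown1 i' hi' q hq v h1 h2 h3 G s h4 h5 h6 h7).1) fun q hq => (hmy q hq).1)
      obtain ⟨e, he1⟩ := Option.ne_none_iff_exists'.1 (hval (s := s) (i := i)
        (tag := .part r P.z0 k j) (fun q => harr _ q fun i' hi' hq v h1 h2 h3 G s h4 h5 h6 h7 =>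
          (hown1 i' hi' q hq v h1 h2 h3 G s h4 h5 h6 h7).2.1) fun q hq => (hmy q hq).2.1)
      have hinp : ∀ b q, (∃ pq ∈ s.inter r zc j k, (if b then pq.2 else pq.1) = q) →
          s.recShare i (.inp r j k b) q ≠ none := by
        intro b q hpq
        refine PartySt.recShareWith_ne_none (harr _ q ?_) fun hq => (hmy q hq).2.2 b hpq
        intro i' hi' hq v g1 g2 g3 G' s' g4 g5 g6 g7
        refine (hown1 i' hi' q hq v g1 g2 g3 G' s' g4 g5 g6 g7).2.2 b ?_
        obtain ⟨-, -, -, -, ho', -⟩ := W.known hc hp hi' g1 g2 (by omega) g4 g5 g6 g7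
        simpa only [PartySt.inter, ho, ho'] using hpq
      have hin : ∀ pq ∈ s.inter r zc j k, s.recShare i (.inp r j k false) pq.1 ≠ none ∧
          s.recShare i (.inp r j k true) pq.2 ≠ none := fun pq hpq =>
        ⟨hinp false _ ⟨pq, hpq, by simp⟩, hinp true _ ⟨pq, hpq, by simp⟩⟩
      have hsum := h7.inp_value W.hQ W.hZ hcs hin
      have hint : G.st.inter r zc j k = u.record.st.inter r zc j k := by
        simp only [PartySt.inter, hoG]
      rw [hps, hint] at hsum
      have hde := (h7.part_value W.hQ W.hZ hd1).2
      have hee := (h7.part_value W.hQ W.hZ he1).2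
      rw [htp zc j k (Or.inl ⟨rfl, hjs, hks⟩)] at hde
      rw [htp P.z0 k j (Or.inr ⟨rfl, hks, hjs⟩)] at hee
      simp only [PartySt.LD, hcs]
      refine ⟨fun hn => Or.inr ⟨j, k, d, e, hjs, hks, hb, hd1, he1, hin, Or.inl ⟨rfl, ?_⟩⟩,
        fun hn => Or.inr ⟨j, k, d, e, hjs, hks, hb, hd1, he1, hin, Or.inr ⟨rfl, ?_⟩⟩⟩
      · rwa [hsum, hde]
      · rwa [hsum, hee]
    by_cases hjT : u.record.tot (.part r zc j k) = u.record.st.prodSum l (u.record.st.inter r zc j k)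
    · exact ⟨P.z0, k, hk, fun i hi v h1 h2 h3 G s h4 h5 h6 h7 =>
        (key i hi v h1 h2 h3 G s h4 h5 h6 h7).2 (by rw [← hjT]; exact hne.symm)⟩
    · exact ⟨zc, j, hj, fun i hi v h1 h2 h3 G s h4 h5 h6 h7 =>
        (key i hi v h1 h2 h3 G s h4 h5 h6 h7).1 hjT⟩

end Window

/-! ### The protocol terminates -/

namespace Window

variable [Fintype F] {B : ℕ} {Zs A : Finset (Fin P.n)} {w u v : World P F} {i j : Fin P.n}

/-- The transition to the next iteration does not last. -/
theorem conf_contra (W : Window B Zs A w u) (ht : w.clock.round + (7 * B + 30) ≤ u.clock.round)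
    {r : ℕ} (hr : ∀ j ∈ A, r ≤ (w.parties j).iter) (hc : ∀ j ∈ A, (w.parties j).conf r ≠ none)
    (hi : i ∈ A) (hir : (w.parties i).iter = r) : False := by
  have hn : 0 < P.n := i.pos
  have hend : (PartySt.gdIter P r → At B Zs A w u (7 * B + 24) (fun v =>
      ∀ k, (v.parties i).aba (.gd r k) ≠ none)) → False := by
    intro hX
    refine W.contra hi (t := 7 * B + 24) (by omega)
      (X := fun v => PartySt.gdIter P r → ∀ k, (v.parties i).aba (.gd r k) ≠ none)
      (fun v h1 h2 h3 hg => hX hg v h1 h2 h3) ?_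
    intro v s v' g1 g2 g3 g4 hs
    have hsame := (W.sameAt g1 (g2.trans g3) hi).trans hs.same
    have hsi : s.iter = r := hsame.iter.trans hir
    refine hs.agree.stepNext_ne (W.invAt (g1.trans g2)).decOK ?_ ?_ hs.quiet.2.2.2
    · rw [hsi, hsame.conf]
      exact hc i hi
    · rw [hsi]
      exact fun hg k => hs.ple.aba.ne_none (g4 hg k)
  refine hend fun hg => ?_
  have hwant : ∀ j ∈ A, ∀ k, (w.parties j).wantsA (.gd r k) := fun j hj k => ⟨hc j hj, hg⟩
  by_cases hall : ∀ j ∈ A, (w.parties j).iter = r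
  swap
  · push Not at hall
    obtain ⟨j, hj, hne⟩ := hall
    intro v g1 g2 g3 k
    refine W.aba (t := 0) hi (hwant i hi k) (fun v' g1 g2 _ => (W.le g1).dec.ne_none ?_) v g1 g2
      (by omega)
    have := (W.agree hj).gdDone r (lt_of_le_of_ne (hr j hj) (Ne.symm hne)) hg k
    simpa [World.record] using this
  obtain ⟨r', h1, h2, h3, h4⟩ := Rec.exists_iter_dealt W.inv.decOK W.hZ hn hg
  have hc' : ∀ j ∈ A, (w.parties j).conf r' ≠ none := fun j hj => by
    rcases h2.lt_or_eq with h | rfl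
    · exact (W.agree hj).confPast r' h1 (by rw [hall j hj]; exact h)
    · exact hc j hj
  obtain ⟨⟨zc, l⟩, hci⟩ := Option.ne_none_iff_exists'.1 (hc' i hi)
  have hcw := ((W.agree hi).confSome _ _ hci).2.2.2
  have hcall : ∀ j ∈ A, (w.parties j).conf r' = some (zc, l) := fun j hj => by
    obtain ⟨p, hp⟩ := Option.ne_none_iff_exists'.1 (hc' j hj)
    rw [hp, ← ((W.agree hj).confSome _ _ hp).2.2.2, hcw]
  obtain ⟨z, x, hx, hLD⟩ := W.identify hcall fun j hj => W.allParts hcall (h4 zc l hcw) hj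
  have hgd : w.record.GDDone r := by rw [← hir]; exact (W.agree hi).gdDone
  have hgd' : w.record.GDDone r' := fun r'' h => hgd r'' (h.trans_le h2)
  have hx' : x ∉ w.record.GD r := by
    rw [← h3, ← hgd'.GD_eq (W.le W.path).record]
    obtain ⟨hop, -, -, -, -, h5, -⟩ := Rec.selected_voteOK (W.invAt W.path).decOK
      (Rec.conf_allDone (Rec.conf_mono (W.le W.path).record hcw)) hx
    exact h5
  refine (W.elect (t := 3 * B + 14) (j0 := x) (sid := fun k => .gd r k) hwant (fun v k h => h)
    ?_ ?_ hi).mono (by omega)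
  · rintro j hj s hs ⟨k', hk'⟩ k hn
    have hsi : s.iter = r := hs.iter.trans (hall j hj)
    simp only [PartySt.newVote, hn, ne_eq, not_true_eq_false, if_false]
    rw [if_pos ⟨hsi.symm, by rw [hs.conf]; exact hc j hj, hg⟩]
    by_cases hg : k ∉ s.GD ∧ ∃ r', 1 ≤ r' ∧ r' ≤ r ∧ s.LD j r' k
    · rw [if_pos hg]
      simp
    · rw [if_neg hg, if_pos ⟨k', hk'⟩]
      simp
  · intro j hj
    refine W.vote hj (hLD j hj) ?_
    intro v s v' g1 g2 g3 g4 hs hn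
    have hsame := (W.sameAt g1 (g2.trans g3) hj).trans hs.same
    have hsi : s.iter = r := hsame.iter.trans (hall j hj)
    simp only [PartySt.newVote, hn, ne_eq, not_true_eq_false, if_false]
    rw [if_pos ⟨hsi.symm, by rw [hsame.conf]; exact hc j hj, hg⟩, if_pos]
    · simp
    refine ⟨?_, r', h1, h2, W.sure g1 g2 g4 hs⟩
    rw [hs.agree.gd, hsi, hgd.GD_eq (W.le (g1.trans g2)).record]
    exact hx'

/-- A long period without progress only occurs when everybody is done. -/
theorem out (W : Window B Zs A w u) (ht : w.clock.round + (7 * B + 30) ≤ u.clock.round)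
    (hi : i ∈ A) : (w.parties i).out ≠ none := by
  obtain ⟨i1, hi1, hmin⟩ := Finset.exists_min_image A (fun i => (w.parties i).iter) W.nonempty
  set r := (w.parties i1).iter with hr
  have h1 : 1 ≤ r := W.one_le_iter (by omega) hi1
  have hch : ∀ j ∈ A, (w.parties j).iter = r →
      (w.parties j).out ≠ none ∨ (w.parties j).conf r ≠ none := fun j hj hjr =>
    W.checked (by omega) h1 hmin hj hjr
  rcases hch i1 hi1 rfl with h2 | h2
  · obtain ⟨T, hT⟩ := Option.ne_none_iff_exists'.1 h2
    have hz := ((W.agree hi1).out T hT).2.1.conf_eq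
    have hnc : ∀ j ∈ A, (w.parties j).conf r = none := fun j hj => by
      by_contra hn
      obtain ⟨p, hp⟩ := Option.ne_none_iff_exists'.1 hn
      rw [← hr, ((W.agree hj).confSome _ _ hp).2.2.2] at hz
      simp at hz
    have hir : (w.parties i).iter = r := by
      by_contra hn
      exact (W.agree hi).confPast r h1 (lt_of_le_of_ne (hmin i hi) (Ne.symm hn)) (hnc i hi)
    exact (hch i hi hir).resolve_right fun h => h (hnc i hi)
  · exfalso
    obtain ⟨p, hp⟩ := Option.ne_none_iff_exists'.1 h2
    have hcp := ((W.agree hi1).confSome _ _ hp).2.2.2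
    refine W.conf_contra ht hmin (fun j hj => ?_) hi1 hr.symm
    rcases (hmin j hj).lt_or_eq with h | h
    · exact (W.agree hj).confPast r h1 h
    · refine (hch j hj h.symm).resolve_left fun ho => ?_
      obtain ⟨T, hT⟩ := Option.ne_none_iff_exists'.1 ho
      have hz := ((W.agree hj).out T hT).2.1.conf_eq
      rw [← h, hcp] at hz
      simp at hz

end Window

/-- A measure of the progress of a party. -/
def PartySt.progress (s : PartySt P F) : ℕ :=
  s.iter + ∑ r ∈ Finset.range (P.n ^ 3 + 1), ∑ z, (s.opt r z).hop +
    ((Finset.range (P.n ^ 3 + 1)).filter fun r => s.conf r ≠ none).card +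
    if s.out = none then 0 else 1

/-- A bound for the progress of a party. -/
def Params.maxProgress (P : Params) : ℕ :=
  P.n ^ 3 + (P.n ^ 3 + 1) * (P.h * (P.n + 1)) + (P.n ^ 3 + 1) + 1

section

variable {s s' : PartySt P F} {G G' : Rec P F} {Zs : Finset (Fin P.n)} {i : Fin P.n}

theorem Agree.progress_le (h : Agree Zs G i s) (hi : s.iter ≤ P.n ^ 3) :
    s.progress ≤ P.maxProgress := by
  have h1 : ∑ r ∈ Finset.range (P.n ^ 3 + 1), ∑ z, (s.opt r z).hop ≤
      (P.n ^ 3 + 1) * (P.h * (P.n + 1)) := by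
    refine (Finset.sum_le_card_nsmul _ _ (P.h * (P.n + 1)) fun r _ => ?_).trans (le_of_eq (by simp))
    exact (Finset.sum_le_card_nsmul _ _ (P.n + 1) fun z _ => (h.opt r z).hop_le).trans
      (le_of_eq (by simp))
  have h2 : ((Finset.range (P.n ^ 3 + 1)).filter fun r => s.conf r ≠ none).card ≤ P.n ^ 3 + 1 :=
    (Finset.card_filter_le _ _).trans (le_of_eq (by simp))
  unfold PartySt.progress Params.maxProgress
  split_ifs <;> omega

theorem PLe.out_le (h : PLe s s') :
    (if s.out = none then 0 else 1) ≤ if s'.out = none then 0 else 1 := by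
  by_cases ho : s.out = none
  · simp [ho]
  · rw [(h.out ho).1]

theorem PLe.conf_subset (h : PLe s s') (I : Finset ℕ) :
    (I.filter fun r => s.conf r ≠ none) ⊆ I.filter fun r => s'.conf r ≠ none :=
  Finset.monotone_filter_right _ fun _ _ hr => h.conf.ne_none hr

theorem PLe.progress_le (h : PLe s s') : s.progress ≤ s'.progress :=
  Nat.add_le_add (Nat.add_le_add (Nat.add_le_add h.iter
    (Finset.sum_le_sum fun r _ => Finset.sum_le_sum fun z _ => h.hop_le r z))
    (Finset.card_le_card (h.conf_subset _))) h.out_le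

/-- A party whose progress does not increase keeps its control. -/
theorem PLe.sameCtl (h : PLe s s') (ha : Agree Zs G i s) (ha' : Agree Zs G' i s')
    (hi : s'.iter ≤ P.n ^ 3) (hp : s'.progress ≤ s.progress) : SameCtl s s' := by
  have h1 := h.iter
  have h2 : ∑ r ∈ Finset.range (P.n ^ 3 + 1), ∑ z, (s.opt r z).hop ≤
      ∑ r ∈ Finset.range (P.n ^ 3 + 1), ∑ z, (s'.opt r z).hop :=
    Finset.sum_le_sum fun r _ => Finset.sum_le_sum fun z _ => h.hop_le r z
  have h3 := Finset.card_le_card (h.conf_subset (Finset.range (P.n ^ 3 + 1)))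
  have h4 := h.out_le
  unfold PartySt.progress at hp
  have e1 : s'.iter = s.iter := by omega
  refine ⟨e1, ?_, ?_, ?_⟩
  · have e2 : ∑ r ∈ Finset.range (P.n ^ 3 + 1), ∑ z, (s.opt r z).hop =
      ∑ r ∈ Finset.range (P.n ^ 3 + 1), ∑ z, (s'.opt r z).hop := by omega
    funext r z
    by_cases hr : r < P.n ^ 3 + 1
    · have e3 := (Finset.sum_eq_sum_iff_of_le fun r _ =>
        Finset.sum_le_sum fun z _ => h.hop_le r z).1 e2 r (Finset.mem_range.2 hr)
      have e4 := (Finset.sum_eq_sum_iff_of_le fun z _ => h.hop_le r z).1 e3 z (Finset.mem_univ _)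
      exact (h.hop r z).resolve_left (by omega)
    · rw [ha.optInit r z (Or.inl (by omega)), ha'.optInit r z (Or.inl (by omega))]
  · have e2 := Finset.eq_of_subset_of_card_le (h.conf_subset (Finset.range (P.n ^ 3 + 1))) (by omega)
    funext r
    by_cases hc : s'.conf r = none
    · rw [hc]
      by_contra hn
      exact h.conf.ne_none (Ne.symm hn) hc
    · have hr := (ha'.one_le_of_conf hc).2.1
      have : r ∈ (Finset.range (P.n ^ 3 + 1)).filter fun r => s.conf r ≠ none := by
        rw [e2, Finset.mem_filter, Finset.mem_range]
        exact ⟨by omega, hc⟩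
      exact h.conf.eq (Finset.mem_filter.1 this).2
  · by_cases ho : s.out = none
    · rw [ho]
      by_contra hn
      simp only [ho, if_true, if_neg hn] at hp
      omega
    · exact (h.out ho).1

end

section

variable [Fintype F] {B : ℕ} {Zs A : Finset (Fin P.n)} {w u v : World P F} {i : Fin P.n}

/-- In every period of `7 * B + 30` rounds in which a party of the quorum is not done, the total progress
increases. -/
theorem Path.progress (hQ : P.Q 4) (hZ : P.Covered Zs) (hq : P.Quorum A) (m : ℕ) :
    ∀ w : World P F, Inv Zs w → w.alive Zs = A → Path B Zs A w u →
      w.clock.round + m * (7 * B + 30) ≤ u.clock.round → ∀ i ∈ A, (u.parties i).out = none →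
      ∑ j ∈ A, (w.parties j).progress + m ≤ ∑ j ∈ A, (u.parties j).progress := by
  induction m with
  | zero =>
      intro w hw hA hp _ i hi _
      exact Finset.sum_le_sum fun j hj => ((hp.le hw hQ hZ).2.parties j).progress_le
  | succ m ih =>
      intro w hw hA hp ht i hi ho
      rw [Nat.succ_mul] at ht
      obtain ⟨v, h1, h2, h3⟩ := hp.exists_round (t := w.clock.round + (7 * B + 30)) (by omega)
        (by omega)
      obtain ⟨hv, hwv⟩ := h1.le hw hQ hZ
      have h4 := ih v hv (h1.alive hA) h2 (by omega) i hi ho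
      have h5 : ∑ j ∈ A, (w.parties j).progress ≤ ∑ j ∈ A, (v.parties j).progress :=
        Finset.sum_le_sum fun j hj => (hwv.parties j).progress_le
      rcases h5.lt_or_eq with h | h
      · omega
      -- a period in which the total progress does not change is a `Window`, which cannot be that long
      exfalso
      have hZi : ∀ j ∈ A, j ∉ Zs := fun j hj => by
        rw [← hA] at hj
        exact (Finset.mem_filter.1 hj).2.1
      have hW : Window B Zs A w v := ⟨hQ, hZ, hw, hA, hq, h1, fun j hj =>
        (hwv.parties j).sameCtl (hw.agree j (hZi j hj)) (hv.agree j (hZi j hj))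
          (hv.iter_le hQ hZ (hZi j hj))
          ((Finset.sum_eq_sum_iff_of_le fun j _ => (hwv.parties j).progress_le).1 h j hj).ge⟩
      have h6 := hW.out (by omega) hi
      have h7 := ((Path.le (h1.trans h2) hw hQ hZ).2.parties i).out h6
      rw [ho] at h7
      exact h6 h7.1.symm

/-- The number of rounds after which all parties are done if no further party receives its input. -/
def Params.delay (P : Params) (B : ℕ) : ℕ := (P.n * P.maxProgress + 1) * (7 * B + 30)

/-- Since the total progress is bounded, all parties are done after `Params.delay` rounds. -/
theorem Path.out (hQ : P.Q 4) (hZ : P.Covered Zs) (hq : P.Quorum A) (hw : Inv Zs w)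
    (hA : w.alive Zs = A) (hp : Path B Zs A w u)
    (ht : w.clock.round + P.delay B ≤ u.clock.round) (hi : i ∈ A) :
    (u.parties i).out ≠ none := by
  intro ho
  have h1 := hp.progress hQ hZ hq _ w hw hA ht i hi ho
  have hu := (hp.le hw hQ hZ).1
  have h2 : ∑ j ∈ A, (u.parties j).progress ≤ P.n * P.maxProgress := by
    refine (Finset.sum_le_card_nsmul A _ P.maxProgress fun j hj => ?_).trans ?_
    · have hj : j ∉ Zs := by
        rw [← hA] at hj
        exact (Finset.mem_filter.1 hj).2.1
      exact (hu.agree j hj).progress_le (hu.iter_le hQ hZ hj)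
    · rw [smul_eq_mul]
      exact Nat.mul_le_mul_right _ ((Finset.card_le_univ A).trans_eq (Fintype.card_fin _))
  omega

theorem Steps.le (h : Relation.ReflTransGen (Step B Zs) w u) (hw : Inv Zs w) (hQ : P.Q 4)
    (hZ : P.Covered Zs) : Inv Zs u ∧ WLe Zs w u := by
  induction h with
  | refl => exact ⟨hw, .refl _ _⟩
  | tail _ hs ih =>
      obtain ⟨h1, h2⟩ := ih.1.step hQ hZ hs
      exact ⟨h1, ih.2.trans h2⟩

theorem WLe.alive (h : WLe Zs w u) : w.alive Zs ⊆ u.alive Zs := fun i hi => by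
  simp only [World.alive, Finset.mem_filter, Finset.mem_univ, true_and] at hi ⊢
  exact ⟨hi.1, (h.parties i).started hi.2⟩

/-- Either no party receives its input during an execution, or there is a first such step. -/
theorem Steps.split (h : Relation.ReflTransGen (Step B Zs) w u) (hA : w.alive Zs = A)
    (hw : Inv Zs w) (hQ : P.Q 4) (hZ : P.Covered Zs) :
    Path B Zs A w u ∨ ∃ v v', Path B Zs A w v ∧ Step B Zs v v' ∧ A ⊂ v'.alive Zs ∧
      Relation.ReflTransGen (Step B Zs) v' u := by
  induction h with
  | refl => exact Or.inl .refl
  | @tail b c hb hs ih =>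
      rcases ih with ih | ⟨v, v', h1, h2, h3, h4⟩
      · have hbA := ih.alive hA
        have hsub := ((ih.le hw hQ hZ).1.step hQ hZ hs).2.alive
        rw [hbA] at hsub
        rcases hsub.eq_or_ssubset with he | he
        · exact Or.inl (ih.tail ⟨hs, hbA, he.symm⟩)
        · exact Or.inr ⟨b, c, ih, hs, he, .refl⟩
      · exact Or.inr ⟨v, v', h1, h2, h3, h4.tail hs⟩

/-- Induction on the number `m` of parties that may yet receive their input: the period before the next
of them does so is either long enough for the parties to be done, or it can be skipped. -/
theorem Steps.out_aux (hQ : P.Q 4) (hZ : P.Covered Zs) (m : ℕ) :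
    ∀ w : World P F, Inv Zs w → Relation.ReflTransGen (Step B Zs) w u → i ∈ w.alive Zs →
      P.Quorum (w.alive Zs) → P.n ≤ (w.alive Zs).card + m →
      w.clock.round + (m + 1) * P.delay B ≤ u.clock.round → (u.parties i).out ≠ none := by
  induction m with
  | zero =>
      intro w hw h hi hq hm ht
      rcases Steps.split h rfl hw hQ hZ with hp | ⟨v, v', h1, h2, h3, h4⟩
      · exact hp.out hQ hZ hq hw rfl (by omega) hi
      · have h5 := Finset.card_lt_card h3
        have h6 := (Finset.card_le_univ (v'.alive Zs)).trans_eq (Fintype.card_fin _)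
        omega
  | succ m ih =>
      intro w hw h hi hq hm ht
      rw [Nat.succ_mul] at ht
      rcases Steps.split h rfl hw hQ hZ with hp | ⟨v, v', h1, h2, h3, h4⟩
      · exact hp.out hQ hZ hq hw rfl (by omega) hi
      · have hv := (h1.le hw hQ hZ).1
        have hv' := hv.step hQ hZ h2
        rcases Nat.lt_or_ge v.clock.round (w.clock.round + P.delay B) with hlt | hge
        · have h5 := h2.round_le
          have h6 := Finset.card_lt_card h3
          exact ih v' hv'.1 h4 (h3.1 hi) (hq.mono h3.1) (by omega) (by omega)
        · have h5 := h1.out hQ hZ hq hw rfl hge hi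
          have h6 := ((hv'.2.trans (Steps.le h4 hv'.1 hQ hZ).2).parties i).out h5
          rw [h6.1]
          exact h5

/-- The factors `n + 1`, `n * maxProgress + 1` and `7 * B + 30` are at most the first, eighth and seventh
power of `n + h + B + 2`, which explains the exponent `16`. -/
theorem Params.delay_le (P : Params) (B : ℕ) {C : ℕ} (hC : 16 ≤ C) :
    (P.n + 1) * P.delay B ≤ (P.n + P.h + B + 2) ^ C := by
  obtain ⟨N, hN⟩ : ∃ N, N = P.n + P.h + B + 2 := ⟨_, rfl⟩
  rw [← hN]
  have hN2 : 2 ≤ N := by omega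
  have hpow : ∀ {a b : ℕ}, a ≤ b → N ^ a ≤ N ^ b := fun h => Nat.pow_le_pow_right (by omega) h
  have h1 : P.n + 1 ≤ N := by omega
  have h2 : P.n ^ 3 + 1 ≤ N ^ 3 := by
    refine le_trans ?_ (Nat.pow_le_pow_left h1 3)
    nlinarith [Nat.zero_le P.n]
  have h3 : (P.n ^ 3 + 1) * (P.h * (P.n + 1)) ≤ N ^ 5 :=
    calc _ ≤ N ^ 3 * (N * N) := Nat.mul_le_mul h2 (Nat.mul_le_mul (by omega) h1)
      _ = N ^ 5 := by rw [← sq, ← pow_add]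
  have h4 : P.maxProgress ≤ N ^ 7 := by
    have h5 := hpow (show 3 ≤ 5 by norm_num)
    have h6 : N ^ 7 = N ^ 5 * N ^ 2 := by rw [← pow_add]
    have h7 : 4 ≤ N ^ 2 := by nlinarith
    have h8 : N ^ 5 * 4 ≤ N ^ 7 := by rw [h6]; exact Nat.mul_le_mul_left _ h7
    unfold Params.maxProgress
    omega
  have h5 : P.n * P.maxProgress + 1 ≤ N ^ 8 :=
    calc P.n * P.maxProgress + 1 ≤ P.n * N ^ 7 + N ^ 7 :=
          Nat.add_le_add (Nat.mul_le_mul_left _ h4) (Nat.one_le_pow _ _ (by omega))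
      _ = (P.n + 1) * N ^ 7 := (Nat.succ_mul _ _).symm
      _ ≤ N * N ^ 7 := Nat.mul_le_mul_right _ h1
      _ = N ^ 8 := (pow_succ' N 7).symm
  have h6 : 7 * B + 30 ≤ N ^ 7 :=
    calc 7 * B + 30 ≤ N * 2 ^ 6 := by omega
      _ ≤ N * N ^ 6 := Nat.mul_le_mul_left _ (Nat.pow_le_pow_left hN2 6)
      _ = N ^ 7 := (pow_succ' N 6).symm
  calc (P.n + 1) * P.delay B ≤ N * (N ^ 8 * N ^ 7) :=
        Nat.mul_le_mul h1 (Nat.mul_le_mul h5 h6)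
    _ = N ^ 16 := by rw [← pow_add, ← pow_succ']
    _ ≤ N ^ C := hpow hC

/-- A party outputs its shares soon after it and a quorum of honest parties have received their
input. -/
theorem Steps.out (hQ : P.Q 4) (hZ : P.Covered Zs) {C : ℕ} (hC : 16 ≤ C) (hw : Inv Zs w)
    (h : Relation.ReflTransGen (Step B Zs) w u) (hi : i ∈ w.alive Zs) (hq : P.Quorum (w.alive Zs))
    (ht : w.clock.round + (P.n + P.h + B + 2) ^ C ≤ u.clock.round) : (u.parties i).out ≠ none :=
  Steps.out_aux hQ hZ P.n w hw h hi hq (Nat.le_add_left _ _)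
    (le_trans (Nat.add_le_add_left (P.delay_le B hC) _) ht)

end

/-! ### Shifts of the hidden shares -/

/-- A change of the shares that the adversary does not see: the changes of the input sharings of
the honest parties, and a sharing of `0` for each triple, by which the sharing of the product is
changed in addition. -/
abbrev Shift (P : Params) (F : Type) : Type :=
  (Fin P.n → Bool → Fin P.M → Fin P.h → F) × (Fin P.M → Fin P.h → F)

/-- Only shares of honest dealers that the adversary does not see are changed. -/
structure Shift.Valid (Zs : Finset (Fin P.n)) (g : Shift P F) : Prop where
  corrupt : ∀ j ∈ Zs, ∀ b l q, g.1 j b l q = 0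
  visible : ∀ j b l q, Visible Zs q → g.1 j b l q = 0
  visible' : ∀ l q, Visible Zs q → g.2 l q = 0
  sum : ∀ l, ∑ q, g.2 l q = 0

/-- The setting of the simulation: `qs` is the index of a set of the structure that contains all
corrupt parties, so that no share with this index is seen by the adversary. -/
structure Hidden (Zs : Finset (Fin P.n)) (qs : Fin P.h) (g : Shift P F) : Prop where
  hQ : P.Q 4
  sub : Zs ⊆ P.Z qs
  valid : g.Valid Zs

theorem Hidden.hZ {Zs : Finset (Fin P.n)} {qs : Fin P.h} {g : Shift P F} (H : Hidden Zs qs g) :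
    P.Covered Zs := ⟨qs, H.sub⟩

namespace Rec

variable {G G' : Rec P F} {g : Shift P F} {qs : Fin P.h} {Zs : Finset (Fin P.n)}

/-- The change of a factor. -/
def dFactor (G : Rec P F) (g : Shift P F) (b : Bool) (l : Fin P.M) (q : Fin P.h) : F :=
  ∑ j ∈ G.st.CS, g.1 j b l q

/-- The change of a summand. -/
def dProd (G : Rec P F) (g : Shift P F) (l : Fin P.M) (pq : Fin P.h × Fin P.h) : F :=
  (G.st.factor false l pq.1 + G.dFactor g false l pq.1) *
    (G.st.factor true l pq.2 + G.dFactor g true l pq.2) -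
    G.st.factor false l pq.1 * G.st.factor true l pq.2

/-- The contribution of a summand to the change of the sharing of a sum of summands. The parties
outside `P.S qs` include all corrupt ones, so that a corrupt party never holds the summand
`(qs, qs)`. -/
def dShare (G : Rec P F) (qs : Fin P.h) (g : Shift P F) (l : Fin P.M)
    (pq : Fin P.h × Fin P.h) (q : Fin P.h) : F :=
  (if q = qs then G.dProd g l pq else 0) + if pq = (qs, qs) then g.2 l q else 0

/-- The change of the vector dealt in a VSS instance. -/
def dDeal (G : Rec P F) (qs : Fin P.h) (g : Shift P F) : VSid P → Fin P.h → F
  | .input j b l => g.1 j b l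
  | .summ r z hop j l =>
      if h : ∃ o, OptReach G.D r z o ∧ o.hop = hop then
        ∑ pq ∈ h.choose.summ j, G.dShare qs g l pq
      else 0
  | .part r z j k =>
      match G.conf r with
      | none => 0
      | some (zc, l) => ∑ pq ∈ G.st.partSumms r zc z j k, G.dShare qs g l pq

/-- The change of the output. -/
def dOut (G : Rec P F) (qs : Fin P.h) (g : Shift P F) : Table P F := fun l =>
  ![G.dFactor g false l, G.dFactor g true l, ∑ pq, G.dShare qs g l pq]

theorem dFactor_visible (hg : g.Valid Zs) {q : Fin P.h} (hq : Visible Zs q) (b : Bool)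
    (l : Fin P.M) : G.dFactor g b l q = 0 :=
  Finset.sum_eq_zero fun j _ => hg.visible j b l q hq

theorem not_visible (hqs : Zs ⊆ P.Z qs) : ¬ Visible Zs qs := by
  rintro ⟨i, hi, hS⟩
  simp only [Params.S, Finset.mem_compl] at hS
  exact hS (hqs hi)

theorem sum_dShare (hg : g.Valid Zs) (l : Fin P.M) (pq : Fin P.h × Fin P.h) :
    ∑ q, G.dShare qs g l pq q = G.dProd g l pq := by
  simp only [dShare, Finset.sum_add_distrib, Finset.sum_ite_eq', Finset.mem_univ, if_true]
  split_ifs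
  · rw [hg.sum, add_zero]
  · simp

theorem dShare_visible (hg : g.Valid Zs) (hqs : Zs ⊆ P.Z qs) {q : Fin P.h} (hq : Visible Zs q)
    (l : Fin P.M) (pq : Fin P.h × Fin P.h) : G.dShare qs g l pq q = 0 := by
  have hne : q ≠ qs := by
    rintro rfl
    exact not_visible hqs hq
  simp [dShare, hne, hg.visible' l q hq]

/-- The summands that a corrupt party holds do not change. -/
theorem dShare_corrupt (hg : g.Valid Zs) (hqs : Zs ⊆ P.Z qs) {j : Fin P.n} (hj : j ∈ Zs)
    {pq : Fin P.h × Fin P.h} (h : j ∈ P.S pq.1 ∧ j ∈ P.S pq.2) (l : Fin P.M) :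
    G.dShare qs g l pq = 0 := by
  have h1 : Visible Zs pq.1 := ⟨j, hj, h.1⟩
  have hne : pq ≠ (qs, qs) := by
    rintro rfl
    exact not_visible hqs h1
  funext q
  simp [dShare, dProd, hne, dFactor_visible hg h1, dFactor_visible hg ⟨j, hj, h.2⟩]

theorem reach_opt' (G : Rec P F) (r : ℕ) (z : Fin P.h) : OptReach G.D r z (G.opt r z) := by
  unfold opt
  split_ifs with h
  · exact h.choose_spec.1
  · exact .init

theorem mem_S_of_partSumms {r : ℕ} {zc z : Fin P.h} {j k : Fin P.n} {pq : Fin P.h × Fin P.h}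
    (h : pq ∈ G.st.partSumms r zc z j k) :
    (j ∈ P.S pq.1 ∧ j ∈ P.S pq.2) ∧ k ∈ P.S pq.1 ∧ k ∈ P.S pq.2 := by
  unfold PartySt.partSumms PartySt.inter at h
  split_ifs at h
  · rw [Finset.mem_inter] at h
    exact ⟨(G.reach_opt' _ _).mem_S_of_mem_summ h.1, (G.reach_opt' _ _).mem_S_of_mem_summ h.2⟩
  · rw [Finset.mem_inter] at h
    exact ⟨(G.reach_opt' _ _).mem_S_of_mem_summ h.2, (G.reach_opt' _ _).mem_S_of_mem_summ h.1⟩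

theorem dDeal_summ {r : ℕ} {z : Fin P.h} {o : OptSt P} (ho : OptReach G.D r z o) (j : Fin P.n)
    (l : Fin P.M) : G.dDeal qs g (.summ r z o.hop j l) = ∑ pq ∈ o.summ j, G.dShare qs g l pq := by
  have h : ∃ o', OptReach G.D r z o' ∧ o'.hop = o.hop := ⟨o, ho, rfl⟩
  simp only [dDeal]
  rw [dif_pos h, h.choose_spec.1.eq_of_hop ho h.choose_spec.2]

theorem dDeal_part {r : ℕ} {zc z : Fin P.h} {l : Fin P.M} (hc : G.conf r = some (zc, l))
    (j k : Fin P.n) : G.dDeal qs g (.part r z j k) =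
      ∑ pq ∈ G.st.partSumms r zc z j k, G.dShare qs g l pq := by
  simp only [dDeal, hc]

/-- The vectors dealt by corrupt parties do not change. -/
theorem dDeal_corrupt (hg : g.Valid Zs) (hqs : Zs ⊆ P.Z qs) {sid : VSid P}
    (h : sid.dealer ∈ Zs) : G.dDeal qs g sid = 0 := by
  cases sid with
  | input j b l => exact funext fun q => hg.corrupt j h b l q
  | summ r z hop j l =>
      simp only [dDeal]
      split_ifs with ho
      · exact Finset.sum_eq_zero fun pq hpq =>
          dShare_corrupt hg hqs h (ho.choose_spec.1.mem_S_of_mem_summ hpq) l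
      · rfl
  | part r z j k =>
      cases hc : G.conf r with
      | none => simp only [dDeal, hc]
      | some p =>
          obtain ⟨zc, l⟩ := p
          rw [dDeal_part hc]
          exact Finset.sum_eq_zero fun pq hpq =>
            dShare_corrupt hg hqs h (mem_S_of_partSumms hpq).1 l

/-- The shares that the adversary sees do not change. -/
theorem dDeal_visible (hg : g.Valid Zs) (hqs : Zs ⊆ P.Z qs) {q : Fin P.h} (hq : Visible Zs q)
    (sid : VSid P) : G.dDeal qs g sid q = 0 := by
  cases sid with
  | input j b l => exact hg.visible j b l q hq
  | summ r z hop j l =>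
      simp only [dDeal]
      split_ifs with ho
      · rw [Finset.sum_apply]
        exact Finset.sum_eq_zero fun pq _ => dShare_visible hg hqs hq l pq
      · rfl
  | part r z j k =>
      cases hc : G.conf r with
      | none => simp only [dDeal, hc, Pi.zero_apply]
      | some p =>
          obtain ⟨zc, l⟩ := p
          rw [dDeal_part hc, Finset.sum_apply]
          exact Finset.sum_eq_zero fun pq _ => dShare_visible hg hqs hq l pq

theorem Stage1.dShare_eq (h : G.Stage1) (hG : G ≤ G') : G'.dShare qs g = G.dShare qs g := by
  funext l pq q
  simp only [dShare, dProd, dFactor, h.factor_eq hG, h.CS_eq hG]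

theorem Stage1.dOut_eq (h : G.Stage1) (hG : G ≤ G') : G'.dOut qs g = G.dOut qs g := by
  unfold dOut
  rw [h.dShare_eq hG]
  funext l
  congr 1
  · funext q
    simp only [dFactor, h.CS_eq hG]
  · congr 1
    funext q
    simp only [dFactor, h.CS_eq hG]

/-- The change of a vector is known when it is dealt. -/
theorem DealOK.dDeal_eq {sid : VSid P} {v : Fin P.h → F} (h : G.DealOK sid v) (hG : G ≤ G') :
    G'.dDeal qs g sid = G.dDeal qs g sid := by
  cases sid with
  | input j b l => rfl
  | summ r z hop j l =>
      obtain ⟨-, h1, o, h2, rfl, -⟩ := h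
      rw [dDeal_summ h2, dDeal_summ (h2.mono hG.1), h1.dShare_eq hG]
  | part r z j k =>
      obtain ⟨h1, zc, l, hc, -⟩ := h
      have hD := fun z => st_optDone.2 (conf_allDone hc z)
      rw [dDeal_part hc, dDeal_part (conf_mono hG hc), h1.dShare_eq hG,
        (ref_st hG).partSumms (hD _) (hD _)]

end Rec

/-! ### Local computations commute with shifts -/

section

variable {i : Fin P.n}

theorem mask_add (v v' : Fin P.h → F) : mask i (v + v') = mask i v + mask i v' := by
  funext q
  simp only [mask, Pi.add_apply]
  split_ifs <;> simp

theorem mask_sum {ι : Type} (I : Finset ι) (v : ι → Fin P.h → F) :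
    mask i (∑ x ∈ I, v x) = ∑ x ∈ I, mask i (v x) := by
  funext q
  simp only [mask, Finset.sum_apply]
  split_ifs <;> simp

theorem mask_of_mem (v : Fin P.h → F) {q : Fin P.h} (hq : i ∈ P.S q) : mask i v q = v q := by
  simp [mask, hq]

end

namespace PartySt

/-- The state of party `i` after a change `δ` of the dealt vectors and `ρ` of the output. -/
def shift (i : Fin P.n) (δ : VSid P → Fin P.h → F) (ρ : Table P F) (s : PartySt P F) :
    PartySt P F :=
  { s with
    vss := fun sid => (s.vss sid).map fun v => v + mask i (δ sid)
    out := s.out.map fun T l x => T l x + mask i (ρ l x) }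

variable {i : Fin P.n} {δ : VSid P → Fin P.h → F} {ρ : Table P F} {s : PartySt P F}

theorem shift_got {sid : VSid P} : (s.shift i δ ρ).got sid ↔ s.got sid := by
  simp [got, shift]

theorem shift_val {sid : VSid P} (h : s.got sid) (q : Fin P.h) :
    (s.shift i δ ρ).val sid q = s.val sid q + mask i (δ sid) q := by
  obtain ⟨v, hv⟩ := Option.ne_none_iff_exists'.1 h
  simp [val, shift, hv]

theorem shift_optDone {r : ℕ} {z : Fin P.h} : (s.shift i δ ρ).optDone r z ↔ s.optDone r z :=
  and_congr Iff.rfl (forall₃_congr fun _ _ _ => shift_got)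

theorem shift_out : (s.shift i δ ρ).out = none ↔ s.out = none := by
  simp [shift]

end PartySt

namespace Agree

variable {Zs : Finset (Fin P.n)} {G : Rec P F} {i : Fin P.n} {s : PartySt P F} {g : Shift P F}
  {qs : Fin P.h} {ρ : Table P F}

theorem shift_factor (h : Agree Zs G i s) (hi : 1 ≤ s.iter) (b : Bool) (l : Fin P.M) :
    (s.shift i (G.dDeal qs g) ρ).factor b l = s.factor b l + mask i (G.dFactor g b l) := by
  funext q
  have h1 := (h.stage hi).2
  have h2 := (h.mono_aux hi).2
  have e : mask i (G.dFactor g b l) q = ∑ j ∈ s.CS, mask i (g.1 j b l) q := by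
    rw [h2, ← Finset.sum_apply, ← mask_sum]
    congr 1
    funext q
    simp [Rec.dFactor]
  rw [Pi.add_apply, e, PartySt.factor, PartySt.factor, ← Finset.sum_add_distrib]
  exact Finset.sum_congr rfl fun j hj => PartySt.shift_val (h1 j hj b l) q

theorem shift_prodSum (h : Agree Zs G i s) (hi : 1 ≤ s.iter) (l : Fin P.M)
    {T : Finset (Fin P.h × Fin P.h)} (hT : ∀ pq ∈ T, i ∈ P.S pq.1 ∧ i ∈ P.S pq.2) :
    (s.shift i (G.dDeal qs g) ρ).prodSum l T = s.prodSum l T + ∑ pq ∈ T, G.dProd g l pq := by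
  rw [PartySt.prodSum, PartySt.prodSum, ← Finset.sum_add_distrib]
  refine Finset.sum_congr rfl fun pq hpq => ?_
  rw [h.shift_factor hi, h.shift_factor hi, Pi.add_apply, Pi.add_apply,
    mask_of_mem _ (hT pq hpq).1, mask_of_mem _ (hT pq hpq).2, Rec.dProd,
    h.factor hi (hT pq hpq).1, h.factor hi (hT pq hpq).2]
  ring

theorem dDeal_sumSid (h : Agree Zs G i s) {r : ℕ} {z : Fin P.h} {j : Fin P.n}
    (hj : j ∈ s.Sel r z) (l : Fin P.M) :
    G.dDeal qs g (s.sumSid r z j l) = ∑ pq ∈ (s.opt r z).summ j, G.dShare qs g l pq := by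
  obtain ⟨o, h1, h2, -, h3, -⟩ := (h.opt r z).exists_of_selected hj
  rw [← h3, ← Rec.dDeal_summ h1, h2]
  rfl

theorem shift_cShare (h : Agree Zs G i s) {r : ℕ} {z : Fin P.h} (hd : s.optDone r z)
    (l : Fin P.M) : (s.shift i (G.dDeal qs g) ρ).cShare r z l =
      s.cShare r z l + mask i (∑ pq, G.dShare qs g l pq) := by
  funext q
  have e : ∑ pq, G.dShare qs g l pq = ∑ j ∈ s.Sel r z, G.dDeal qs g (s.sumSid r z j l) := by
    rw [← (h.opt r z).sum_summ, hd.1, Finset.sum_empty, add_zero]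
    exact Finset.sum_congr rfl fun j hj => (h.dDeal_sumSid hj l).symm
  rw [Pi.add_apply, e, mask_sum, Finset.sum_apply, PartySt.cShare, PartySt.cShare,
    ← Finset.sum_add_distrib]
  exact Finset.sum_congr rfl fun j hj => PartySt.shift_val (hd.2 j hj l) q

/-- The differences that are opened do not change, not even share by share. -/
theorem shift_baseShare (h : Agree Zs G i s) {q : Fin P.h} (hq : i ∈ P.S q) (tag : RTag P) :
    (s.shift i (G.dDeal qs g) ρ).baseShare q tag = s.baseShare q tag := by
  cases tag with
  | diff r z l =>
      simp only [PartySt.baseShare, PartySt.shift_optDone]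
      refine if_ctx_congr Iff.rfl (fun hd => ?_) fun _ => rfl
      rw [h.shift_cShare hd.1, h.shift_cShare hd.2]
      simp
  | sumCheck r z j =>
      simp only [PartySt.baseShare]
      change (match s.conf r with | none => none | some (zc, l) => _) = _
      cases hc : s.conf r with
      | none => rfl
      | some p =>
          obtain ⟨zc, l⟩ := p
          obtain ⟨-, -, hd, hcG⟩ := h.confSome _ _ hc
          simp only [PartySt.shift_got]
          refine if_ctx_congr Iff.rfl (fun hcond => ?_) fun _ => rfl
          obtain ⟨h1, h2, h3, h4⟩ := hcond
          congr 1
          have h5 : ∀ k ∈ Finset.univ.filter (fun k => s.partDue r zc z j k),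
              (s.shift i (G.dDeal qs g) ρ).val (.part r z j k) q =
              s.val (.part r z j k) q + G.dDeal qs g (.part r z j k) q := fun k hk => by
            rw [PartySt.shift_val (h4 k (Finset.mem_filter.1 hk).2), mask_of_mem _ hq]
          change (s.shift i (G.dDeal qs g) ρ).val (s.sumSid r z j l) q -
            ∑ k ∈ Finset.univ.filter (fun k => s.partDue r zc z j k),
              (s.shift i (G.dDeal qs g) ρ).val (.part r z j k) q = _
          rw [PartySt.shift_val h3, mask_of_mem _ hq, Finset.sum_congr rfl h5,
            Finset.sum_add_distrib, h.dDeal_sumSid h2]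
          have h6 : ∑ k ∈ Finset.univ.filter (fun k => s.partDue r zc z j k),
              G.dDeal qs g (.part r z j k) q =
              (∑ pq ∈ (s.opt r z).summ j, G.dShare qs g l pq) q := by
            rw [← Finset.sum_apply, ← h.ref.opt r z (hd z)]
            change _ = (∑ pq ∈ (G.opt r z).summ j, G.dShare qs g l pq) q
            rw [← Rec.sum_partSumms hcG h1 (by rw [h.ref.Sel (hd z)]; exact h2)]
            simp only [h.ref.partDue (hd zc) (hd P.z0), Rec.dDeal_part hcG]
          rw [h6]
          ring
  | pairDiff r j k =>
      simp only [PartySt.baseShare]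
      change (match s.conf r with | none => none | some (zc, l) => _) = _
      cases hc : s.conf r with
      | none => rfl
      | some p =>
          obtain ⟨zc, l⟩ := p
          obtain ⟨-, -, hd, hcG⟩ := h.confSome _ _ hc
          simp only [PartySt.shift_got]
          refine if_ctx_congr Iff.rfl (fun hcond => ?_) fun _ => rfl
          rw [PartySt.shift_val hcond.2.2.1, PartySt.shift_val hcond.2.2.2, mask_of_mem _ hq,
            mask_of_mem _ hq, Rec.dDeal_part hcG, Rec.dDeal_part hcG, PartySt.partSumms,
            PartySt.partSumms, if_pos rfl, if_neg (Rec.conf_ne_z0 hcG).symm]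
          simp
  | part r z j k => rfl
  | inp r j k b => rfl

theorem shift_recShareWith {own own' : Option F} {tag : RTag P} {q : Fin P.h}
    {δ : VSid P → Fin P.h → F} (ho : i ∈ P.S q → own' = own) :
    (s.shift i δ ρ).recShareWith i own' tag q = s.recShareWith i own tag q := by
  unfold PartySt.recShareWith
  exact if_ctx_congr Iff.rfl ho fun _ => rfl

theorem shift_pairBad (h : Agree Zs G i s) {r : ℕ} {j k : Fin P.n} :
    (s.shift i (G.dDeal qs g) ρ).pairBad i r j k ↔ s.pairBad i r j k := by
  unfold PartySt.pairBad
  simp only [shift_recShareWith fun hq => h.shift_baseShare hq _]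

/-- What is opened of a pair of parts that differ does not change, as one of the two parties is
corrupt. -/
theorem shift_myShare (h : Agree Zs G i s) (H : Hidden Zs qs g) (hG : G.DealsOK Zs)
    (tag : RTag P) (q : Fin P.h) :
    (s.shift i (G.dDeal qs g) ρ).myShare i tag q = s.myShare i tag q := by
  unfold PartySt.myShare
  refine if_ctx_congr Iff.rfl (fun hq => ?_) fun _ => rfl
  cases tag with
  | diff r z l => exact h.shift_baseShare hq _
  | sumCheck r z j => exact h.shift_baseShare hq _
  | pairDiff r j k => exact h.shift_baseShare hq _
  | part r z j k =>
      change (match s.conf r with | none => none | some (zc, l) => _) =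
        match s.conf r with | none => none | some (zc, l) => _
      cases hc : s.conf r with
      | none => rfl
      | some p =>
          obtain ⟨zc, l⟩ := p
          obtain ⟨-, -, hd, hcG⟩ := h.confSome _ _ hc
          simp only [PartySt.shift_got, h.shift_pairBad]
          refine if_ctx_congr Iff.rfl (fun hcond => ?_) fun _ => rfl
          obtain ⟨-, h2, h3⟩ := hcond
          rw [PartySt.shift_val h2, mask_of_mem _ hq, Rec.dDeal_part hcG]
          have hbad : j ∈ Zs ∨ k ∈ Zs := by
            split_ifs at h3
            · exact h.pairBad_corrupt H.hQ H.hZ hG h3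
            · exact (h.pairBad_corrupt H.hQ H.hZ hG h3).symm
          rw [Finset.sum_eq_zero, Pi.zero_apply, add_zero]
          intro pq hpq
          have hS := Rec.mem_S_of_partSumms hpq
          rcases hbad with hb | hb
          · exact Rec.dShare_corrupt H.valid H.sub hb hS.1 l
          · exact Rec.dShare_corrupt H.valid H.sub hb hS.2 l
  | inp r j k b =>
      change (match s.conf r with | none => none | some (zc, l) => _) =
        match s.conf r with | none => none | some (zc, l) => _
      cases hc : s.conf r with
      | none => rfl
      | some p =>
          obtain ⟨zc, l⟩ := p
          obtain ⟨hr, hr', hd, hcG⟩ := h.confSome _ _ hc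
          simp only [h.shift_pairBad]
          refine if_ctx_congr Iff.rfl (fun hcond => ?_) fun _ => rfl
          obtain ⟨-, -, h3, pq, hpq, hpq'⟩ := hcond
          rw [h.shift_factor (hr.trans hr'), Pi.add_apply, mask_of_mem _ hq,
            Rec.dFactor_visible H.valid, add_zero]
          have hpq1 : pq ∈ (s.opt r zc).summ j ∩ (s.opt r P.z0).summ k := hpq
          have h4 := (h.opt r zc).mem_S_of_mem_summ (Finset.mem_inter.1 hpq1).1
          have h5 := (h.opt r P.z0).mem_S_of_mem_summ (Finset.mem_inter.1 hpq1).2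
          rw [← hpq']
          rcases h.pairBad_corrupt H.hQ H.hZ hG h3 with hb | hb
          · cases b
            · exact ⟨j, hb, h4.1⟩
            · exact ⟨j, hb, h4.2⟩
          · cases b
            · exact ⟨k, hb, h5.1⟩
            · exact ⟨k, hb, h5.2⟩

theorem shift_recShare (h : Agree Zs G i s) (H : Hidden Zs qs g) (hG : G.DealsOK Zs)
    (tag : RTag P) (q : Fin P.h) :
    (s.shift i (G.dDeal qs g) ρ).recShare i tag q = s.recShare i tag q :=
  shift_recShareWith fun _ => h.shift_myShare H hG tag q

theorem shift_recValue (h : Agree Zs G i s) (H : Hidden Zs qs g) (hG : G.DealsOK Zs)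
    (tag : RTag P) :
    (s.shift i (G.dDeal qs g) ρ).recValue i tag = s.recValue i tag :=
  congrArg PartySt.total (funext fun q => h.shift_recShare H hG tag q)

/-- The same parties are refuted in the shifted world, for opened values do not change. -/
theorem shift_LD (h : Agree Zs G i s) (H : Hidden Zs qs g) (hG : G.DealsOK Zs) {r : ℕ} {x : Fin P.n} :
    (s.shift i (G.dDeal qs g) ρ).LD i r x ↔ s.LD i r x := by
  unfold PartySt.LD
  simp only [h.shift_recValue H hG, h.shift_recShare H hG, h.shift_pairBad]
  rfl

end Agree

/-! ### Activations commute with shifts -/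

namespace PartySt

variable {i : Fin P.n} {δ : VSid P → Fin P.h → F} {ρ : Table P F} {s : PartySt P F}

theorem shift_Waiting {r : ℕ} {j : Fin P.n} :
    (s.shift i δ ρ).Waiting r j ↔ s.Waiting r j := by
  unfold Waiting
  simp only [shift_got]
  rfl

theorem shift_stepStage : (s.shift i δ ρ).stepStage = s.stepStage.shift i δ ρ := by
  unfold stepStage
  simp only [shift_got]
  change (if s.iter = 0 ∧ (∀ j, s.aba (.acs j) ≠ none) ∧ ∀ j ∈ s.CS, ∀ b l, s.got (.input j b l) then
    _ else _) = _
  split_ifs <;> rfl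

theorem shift_stepNext : (s.shift i δ ρ).stepNext = s.stepNext.shift i δ ρ := by
  unfold stepNext
  by_cases h1 : s.conf s.iter = none
  · rw [if_pos h1]
    exact if_pos h1
  rw [if_neg h1]
  refine (if_neg h1).trans ?_
  by_cases h2 : gdIter P s.iter
  · rw [if_pos h2]
    refine (if_pos h2).trans ?_
    by_cases h3 : ∀ j, s.aba (.gd s.iter j) ≠ none
    · rw [if_pos h3]
      refine (if_pos h3).trans ?_
      change (match least fun j => s.aba (.gd s.iter j) = some true with
        | some j => _ | none => _) = _
      cases least fun j => s.aba (.gd s.iter j) = some true <;> rfl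
    · rw [if_neg h3]
      exact if_neg h3
  · rw [if_neg h2]
    exact if_neg h2

end PartySt

theorem ite_congr_inst {α : Type} {p q : Prop} (hp : Decidable p) (hq : Decidable q) (a b : α)
    (h : p ↔ q) : @ite α p hp a b = @ite α q hq a b :=
  if_congr h rfl rfl

namespace Agree

variable {Zs : Finset (Fin P.n)} {G : Rec P F} {i : Fin P.n} {s : PartySt P F} {g : Shift P F}
  {qs : Fin P.h} {ρ : Table P F}

theorem shift_stepCheck (h : Agree Zs G i s) (H : Hidden Zs qs g) (hG : G.DealsOK Zs) :
    (s.shift i (G.dDeal qs g) (G.dOut qs g)).stepCheck i =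
      (s.stepCheck i).shift i (G.dDeal qs g) (G.dOut qs g) := by
  unfold PartySt.stepCheck
  simp only [h.shift_recValue H hG, PartySt.shift_optDone, PartySt.shift_out]
  by_cases hc : 1 ≤ s.iter ∧ s.out = none ∧ s.conf s.iter = none ∧ (∀ z, s.optDone s.iter z) ∧
      ∀ z l, s.recValue i (.diff s.iter z l) ≠ none
  · rw [if_pos hc]
    refine (if_pos hc).trans ?_
    change (match least fun z => ∃ l, s.recValue i (.diff s.iter z l) ≠ some 0 with
      | none => _ | some z => _) = _
    cases hl : least fun z => ∃ l, s.recValue i (.diff s.iter z l) ≠ some 0 with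
    | some z => rfl
    | none =>
        have hT : (fun l => ![mask i ((s.shift i (G.dDeal qs g) (G.dOut qs g)).factor false l),
            mask i ((s.shift i (G.dDeal qs g) (G.dOut qs g)).factor true l),
            mask i ((s.shift i (G.dDeal qs g) (G.dOut qs g)).cShare s.iter P.z0 l)] : Table P F) =
            fun l x => (![mask i (s.factor false l), mask i (s.factor true l),
              mask i (s.cShare s.iter P.z0 l)] : Fin 3 → Fin P.h → F) x +
                mask i (G.dOut qs g l x) := by
          have hmm : ∀ v : Fin P.h → F, mask i (mask i v) = mask i v := fun v => by
            funext q
            simp only [mask]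
            split_ifs <;> rfl
          funext l x
          fin_cases x
          · simp [h.shift_factor hc.1, mask_add, Rec.dOut, hmm]
          · simp [h.shift_factor hc.1, mask_add, Rec.dOut, hmm]
          · simp [h.shift_cShare (hc.2.2.2.1 P.z0), mask_add, Rec.dOut, hmm]
        change ({ s.shift i (G.dDeal qs g) (G.dOut qs g) with
          out := some fun l => ![mask i ((s.shift i (G.dDeal qs g) (G.dOut qs g)).factor false l),
            mask i ((s.shift i (G.dDeal qs g) (G.dOut qs g)).factor true l),
            mask i ((s.shift i (G.dDeal qs g) (G.dOut qs g)).cShare s.iter P.z0 l)] } :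
              PartySt P F) = _
        rw [hT]
        rfl
  · rw [if_neg hc]
    exact if_neg hc

theorem shift_update (h : Agree Zs G i s) (H : Hidden Zs qs g) (hD : G.DecOK Zs)
    (hG : G.DealsOK Zs) : (s.shift i (G.dDeal qs g) (G.dOut qs g)).update i =
      (s.update i).shift i (G.dDeal qs g) (G.dOut qs g) := by
  unfold PartySt.update
  have h1 : (s.stepStage.shift i (G.dDeal qs g) (G.dOut qs g)).stepHop =
    s.stepStage.stepHop.shift i (G.dDeal qs g) (G.dOut qs g) := rfl
  rw [PartySt.shift_stepStage, h1, (h.stepStage.stepHop hD).shift_stepCheck H hG,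
    PartySt.shift_stepNext]

theorem shift_newVote (h : Agree Zs G i s) (H : Hidden Zs qs g) (hG : G.DealsOK Zs) :
    (s.shift i (G.dDeal qs g) ρ).newVote i = s.newVote i := by
  funext sid
  unfold PartySt.newVote
  cases sid with
  | acs j =>
      simp only [PartySt.shift_got]
      rfl
  | sel r z hop j =>
      refine if_congr Iff.rfl rfl (if_congr Iff.rfl (ite_congr_inst _ _ _ _ ?_) rfl)
      simp only [PartySt.shift_got, PartySt.shift_Waiting, h.shift_LD H hG]
      rfl
  | gd r j =>
      simp only [h.shift_LD H hG]
      rfl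

theorem sum_dShare_summs (h : Agree Zs G i s) (H : Hidden Zs qs g) (hi : 1 ≤ s.iter)
    (l : Fin P.M) {T : Finset (Fin P.h × Fin P.h)} (hT : ∀ pq ∈ T, i ∈ P.S pq.1 ∧ i ∈ P.S pq.2) :
    (s.shift i (G.dDeal qs g) ρ).prodSum l T =
      s.prodSum l T + ∑ q, (∑ pq ∈ T, G.dShare qs g l pq) q := by
  rw [h.shift_prodSum hi l hT]
  simp only [Finset.sum_apply]
  rw [Finset.sum_comm]
  simp only [Rec.sum_dShare H.valid]

/-- A party with shifted shares and shifted random values shares shifted values. -/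
theorem shift_toDeal (h : Agree Zs G i s) (H : Hidden Zs qs g) (rnd : Bool → Fin P.M → F) :
    (s.shift i (G.dDeal qs g) ρ).toDeal i (fun b l => rnd b l + ∑ q, g.1 i b l q) =
      (s.toDeal i rnd).map fun x => (x.1, x.2 + ∑ q, G.dDeal qs g x.1 q) := by
  unfold PartySt.toDeal
  rw [List.map_append, List.map_append]
  refine congrArg₂ _ (congrArg₂ _ ?_ ?_) ?_
  · simp only [List.map_flatMap, List.map_map]
    rfl
  · rw [List.map_flatMap]
    refine congrArg (fun f => List.flatMap f (List.finRange P.h)) (funext fun z => ?_)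
    rw [List.map_flatMap]
    refine congrArg (fun f => List.flatMap f (List.finRange P.M)) (funext fun l => ?_)
    change (if 1 ≤ s.iter ∧ i ∉ P.Z z ∧ i ∉ s.Sel s.iter z ∧ (s.opt s.iter z).rem.Nonempty then
      _ else _) = _
    split_ifs with hc
    · simp only [List.map_cons, List.map_nil]
      rw [Rec.dDeal_summ (h.opt s.iter z), ← h.sum_dShare_summs H hc.1 l (ρ := ρ)
        fun pq hpq => (h.opt _ _).mem_S_of_mem_summ hpq]
      rfl
    · rfl
  · rw [List.map_flatMap]
    refine congrArg (fun f => List.flatMap f (List.range (s.iter + 1))) (funext fun r => ?_)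
    change (match s.conf r with | none => [] | some (zc, l) => _) = _
    cases hc : s.conf r with
    | none => rfl
    | some p =>
        obtain ⟨zc, l⟩ := p
        obtain ⟨h1, h2, hd, hcG⟩ := h.confSome _ _ hc
        simp only [List.map_flatMap]
        refine congrArg (fun f => List.flatMap f (List.finRange P.n)) (funext fun k => ?_)
        refine congrArg (fun f => List.flatMap f [zc, P.z0]) (funext fun z => ?_)
        change (if s.partDue r zc z i k then _ else _) = _
        split_ifs
        · simp only [List.map_cons, List.map_nil]
          rw [Rec.dDeal_part hcG, h.ref.partSumms (hd _) (hd _),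
            ← h.sum_dShare_summs H (h1.trans h2) l (ρ := ρ) fun pq hpq => ?_]
          · rfl
          · exact h.partSumms_mem_S hpq
        · rfl

end Agree

theorem map_uniformOn_equiv {α β : Type} (e : α ≃ β) {S : Finset α} {T : Finset β}
    (h : ∀ a, a ∈ S ↔ e a ∈ T) (hS : S.Nonempty) (d : α) (d' : β) :
    (uniformOn S d).map e = uniformOn T d' := by
  have hT : T.Nonempty := hS.imp' e fun a ha => (h a).1 ha
  have hc : S.card = T.card := Finset.card_bij (fun a _ => e a) (fun a ha => (h a).1 ha)
    (fun a _ b _ hab => e.injective hab)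
    fun b hb => ⟨e.symm b, (h _).2 (by simpa using hb), by simp⟩
  unfold uniformOn
  rw [dif_pos hS, dif_pos hT]
  ext b
  rw [PMF.map_apply, tsum_eq_single (e.symm b)]
  · have := h (e.symm b)
    rw [e.apply_symm_apply] at this
    simp only [Equiv.apply_symm_apply, if_true, PMF.uniformOfFinset_apply, this, hc]
  · intro a ha
    rw [if_neg]
    rintro rfl
    simp at ha

theorem uniformOfFintype_bind_equiv {α β : Type} [Fintype α] [Nonempty α] (e : α ≃ α)
    (f : α → PMF β) : (PMF.uniformOfFintype α).bind f =
      (PMF.uniformOfFintype α).bind fun a => f (e a) := by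
  have h : (PMF.uniformOfFintype α).map e = PMF.uniformOfFintype α := by
    have := map_uniformOn_equiv e (S := Finset.univ) (T := Finset.univ) (by simp)
      Finset.univ_nonempty (Classical.arbitrary α) (Classical.arbitrary α)
    rw [uniformOn, dif_pos Finset.univ_nonempty] at this
    exact this
  conv_lhs => rw [← h]
  rw [PMF.bind_map]
  rfl

section

variable [Fintype F] {Zs : Finset (Fin P.n)}

theorem randomShares_shift (x : F) (v : Fin P.h → F) :
    randomShares (P := P) (x + ∑ q, v q) = (randomShares x).map fun u => u + v := by
  refine (map_uniformOn_equiv (Equiv.addRight v) (fun u => ?_) ?_ _ _).symm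
  · simp [Finset.sum_add_distrib]
  · exact ⟨Pi.single P.z0 x, by simp [Finset.sum_pi_single']⟩

theorem shareAll_shift (δ : VSid P → Fin P.h → F) (L : List (VSid P × F)) :
    shareAll (L.map fun x => (x.1, x.2 + ∑ q, δ x.1 q)) =
      (shareAll L).map fun f sid => (f sid).map fun v => v + δ sid := by
  induction L with
  | nil =>
      simp only [List.map_nil, shareAll, PMF.pure_map]
      rfl
  | cons x L ih =>
      simp only [List.map_cons, shareAll, ih, randomShares_shift, PMF.map_bind, PMF.bind_map,
        PMF.map_comp]
      congr 1
      funext v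
      simp only [Function.comp_apply]
      congr 1
      funext f
      funext sid
      by_cases h : sid = x.1
      · subst h
        simp
      · simp [Function.update_of_ne h]

/-- The world after a change `δ` of the dealt vectors and `ρ` of the outputs. -/
def World.shift (Zs : Finset (Fin P.n)) (δ : VSid P → Fin P.h → F) (ρ : Table P F)
    (w : World P F) : World P F :=
  { w with
    parties := fun i => if i ∈ Zs then w.parties i else (w.parties i).shift i δ ρ
    deals := fun sid => (w.deals sid).map fun d => (d.1 + δ sid, d.2) }

variable {w : World P F} {i : Fin P.n} {g : Shift P F} {qs : Fin P.h}

theorem World.shift_castVotes {δ : VSid P → Fin P.h → F} {ρ : Table P F} {nv : ASid P → Option Bool} :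
    (w.castVotes Zs i nv).shift Zs δ ρ = (w.shift Zs δ ρ).castVotes Zs i nv := rfl

theorem Inv.acted_shift (h : Inv Zs w) (H : Hidden Zs qs g) (hi : i ∉ Zs)
    (f : VSid P → Option (Fin P.h → F)) :
    (w.shift Zs (w.record.dDeal qs g) (w.record.dOut qs g)).acted Zs i
        (fun sid => (f sid).map fun v => v + w.record.dDeal qs g sid) =
      (w.acted Zs i f).shift Zs (w.record.dDeal qs g) (w.record.dOut qs g) := by
  have ha := h.agree i hi
  have hu := ha.update H.hQ H.hZ h.decOK
  have e1 : ((w.shift Zs (w.record.dDeal qs g) (w.record.dOut qs g)).parties i).update i =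
      ((w.parties i).update i).shift i (w.record.dDeal qs g) (w.record.dOut qs g) := by
    simp only [World.shift, if_neg hi]
    exact ha.shift_update H h.decOK h.dealsOK
  unfold World.acted
  simp only [e1, hu.shift_newVote H h.dealsOK, hu.shift_myShare H h.dealsOK]
  rw [World.shift_castVotes]
  congr 1
  simp only [World.shift, World.mk.injEq, and_true]
  refine ⟨?_, ?_, ?_⟩
  · funext j
    by_cases hj : j = i
    · subst hj
      simp only [Function.update_self, if_neg hi, PartySt.shift, ne_eq, Option.map_eq_none_iff]
      rfl
    · simp only [Function.update_of_ne hj]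
  · funext sid
    simp only [Option.map_eq_none_iff]
    split_ifs with hn
    · cases f sid <;> rfl
    · rfl
  · trivial

/-- The actions of a party commute with shifts. -/
theorem Inv.actions_shift (h : Inv Zs w) (H : Hidden Zs qs g) (hi : i ∉ Zs) :
    (w.shift Zs (w.record.dDeal qs g) (w.record.dOut qs g)).actions Zs i =
      (w.actions Zs i).map (World.shift Zs (w.record.dDeal qs g) (w.record.dOut qs g)) := by
  have ha := h.agree i hi
  have hu := ha.update H.hQ H.hZ h.decOK
  have e1 : ((w.shift Zs (w.record.dDeal qs g) (w.record.dOut qs g)).parties i).update i =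
      ((w.parties i).update i).shift i (w.record.dDeal qs g) (w.record.dOut qs g) := by
    simp only [World.shift, if_neg hi]
    exact ha.shift_update H h.decOK h.dealsOK
  rw [World.actions_eq, World.actions_eq, uniformOfFintype_bind_equiv
    (Equiv.addRight fun b l => ∑ q, g.1 i b l q : (Bool → Fin P.M → F) ≃ (Bool → Fin P.M → F)),
    PMF.map_bind]
  congr 1
  funext rnd
  rw [e1]
  have e2 := hu.shift_toDeal H rnd (ρ := w.record.dOut qs g)
  change (shareAll (((((w.parties i).update i).shift i _ _).toDeal i
    (fun b l => rnd b l + ∑ q, g.1 i b l q)).filter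
      fun x => decide (x.1 ∉ ((w.parties i).update i).dealt))).map _ = _
  rw [e2, List.filter_map]
  have e3 := shareAll_shift (w.record.dDeal qs g) ((((w.parties i).update i).toDeal i rnd).filter
    fun x => decide (x.1 ∉ ((w.parties i).update i).dealt))
  refine (congrArg (PMF.map _) e3).trans ?_
  rw [PMF.map_comp, PMF.map_comp]
  congr 1
  funext f
  exact h.acted_shift H hi f

end

/-! ### The transitions of the hybrid world commute with shifts -/

section

variable {Zs : Finset (Fin P.n)} {w : World P F} {i : Fin P.n} {g : Shift P F} {qs : Fin P.h}
  {δ : VSid P → Fin P.h → F} {ρ : Table P F}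

/-- The world after a change of the hidden shares. -/
def World.blur (Zs : Finset (Fin P.n)) (qs : Fin P.h) (g : Shift P F) (w : World P F) :
    World P F :=
  w.shift Zs (w.record.dDeal qs g) (w.record.dOut qs g)

theorem World.shift_applyOp (hδ : ∀ sid, sid.dealer ∈ Zs → δ sid = 0) (op : Op P F) :
    (w.shift Zs δ ρ).applyOp Zs op = (w.applyOp Zs op).shift Zs δ ρ := by
  cases op with
  | deal sid v =>
      simp only [World.applyOp]
      have hc : (w.shift Zs δ ρ).deals sid = none ↔ w.deals sid = none := by simp [World.shift]
      by_cases h : sid.dealer ∈ Zs ∧ w.deals sid = none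
      · rw [if_pos h]
        refine (if_pos ⟨h.1, hc.2 h.2⟩).trans ?_
        simp only [World.shift, World.mk.injEq, and_true, true_and]
        funext sid'
        by_cases hs : sid' = sid
        · subst hs
          simp [hδ _ h.1]
        · simp [Function.update_of_ne hs]
      · rw [if_neg h]
        exact if_neg fun h' => h ⟨h'.1, hc.1 h'.2⟩
  | vote sid j b =>
      simp only [World.applyOp]
      split_ifs <;> rfl
  | coreset sid C =>
      simp only [World.applyOp]
      by_cases h : P.Quorum C ∧ w.dec sid = none
      · rw [if_pos h]
        exact if_pos h
      · rw [if_neg h]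
        exact if_neg h
  | send j k tag q v =>
      simp only [World.applyOp]
      split_ifs with h
      · simp only [World.setParty, World.shift, World.mk.injEq, and_true]
        funext k'
        by_cases hk : k' = k
        · subst hk
          simp only [Function.update_self]
          split_ifs <;> rfl
        · simp only [Function.update_of_ne hk]
      · rfl

theorem World.shift_applyOps (hδ : ∀ sid, sid.dealer ∈ Zs → δ sid = 0) (ops : List (Op P F)) :
    (w.shift Zs δ ρ).applyOps Zs ops = (w.applyOps Zs ops).shift Zs δ ρ := by
  unfold World.applyOps
  induction ops generalizing w with
  | nil => rfl
  | cons op ops ih => rw [List.foldl_cons, List.foldl_cons, World.shift_applyOp hδ, ih]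

theorem World.shift_forceAba {B : ℕ} :
    (w.shift Zs δ ρ).forceAba B Zs = (w.forceAba B Zs).shift Zs δ ρ := rfl

theorem World.shift_deliver {B : ℕ} {D : Set (Item P)} (hi : i ∉ Zs) :
    (w.shift Zs δ ρ).deliver B i D = (w.deliver B i D).shift Zs δ ρ := by
  simp only [World.deliver, World.setParty, World.shift, World.mk.injEq, and_true]
  funext k
  by_cases hk : k = i
  · subst hk
    simp only [Function.update_self, if_neg hi, PartySt.shift, PartySt.mk.injEq, and_true, true_and]
    refine ⟨?_, rfl, rfl⟩
    funext sid
    have e1 : (∃ v c, Option.map (fun d : (Fin P.h → F) × ℕ => (d.1 + δ sid, d.2)) (w.deals sid) =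
        some (v, c) ∧ (Item.vss sid ∈ D ∨ w.overdue B c)) ↔
        ∃ v c, w.deals sid = some (v, c) ∧ (Item.vss sid ∈ D ∨ w.overdue B c) := by
      cases w.deals sid with
      | none => simp
      | some d => simp [Prod.ext_iff]
    have e2 : (if (w.parties k).vss sid = none ∧ (w.parties k).wantsV sid ∧
          ∃ v c, Option.map (fun d : (Fin P.h → F) × ℕ => (d.1 + δ sid, d.2)) (w.deals sid) =
            some (v, c) ∧ (Item.vss sid ∈ D ∨ w.overdue B c) then
          (Option.map (fun d : (Fin P.h → F) × ℕ => (d.1 + δ sid, d.2)) (w.deals sid)).map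
            fun d => mask k d.1
        else ((w.parties k).vss sid).map fun v => v + mask k (δ sid)) =
        Option.map (fun v => v + mask k (δ sid)) (if (w.parties k).vss sid = none ∧
          (w.parties k).wantsV sid ∧
            ∃ v c, w.deals sid = some (v, c) ∧ (Item.vss sid ∈ D ∨ w.overdue B c) then
          (w.deals sid).map fun d => mask k d.1 else (w.parties k).vss sid) := by
      simp only [e1]
      split_ifs
      · cases w.deals sid with
        | none => rfl
        | some d => simp [mask_add]
      · rfl
    rw [← e2]
    refine ite_congr_inst _ _ _ _ ?_
    rw [Option.map_eq_none_iff]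
    cases sid <;> rfl
  · simp only [Function.update_of_ne hk]

theorem World.shift_view (hδ : ∀ sid q, Visible Zs q → δ sid q = 0) :
    (w.shift Zs δ ρ).view Zs = w.view Zs := by
  simp only [World.view, World.shift, View.mk.injEq, Option.map_map, true_and]
  refine ⟨?_, ?_, ?_, ?_, trivial⟩
  · ext k
    simp only [Set.mem_ofPred_eq]
    split_ifs <;> rfl
  · funext sid
    congr 1
    funext d q
    simp only [Function.comp_apply, Pi.add_apply]
    split_ifs with hq
    · rw [hδ _ _ hq, add_zero]
    · rfl
  · funext k sid
    split_ifs
    · rfl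
    · cases sid <;> rfl
  · funext k sid
    split_ifs
    · rfl
    · cases sid <;> rfl

/-- The adversary does not notice the shift. -/
theorem World.blur_view (H : Hidden Zs qs g) : (w.blur Zs qs g).view Zs = w.view Zs :=
  World.shift_view fun sid _ hq => Rec.dDeal_visible H.valid H.sub hq sid

theorem World.shift_started {k : Fin P.n} :
    ((w.shift Zs δ ρ).parties k).started ↔ (w.parties k).started := by
  simp only [World.shift]
  split_ifs <;> rfl

/-- The shift of a world is determined by an earlier record in which all that has been dealt was
already due. -/
theorem Inv.shift_eq_blur (h : Inv Zs w) (H : Hidden Zs qs g) {G : Rec P F} (hG : G ≤ w.record)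
    (hd : ∀ sid d c, w.deals sid = some (d, c) → sid.dealer ∉ Zs → G.DealOK sid d)
    (ho : ∀ k ∉ Zs, (w.parties k).out ≠ none → G.Stage1) :
    w.shift Zs (G.dDeal qs g) (G.dOut qs g) = w.blur Zs qs g := by
  have hδ : ∀ sid, w.deals sid ≠ none → G.dDeal qs g sid = w.record.dDeal qs g sid := by
    intro sid hs
    by_cases hZ : sid.dealer ∈ Zs
    · rw [Rec.dDeal_corrupt H.valid H.sub hZ, Rec.dDeal_corrupt H.valid H.sub hZ]
    · obtain ⟨⟨d, c⟩, hdc⟩ := Option.ne_none_iff_exists'.1 hs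
      exact ((hd sid d c hdc hZ).dDeal_eq hG).symm
  simp only [World.blur, World.shift, World.mk.injEq, and_true]
  constructor
  · funext k
    split_ifs with hk
    · rfl
    simp only [PartySt.shift, PartySt.mk.injEq, true_and]
    constructor
    · funext sid
      by_cases hs : (w.parties k).vss sid = none
      · rw [hs]
        rfl
      · have := (h.agree k hk).got_V hs
        rw [hδ sid (by simpa [World.record] using this)]
    · by_cases hs : (w.parties k).out = none
      · rw [hs]
        rfl
      · rw [(ho k hk hs).dOut_eq hG]
  · funext sid
    by_cases hs : w.deals sid = none
    · rw [hs]
      rfl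
    · rw [hδ sid hs]

theorem World.applyOp_same (op : Op P F) :
    (∀ sid, sid.dealer ∉ Zs → (w.applyOp Zs op).deals sid = w.deals sid) ∧
      ∀ k, ((w.applyOp Zs op).parties k).out = (w.parties k).out ∧
        ((w.applyOp Zs op).parties k).started = (w.parties k).started := by
  cases op with
  | deal sid v =>
      simp only [World.applyOp]
      split_ifs with h
      · refine ⟨fun sid' h' => ?_, fun _ => ⟨rfl, rfl⟩⟩
        have hne : sid' ≠ sid := by
          rintro rfl
          exact h' h.1
        exact Function.update_of_ne hne _ _
      · exact ⟨fun _ _ => rfl, fun _ => ⟨rfl, rfl⟩⟩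
  | vote sid j b =>
      simp only [World.applyOp]
      split_ifs <;> exact ⟨fun _ _ => rfl, fun _ => ⟨rfl, rfl⟩⟩
  | coreset sid C =>
      simp only [World.applyOp]
      split_ifs <;> exact ⟨fun _ _ => rfl, fun _ => ⟨rfl, rfl⟩⟩
  | send j k tag q v =>
      simp only [World.applyOp]
      split_ifs
      · refine ⟨fun _ _ => rfl, fun k' => ?_⟩
        by_cases hk : k' = k
        · subst hk
          simp [World.setParty]
        · simp [World.setParty, Function.update_of_ne hk]
      · exact ⟨fun _ _ => rfl, fun _ => ⟨rfl, rfl⟩⟩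

theorem World.applyOps_same (ops : List (Op P F)) :
    (∀ sid, sid.dealer ∉ Zs → (w.applyOps Zs ops).deals sid = w.deals sid) ∧
      ∀ k, ((w.applyOps Zs ops).parties k).out = (w.parties k).out ∧
        ((w.applyOps Zs ops).parties k).started = (w.parties k).started := by
  unfold World.applyOps
  induction ops generalizing w with
  | nil => exact ⟨fun _ _ => rfl, fun _ => ⟨rfl, rfl⟩⟩
  | cons op ops ih =>
      obtain ⟨h1, h2⟩ := ih (w := w.applyOp Zs op)
      obtain ⟨h3, h4⟩ := World.applyOp_same (Zs := Zs) (w := w) op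
      exact ⟨fun sid hs => (h1 sid hs).trans (h3 sid hs),
        fun k => ⟨(h2 k).1.trans (h4 k).1, (h2 k).2.trans (h4 k).2⟩⟩

theorem Inv.stage1_of_out (h : Inv Zs w) {k : Fin P.n} (hk : k ∉ Zs)
    (ho : (w.parties k).out ≠ none) : w.record.Stage1 := by
  obtain ⟨T, hT⟩ := Option.ne_none_iff_exists'.1 ho
  exact (h.agree k hk).stage1 ((h.agree k hk).out T hT).1

theorem Inv.shift_eq_blur' {w' : World P F} (h : Inv Zs w) (h' : Inv Zs w') (H : Hidden Zs qs g)
    (hG : w.record ≤ w'.record)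
    (hd : ∀ sid, sid.dealer ∉ Zs → w'.deals sid = w.deals sid)
    (ho : ∀ k, (w'.parties k).out = (w.parties k).out) :
    w'.shift Zs (w.record.dDeal qs g) (w.record.dOut qs g) = w'.blur Zs qs g :=
  h'.shift_eq_blur H hG
    (fun sid d c hs hZ => ((h.deals sid d c (by rw [← hd sid hZ, hs])).2 hZ).1)
    fun k hk hn => h.stage1_of_out hk (by rwa [← ho k])

theorem Inv.applyOps_blur (h : Inv Zs w) (H : Hidden Zs qs g) (ops : List (Op P F)) :
    (w.blur Zs qs g).applyOps Zs ops = (w.applyOps Zs ops).blur Zs qs g := by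
  obtain ⟨h1, h2⟩ := h.applyOps H.hQ H.hZ ops
  rw [World.blur, World.shift_applyOps fun sid hs => Rec.dDeal_corrupt H.valid H.sub hs]
  exact h.shift_eq_blur' h1 H h2.record (World.applyOps_same ops).1
    fun k => ((World.applyOps_same ops).2 k).1

theorem World.start_blur (hi : i ∉ Zs) :
    (w.blur Zs qs g).setParty i { (w.blur Zs qs g).parties i with started := True } =
      (w.setParty i { w.parties i with started := True }).blur Zs qs g := by
  have e : (w.setParty i { w.parties i with started := True }).record = w.record := rfl
  simp only [World.blur, e]
  simp only [World.setParty, World.shift, World.mk.injEq, and_true]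
  funext k
  by_cases hk : k = i
  · subst hk
    simp only [Function.update_self, if_neg hi, PartySt.shift]
  · simp only [Function.update_of_ne hk]

theorem PMF.map_congr_support {α β : Type} {p : PMF α} {f f' : α → β}
    (h : ∀ a ∈ p.support, f a = f' a) : p.map f = p.map f' := by
  ext b
  rw [PMF.map_apply, PMF.map_apply]
  refine tsum_congr fun a => ?_
  by_cases ha : a ∈ p.support
  · rw [h a ha]
  · rw [PMF.mem_support_iff, not_not] at ha
    simp [ha]

variable [Fintype F]

/-- The actions of an honest party in the shifted world are the shifted actions: its fresh random
values are shifted as well, which does not change their distribution. -/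
theorem Inv.actions_blur (h : Inv Zs w) (H : Hidden Zs qs g) (hi : i ∉ Zs)
    (hs : (w.parties i).started) :
    (w.blur Zs qs g).actions Zs i = (w.actions Zs i).map (World.blur Zs qs g) := by
  rw [World.blur, h.actions_shift H hi]
  refine PMF.map_congr_support fun w' hw' => ?_
  obtain ⟨h1, h2, h3, h4, -⟩ := h.actions H.hQ H.hZ hi hs hw'
  have ha := (h.agree i hi).update H.hQ H.hZ h.decOK
  refine h1.shift_eq_blur H h2.record ?_ ?_
  · intro sid d c hd hZ
    rw [World.actions_eq, PMF.mem_support_bind_iff] at hw'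
    obtain ⟨rnd, -, hw'⟩ := hw'
    obtain ⟨f, hf, rfl⟩ := (PMF.mem_support_map_iff _ _ _).1 hw'
    change (if w.deals sid = none then _ else _) = _ at hd
    split_ifs at hd with h0
    · obtain ⟨v, hv, hvd⟩ := Option.map_eq_some_iff.1 hd
      cases hvd
      obtain ⟨x, hx, hsum⟩ := (mem_support_shareAll hf).1 sid _ hv
      exact (ha.toDeal (List.mem_filter.1 hx).1).2 _ hsum
    · exact ((h.deals sid d c hd).2 hZ).1
  · intro k hk hn
    by_cases hki : k = i
    · subst hki
      rw [h3.out] at hn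
      obtain ⟨T, hT⟩ := Option.ne_none_iff_exists'.1 hn
      exact ha.stage1 (ha.out T hT).1
    · rw [h4 k hki] at hn
      exact h.stage1_of_out hk hn

/-- The response to an activation after a change `ρ` of the output. -/
def Resp.shift (i : Fin P.n) (ρ : Table P F) : Resp (Table P F) → Resp (Table P F)
  | .output T => .output fun l x => T l x + mask i (ρ l x)
  | r => r

/-- An activation of an honest party commutes with the shift of the hidden shares; only the output is
shifted visibly. -/
theorem Inv.activate_blur (h : Inv Zs w) (H : Hidden Zs qs g) (hi : i ∉ Zs)
    (hs : (w.parties i).started) (B : ℕ) (D : Set (Item P)) :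
    (w.blur Zs qs g).activate B Zs i D = (w.activate B Zs i D).map fun y =>
      (y.1.blur Zs qs g, y.2.shift i (y.1.record.dOut qs g)) := by
  obtain ⟨h1, h2⟩ := h.forceAba H.hQ H.hZ B
  obtain ⟨h3, h4⟩ := h1.deliver hi B D
  have hs' := (h4.parties i).started ((h2.parties i).started hs)
  have e : ((w.blur Zs qs g).forceAba B Zs).deliver B i D =
      ((w.forceAba B Zs).deliver B i D).blur Zs qs g := by
    rw [World.blur, World.shift_forceAba, World.shift_deliver hi]
    refine h.shift_eq_blur' h3 H (h2.trans h4).record (fun _ _ => rfl) fun k => ?_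
    by_cases hk : k = i
    · subst hk
      simp [World.deliver, World.setParty, World.forceAba, World.decideAba]
    · simp [World.deliver, World.setParty, World.forceAba, World.decideAba,
        Function.update_of_ne hk]
  rw [World.activate, World.activate, e, h3.actions_blur H hi hs', PMF.map_comp, PMF.map_comp]
  refine PMF.map_congr_support fun w' hw' => ?_
  simp only [Function.comp_apply, Prod.mk.injEq]
  constructor
  · have hal : (w'.blur Zs qs g).alive Zs = w'.alive Zs := by
      ext k
      simp only [World.alive, Finset.mem_filter, World.blur, World.shift_started]
    rw [hal]
    rfl
  · have e1 : ((w.blur Zs qs g).parties i).out =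
        (w.parties i).out.map fun T l x => T l x + mask i (w.record.dOut qs g l x) := by
      simp only [World.blur, World.shift, if_neg hi]
      rfl
    have e2 : ((w'.blur Zs qs g).parties i).out =
        (w'.parties i).out.map fun T l x => T l x + mask i (w'.record.dOut qs g l x) := by
      simp only [World.blur, World.shift, if_neg hi]
      rfl
    rw [e1, e2]
    cases (w.parties i).out <;> cases (w'.parties i).out <;> rfl

end

/-! ### Uniform distributions and completed triples -/

theorem mem_support_uniformOn {α : Type} {S : Finset α} (hS : S.Nonempty) {d a : α} :
    a ∈ (uniformOn S d).support ↔ a ∈ S := by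
  rw [uniformOn, dif_pos hS, PMF.mem_support_uniformOfFinset_iff]

theorem uniformOn_apply_of_mem {α : Type} {S : Finset α} {a : α} (h : a ∈ S) (d : α) :
    uniformOn S d a = (S.card : ENNReal)⁻¹ := by
  have hS : S.Nonempty := ⟨a, h⟩
  rw [uniformOn, dif_pos hS, PMF.uniformOfFinset_apply_of_mem _ h]

theorem uniformOn_apply_of_notMem {α : Type} {S : Finset α} (hS : S.Nonempty) {a : α}
    (h : a ∉ S) (d : α) : uniformOn S d a = 0 := by
  rw [uniformOn, dif_pos hS, PMF.uniformOfFinset_apply_of_notMem _ h]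

theorem uniformOn_univ {α : Type} [Fintype α] [Nonempty α] (d : α) :
    uniformOn (Finset.univ : Finset α) d = PMF.uniformOfFintype α := by
  rw [uniformOn, dif_pos Finset.univ_nonempty]
  rfl

theorem PMF.bind_congr_support {α β : Type} {p : PMF α} {f f' : α → PMF β}
    (h : ∀ a ∈ p.support, f a = f' a) : p.bind f = p.bind f' := by
  ext b
  rw [PMF.bind_apply, PMF.bind_apply]
  refine tsum_congr fun a => ?_
  by_cases ha : a ∈ p.support
  · rw [h a ha]
  · rw [PMF.mem_support_iff, not_not] at ha
    simp [ha]

/-- A uniform element of `S` can be chosen by first choosing its image under a map all of whose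
fibers are equally large, and then a uniform element of the fiber. -/
theorem uniformOn_bind_fiber {α β : Type} {S : Finset α} {T : Finset β} {f : α → β}
    {Φ : β → Finset α} (hΦ : ∀ y x, x ∈ Φ y ↔ x ∈ S ∧ f x = y) (hS : S.Nonempty)
    (hf : ∀ x ∈ S, f x ∈ T) (hT : ∀ y ∈ T, ∀ y' ∈ T, ∃ e : α → α, Function.Injective e ∧
      ∀ x ∈ S, f x = y → e x ∈ S ∧ f (e x) = y') (d : β) (d' : α) :
    (uniformOn T d).bind (fun y => uniformOn (Φ y) d') = uniformOn S d' := by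
  obtain ⟨x0, hx0⟩ := hS
  have hTn : T.Nonempty := ⟨_, hf x0 hx0⟩
  have hle : ∀ y ∈ T, ∀ y' ∈ T, (Φ y).card ≤ (Φ y').card := by
    intro y hy y' hy'
    obtain ⟨e, he, h⟩ := hT y hy y' hy'
    refine Finset.card_le_card_of_injOn e (fun x hx => ?_) he.injOn
    obtain ⟨h1, h2⟩ := (hΦ _ _).1 hx
    exact (hΦ _ _).2 (h x h1 h2)
  have hcard : ∀ y ∈ T, S.card = T.card * (Φ y).card := by
    intro y hy
    rw [Finset.card_eq_sum_card_fiberwise hf]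
    refine Finset.sum_const_nat fun y' hy' => ?_
    have e : (S.filter fun x => f x = y') = Φ y' := by
      ext x
      rw [hΦ, Finset.mem_filter]
    rw [e]
    exact le_antisymm (hle y' hy' y hy) (hle y hy y' hy')
  have hfib : ∀ y ∈ T, (Φ y).Nonempty := by
    intro y hy
    refine Finset.card_pos.1 (Nat.pos_of_ne_zero fun h0 => ?_)
    have := hcard y hy
    rw [h0, mul_zero, Finset.card_eq_zero] at this
    simp [this] at hx0
  ext x
  rw [PMF.bind_apply]
  rw [tsum_eq_single (f x)]
  · by_cases hx : x ∈ S
    · have hy := hf x hx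
      rw [uniformOn_apply_of_mem hy, uniformOn_apply_of_mem hx,
        uniformOn_apply_of_mem ((hΦ _ _).2 ⟨hx, rfl⟩), hcard _ hy, Nat.cast_mul,
        ENNReal.mul_inv (Or.inr (ENNReal.natCast_ne_top _)) (Or.inl (ENNReal.natCast_ne_top _))]
    · rw [uniformOn_apply_of_notMem ⟨x0, hx0⟩ hx]
      by_cases hy : f x ∈ T
      · rw [uniformOn_apply_of_notMem (hfib _ hy) fun h => hx ((hΦ _ _).1 h).1, mul_zero]
      · rw [uniformOn_apply_of_notMem hTn hy, zero_mul]
  · intro y hy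
    by_cases hyT : y ∈ T
    · rw [uniformOn_apply_of_notMem (hfib _ hyT) fun h => hy ((hΦ _ _).1 h).2.symm, mul_zero]
    · rw [uniformOn_apply_of_notMem hTn hyT, zero_mul]

theorem uniformOfFintype_bind_bind {α β γ : Type} [Fintype α] [Nonempty α] [Fintype β] [Nonempty β]
    (k : α → β → PMF γ) : ((PMF.uniformOfFintype α).bind fun a =>
      (PMF.uniformOfFintype β).bind fun b => k a b) =
      (PMF.uniformOfFintype (α × β)).bind fun x => k x.1 x.2 := by
  ext c
  simp only [PMF.bind_apply, PMF.uniformOfFintype_apply, ENNReal.tsum_mul_left]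
  rw [ENNReal.tsum_prod (f := fun a b => k a b c), Fintype.card_prod, Nat.cast_mul,
    ENNReal.mul_inv (Or.inr (ENNReal.natCast_ne_top _)) (Or.inl (ENNReal.natCast_ne_top _)),
    mul_assoc]

section

variable [Fintype F] {Zs : Finset (Fin P.n)} {qs : Fin P.h}

/-- The multiplication triples with the shares given by `T` that the adversary sees. -/
def completions (Zs : Finset (Fin P.n)) (T : Table P F) : Finset (Table P F) :=
  Finset.univ.filter fun R => (∀ l x q, Visible Zs q → R l x q = T l x q) ∧
    ∀ l, ∑ q, R l 2 q = (∑ q, R l 0 q) * ∑ q, R l 1 q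

/-- The table in which the values `v` are added to the shares with index `qs`. -/
def addAt (qs : Fin P.h) (v : Fin P.M → Fin 3 → F) (R : Table P F) : Table P F :=
  fun l x => R l x + Pi.single qs (v l x)

theorem sum_addAt (v : Fin P.M → Fin 3 → F) (R : Table P F) (l : Fin P.M) (x : Fin 3) :
    ∑ q, addAt qs v R l x q = ∑ q, R l x q + v l x := by
  simp [addAt, Finset.sum_add_distrib]

theorem addAt_visible (hqs : Zs ⊆ P.Z qs) (v : Fin P.M → Fin 3 → F) (R : Table P F) (l : Fin P.M)
    (x : Fin 3) {q : Fin P.h} (hq : Visible Zs q) : addAt qs v R l x q = R l x q := by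
  have hne : q ≠ qs := by
    rintro rfl
    exact Rec.not_visible hqs hq
  simp [addAt, Pi.single_eq_of_ne hne]

theorem addAt_injective (v : Fin P.M → Fin 3 → F) : Function.Injective (addAt (P := P) qs v) :=
  fun R R' h => by
    funext l x
    exact add_right_cancel (congrFun (congrFun h l) x)

theorem completions_nonempty (hqs : Zs ⊆ P.Z qs) (T : Table P F) : (completions Zs T).Nonempty := by
  refine ⟨addAt qs (fun l => ![0, 0, (∑ q, T l 0 q) * (∑ q, T l 1 q) - ∑ q, T l 2 q]) T,
    Finset.mem_filter.2 ⟨Finset.mem_univ _, fun l x q hq => addAt_visible hqs _ T l x hq,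
      fun l => ?_⟩⟩
  simp only [sum_addAt]
  simp

/-- The functionality chooses a uniform completion of the shares of the corrupt parties. -/
theorem completeTriples_eq (hqs : Zs ⊆ P.Z qs) (T : Table P F) :
    completeTriples Zs T = uniformOn (completions Zs T) T := by
  rw [completeTriples, uniformOfFintype_bind_bind, ← uniformOn_univ 0]
  refine uniformOn_bind_fiber (f := fun R : Table P F =>
    ((fun l => ∑ q, R l 0 q, fun l => ∑ q, R l 1 q) : (Fin P.M → F) × (Fin P.M → F)))
    (fun y R => ?_) (completions_nonempty hqs T) (fun _ _ => Finset.mem_univ _) ?_ 0 T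
  · simp only [completions, Finset.mem_filter, Finset.mem_univ, true_and, Prod.ext_iff,
      funext_iff, and_assoc]
    refine and_congr_right fun _ => ⟨fun h => ⟨fun l => ?_, fun l => (h l).1, fun l => (h l).2.1⟩,
      fun h l => ⟨h.2.1 l, h.2.2 l, ?_⟩⟩
    · rw [(h l).1, (h l).2.1, (h l).2.2]
    · rw [h.1 l, h.2.1 l, h.2.2 l]
  · intro y _ y' _
    refine ⟨addAt qs fun l => ![y'.1 l - y.1 l, y'.2 l - y.2 l, y'.1 l * y'.2 l - y.1 l * y.2 l],
      addAt_injective _, fun R hR hy => ?_⟩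
    obtain ⟨-, h1, h2⟩ := Finset.mem_filter.1 hR
    subst hy
    refine ⟨Finset.mem_filter.2 ⟨Finset.mem_univ _, fun l x q hq => ?_, fun l => ?_⟩, ?_⟩
    · rw [addAt_visible hqs _ R l x hq, h1 l x q hq]
    · simp only [sum_addAt, h2]
      simp
    · simp only [sum_addAt]
      simp

/-- The valid shifts. -/
def validShifts (P : Params) (F : Type) [Field F] [Fintype F] (Zs : Finset (Fin P.n)) :
    Finset (Shift P F) := Finset.univ.filter fun g => g.Valid Zs

theorem Shift.valid_zero : Shift.Valid Zs (0 : Shift P F) :=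
  ⟨fun _ _ _ _ _ => rfl, fun _ _ _ _ _ => rfl, fun _ _ _ => rfl, fun _ => by simp⟩

theorem Shift.Valid.add {g g' : Shift P F} (h : g.Valid Zs) (h' : g'.Valid Zs) :
    (g + g').Valid Zs where
  corrupt j hj b l q := by simp [h.corrupt j hj, h'.corrupt j hj]
  visible j b l q hq := by simp [h.visible j b l q hq, h'.visible j b l q hq]
  visible' l q hq := by simp [h.visible' l q hq, h'.visible' l q hq]
  sum l := by simp [Finset.sum_add_distrib, h.sum, h'.sum]

namespace Rec

variable {G G' : Rec P F} {r : ℕ}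

/-- The full output: the shares of the factors and of the products computed with respect to the
reference set in iteration `r`. -/
def table (G : Rec P F) (r : ℕ) : Table P F := fun l =>
  ![G.st.factor false l, G.st.factor true l, G.st.cShare r P.z0 l]

theorem table_mono (h1 : G.Stage1) (h : G.AllDone r) (hG : G ≤ G') : G'.table r = G.table r := by
  funext l
  unfold table
  congr 1
  · exact funext fun q => h1.factor_eq hG _ _ _
  · congr 1
    · exact funext fun q => h1.factor_eq hG _ _ _
    · congr 1
      exact funext fun q => (ref_st hG).cShare (st_optDone.2 (h _)) l trivial

/-- If all products agree, they are right, since one of them has been computed by honest parties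
only. -/
theorem ZeroDiff.table_sum (h : G.ZeroDiff r) (hG : G.DealsOK Zs) (hqs : Zs ⊆ P.Z qs)
    (l : Fin P.M) : ∑ q, G.table r l 2 q = (∑ q, G.table r l 0 q) * ∑ q, G.table r l 1 q := by
  have h0 := h.2 qs l
  rw [diff_eq_tot, sub_eq_zero] at h0
  have hf := reach_opt h.1 qs
  change ∑ q, G.st.cShare r P.z0 l q = (∑ q, G.st.factor false l q) * ∑ q, G.st.factor true l q
  have e1 : ∑ q, G.st.cShare r P.z0 l q = ∑ k ∈ G.st.Sel r P.z0, G.tot (G.st.sumSid r P.z0 k l) :=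
    Finset.sum_comm
  have e2 : ∑ j ∈ G.st.Sel r qs, G.tot (G.st.sumSid r qs j l) =
      ∑ j ∈ (G.opt r qs).selected, ∑ pq ∈ (G.opt r qs).summ j,
        G.st.factor false l pq.1 * G.st.factor true l pq.2 :=
    Finset.sum_congr rfl fun j hj =>
      hG.tot_sum h.1 (fun hj' => hf.1.notMem_Z hj (hqs hj')) hj l
  have e3 := hf.1.sum_summ fun pq => G.st.factor false l pq.1 * G.st.factor true l pq.2
  rw [hf.2.1, Finset.sum_empty, add_zero] at e3
  rw [e1, ← h0, e2, e3, Finset.sum_mul_sum, ← Finset.univ_product_univ, Finset.sum_product]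

/-- Some honest party belongs to the common subset. -/
theorem Stage1.exists_honest (h : G.Stage1) (hQ : P.Q 4) (hqs : Zs ⊆ P.Z qs) (hD : G.DecOK Zs) :
    ∃ j ∈ G.st.CS, j ∉ Zs := by
  by_cases hf : ∃ j, G.D (.acs j) = some false
  · obtain ⟨j, hj⟩ := hf
    obtain ⟨i, h1, h2, -⟩ := Params.Quorum.exists_honest hQ (hD _ _ hj) ⟨qs, hqs⟩ P.z0 P.z0
    exact ⟨i, h1, h2⟩
  · obtain ⟨i, -, h2, -⟩ := Params.Quorum.exists_honest hQ (A := Finset.univ) ⟨qs, by simp⟩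
      ⟨qs, hqs⟩ P.z0 P.z0
    refine ⟨i, Finset.mem_filter.2 ⟨Finset.mem_univ _, ?_⟩, h2⟩
    obtain ⟨b, hb⟩ := Option.ne_none_iff_exists'.1 (h.1 i)
    cases b
    · exact absurd ⟨i, hb⟩ hf
    · exact hb

theorem dOut_zero (g : Shift P F) (l : Fin P.M) : G.dOut qs g l 0 = G.dFactor g false l := rfl

theorem dOut_one (g : Shift P F) (l : Fin P.M) : G.dOut qs g l 1 = G.dFactor g true l := rfl

theorem dOut_two (g : Shift P F) (l : Fin P.M) :
    G.dOut qs g l 2 = Pi.single qs (∑ pq, G.dProd g l pq) + g.2 l := by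
  funext q
  change (∑ pq, G.dShare qs g l pq) q = _
  simp only [Finset.sum_apply, dShare, Finset.sum_add_distrib, Finset.sum_ite_eq',
    Finset.mem_univ, if_true, Pi.add_apply]
  congr 1
  by_cases hq : q = qs
  · subst hq
    simp
  · simp [hq]

theorem sum_dProd (g : Shift P F) (l : Fin P.M) : ∑ pq, G.dProd g l pq =
    (∑ q, (G.st.factor false l q + G.dFactor g false l q)) *
      (∑ q, (G.st.factor true l q + G.dFactor g true l q)) -
      (∑ q, G.st.factor false l q) * ∑ q, G.st.factor true l q := by
  simp only [dProd]
  rw [Finset.sum_sub_distrib, Finset.sum_mul_sum, Finset.sum_mul_sum, ← Finset.univ_product_univ,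
    Finset.sum_product, Finset.sum_product]

theorem sum_dOut_two {g : Shift P F} (hg : g.Valid Zs) (l : Fin P.M) :
    ∑ q, G.dOut qs g l 2 q = ∑ pq, G.dProd g l pq := by
  rw [dOut_two]
  simp [Finset.sum_add_distrib, hg.sum]

theorem dOut_visible {g : Shift P F} (hg : g.Valid Zs) (hqs : Zs ⊆ P.Z qs) {q : Fin P.h}
    (hq : Visible Zs q) (l : Fin P.M) (x : Fin 3) : G.dOut qs g l x q = 0 := by
  fin_cases x
  · exact dFactor_visible hg hq _ _
  · exact dFactor_visible hg hq _ _
  · change (∑ pq, G.dShare qs g l pq) q = 0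
    rw [Finset.sum_apply]
    exact Finset.sum_eq_zero fun pq _ => dShare_visible hg hqs hq l pq

/-- A shifted output is again a completion. -/
theorem ZeroDiff.add_dOut_mem (h : G.ZeroDiff r) (hG : G.DealsOK Zs) (hqs : Zs ⊆ P.Z qs)
    {g : Shift P F} (hg : g.Valid Zs) :
    G.table r + G.dOut qs g ∈ completions Zs (G.table r) := by
  refine Finset.mem_filter.2 ⟨Finset.mem_univ _, fun l x q hq => ?_, fun l => ?_⟩
  · simp [dOut_visible hg hqs hq]
  · have e := h.table_sum hG hqs l
    simp only [Pi.add_apply, Finset.sum_add_distrib] at e ⊢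
    rw [sum_dOut_two hg, sum_dProd, e, dOut_zero, dOut_one]
    simp only [Finset.sum_add_distrib]
    change (∑ q, G.st.factor false l q) * (∑ q, G.st.factor true l q) + _ =
      (∑ q, G.st.factor false l q + _) * (∑ q, G.st.factor true l q + _)
    ring

/-- The shift by which a change of the output from `R` to `R'` is effected: the factors are changed
in the input sharings of party `j`, and the difference of the product sharings is corrected by what
the change of the factors itself adds to the share with index `qs`. -/
def move (qs : Fin P.h) (j : Fin P.n) (R R' : Table P F) : Shift P F :=
  (fun i b l => if i = j then (if b then R' l 1 - R l 1 else R' l 0 - R l 0) else 0,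
    fun l => R' l 2 - R l 2 - Pi.single qs (∑ q, (R' l 2 q - R l 2 q)))

/-- The two tables agree in the shares that the adversary sees. -/
theorem valid_move (hqs : Zs ⊆ P.Z qs) {T R R' : Table P F} (hR : R ∈ completions Zs T)
    (hR' : R' ∈ completions Zs T) {j : Fin P.n} (hj : j ∉ Zs) : (move qs j R R').Valid Zs := by
  obtain ⟨-, h1, -⟩ := Finset.mem_filter.1 hR
  obtain ⟨-, h2, -⟩ := Finset.mem_filter.1 hR'
  refine ⟨fun i hi b l q => ?_, fun i b l q hq => ?_, fun l q hq => ?_, fun l => ?_⟩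
  · have : i ≠ j := by
      rintro rfl
      exact hj hi
    simp [move, this]
  · simp only [move]
    split_ifs <;> simp [h1 _ _ _ hq, h2 _ _ _ hq]
  · have hne : q ≠ qs := by
      rintro rfl
      exact not_visible hqs hq
    simp [move, h1 _ _ _ hq, h2 _ _ _ hq, Pi.single_eq_of_ne hne]
  · simp [move, Finset.sum_sub_distrib]

theorem dFactor_move {j : Fin P.n} (hj : j ∈ G.st.CS) (g : Shift P F) (R R' : Table P F)
    (b : Bool) (l : Fin P.M) : G.dFactor (g + move qs j R R') b l =
      G.dFactor g b l + (if b then R' l 1 - R l 1 else R' l 0 - R l 0) := by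
  funext q
  simp only [dFactor, Prod.fst_add, Pi.add_apply, Finset.sum_add_distrib]
  congr 1
  rw [Finset.sum_eq_single_of_mem j hj]
  · simp [move]
  · intro i _ hi
    simp [move, hi]

/-- The shifts that lead from the computed output to different completions are in bijection. -/
theorem ZeroDiff.add_dOut_move (h : G.ZeroDiff r) (hG : G.DealsOK Zs) (hqs : Zs ⊆ P.Z qs)
    {j : Fin P.n} (hj : j ∈ G.st.CS) (hjZ : j ∉ Zs) {R R' : Table P F}
    (hR : R ∈ completions Zs (G.table r)) (hR' : R' ∈ completions Zs (G.table r)) {g : Shift P F}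
    (hg : g.Valid Zs) (he : G.table r + G.dOut qs g = R) :
    G.table r + G.dOut qs (g + move qs j R R') = R' := by
  have hv := hg.add (valid_move hqs hR hR' hjZ)
  have h0 : ∀ l, (G.table r + G.dOut qs (g + move qs j R R')) l 0 = R' l 0 := fun l => by
    have := congrFun (congrFun he l) 0
    rw [Pi.add_apply, Pi.add_apply, dOut_zero] at this ⊢
    rw [dFactor_move hj, ← add_assoc, this]
    simp
  have h1 : ∀ l, (G.table r + G.dOut qs (g + move qs j R R')) l 1 = R' l 1 := fun l => by
    have := congrFun (congrFun he l) 1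
    rw [Pi.add_apply, Pi.add_apply, dOut_one] at this ⊢
    rw [dFactor_move hj, ← add_assoc, this]
    simp
  have h2 : ∀ l, (G.table r + G.dOut qs (g + move qs j R R')) l 2 = R' l 2 := fun l => by
    have hs : ∀ g' : Shift P F, g'.Valid Zs → ∑ pq, G.dProd g' l pq =
        (∑ q, (G.table r + G.dOut qs g') l 2 q) - ∑ q, G.table r l 2 q := fun g' hg' => by
      simp only [Pi.add_apply, Finset.sum_add_distrib]
      rw [sum_dOut_two hg', add_sub_cancel_left]
    have hm := (Finset.mem_filter.1 (h.add_dOut_mem hG hqs hv)).2.2 l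
    have hm' := (Finset.mem_filter.1 hR').2.2 l
    have h3 : ∑ q, (G.table r + G.dOut qs (g + move qs j R R')) l 2 q = ∑ q, R' l 2 q := by
      rw [hm, h0, h1, hm']
    have h4 := hs _ hv
    have h5 := hs g hg
    rw [h3] at h4
    rw [he] at h5
    have := congrFun (congrFun he l) 2
    rw [Pi.add_apply, Pi.add_apply, dOut_two, h5] at this
    rw [Pi.add_apply, Pi.add_apply, dOut_two, h4]
    have e : (g + move qs j R R').2 l =
        g.2 l + (R' l 2 - R l 2 - Pi.single qs (∑ q, (R' l 2 q - R l 2 q))) := rfl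
    rw [e, Finset.sum_sub_distrib]
    funext q
    have := congrFun this q
    by_cases hq : q = qs
    · subst hq
      simp only [Pi.add_apply, Pi.sub_apply, Pi.single_eq_same] at this ⊢
      linear_combination this
    · simp only [Pi.add_apply, Pi.sub_apply, Pi.single_eq_of_ne hq] at this ⊢
      linear_combination this
  funext l x
  fin_cases x
  · exact h0 l
  · exact h1 l
  · exact h2 l

/-- The valid shifts that lead from the computed output to `R`. -/
def fiber (Zs : Finset (Fin P.n)) (qs : Fin P.h) (G : Rec P F) (T R : Table P F) :
    Finset (Shift P F) := (validShifts P F Zs).filter fun g => T + G.dOut qs g = R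

theorem ZeroDiff.fiber_nonempty (h : G.ZeroDiff r) (h1 : G.Stage1) (hQ : P.Q 4)
    (hqs : Zs ⊆ P.Z qs) (hD : G.DecOK Zs) (hG : G.DealsOK Zs) {R : Table P F}
    (hR : R ∈ completions Zs (G.table r)) : (fiber Zs qs G (G.table r) R).Nonempty := by
  obtain ⟨j, hj, hjZ⟩ := h1.exists_honest hQ hqs hD
  have h0 := h.add_dOut_mem hG hqs (Shift.valid_zero (Zs := Zs) (F := F))
  exact ⟨_, Finset.mem_filter.2 ⟨Finset.mem_filter.2 ⟨Finset.mem_univ _,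
    Shift.valid_zero.add (valid_move hqs h0 hR hjZ)⟩,
    h.add_dOut_move hG hqs hj hjZ h0 hR Shift.valid_zero rfl⟩⟩

/-- A uniform completion, together with a uniform shift that leads to it, is the same as a uniform
shift, together with the completion to which it leads. -/
theorem ZeroDiff.bind_completeTriples (h : G.ZeroDiff r) (h1 : G.Stage1) (hQ : P.Q 4)
    (hqs : Zs ⊆ P.Z qs) (hD : G.DecOK Zs) (hG : G.DealsOK Zs) {α : Type}
    (k : Table P F → Shift P F → PMF α) :
    ((completeTriples Zs (G.table r)).bind fun R =>
      (uniformOn (fiber Zs qs G (G.table r) R) 0).bind (k R)) =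
      (uniformOn (validShifts P F Zs) 0).bind fun g => k (G.table r + G.dOut qs g) g := by
  obtain ⟨j, hj, hjZ⟩ := h1.exists_honest hQ hqs hD
  have hz : (0 : Shift P F) ∈ validShifts P F Zs :=
    Finset.mem_filter.2 ⟨Finset.mem_univ _, Shift.valid_zero⟩
  have hmove : ∀ R ∈ completions Zs (G.table r), ∀ R' ∈ completions Zs (G.table r),
      ∀ g ∈ validShifts P F Zs, G.table r + G.dOut qs g = R →
        g + move qs j R R' ∈ validShifts P F Zs ∧
          G.table r + G.dOut qs (g + move qs j R R') = R' := fun R hR R' hR' g hg he =>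
    ⟨Finset.mem_filter.2 ⟨Finset.mem_univ _,
      (Finset.mem_filter.1 hg).2.add (valid_move hqs hR hR' hjZ)⟩,
      h.add_dOut_move hG hqs hj hjZ hR hR' (Finset.mem_filter.1 hg).2 he⟩
  have hf : ∀ g ∈ validShifts P F Zs, G.table r + G.dOut qs g ∈ completions Zs (G.table r) :=
    fun g hg => h.add_dOut_mem hG hqs (Finset.mem_filter.1 hg).2
  have hu := uniformOn_bind_fiber (f := fun g => G.table r + G.dOut qs g)
    (Φ := fiber Zs qs G (G.table r)) (fun _ _ => Finset.mem_filter) ⟨0, hz⟩ hf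
    (fun R hR R' hR' => ⟨fun g => g + move qs j R R', add_left_injective _, hmove R hR R' hR'⟩)
    (G.table r) 0
  rw [completeTriples_eq hqs, ← hu, PMF.bind_bind]
  refine PMF.bind_congr_support fun R hR => PMF.bind_congr_support fun g hg => ?_
  rw [mem_support_uniformOn (completions_nonempty hqs _)] at hR
  have hne := h.fiber_nonempty h1 hQ hqs hD hG hR
  rw [mem_support_uniformOn hne] at hg
  rw [(Finset.mem_filter.1 hg).2]

end Rec

end

/-! ### Simulation of systems -/

section

variable {n : ℕ} {Out : Type} {Y Y' : System n Out}

/-- If the state of `Y` is, given that of `Y'` and all responses so far, always distributed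
according to `κ`, then no environment distinguishes `Y` from `Y'`. -/
theorem outcome_eq_of_simulation (κ : Y'.W → PMF Y.W) (J : Y'.W → Prop) (hJ0 : J Y'.init)
    (hκ0 : κ Y'.init = PMF.pure Y.init)
    (hJ : ∀ x cmd, J x → ∀ y ∈ (Y'.respond x cmd).support, J y.1)
    (hκ : ∀ x cmd, J x → (κ x).bind (fun u => Y.respond u cmd) =
      (Y'.respond x cmd).bind fun y => (κ y.1).map fun u => (u, y.2))
    (E : Env n Out) (k : ℕ) : outcome E Y k = outcome E Y' k := by
  let lift : Config E Y' → PMF (Config E Y) := fun c =>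
    (κ c.sys).map fun u => ⟨c.env, u, c.last, c.bit⟩
  have h : (∀ c ∈ (run E Y' k).support, J c.sys) ∧ run E Y k = (run E Y' k).bind lift := by
    induction k with
    | zero =>
        refine ⟨fun c hc => ?_, ?_⟩
        · obtain rfl := (PMF.mem_support_pure_iff _ _).1 hc
          exact hJ0
        · simp only [run, PMF.pure_bind, lift, hκ0, PMF.pure_map]
    | succ k ih =>
        obtain ⟨ih1, ih2⟩ := ih
        refine ⟨fun c hc => ?_, ?_⟩
        · obtain ⟨c', hc', hc⟩ := (PMF.mem_support_bind_iff _ _ _).1 hc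
          unfold runStep at hc
          split_ifs at hc with hb
          · obtain ⟨⟨e, cmd | b⟩, -, hc⟩ := (PMF.mem_support_bind_iff _ _ _).1 hc
            · obtain ⟨y, hy, rfl⟩ := (PMF.mem_support_map_iff _ _ _).1 hc
              exact hJ _ _ (ih1 c' hc') y hy
            · obtain rfl := (PMF.mem_support_pure_iff _ _).1 hc
              exact ih1 c' hc'
          · obtain rfl := (PMF.mem_support_pure_iff _ _).1 hc
            exact ih1 c hc'
        · simp only [run]
          rw [ih2, PMF.bind_bind, PMF.bind_bind]
          refine PMF.bind_congr_support fun c hc => ?_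
          simp only [lift, PMF.bind_map]
          unfold runStep
          by_cases hb : c.bit = none
          · simp only [hb, Function.comp_def, if_true]
            rw [PMF.bind_comm, PMF.bind_bind]
            congr 1
            funext x
            obtain ⟨e, cmd | b⟩ := x
            · simp only [PMF.bind_map, Function.comp_def]
              rw [← PMF.map_bind, hκ _ _ (ih1 c hc), PMF.map_bind]
              simp only [PMF.map_comp, Function.comp_def]
            · simp only [PMF.pure_bind]
              rfl
          · simp only [if_neg hb, Function.comp_def, PMF.pure_bind]
            rfl
  rw [outcome, outcome, h.2, PMF.map_bind]
  rw [← PMF.bind_pure_comp]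
  congr 1
  funext c
  simp only [lift, PMF.map_comp, Function.comp_def]
  exact PMF.map_const _ _

end

/-! ### The simulator -/

section

variable [Fintype F] {Zs : Finset (Fin P.n)} {qs : Fin P.h} {w w' : World P F} {I I' : Ideal P F}
  {B : ℕ} {i : Fin P.n}

/-- The parties in `S` receive their input. -/
def World.sync (S : Set (Fin P.n)) (w : World P F) : World P F :=
  { w with parties := fun i =>
      if i ∈ S then { w.parties i with started := True } else w.parties i }

theorem World.sync_eq {S : Set (Fin P.n)} (h : ∀ i ∈ S, (w.parties i).started) :
    w.sync S = w := by
  have e : (fun i => if i ∈ S then { w.parties i with started := True } else w.parties i) =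
      w.parties := by
    funext i
    split_ifs with hi
    · have : (w.parties i).started = True := eq_true (h i hi)
      rw [← this]
    · rfl
  rw [World.sync, e]

theorem World.sync_insert (S : Set (Fin P.n)) :
    w.sync (insert i S) =
      (w.sync S).setParty i { (w.sync S).parties i with started := True } := by
  simp only [World.sync, World.setParty, World.mk.injEq, and_true]
  funext k
  by_cases hk : k = i
  · subst hk
    simp only [Set.mem_insert_iff, true_or, if_true, Function.update_self]
    split_ifs <;> rfl
  · simp only [Set.mem_insert_iff, hk, false_or, Function.update_of_ne hk]

/-- What the simulator tells the functionality after an activation of party `i` in its copy of the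
hybrid world: it requests triples for all corrupt parties, and if party `i` obtains its output in
the copy, then it supplies the shares of this output. -/
def simOps (Zs : Finset (Fin P.n)) (i : Fin P.n) (y : World P F × Resp (Table P F)) :
    List (SOp P F) :=
  Zs.toList.map SOp.triples ++
    match y.2 with
    | .output _ => [.shares (y.1.record.table (y.1.parties i).iter)]
    | _ => []

/-- The simulator runs the hybrid world with the adversary. Party `i` gets its output when it does
so there. -/
def simulator (B : ℕ) (Zs : Finset (Fin P.n)) (A : Adversary P F) : Simulator P F where
  St := A.St × World P F
  init := (A.init, World.init P F)
  onEnv := fun s v m => (A.onEnv s.1 ((s.2.sync v.started).view Zs) m).map fun a =>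
    ((a.1, (s.2.sync v.started).applyOps Zs a.2.1), [], a.2.2)
  onReq := fun s v i => (A.onReq s.1 ((s.2.sync v.started).view Zs) i).bind fun a =>
    (((s.2.sync v.started).applyOps Zs a.2.1).activate B Zs i a.2.2).map fun y =>
      ((a.1, y.1), simOps Zs i y, match y.2 with | .output _ => true | _ => false)

/-- The copy `w` of the hybrid world keeps pace with the ideal world `I`. -/
structure Synced (B : ℕ) (Zs : Finset (Fin P.n)) (w : World P F) (I : Ideal P F) : Prop where
  inv : Inv Zs w
  clock : I.clock = w.clock
  started : ∀ i, I.startedAt i ≠ none ↔ (w.parties i).started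
  sent : I.alive ⊆ I.sent
  quorum : I.quorumAt ≠ none → P.Quorum I.alive
  past : ∀ i c d, I.startedAt i = some c → I.quorumAt = some d →
    ∃ x : World P F, Inv Zs x ∧ Relation.ReflTransGen (Step B Zs) x w ∧
      x.clock.round ≤ max c d ∧ i ∈ x.alive Zs ∧ P.Quorum (x.alive Zs)

/-- The output table has been computed in iteration `r`. -/
structure Rec.Final (G : Rec P F) (r : ℕ) : Prop where
  pos : 1 ≤ r
  stage : G.Stage1
  zero : G.ZeroDiff r
  first : ∀ r', 1 ≤ r' → r' < r → G.conf r' ≠ none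

/-- In addition, the outputs have been given to the same parties, and the completed triples are
compatible with the output in the copy. -/
structure Coupled (B : ℕ) (Zs : Finset (Fin P.n)) (w : World P F) (I : Ideal P F) : Prop
    extends Synced B Zs w I where
  delivered : ∀ i ∉ Zs, i ∈ I.delivered ↔ (w.parties i).out ≠ none
  fresh : I.result = none → I.shares = none ∧ ∀ i ∉ Zs, (w.parties i).out = none
  fixed : ∀ R, I.result = some R → ∃ r, w.record.Final r ∧
    I.shares = some (w.record.table r) ∧ R ∈ completions Zs (w.record.table r)

theorem Rec.Final.mono {G G' : Rec P F} {r : ℕ} (h : G.Final r) (hG : G ≤ G') :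
    G'.Final r ∧ G'.table r = G.table r := by
  refine ⟨⟨h.pos, h.stage.mono hG, h.zero.mono hG, fun r' h1 h2 => ?_⟩,
    Rec.table_mono h.stage h.zero.1 hG⟩
  obtain ⟨p, hp⟩ := Option.ne_none_iff_exists'.1 (h.first r' h1 h2)
  rw [Rec.conf_mono hG hp]
  simp

theorem Rec.Final.unique {G : Rec P F} {r r' : ℕ} (h : G.Final r) (h' : G.Final r') : r = r' := by
  rcases lt_trichotomy r r' with hl | hl | hl
  · exact absurd h.zero.conf_eq (h'.first r h.pos hl)
  · exact hl
  · exact absurd h'.zero.conf_eq (h.first r' h'.pos hl)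

/-- An honest party outputs its shares of the output table. -/
theorem Inv.final (h : Inv Zs w) (hi : i ∉ Zs) {T : Table P F}
    (hT : (w.parties i).out = some T) : w.record.Final (w.parties i).iter ∧
      T = fun l x => mask i (w.record.table (w.parties i).iter l x) := by
  have ha := h.agree i hi
  obtain ⟨h1, h2, h3, h4⟩ := ha.out T hT
  refine ⟨⟨h1, ha.stage1 h1, h2, fun r' h5 h6 => ?_⟩, ?_⟩
  · obtain ⟨p, hp⟩ := Option.ne_none_iff_exists'.1 (ha.confPast r' h5 h6)
    rw [(ha.confSome _ _ hp).2.2.2]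
    simp
  · rw [h4]
    funext l x
    fin_cases x <;> rfl

theorem Synced.alive_eq (h : Synced B Zs w I) : I.alive = w.alive Zs := by
  ext i
  simp only [Ideal.alive, World.alive, Finset.mem_filter, Finset.mem_univ, true_and, h.started]
  exact ⟨fun hs => ⟨h.inv.startedHonest i hs, hs⟩, fun hs => hs.2⟩

theorem Synced.step (h : Synced B Zs w I) (hQ : P.Q 4) (hZ : P.Covered Zs)
    (hs : Step B Zs w w') (hst : ∀ i, (w'.parties i).started ↔ (w.parties i).started)
    (e1 : I'.startedAt = I.startedAt) (e2 : I'.quorumAt = I.quorumAt) (e3 : I.sent ⊆ I'.sent)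
    (e4 : I'.clock = w'.clock) : Synced B Zs w' I' := by
  have ea : I'.alive = I.alive := by simp only [Ideal.alive, e1]
  refine ⟨(h.inv.step hQ hZ hs).1, e4, fun i => ?_, ?_, ?_, ?_⟩
  · rw [e1, hst, h.started]
  · rw [ea]
    exact h.sent.trans e3
  · rw [e2, ea]
    exact h.quorum
  · rw [e1, e2]
    intro i c d hc hd
    obtain ⟨x, h1, h2, h3⟩ := h.past i c d hc hd
    exact ⟨x, h1, h2.tail hs, h3⟩

/-- The output of a party is not yet due in the ideal world if it has no output in the copy. -/
theorem Synced.not_due (h : Synced B Zs w I) (hQ : P.Q 4) (hZ : P.Covered Zs) {C : ℕ}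
    (hC : 16 ≤ C) (ho : (w.parties i).out = none) : ¬ I.due ((P.n + P.h + B + 2) ^ C) i := by
  rintro ⟨c, d, hc, hd, hle⟩
  obtain ⟨x, h1, h2, h3, h4, h5⟩ := h.past i c d hc hd
  refine Steps.out hQ hZ hC h1 h2 h4 h5 ?_ ho
  rw [← h.clock]
  omega

/-- When an output is computed, the requests of a quorum have been sent. -/
theorem Synced.quorum_sent (h : Synced B Zs w I) (hQ : P.Q 4) (hZ : P.Covered Zs)
    (h1 : w.record.Stage1) : P.Quorum (I.sent ∪ Zs) := by
  obtain ⟨j, -, -⟩ := Params.Quorum.exists_honest hQ (A := Finset.univ) ⟨P.z0, by simp⟩ hZ P.z0 P.z0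
  obtain ⟨b, hb⟩ := Option.ne_none_iff_exists'.1 (h1.1 j)
  obtain ⟨⟨b', c⟩, hd, -⟩ := Option.map_eq_some_iff.1 hb
  obtain ⟨-, -, C, hC, hv⟩ := h.inv.dec _ _ _ hd
  refine hC.mono fun k hk => ?_
  by_cases hkZ : k ∈ Zs
  · exact Finset.mem_union_right _ hkZ
  · obtain ⟨x, hx⟩ := Option.ne_none_iff_exists'.1 (hv k hk)
    refine Finset.mem_union_left _ (h.sent ?_)
    rw [h.alive_eq]
    exact Finset.mem_filter.2 ⟨Finset.mem_univ _, hkZ, (h.inv.votes k hkZ _ _ hx).1⟩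

theorem Ideal.applyOps_triples (L : List (Fin P.n)) (hL : ∀ j ∈ L, j ∈ Zs) (I : Ideal P F)
    (ops : List (SOp P F)) : I.applyOps Zs (L.map SOp.triples ++ ops) =
      Ideal.applyOps Zs { I with sent := I.sent ∪ L.toFinset } ops := by
  unfold Ideal.applyOps
  induction L generalizing I with
  | nil => simp
  | cons j L ih =>
      have e : I.applyOp Zs (.triples j) = { I with sent := insert j I.sent } :=
        if_pos (hL j (by simp))
      rw [List.map_cons, List.cons_append, List.foldl_cons, e,
        ih fun k hk => hL k (List.mem_cons_of_mem _ hk)]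
      congr 2
      ext k
      simp only [Finset.mem_union, Finset.mem_insert, List.mem_toFinset, List.mem_cons]
      tauto

theorem World.activate_support (h : Inv Zs w) (hQ : P.Q 4) (hZ : P.Covered Zs) (hi : i ∉ Zs)
    (hs : (w.parties i).started) {D : Set (Item P)} {y : World P F × Resp (Table P F)}
    (hy : y ∈ (w.activate B Zs i D).support) :
    Step B Zs w y.1 ∧ (∀ k, (y.1.parties k).started ↔ (w.parties k).started) ∧
      (∀ k ≠ i, (y.1.parties k).out = (w.parties k).out) ∧
      y.1.clock = w.clock.tick (w.alive Zs) i ∧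
      (((w.parties i).out ≠ none ∧ (y.1.parties i).out ≠ none ∧ y.2 = .nothing) ∨
        ((w.parties i).out = none ∧ (y.1.parties i).out = none ∧ y.2 = .nothing) ∨
        ∃ T, (w.parties i).out = none ∧ (y.1.parties i).out = some T ∧ y.2 = .output T) := by
  obtain ⟨v, hv, rfl⟩ := (PMF.mem_support_map_iff _ _ _).1 hy
  have hstep : Step B Zs w { v with clock := v.clock.tick (v.alive Zs) i } := .act hi hs D hv
  obtain ⟨h1, h2⟩ := h.forceAba hQ hZ B
  obtain ⟨h3, h4⟩ := h1.deliver hi B D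
  obtain ⟨h5, h6, -, h7, h8⟩ := h3.actions hQ hZ hi
    ((h4.parties _).started ((h2.parties _).started hs)) hv
  have hk : ∀ k ≠ i, v.parties k = w.parties k := fun k hk => by
    rw [h7 k hk]
    exact Function.update_of_ne hk _ _
  have hst : ∀ k, (v.parties k).started ↔ (w.parties k).started := fun k => by
    by_cases hki : k = i
    · subst hki
      exact iff_of_true (((h.step hQ hZ hstep).2.parties k).started hs) hs
    · rw [hk k hki]
  refine ⟨hstep, hst, fun k hki => by rw [← hk k hki], ?_, ?_⟩
  · have e : v.alive Zs = w.alive Zs := by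
      ext k
      simp only [World.alive, Finset.mem_filter, hst]
    simp only [e, h8]
    rfl
  · have hmono := ((h.step hQ hZ hstep).2.parties i).out
    cases ho : (w.parties i).out with
    | some T =>
        left
        have := (hmono (by simp [ho])).1
        simp only [ho] at this
        refine ⟨by simp, by simp [this], rfl⟩
    | none =>
        right
        cases ho' : (v.parties i).out with
        | none => exact Or.inl ⟨rfl, rfl, rfl⟩
        | some T => exact Or.inr ⟨T, rfl, rfl, rfl⟩

end

/-! ### Perfect security -/

section

variable [Fintype F] {Zs : Finset (Fin P.n)} {qs : Fin P.h} {w w' : World P F} {I I' : Ideal P F}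
  {B : ℕ} {i : Fin P.n}

/-- The distribution of the shift of the hidden shares, given the completed triples. -/
def shiftDist (Zs : Finset (Fin P.n)) (qs : Fin P.h) (G : Rec P F) (I : Ideal P F) :
    PMF (Shift P F) :=
  match I.result with
  | none => uniformOn (validShifts P F Zs) 0
  | some R => uniformOn (Rec.fiber Zs qs G (I.shares.getD 0) R) 0

theorem validShifts_nonempty : (validShifts P F Zs).Nonempty :=
  ⟨0, Finset.mem_filter.2 ⟨Finset.mem_univ _, Shift.valid_zero⟩⟩

theorem shiftDist_congr {G : Rec P F} (e1 : I'.result = I.result) (e2 : I'.shares = I.shares) :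
    shiftDist Zs qs G I' = shiftDist Zs qs G I := by
  simp only [shiftDist, e1, e2]

/-- The shifts that can occur are valid, and they turn the output of the hybrid world into the completed
triples. -/
theorem Coupled.mem_shiftDist (h : Coupled B Zs w I) (hQ : P.Q 4) (hqs : Zs ⊆ P.Z qs)
    {g : Shift P F} (hg : g ∈ (shiftDist Zs qs w.record I).support) : Hidden Zs qs g ∧
      ∀ R, I.result = some R → I.shares.getD 0 + w.record.dOut qs g = R := by
  unfold shiftDist at hg
  cases hR : I.result with
  | none =>
      simp only [hR] at hg
      rw [mem_support_uniformOn validShifts_nonempty] at hg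
      exact ⟨⟨hQ, hqs, (Finset.mem_filter.1 hg).2⟩, fun R h => by simp at h⟩
  | some R =>
      simp only [hR] at hg
      obtain ⟨r, h1, h2, h3⟩ := h.fixed R hR
      rw [h2, Option.getD_some, mem_support_uniformOn
        (h1.zero.fiber_nonempty h1.stage hQ hqs h.inv.decOK h.inv.dealsOK h3)] at hg
      obtain ⟨h4, h5⟩ := Finset.mem_filter.1 hg
      refine ⟨⟨hQ, hqs, (Finset.mem_filter.1 h4).2⟩, fun R' h => ?_⟩
      cases h
      rw [h2, Option.getD_some, h5]

/-- As soon as there are completed triples, the change of the output does not depend on the further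
course of the execution. -/
theorem Coupled.shiftDist_eq (h : Coupled B Zs w I) (hG : w.record ≤ w'.record) :
    shiftDist Zs qs w'.record I = shiftDist Zs qs w.record I := by
  unfold shiftDist
  cases hR : I.result with
  | none => rfl
  | some R =>
      obtain ⟨r, h1, -⟩ := h.fixed R hR
      simp only [Rec.fiber, h1.stage.dOut_eq hG]

/-- A step without new outputs. -/
theorem Coupled.step (h : Coupled B Zs w I) (hQ : P.Q 4) (hZ : P.Covered Zs)
    (hs : Step B Zs w w') (hS : Synced B Zs w' I')
    (ho : ∀ i ∉ Zs, (w'.parties i).out = none ↔ (w.parties i).out = none)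
    (e1 : I'.delivered = I.delivered) (e2 : I'.result = I.result) (e3 : I'.shares = I.shares) :
    Coupled B Zs w' I' := by
  refine { hS with delivered := fun i hi => ?_, fresh := fun hR => ?_, fixed := fun R hR => ?_ }
  · rw [e1, h.delivered i hi, ne_eq, ne_eq, ho i hi]
  · rw [e2] at hR
    rw [e3]
    exact ⟨(h.fresh hR).1, fun i hi => (ho i hi).2 ((h.fresh hR).2 i hi)⟩
  · rw [e2] at hR
    obtain ⟨r, h1, h2, h3⟩ := h.fixed R hR
    obtain ⟨h4, h5⟩ := h1.mono (h.inv.step hQ hZ hs).2.record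
    exact ⟨r, h4, by rw [e3, h5, h2], by rwa [h5]⟩

theorem Coupled.init (hQ : P.Q 4) : Coupled B Zs (World.init P F) (Ideal.init P F) where
  inv := .init hQ Zs
  clock := rfl
  started i := by simp [Ideal.init, World.init, PartySt.init]
  sent := by simp [Ideal.init, Ideal.alive]
  quorum h := by simp [Ideal.init] at h
  past _ _ _ h := by simp [Ideal.init] at h
  delivered i _ := by simp [Ideal.init, World.init, PartySt.init]
  fresh _ := ⟨rfl, fun _ _ => rfl⟩
  fixed _ h := by simp [Ideal.init] at h

/-- A party gets its input. -/
theorem Coupled.request (h : Coupled B Zs w I) (hQ : P.Q 4) (hZ : P.Covered Zs) (hi : i ∉ Zs) :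
    Coupled B Zs (w.setParty i { w.parties i with started := True }) (I.request i) := by
  have hstep : Step B Zs w (w.setParty i { w.parties i with started := True }) := .start hi
  have hst : ∀ k, ((w.setParty i { w.parties i with started := True }).parties k).started ↔
      (w.parties k).started ∨ k = i := fun k => by
    by_cases hk : k = i
    · subst hk
      simp [World.setParty]
    · simp [World.setParty, hk]
  have hout : ∀ k ∉ Zs, ((w.setParty i { w.parties i with started := True }).parties k).out = none ↔
      (w.parties k).out = none := fun k _ => by
    by_cases hk : k = i
    · subst hk
      simp [World.setParty]
    · simp [World.setParty, Function.update_of_ne hk]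
  by_cases hn : I.startedAt i = none
  · have hinv := (h.inv.step hQ hZ hstep).1
    have hnew : ∀ k, Function.update I.startedAt i (some I.clock.round) k ≠ none ↔
        I.startedAt k ≠ none ∨ k = i := fun k => by
      by_cases hk : k = i
      · subst hk
        simp
      · simp [hk]
    have halive : ∀ {J : Ideal P F}, J.startedAt =
        Function.update I.startedAt i (some I.clock.round) → J.alive = insert i I.alive := by
      intro J hJ
      ext k
      simp only [Ideal.alive, hJ, hnew, Finset.mem_filter, Finset.mem_univ, true_and,
        Finset.mem_insert]
      tauto
    have halive' : (w.setParty i { w.parties i with started := True }).alive Zs =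
        insert i I.alive := by
      ext k
      rw [h.alive_eq]
      simp only [World.alive, Finset.mem_filter, Finset.mem_univ, true_and, hst,
        Finset.mem_insert]
      constructor
      · tauto
      · rintro (rfl | h1)
        · exact ⟨hi, Or.inr rfl⟩
        · exact ⟨h1.1, Or.inl h1.2⟩
    unfold Ideal.request
    rw [if_pos hn]
    refine h.step hQ hZ hstep ⟨hinv, h.clock, fun k => ?_, ?_, ?_, ?_⟩ hout rfl rfl rfl
    · rw [hst, ← h.started]
      exact hnew k
    · rw [halive rfl]
      exact Finset.insert_subset_insert _ h.sent
    · rw [halive rfl]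
      intro hq
      by_cases hq' : I.quorumAt = none
      · simp only at hq
        split_ifs at hq with hc
        · rw [halive rfl] at hc
          exact hc.2
        · exact absurd hq' hq
      · exact (h.quorum hq').mono (Finset.subset_insert _ _)
    · intro k c d hc hd
      have hk : k ∈ insert i I.alive := by
        rw [← halive' , World.alive, Finset.mem_filter, hst, ← h.started]
        have := (hnew k).1 (Option.ne_none_iff_exists'.2 ⟨c, hc⟩)
        refine ⟨Finset.mem_univ _, ?_, this⟩
        rcases this with h1 | rfl
        · exact h.inv.startedHonest k ((h.started k).1 h1)
        · exact hi
      -- either the past of the earlier state can be used, or everything is as required right now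
      have hnow : P.Quorum (insert i I.alive) → w.clock.round ≤ max c d →
          ∃ x : World P F, Inv Zs x ∧ Relation.ReflTransGen (Step B Zs) x
            (w.setParty i { w.parties i with started := True }) ∧
            x.clock.round ≤ max c d ∧ k ∈ x.alive Zs ∧ P.Quorum (x.alive Zs) := fun h1 h2 =>
        ⟨_, hinv, .refl, h2, by rwa [halive'], by rwa [halive']⟩
      simp only at hd
      split_ifs at hd with hq
      · rw [halive rfl] at hq
        cases hd
        exact hnow hq.2 (by rw [← h.clock]; exact le_max_right _ _)
      · by_cases hki : k = i
        · subst hki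
          simp only [Function.update_self, Option.some.injEq] at hc
          refine hnow ((h.quorum (by simp [hd])).mono (Finset.subset_insert _ _)) ?_
          rw [← h.clock, ← hc]
          exact le_max_left _ _
        · simp only [Function.update_of_ne hki] at hc
          obtain ⟨x, h1, h2, h3⟩ := h.past k c d hc hd
          exact ⟨x, h1, h2.tail hstep, h3⟩
  · have e : w.setParty i { w.parties i with started := True } = w := by
      have hs : (w.parties i).started = True := eq_true ((h.started i).1 hn)
      rw [World.setParty, ← hs, Function.update_eq_self]
    rw [Ideal.request, if_neg hn, e]
    exact h

/-- The activation of a party without a new output. -/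
theorem Coupled.activate_nothing (h : Coupled B Zs w I) (hQ : P.Q 4) (hZ : P.Covered Zs) {C : ℕ}
    (hC : 16 ≤ C) (hi : i ∉ Zs) (hs : (w.parties i).started) {D : Set (Item P)}
    {v : World P F} (hy : (v, .nothing) ∈ (w.activate B Zs i D).support) :
    (I.applyOps Zs (simOps Zs i (v, .nothing))).activate ((P.n + P.h + B + 2) ^ C) Zs i false =
        PMF.pure ({ I with sent := I.sent ∪ Zs, clock := v.clock }, .nothing) ∧
      Coupled B Zs v { I with sent := I.sent ∪ Zs, clock := v.clock } := by
  obtain ⟨h1, h2, h3, h4, h5⟩ := World.activate_support h.inv hQ hZ hi hs hy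
  have e : I.applyOps Zs (simOps Zs i (v, .nothing)) = { I with sent := I.sent ∪ Zs } := by
    rw [simOps, Ideal.applyOps_triples _ fun j hj => Finset.mem_toList.1 hj,
      Finset.toList_toFinset]
    rfl
  rw [e]
  have hio : (v.parties i).out = none ↔ (w.parties i).out = none := by
    rcases h5 with h5 | h5 | ⟨T, -, -, h5⟩
    · exact iff_of_false h5.2.1 h5.1
    · exact iff_of_true h5.2.1 h5.1
    · cases h5
  constructor
  · unfold Ideal.activate
    rw [if_neg]
    · have hc : I.clock.tick I.alive i = v.clock := by rw [h4, h.clock, h.alive_eq]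
      have ea : ({ I with sent := I.sent ∪ Zs } : Ideal P F).alive = I.alive := rfl
      simp only [ea, hc]
    · rintro ⟨hd, -, ⟨hf, -⟩ | hdue⟩
      · cases hf
      · refine h.not_due hQ hZ hC ?_ hdue
        by_contra hn
        exact hd ((h.delivered i hi).2 hn)
  · refine h.step hQ hZ h1 (h.toSynced.step hQ hZ h1 h2 rfl rfl Finset.subset_union_left rfl)
      (fun k _ => ?_) rfl rfl rfl
    by_cases hk : k = i
    · rw [hk]
      exact hio
    · rw [h3 k hk]

/-- The ideal world after party `i` has received its output, where the triples are `R`. -/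
def Ideal.afterOutput (Zs : Finset (Fin P.n)) (I : Ideal P F) (i : Fin P.n) (v : World P F)
    (R : Table P F) : Ideal P F :=
  { I with
    sent := I.sent ∪ Zs
    shares := some (v.record.table (v.parties i).iter)
    result := some R
    delivered := insert i I.delivered
    clock := v.clock }

/-- The activation of a party with a new output. -/
theorem Coupled.activate_output (h : Coupled B Zs w I) (hQ : P.Q 4) (hZ : P.Covered Zs) (b : ℕ)
    (hi : i ∉ Zs) (hs : (w.parties i).started) {D : Set (Item P)}
    {v : World P F} {T : Table P F} (hy : (v, .output T) ∈ (w.activate B Zs i D).support) :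
    v.record.Final (v.parties i).iter ∧
      T = (fun l x => mask i (v.record.table (v.parties i).iter l x)) ∧
      (∀ R, I.result = some R → I.shares = some (v.record.table (v.parties i).iter) ∧
        R ∈ completions Zs (v.record.table (v.parties i).iter)) ∧
      (I.applyOps Zs (simOps Zs i (v, .output T))).activate b Zs i true =
        PMF.map (fun R => (I.afterOutput Zs i v R, .output fun l x => mask i (R l x)))
          (match I.result with
            | some R => PMF.pure R
            | none => completeTriples Zs (v.record.table (v.parties i).iter)) ∧
      ∀ R ∈ completions Zs (v.record.table (v.parties i).iter),
        Coupled B Zs v (I.afterOutput Zs i v R) := by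
  obtain ⟨h1, h2, h3, h4, h5⟩ := World.activate_support h.inv hQ hZ hi hs hy
  obtain ⟨h6, h7⟩ := h.inv.step hQ hZ h1
  obtain ⟨T', ho, ho', hT⟩ : ∃ T', (w.parties i).out = none ∧ (v.parties i).out = some T' ∧
      (Resp.output T : Resp (Table P F)) = .output T' := by
    rcases h5 with ⟨-, -, h5⟩ | ⟨-, -, h5⟩ | h5
    · cases h5
    · cases h5
    · exact h5
  cases hT
  obtain ⟨hfin, hTeq⟩ := h6.final hi ho'
  have hres : ∀ R, I.result = some R → I.shares = some (v.record.table (v.parties i).iter) ∧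
      R ∈ completions Zs (v.record.table (v.parties i).iter) := fun R hR => by
    obtain ⟨r, h8, h9, h10⟩ := h.fixed R hR
    obtain ⟨h11, h12⟩ := h8.mono h7.record
    rw [← h11.unique hfin, h12]
    exact ⟨h9, h10⟩
  have e : I.applyOps Zs (simOps Zs i (v, .output T)) = { I with
      sent := I.sent ∪ Zs
      shares := some (v.record.table (v.parties i).iter) } := by
    rw [simOps, Ideal.applyOps_triples _ fun j hj => Finset.mem_toList.1 hj,
      Finset.toList_toFinset]
    simp only [Ideal.applyOps, List.foldl_cons, List.foldl_nil, Ideal.applyOp]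
    split_ifs with hn
    · rfl
    · cases hR : I.result with
      | none => exact absurd (h.fresh hR).1 hn
      | some R => rw [← (hres R hR).1]
  have hsync : ∀ R, Synced B Zs v (I.afterOutput Zs i v R) := fun R =>
    h.toSynced.step hQ hZ h1 h2 rfl rfl Finset.subset_union_left rfl
  refine ⟨hfin, hTeq, hres, ?_, fun R hR => ?_⟩
  · rw [e]
    unfold Ideal.activate
    rw [if_pos]
    · have hc : I.clock.tick I.alive i = v.clock := by rw [h4, h.clock, h.alive_eq]
      have ea : ({ I with
        sent := I.sent ∪ Zs
        shares := some (v.record.table (v.parties i).iter) } : Ideal P F).alive = I.alive := rfl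
      simp only [ea, hc]
      unfold Ideal.prepare
      rfl
    · refine ⟨fun hd => (h.delivered i hi).1 hd ho, ?_, Or.inl ⟨rfl, Or.inl (by simp)⟩⟩
      have := (hsync 0).quorum_sent hQ hZ hfin.stage
      refine this.mono ?_
      simp only [Ideal.afterOutput, Finset.union_assoc, Finset.union_self, subset_rfl]
  · refine { hsync R with
      delivered := fun k hk => ?_
      fresh := fun hn => by simp [Ideal.afterOutput] at hn
      fixed := fun R' hR' => ?_ }
    · simp only [Ideal.afterOutput, Finset.mem_insert]
      by_cases hki : k = i
      · subst hki
        simp [ho']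
      · rw [h3 k hki, h.delivered k hk]
        simp [hki]
    · simp only [Ideal.afterOutput, Option.some.injEq] at hR'
      subst hR'
      exact ⟨_, hfin, rfl, hR⟩

/-- The shares of an output and the shift of the hidden shares are distributed in the same way,
whether the output in the copy is shifted, or the functionality chooses the output and the shift is
chosen accordingly. -/
theorem Coupled.bind_activate (h : Coupled B Zs w I) (hQ : P.Q 4) (hqs : Zs ⊆ P.Z qs) {C : ℕ}
    (hC : 16 ≤ C) (hi : i ∉ Zs) (hs : (w.parties i).started) {D : Set (Item P)}
    {y : World P F × Resp (Table P F)} (hy : y ∈ (w.activate B Zs i D).support) :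
    (shiftDist Zs qs w.record I).map
        (fun g => (y.1.blur Zs qs g, y.2.shift i (y.1.record.dOut qs g))) =
      ((I.applyOps Zs (simOps Zs i y)).activate ((P.n + P.h + B + 2) ^ C) Zs i
        (match y.2 with | .output _ => true | _ => false)).bind fun z =>
          (shiftDist Zs qs y.1.record z.1).map fun g => (y.1.blur Zs qs g, z.2) := by
  have hZ : P.Covered Zs := ⟨qs, hqs⟩
  have hrec := (h.inv.step hQ hZ (World.activate_support h.inv hQ hZ hi hs hy).1).2.record
  have hinv := (h.inv.step hQ hZ (World.activate_support h.inv hQ hZ hi hs hy).1).1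
  obtain ⟨v, _ | T | m⟩ := y
  · dsimp only at hrec ⊢
    rw [(h.activate_nothing hQ hZ hC hi hs hy).1, PMF.pure_bind, ← h.shiftDist_eq hrec]
    rfl
  · obtain ⟨h1, rfl, h3, h4, -⟩ := h.activate_output hQ hZ ((P.n + P.h + B + 2) ^ C) hi hs hy
    have hmask : ∀ g : Shift P F, (fun l x => mask i (v.record.table (v.parties i).iter l x) +
        mask i (v.record.dOut qs g l x) : Table P F) = fun l x =>
          mask i ((v.record.table (v.parties i).iter + v.record.dOut qs g) l x) := fun g => by
      funext l x
      rw [Pi.add_apply, Pi.add_apply, mask_add]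
    simp only [h4, Resp.shift, hmask, PMF.bind_map, Function.comp_def]
    cases hR : I.result with
    | none =>
        have := h1.zero.bind_completeTriples h1.stage hQ hqs hinv.decOK hinv.dealsOK
          fun R g => PMF.pure (v.blur Zs qs g,
            (Resp.output fun l x => mask i (R l x) : Resp (Table P F)))
        simp only [shiftDist, hR, Ideal.afterOutput, Option.getD_some]
        exact this.symm
    | some R =>
        simp only [PMF.pure_bind]
        rw [shiftDist_congr (I := I) (I' := I.afterOutput Zs i v R) hR.symm (h3 R hR).1.symm, h.shiftDist_eq hrec]
        refine PMF.map_congr_support fun g hg => ?_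
        rw [← h.shiftDist_eq hrec] at hg
        obtain ⟨-, h5⟩ := h.mem_shiftDist hQ hqs ((h.shiftDist_eq hrec) ▸ hg)
        have h6 := h5 R hR
        obtain ⟨r, h7, -⟩ := h.fixed R hR
        rw [(h3 R hR).1, Option.getD_some, ← h7.stage.dOut_eq hrec] at h6
        rw [h6]
  · have := (World.activate_support h.inv hQ hZ hi hs hy).2.2.2.2
    simp at this

theorem Coupled.sync_eq (h : Coupled B Zs w I) : w.sync I.view.started = w :=
  World.sync_eq fun i hi => (h.started i).1 hi

/-- The copy of the hybrid world run by the simulator. -/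
def copy {St : Type} (x : (St × World P F) × Ideal P F) : World P F :=
  x.1.2.sync x.2.view.started

/-- The distribution of the state of the hybrid world, given that of the ideal world. -/
def hybridDist {St : Type} (Zs : Finset (Fin P.n)) (qs : Fin P.h)
    (x : (St × World P F) × Ideal P F) : PMF (St × World P F) :=
  (shiftDist Zs qs (copy x).record x.2).map fun g => (x.1.1, (copy x).blur Zs qs g)

theorem Coupled.hybridDist {St : Type} {a : St} (h : Coupled B Zs w I) :
    hybridDist Zs qs ((a, w), I) =
      (shiftDist Zs qs w.record I).map fun g => (a, w.blur Zs qs g) := by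
  have e : copy ((a, w), I) = w := h.sync_eq
  rw [AMPC.hybridDist, e]

theorem copy_request {St : Type} {a : St} {v : World P F} : copy ((a, v), I.request i) = (copy ((a, v), I)).setParty i
      { (copy ((a, v), I)).parties i with started := True } := by
  have e : (I.request i).view.started = insert i I.view.started := by
    ext k
    unfold Ideal.request
    split_ifs with h
    · by_cases hk : k = i
      · subst hk
        simp [Ideal.view]
      · simp [Ideal.view, hk]
    · have hi : i ∈ I.view.started := h
      rw [Set.insert_eq_of_mem hi]
  simp only [copy, e]
  exact World.sync_insert _

theorem map_bind_comm {α β γ : Type} (p : PMF α) (q : PMF β) (f : α → β → γ) :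
    (p.bind fun a => q.map (f a)) = q.bind fun b => p.map fun a => f a b :=
  PMF.bind_comm p q fun a b => PMF.pure (f a b)

/-- The reaction `r` of the hybrid world corresponds to the reaction `p` of the ideal world with
the simulator in the state `x`. -/
def Matches {St : Type} (B : ℕ) (Zs : Finset (Fin P.n)) (qs : Fin P.h)
    (x : (St × World P F) × Ideal P F)
    (r : St × World P F → PMF ((St × World P F) × Resp (Table P F)))
    (p : PMF (((St × World P F) × Ideal P F) × Resp (Table P F))) : Prop :=
  (∀ y ∈ p.support, Coupled B Zs (copy y.1) y.1.2) ∧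
    (hybridDist Zs qs x).bind r = p.bind fun y => (hybridDist Zs qs y.1).map fun u => (u, y.2)

variable {A : Adversary P F} {a : A.St}

theorem matches_nothing (hx : Coupled B Zs (copy ((a, w), I)) I) :
    Matches B Zs qs ((a, w), I) (fun u => PMF.pure (u, .nothing))
      (PMF.pure (((a, w), I), .nothing)) := by
  refine ⟨fun y hy => ?_, ?_⟩
  · obtain rfl := (PMF.mem_support_pure_iff _ _).1 hy
    exact hx
  · rw [PMF.pure_bind]
    rfl

theorem matches_input (hQ : P.Q 4) (hZ : P.Covered Zs) (hx : Coupled B Zs (copy ((a, w), I)) I) :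
    Matches B Zs qs ((a, w), I)
      (fun u => PMF.pure ((u.1, if i ∈ Zs then u.2 else
        u.2.setParty i { u.2.parties i with started := True }), .nothing))
      (PMF.pure (((a, w), if i ∈ Zs then I else I.request i), .nothing)) := by
  by_cases hi : i ∈ Zs
  · simp only [if_pos hi]
    exact matches_nothing hx
  simp only [if_neg hi]
  have h1 := hx.request hQ hZ hi
  have e := copy_request (i := i) (I := I) (a := a) (v := w)
  refine ⟨fun y hy => ?_, ?_⟩
  · obtain rfl := (PMF.mem_support_pure_iff _ _).1 hy
    dsimp only
    rw [e]
    exact h1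
  · rw [PMF.pure_bind]
    simp only [hybridDist, PMF.bind_map, PMF.map_comp, e]
    have e2 : shiftDist Zs qs ((copy ((a, w), I)).setParty i
        { (copy ((a, w), I)).parties i with started := True }).record (I.request i) =
        shiftDist Zs qs (copy ((a, w), I)).record I := by
      unfold Ideal.request
      split_ifs <;> rfl
    rw [e2, ← PMF.bind_pure_comp]
    congr 1
    funext g
    simp only [Function.comp_def]
    rw [World.start_blur hi]

theorem Coupled.applyOps (h : Coupled B Zs w I) (hQ : P.Q 4) (hZ : P.Covered Zs)
    (ops : List (Op P F)) : Coupled B Zs (w.applyOps Zs ops) I :=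
  h.step hQ hZ (.ops ops) (h.toSynced.step hQ hZ (.ops ops)
    (fun k => by rw [((World.applyOps_same ops).2 k).2]) rfl rfl subset_rfl
    (by rw [h.clock, World.applyOps_clock]))
    (fun k _ => by rw [((World.applyOps_same ops).2 k).1]) rfl rfl rfl

theorem matches_toAdv (hQ : P.Q 4) (hqs : Zs ⊆ P.Z qs) (hx : Coupled B Zs (copy ((a, w), I)) I)
    (m : Msg) : Matches B Zs qs ((a, w), I)
      (fun u => (A.onEnv u.1 (u.2.view Zs) m).map fun b =>
        ((b.1, u.2.applyOps Zs b.2.1), .fromAdv b.2.2))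
      ((A.onEnv a ((copy ((a, w), I)).view Zs) m).map fun b =>
        (((b.1, (copy ((a, w), I)).applyOps Zs b.2.1), I), .fromAdv b.2.2)) := by
  have hZ : P.Covered Zs := ⟨qs, hqs⟩
  constructor
  · intro y hy'
    obtain ⟨b, -, rfl⟩ := (PMF.mem_support_map_iff _ _ _).1 hy'
    dsimp only
    have e : copy ((b.1, (copy ((a, w), I)).applyOps Zs b.2.1), I) =
        (copy ((a, w), I)).applyOps Zs b.2.1 := (hx.applyOps hQ hZ b.2.1).sync_eq
    rw [e]
    exact hx.applyOps hQ hZ b.2.1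
  · rw [hybridDist, PMF.bind_map, PMF.bind_map]
    refine Eq.trans (PMF.bind_congr_support fun g hg => ?_)
      ((map_bind_comm _ (A.onEnv a ((copy ((a, w), I)).view Zs) m) fun g b =>
        ((b.1, ((copy ((a, w), I)).applyOps Zs b.2.1).blur Zs qs g),
          Resp.fromAdv b.2.2)).trans ?_)
    · obtain ⟨H, -⟩ := hx.mem_shiftDist hQ hqs hg
      simp only [Function.comp_apply, World.blur_view H, hx.inv.applyOps_blur H]
    · congr 1
      funext b
      simp only [Function.comp_apply]
      rw [(hx.applyOps hQ hZ b.2.1).hybridDist, PMF.map_comp,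
        hx.shiftDist_eq (hx.inv.applyOps hQ hZ b.2.1).2.record]
      rfl

/-- An activation leads to coupled states whatever the random choices are. -/
theorem Coupled.activate_coupled (h : Coupled B Zs w I) (hQ : P.Q 4) (hqs : Zs ⊆ P.Z qs) {C : ℕ}
    (hC : 16 ≤ C) (hi : i ∉ Zs) (hs : (w.parties i).started) {D : Set (Item P)}
    {y : World P F × Resp (Table P F)} (hy : y ∈ (w.activate B Zs i D).support)
    {z : Ideal P F × Resp (Table P F)}
    (hz : z ∈ ((I.applyOps Zs (simOps Zs i y)).activate ((P.n + P.h + B + 2) ^ C) Zs i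
      (match y.2 with | .output _ => true | _ => false)).support) : Coupled B Zs y.1 z.1 := by
  have hZ : P.Covered Zs := ⟨qs, hqs⟩
  obtain ⟨v, _ | T | m⟩ := y
  · obtain ⟨h1, h2⟩ := h.activate_nothing hQ hZ hC hi hs hy
    rw [h1] at hz
    obtain rfl := (PMF.mem_support_pure_iff _ _).1 hz
    exact h2
  · obtain ⟨-, -, h3, h4, h5⟩ := h.activate_output hQ hZ ((P.n + P.h + B + 2) ^ C) hi hs hy
    simp only [h4] at hz
    obtain ⟨R, hR, rfl⟩ := (PMF.mem_support_map_iff _ _ _).1 hz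
    refine h5 R ?_
    cases hI : I.result with
    | none =>
        simp only [hI] at hR
        rwa [completeTriples_eq hqs, mem_support_uniformOn (completions_nonempty hqs _)] at hR
    | some R' =>
        simp only [hI] at hR
        obtain rfl := (PMF.mem_support_pure_iff _ _).1 hR
        exact (h3 _ hI).2
  · have := (World.activate_support h.inv hQ hZ hi hs hy).2.2.2.2
    simp at this

/-- The reaction to an activation: the shift is independent of what the adversary sees, so that it may
be drawn after the reaction. -/
theorem matches_activate (hQ : P.Q 4) (hqs : Zs ⊆ P.Z qs) {C : ℕ} (hC : 16 ≤ C)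
    (hx : Coupled B Zs (copy ((a, w), I)) I) : Matches B Zs qs ((a, w), I)
      (fun u => if i ∉ Zs ∧ (u.2.parties i).started then
          (A.onReq u.1 (u.2.view Zs) i).bind fun b =>
            ((u.2.applyOps Zs b.2.1).activate B Zs i b.2.2).map fun y => ((b.1, y.1), y.2)
        else PMF.pure (u, .nothing))
      (if i ∉ Zs ∧ I.startedAt i ≠ none then
        ((A.onReq a ((copy ((a, w), I)).view Zs) i).bind fun b =>
          (((copy ((a, w), I)).applyOps Zs b.2.1).activate B Zs i b.2.2).map fun y =>
            ((b.1, y.1), simOps Zs i y, match y.2 with | .output _ => true | _ => false)).bind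
          fun b => ((I.applyOps Zs b.2.1).activate ((P.n + P.h + B + 2) ^ C) Zs i b.2.2).map
            fun y => ((b.1, y.1), y.2)
      else PMF.pure (((a, w), I), .nothing)) := by
  have hZ : P.Covered Zs := ⟨qs, hqs⟩
  have hst : ∀ g, (((copy ((a, w), I)).blur Zs qs g).parties i).started ↔
      I.startedAt i ≠ none := fun g => World.shift_started.trans (hx.started i).symm
  have hr : ∀ r r' : A.St × World P F → PMF ((A.St × World P F) × Resp (Table P F)),
      (∀ g ∈ (shiftDist Zs qs (copy ((a, w), I)).record I).support,
        r (a, (copy ((a, w), I)).blur Zs qs g) = r' (a, (copy ((a, w), I)).blur Zs qs g)) →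
      (hybridDist Zs qs ((a, w), I)).bind r = (hybridDist Zs qs ((a, w), I)).bind r' := by
    intro r r' h
    rw [hybridDist, PMF.bind_map, PMF.bind_map]
    exact PMF.bind_congr_support h
  by_cases hi : i ∉ Zs ∧ I.startedAt i ≠ none
  · rw [if_pos hi]
    have hc := hx.applyOps hQ hZ
    have hs : ∀ ops, (((copy ((a, w), I)).applyOps Zs ops).parties i).started := fun ops => by
      rw [((World.applyOps_same ops).2 i).2]
      exact (hx.started i).1 hi.2
    constructor
    · intro y hy
      obtain ⟨b', hb', hy⟩ := (PMF.mem_support_bind_iff _ _ _).1 hy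
      obtain ⟨b, -, hb'⟩ := (PMF.mem_support_bind_iff _ _ _).1 hb'
      obtain ⟨y', hy', rfl⟩ := (PMF.mem_support_map_iff _ _ _).1 hb'
      obtain ⟨z, hz, rfl⟩ := (PMF.mem_support_map_iff _ _ _).1 hy
      have h := (hc b.2.1).activate_coupled hQ hqs hC hi.1 (hs _) hy' hz
      have e : copy ((b.1, y'.1), z.1) = y'.1 := h.sync_eq
      dsimp only
      rw [e]
      exact h
    · rw [PMF.bind_bind, PMF.bind_bind]
      have h1 : ∀ g ∈ (shiftDist Zs qs (copy ((a, w), I)).record I).support,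
          (if i ∉ Zs ∧ (((copy ((a, w), I)).blur Zs qs g).parties i).started then
            (A.onReq a (((copy ((a, w), I)).blur Zs qs g).view Zs) i).bind fun b =>
              ((((copy ((a, w), I)).blur Zs qs g).applyOps Zs b.2.1).activate B Zs i b.2.2).map
                fun y => ((b.1, y.1), y.2)
          else PMF.pure ((a, (copy ((a, w), I)).blur Zs qs g), .nothing)) =
          (A.onReq a ((copy ((a, w), I)).view Zs) i).bind fun b =>
            (((copy ((a, w), I)).applyOps Zs b.2.1).activate B Zs i b.2.2).map fun y =>
              ((b.1, y.1.blur Zs qs g), y.2.shift i (y.1.record.dOut qs g)) := by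
        intro g hg
        obtain ⟨H, -⟩ := hx.mem_shiftDist hQ hqs hg
        rw [if_pos ⟨hi.1, (hst g).2 hi.2⟩, World.blur_view H]
        congr 1
        funext b
        rw [hx.inv.applyOps_blur H, (hc b.2.1).inv.activate_blur H hi.1 (hs _), PMF.map_comp]
        rfl
      rw [hybridDist, PMF.bind_map]
      refine (PMF.bind_congr_support h1).trans ?_
      rw [PMF.bind_comm]
      congr 1
      funext b
      rw [map_bind_comm, PMF.bind_map]
      refine PMF.bind_congr_support fun y hy => ?_
      have h2 := congrArg (PMF.map fun z : World P F × Resp (Table P F) => ((b.1, z.1), z.2))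
        ((hc b.2.1).bind_activate hQ hqs hC hi.1 (hs _) hy)
      rw [PMF.map_comp, PMF.map_bind,
        hx.shiftDist_eq (hx.inv.applyOps hQ hZ b.2.1).2.record] at h2
      refine h2.trans ?_
      simp only [Function.comp_apply]
      rw [PMF.bind_map]
      refine PMF.bind_congr_support fun z hz => ?_
      simp only [Function.comp_apply]
      rw [((hc b.2.1).activate_coupled hQ hqs hC hi.1 (hs _) hy hz).hybridDist, PMF.map_comp,
        PMF.map_comp]
      rfl
  · rw [if_neg hi]
    refine ⟨(matches_nothing (qs := qs) hx).1, Eq.trans (hr _ _ fun g _ => ?_)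
      (matches_nothing (qs := qs) hx).2⟩
    exact if_neg fun h => hi ⟨h.1, (hst g).1 h.2⟩

/-- The simulation is perfect. -/
theorem perfectlyUCRealizes (hQ : P.Q 4) (B : ℕ) {C : ℕ} (hC : 16 ≤ C) :
    PerfectlyUCRealizes P F B ((P.n + P.h + B + 2) ^ C) := by
  rintro Zs ⟨qs, hqs⟩ A
  have hZ : P.Covered Zs := ⟨qs, hqs⟩
  have hm : ∀ (x : (A.St × World P F) × Ideal P F) (cmd : Cmd P.n), Coupled B Zs (copy x) x.2 →
      Matches B Zs qs x (fun u => (realSystem B Zs A).respond u cmd)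
        ((idealSystem ((P.n + P.h + B + 2) ^ C) Zs (simulator B Zs A)).respond x cmd) := by
    rintro ⟨⟨a, w⟩, I⟩ cmd hx
    cases cmd with
    | input i => exact matches_input hQ hZ hx
    | toAdv m =>
        have h := matches_toAdv hQ hqs hx m
        simp only [idealSystem, simulator, PMF.map_comp]
        exact h
    | activate i => exact matches_activate hQ hqs hC hx
  refine ⟨simulator B Zs A, fun E k => outcome_eq_of_simulation
    (Y := realSystem B Zs A) (Y' := idealSystem ((P.n + P.h + B + 2) ^ C) Zs (simulator B Zs A))
    (fun x => hybridDist Zs qs x) (fun x => Coupled B Zs (copy x) x.2) ?_ ?_ ?_ ?_ E k⟩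
  · have e : copy ((A.init, World.init P F), Ideal.init P F) = World.init P F :=
      (Coupled.init (B := B) (Zs := Zs) hQ).sync_eq
    change Coupled B Zs (copy ((A.init, World.init P F), Ideal.init P F)) _
    rw [e]
    exact Coupled.init hQ
  · change hybridDist Zs qs ((A.init, World.init P F), Ideal.init P F) = _
    rw [(Coupled.init (B := B) hQ).hybridDist]
    have e : ∀ g : Shift P F, (World.init P F).blur Zs qs g = World.init P F := fun g => by
      simp only [World.blur, World.shift, World.init, World.mk.injEq, and_true]
      refine ⟨funext fun k => ?_, rfl⟩
      split_ifs <;> rfl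
    simp only [e]
    exact PMF.map_const _ _
  · exact fun x cmd hx => (hm x cmd hx).1
  · exact fun x cmd hx => (hm x cmd hx).2

end

end

end AMPC

theorem mainTheorem3 :
    ∃ C : ℕ, ∀ (F : Type) [Field F] [Fintype F] (P : AMPC.Params),
      Function.Injective P.Z → P.Q 4 →
      (∀ B : ℕ, AMPC.PerfectlyUCRealizes P F B ((P.n + P.h + B + 2) ^ C)) ∧
      (∀ (B : ℕ) (Zs : Finset (Fin P.n)), P.Covered Zs →
        ∀ (A : AMPC.Adversary P F) (E : AMPC.Env P.n (AMPC.Table P F)) (k : ℕ),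
        ∀ c ∈ (AMPC.run E (AMPC.realSystem B Zs A) k).support,
          ((c.sys.2.vssCalls Zs).Finite ∧
            (c.sys.2.vssCalls Zs).ncard ≤ C * (P.M * P.h * P.n ^ 5)) ∧
          ((c.sys.2.abaCalls Zs).Finite ∧
            (c.sys.2.abaCalls Zs).ncard ≤ C * (P.h * P.n ^ 5)) ∧
          ((c.sys.2.sentMsgs Zs).Finite ∧
            (((c.sys.2.sentMsgs Zs).ncard * Nat.clog 2 (Fintype.card F) : ℕ) : ℝ) ≤
              C * (P.M * P.h ^ 2 * P.n ^ 5 * Real.logb 2 (Fintype.card F) +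
                P.h * P.n ^ 7 * Real.logb 2 (Fintype.card F)))) :=
  ⟨16, fun _ _ _ _ _ hQ => ⟨fun B => AMPC.perfectlyUCRealizes hQ B le_rfl, fun _ _ hZ _ _ _ _ hc =>
    AMPC.complexity hQ hZ (by norm_num) (AMPC.reachable_run hQ hZ hc)⟩⟩
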